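/- Let $M$ be a smooth (Hausdorff, second countable) real manifold of dimension $d$. Let $T_{poly}(M)=\bigoplus_{k\ge -1}\Gamma(\wedge^{k+1}TM)$ be the DGLA of polyvector fields (Schouten–Nijenhuis bracket, zero differential). Let $D_{poly}(M)=\bigoplus_{k\ge -1}D^k_{poly}(M)$ be the DGLA of polydifferential operators $C^\infty(M)^{\otimes(k+1)}\to C^\infty(M)$ (Gerstenhaber bracket, differential $\partial=[m_0,\cdot]$ with $m_0$ the multiplication). Let $\Gamma(\mathcal SM)$ be the algebra of formal series $\sum_p a_{i_1\dots i_p}(x)y^{i_1}\cdots y^{i_p}$ whose coefficients are symmetric covariant tensors. Let $\mathcal T_{poly}$ and $\mathcal D_{poly}$ be the graded bundles of formal fiberwise polyvector fields and polydifferential operators, i.e. those acting $C^\infty(M)$-multilinearly on $\Gamma(\mathcal SM)$ through derivatives in $y$ (with polydifferential operators of finite order). For $\mathcal B=\mathcal T_{poly},\mathcal D_{poly}$ the space $\Omega(M,\mathcal B)$ of $\mathcal B$-valued exterior forms carries the fiberwise bracket, and the differential $0$, respectively $\partial=[m,\cdot]$ with $m$ the multiplication of $\Gamma(\mathcal SM)$.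 Let $\nabla$ be a torsion-free affine connection on $M$, $\delta=dx^i\,\partial/\partial y^i$, and $A=\sum_{p\ge2}dx^kA^j_{k i_1\dots i_p}(x)y^{i_1}\cdots y^{i_p}\,\partial/\partial y^j\in\Omega^1(M,\mathcal T^0_{poly})$. Put $D=\nabla-\delta+A$ on $\Omega(M,\mathcal SM)$ and $D=\nabla-\delta+[A,\cdot]$ on $\Omega(M,\mathcal B)$. (1) If $A=\delta^{-1}\bigl(R+\nabla A+\tfrac12[A,A]\bigr)$, where $R=\nabla^2$ and $\delta^{-1}$ is $\frac1{p+q}\,y^k\,i(\partial/\partial x^k)$ on $q$-forms of degree $p$ in $y$ (and $0$ for $p=q=0$), then $D^2=0$ on $\Omega(M,\mathcal SM)$. (2) Suppose that $D^2=0$ on $\Omega(M,\mathcal SM)$ ($D$ is a Fedosov differential). Then every $f\in C^\infty(M)$ has a unique $D$-closed lift $\tau f\in\Gamma(\mathcal SM)$ with $\tau f|_{y=0}=f$, and the following holds for $(\mathcal B,L)=(\mathcal T_{poly},T_{poly}(M))$ and for $(\mathcal B,L)=(\mathcal D_{poly},D_{poly}(M))$. Let $\mathcal F^0\mathcal B\subset\Omega^0(M,\mathcal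 B)$ be the elements with coefficients constant in $y$, let $\sigma(\mathfrak P)=\mathfrak P|_{y=0}\in\mathcal F^0\mathcal B$ for $\mathfrak P\in\Omega^0(M,\mathcal B)$ (restriction of the coefficients), and let $\mu(\mathfrak P)(f_0,\dots,f_k)=\mathfrak P(\tau f_0,\dots,\tau f_k)|_{y=0}$. (a) $D$, the bracket and the differential preserve $\Omega(M,\mathcal B)$, one has $D^2=0$ there, and the bracket and the differential descend to the cohomology $H^\bullet(\Omega(M,\mathcal B),D)$, graded by exterior degree. (b) $H^q(\Omega(M,\mathcal B),D)=0$ for $q>0$. The maps $\sigma:H^0(\Omega(M,\mathcal B),D)\to\mathcal F^0\mathcal B$ and $\mu:\mathcal F^0\mathcal B\to L$ are linear isomorphisms preserving the degree $k$, and the bracket and differential induced on $H^\bullet(\Omega(M,\mathcal B),D)$ are those of $L$ transported by $\mu\circ\sigma$. Thus $\Omega(M,\mathcal B)$ with $D$ is a DGLA resolution of $L$. (c) $\mu\circ\sigma$ is an isomorphism of DGLAs from the $D$-closed elements of $\Omega^0(M,\mathcal B)$ onto $L$. -/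

import Mathlib

open scoped Manifold ContDiff

noncomputable section

namespace Fedosov

/-! ### Operators with several arguments on a commutative algebra

`Op A n` is the space of all maps `A × ⋯ × A → A` of `n` arguments.  An operator of `n` arguments
has degree `n - 1`, so degree `-1` is `n = 0`. -/

abbrev Op (A : Type*) (n : ℕ) : Type _ := (Fin n → A) → A

/-- The `j`-th entry of a tuple; it is only used for `j < l`. -/
def argAt {A : Type*} [Zero A] {l : ℕ} (a : Fin l → A) (j : ℕ) : A :=
  if h : j < l then a ⟨j, h⟩ else 0

/-- `P (a₀, …, aᵢ₋₁, Q (aᵢ, …, aᵢ₊ₙ'₋₁), aᵢ₊ₙ', …)`, where `l = n + n' - 1`. -/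
def insertAt {A : Type*} [Zero A] {n n' : ℕ} (l : ℕ) (P : Op A n) (Q : Op A n') (i : Fin n) :
    Op A l := fun a =>
  P fun j =>
    if (j : ℕ) < i then argAt a j
    else if j = i then Q fun r => argAt a (i + r)
    else argAt a (j + n' - 1)

/-- The Gerstenhaber bracket
`[P, Q] = ∑ᵢ (-1)^(i k') P (…, Q (…), …) - (-1)^(k k') ∑ᵢ (-1)^(i k) Q (…, P (…), …)` of operators
of degrees `k = n - 1` and `k' = n' - 1`; here `l = n + n' - 1`.  As only parities matter, `k` is
written `n + 1` in the exponents. -/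
def gerstenhaber {A : Type*} [CommRing A] {n n' : ℕ} (l : ℕ) (P : Op A n) (Q : Op A n') :
    Op A l := fun a =>
  (∑ i : Fin n, (-1 : A) ^ ((i : ℕ) * (n' + 1)) * insertAt l P Q i a)
    - (-1 : A) ^ ((n + 1) * (n' + 1)) *
      ∑ i : Fin n', (-1 : A) ^ ((i : ℕ) * (n + 1)) * insertAt l Q P i a

/-- The multiplication of the algebra, an operator of degree `1`. -/
def mulOp (A : Type*) [CommRing A] : Op A 2 := fun a => a 0 * a 1

/-- The differential `∂ P = [m, P]`, where `m` is the multiplication. -/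
def hochschild {A : Type*} [CommRing A] {n : ℕ} (P : Op A n) : Op A (n + 1) :=
  gerstenhaber (n + 1) (mulOp A) P

/-- The sum over all `(n', n - 1)`-shuffles `σ` of
`sgn σ • P (Q (a_{σ 0}, …, a_{σ (n'-1)}), a_{σ n'}, …)`, for alternating `P` and `Q`
and `l = n + n' - 1`, written as a normalized sum over all permutations. It is `0` for `n = 0`. -/
def shuffleInsert {A : Type*} [CommRing A] [Algebra ℝ A] {n n' : ℕ} (l : ℕ) (P : Op A n)
    (Q : Op A n') : Op A l := fun a =>
  if n = 0 then 0
  else ((n'.factorial * (n - 1).factorial : ℕ) : ℝ)⁻¹ •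
    ∑ σ : Equiv.Perm (Fin l), (Equiv.Perm.sign σ : ℤ) •
      P fun j =>
        if (j : ℕ) = 0 then Q fun r => argAt (fun i => a (σ i)) r
        else argAt (fun i => a (σ i)) (j + n' - 1)

/-- The Schouten-Nijenhuis bracket of alternating multiderivations of `n` and `n'` arguments,
where `l = n + n' - 1`.  It is the commutator for `n = n' = 1`, it is `[X, f] = X f` for a
derivation `X` and an element `f`, and it satisfies the Leibniz rule
`[P, Q ∧ R] = [P, Q] ∧ R + (-1)^((n-1) n') Q ∧ [P, R]`. -/
def schouten {A : Type*} [CommRing A] [Algebra ℝ A] {n n' : ℕ} (l : ℕ) (P : Op A n)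
    (Q : Op A n') : Op A l := fun a =>
  (-1 : A) ^ ((n + 1) * (n' + 1)) * shuffleInsert l P Q a - shuffleInsert l Q P a

/-- The commutator of `P` with the multiplication by `s`, in the `i`-th argument. -/
def adAt {A : Type*} [CommRing A] {n : ℕ} (i : Fin n) (s : A) (P : Op A n) : Op A n := fun a =>
  P (Function.update a i (s * a i)) - s * P a

/-- `P` is a differential operator of order `< N` in its `i`-th argument: all `N`-fold
commutators with multiplications vanish. -/
def OrderLT {A : Type*} [CommRing A] {n : ℕ} (i : Fin n) : ℕ → Op A n → Prop
  | 0, P => P = 0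
  | N + 1, P => ∀ s : A, OrderLT i N (adAt i s P)

theorem adAt_add {A : Type*} [CommRing A] {n : ℕ} (i : Fin n) (s : A) (P Q : Op A n) :
    adAt i s (P + Q) = adAt i s P + adAt i s Q := by
  funext a; simp only [adAt, Pi.add_apply]; ring

theorem adAt_smul {R A : Type*} [CommRing R] [CommRing A] [Algebra R A] {n : ℕ} (i : Fin n)
    (s : A) (c : R) (P : Op A n) : adAt i s (c • P) = c • adAt i s P := by
  funext a; simp only [adAt, Pi.smul_apply, smul_sub, mul_smul_comm]

theorem OrderLT.add {A : Type*} [CommRing A] {n : ℕ} {i : Fin n} {N : ℕ} :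
    ∀ {P Q : Op A n}, OrderLT i N P → OrderLT i N Q → OrderLT i N (P + Q) := by
  induction N with
  | zero => intro P Q hP hQ; simp only [OrderLT] at *; rw [hP, hQ, add_zero]
  | succ N ih => intro P Q hP hQ s; rw [adAt_add]; exact ih (hP s) (hQ s)

theorem OrderLT.smul {R A : Type*} [CommRing R] [CommRing A] [Algebra R A] {n : ℕ} {i : Fin n}
    {N : ℕ} (c : R) : ∀ {P : Op A n}, OrderLT i N P → OrderLT i N (c • P) := by
  induction N with
  | zero => intro P hP; simp only [OrderLT] at *; rw [hP, smul_zero]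
  | succ N ih => intro P hP s; rw [adAt_smul]; exact ih (hP s)

theorem OrderLT.zero {A : Type*} [CommRing A] {n : ℕ} {i : Fin n} {N : ℕ} :
    OrderLT i N (0 : Op A n) := by
  induction N with
  | zero => rfl
  | succ N ih =>
    intro s
    have h : adAt i s (0 : Op A n) = 0 := by funext a; simp [adAt]
    rw [h]; exact ih

theorem OrderLT.succ {A : Type*} [CommRing A] {n : ℕ} {i : Fin n} {N : ℕ} :
    ∀ {P : Op A n}, OrderLT i N P → OrderLT i (N + 1) P := by
  induction N with
  | zero => intro P hP; simp only [OrderLT] at hP; rw [hP]; exact OrderLT.zero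
  | succ N ih => intro P hP s; exact ih (hP s)

theorem OrderLT.mono {A : Type*} [CommRing A] {n : ℕ} {i : Fin n} {N N' : ℕ} (h : N ≤ N')
    {P : Op A n} (hP : OrderLT i N P) : OrderLT i N' P := by
  induction h with
  | refl => exact hP
  | step _ ih => exact ih.succ

/-- The `R`-multilinear operators of `n` arguments. -/
def multilinearOps (R A : Type*) [CommRing R] [CommRing A] [Algebra R A] (n : ℕ) :
    Submodule R (Op A n) where
  carrier := {P | ∃ f : MultilinearMap R (fun _ : Fin n => A) A, ⇑f = P}
  add_mem' := by rintro _ _ ⟨f, rfl⟩ ⟨g, rfl⟩; exact ⟨f + g, rfl⟩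
  zero_mem' := ⟨0, rfl⟩
  smul_mem' := by rintro c _ ⟨f, rfl⟩; exact ⟨c • f, rfl⟩

/-- Polydifferential operators over `R` on `A` of order at most `N` in each of the `n`
arguments. -/
def polyDiffLE (R A : Type*) [CommRing R] [CommRing A] [Algebra R A] (n N : ℕ) :
    Submodule R (Op A n) where
  carrier := {P | P ∈ multilinearOps R A n ∧ ∀ i, OrderLT i (N + 1) P}
  add_mem' hP hQ := ⟨add_mem hP.1 hQ.1, fun i => (hP.2 i).add (hQ.2 i)⟩
  zero_mem' := ⟨zero_mem _, fun _ => OrderLT.zero⟩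
  smul_mem' c _ hP := ⟨Submodule.smul_mem _ c hP.1, fun i => (hP.2 i).smul c⟩

theorem polyDiffLE_mono (R A : Type*) [CommRing R] [CommRing A] [Algebra R A] (n : ℕ) :
    Monotone (polyDiffLE R A n) := fun _ _ h _ hP =>
  ⟨hP.1, fun i => (hP.2 i).mono (Nat.succ_le_succ h)⟩

/-- Polydifferential operators over `R` on `A` of `n` arguments (of finite order). -/
def polyDiff (R A : Type*) [CommRing R] [CommRing A] [Algebra R A] (n : ℕ) :
    Submodule R (Op A n) where
  carrier := {P | ∃ N, P ∈ polyDiffLE R A n N}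
  add_mem' := by
    rintro P Q ⟨N, hP⟩ ⟨N', hQ⟩
    exact ⟨max N N', add_mem (polyDiffLE_mono R A n (le_max_left N N') hP)
      (polyDiffLE_mono R A n (le_max_right N N') hQ)⟩
  zero_mem' := ⟨0, zero_mem _⟩
  smul_mem' := fun c _ ⟨N, hP⟩ => ⟨N, Submodule.smul_mem _ c hP⟩

/-- Polyvector fields of `n` arguments over `R` on `A`: the alternating `R`-multilinear maps that
are derivations in each argument. -/
def polyVect (R A : Type*) [CommRing R] [CommRing A] [Algebra R A] (n : ℕ) :
    Submodule R (Op A n) where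
  carrier := {P | (∃ f : A [⋀^Fin n]→ₗ[R] A, ⇑f = P) ∧
    ∀ (i : Fin n) (a : Fin n → A) (s t : A),
      P (Function.update a i (s * t)) =
        s * P (Function.update a i t) + t * P (Function.update a i s)}
  add_mem' := by
    rintro _ _ ⟨⟨f, rfl⟩, hf⟩ ⟨⟨g, rfl⟩, hg⟩
    refine ⟨⟨f + g, rfl⟩, fun i a s t => ?_⟩
    simp only [Pi.add_apply, hf i a s t, hg i a s t]; ring
  zero_mem' := ⟨⟨0, rfl⟩, by simp⟩
  smul_mem' := by
    rintro c _ ⟨⟨f, rfl⟩, hf⟩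
    refine ⟨⟨c • f, rfl⟩, fun i a s t => ?_⟩
    simp only [Pi.smul_apply, hf i a s t, smul_add, mul_smul_comm]

/-- The action of an endomorphism `δ` of `A` on operators,
`(δ P)(a₁, …, aₙ) = δ (P (a₁, …, aₙ)) - ∑ᵢ P (a₁, …, δ aᵢ, …, aₙ)`. -/
def opDer {A : Type*} [CommRing A] [Algebra ℝ A] {n : ℕ} (δ : A →ₗ[ℝ] A) :
    Op A n →ₗ[ℝ] Op A n where
  toFun P := fun a => δ (P a) - ∑ i, P (Function.update a i (δ (a i)))
  map_add' P Q := by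
    funext a; simp only [Pi.add_apply, map_add, Finset.sum_add_distrib]; abel
  map_smul' c P := by
    funext a; simp only [Pi.smul_apply, map_smul, RingHom.id_apply, smul_sub, Finset.smul_sum]

/-! ### Vector fields and the formally completed symmetric algebra

In this part `C` is the algebra `C^∞(M)` of smooth functions. Vector fields are its derivations,
tensor fields are `C`-multilinear maps on vector fields. -/

abbrev VF (C : Type*) [CommRing C] [Algebra ℝ C] : Type _ := Derivation ℝ C C

/-- The algebra `Γ(SM)` of sections of the formally completed symmetric algebra of `T*M`.
A section `∑ₚ a_{i₁…iₚ}(x) y^{i₁} ⋯ y^{iₚ}` is recorded by its values at `y = tY`,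
`Y ↦ ∑ₚ tᵖ aₚ(Y, …, Y)`, where `Y` is a vector field and `aₚ` is a covariant `p`-tensor. -/
def sections (C : Type*) [CommRing C] [Algebra ℝ C] : Subalgebra C (VF C → PowerSeries C) where
  carrier := {a | ∀ p, ∃ α : MultilinearMap C (fun _ : Fin p => VF C) C,
    ∀ Y, PowerSeries.coeff p (a Y) = α fun _ => Y}
  add_mem' := by
    intro a b ha hb p
    obtain ⟨α, hα⟩ := ha p
    obtain ⟨β, hβ⟩ := hb p
    exact ⟨α + β, fun Y => by simp [hα, hβ]⟩
  mul_mem' := by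
    intro a b ha hb p
    choose α hα using ha
    choose β hβ using hb
    refine ⟨∑ x : {x // x ∈ Finset.HasAntidiagonal.antidiagonal p},
      ((LinearMap.mul' C C).compMultilinearMap ((α x.1.1).domCoprod (β x.1.2))).domDomCongr
        (finSumFinEquiv.trans (finCongr (Finset.HasAntidiagonal.mem_antidiagonal.1 x.2))), fun Y => ?_⟩
    rw [Pi.mul_apply, PowerSeries.coeff_mul, sum_apply, ← Finset.sum_coe_sort]
    refine Finset.sum_congr rfl fun x _ => ?_
    simp [hα, hβ, MultilinearMap.domCoprod_apply]
  algebraMap_mem' := by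
    intro c p
    rcases p with _ | p
    · exact ⟨MultilinearMap.constOfIsEmpty C _ c, fun Y => by
        simp [Pi.algebraMap_apply]⟩
    · exact ⟨0, fun Y => by simp [Pi.algebraMap_apply]⟩

/-- The commutative algebra `Γ(SM)`. -/
def SM (C : Type*) [CommRing C] [Algebra ℝ C] : Type _ := sections C

variable {C : Type*} [CommRing C] [Algebra ℝ C]

instance : CommRing (SM C) := inferInstanceAs (CommRing (sections C))

instance : Algebra C (SM C) := inferInstanceAs (Algebra C (sections C))

instance : Algebra ℝ (SM C) := inferInstanceAs (Algebra ℝ (sections C))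

instance : IsScalarTower ℝ C (SM C) := inferInstanceAs (IsScalarTower ℝ C (sections C))

/-- The value at `y = Y` of the component of degree `p` in `y`. -/
def comp (p : ℕ) (a : SM C) (Y : VF C) : C := PowerSeries.coeff p (a.1 Y)

/-- The section with given components. -/
def ofComp (c : ℕ → VF C → C)
    (h : ∀ p, ∃ α : MultilinearMap C (fun _ : Fin p => VF C) C, ∀ Y, c p Y = α fun _ => Y) :
    SM C :=
  ⟨fun Y => PowerSeries.mk fun p => c p Y, fun p => by simpa using h p⟩

theorem comp_ofComp (c : ℕ → VF C → C)
    (h : ∀ p, ∃ α : MultilinearMap C (fun _ : Fin p => VF C) C, ∀ Y, c p Y = α fun _ => Y)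
    (p : ℕ) (Y : VF C) : comp p (ofComp c h) Y = c p Y :=
  PowerSeries.coeff_mk p fun p => c p Y

/-- Restriction to `y = 0`. -/
def atZero (a : SM C) : C := comp 0 a 0

/-- A covariant `p`-tensor representing the component of degree `p`. -/
def tensor (p : ℕ) (a : SM C) : MultilinearMap C (fun _ : Fin p => VF C) C := (a.2 p).choose

theorem tensor_diag (p : ℕ) (a : SM C) (Y : VF C) : tensor p a (fun _ => Y) = comp p a Y :=
  ((a.2 p).choose_spec Y).symm

theorem linearDeriv_eq_zero {p : ℕ} (γ : MultilinearMap C (fun _ : Fin p => VF C) C)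
    (h : ∀ Y, γ (fun _ => Y) = 0) (Y Z : VF C) :
    γ.linearDeriv (fun _ => Y) (fun _ => Z) = 0 := by
  classical
  rw [← Module.forall_dual_apply_eq_zero_iff ℝ]
  intro φ
  have key : ∀ t : ℝ, ∑ s : Finset (Fin p), t ^ s.card *
      φ (γ (s.piecewise (fun _ => Z) (fun _ => Y))) = 0 := by
    intro t
    have h1 := h (t • Z + Y)
    have h2 := γ.map_add_univ (fun _ => t • Z) (fun _ => Y)
    have h3 : ((fun _ => t • Z) + (fun _ => Y) : Fin p → VF C) = fun _ => t • Z + Y := rfl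
    rw [h3, h1] at h2
    have h4 := congrArg φ h2
    rw [map_zero, map_sum] at h4
    rw [h4]
    refine Finset.sum_congr rfl fun s _ => ?_
    have h5 : s.piecewise (fun _ => t • Z) (fun _ => Y) =
        s.piecewise (fun i => (algebraMap ℝ C t) • s.piecewise (fun _ => Z) (fun _ => Y) i)
          (s.piecewise (fun _ => Z) (fun _ => Y)) := by
      funext i
      by_cases hi : i ∈ s <;> simp [hi, algebraMap_smul]
    rw [h5, γ.map_piecewise_smul (fun _ => algebraMap ℝ C t), Finset.prod_const, ← map_pow,
      algebraMap_smul, map_smul, smul_eq_mul]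
  let q : Polynomial ℝ := ∑ s : Finset (Fin p),
    Polynomial.C (φ (γ (s.piecewise (fun _ => Z) (fun _ => Y)))) * Polynomial.X ^ s.card
  have hq : q = 0 := by
    refine Polynomial.funext fun t => ?_
    simp only [q, Polynomial.eval_finsetSum, Polynomial.eval_mul, Polynomial.eval_C,
      Polynomial.eval_pow, Polynomial.eval_X, Polynomial.eval_zero]
    rw [← key t]
    exact Finset.sum_congr rfl fun s _ => mul_comm _ _
  have hc := congrArg (fun r => Polynomial.coeff r 1) hq
  simp only [q, Polynomial.finsetSum_coeff, Polynomial.coeff_C_mul, Polynomial.coeff_X_pow,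
    Polynomial.coeff_zero, mul_ite, mul_one, mul_zero] at hc
  rw [← Finset.sum_filter] at hc
  rw [MultilinearMap.linearDeriv_apply, map_sum, ← hc]
  refine Finset.sum_bij (fun i _ => {i}) (by simp) (by simp) ?_ ?_
  · intro s hs
    obtain ⟨i, hi⟩ := Finset.card_eq_one.1 (Finset.mem_filter.1 hs).2.symm
    exact ⟨i, Finset.mem_univ _, hi.symm⟩
  · intro i _
    rw [Finset.piecewise_singleton]

/-- The derivative at `y = Y` in the direction `Z` of the component of degree `p` in `y`. -/
def dirComp (p : ℕ) (a : SM C) (Y Z : VF C) : C :=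
  (tensor p a).linearDeriv (fun _ => Y) (fun _ => Z)

theorem dirComp_eq {p : ℕ} {a : SM C} {α : MultilinearMap C (fun _ : Fin p => VF C) C}
    (h : ∀ Y, α (fun _ => Y) = comp p a Y) (Y Z : VF C) :
    dirComp p a Y Z = α.linearDeriv (fun _ => Y) (fun _ => Z) := by
  have := linearDeriv_eq_zero (tensor p a - α) (fun Y => by simp [tensor_diag, h]) Y Z
  simp only [MultilinearMap.linearDeriv_apply, sub_apply,
    Finset.sum_sub_distrib, sub_eq_zero] at this
  simpa only [dirComp, MultilinearMap.linearDeriv_apply] using this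

theorem comp_add (p : ℕ) (a b : SM C) (Y : VF C) :
    comp p (a + b) Y = comp p a Y + comp p b Y :=
  map_add (PowerSeries.coeff p) (a.1 Y) (b.1 Y)

theorem comp_smul (p : ℕ) (t : ℝ) (a : SM C) (Y : VF C) : comp p (t • a) Y = t • comp p a Y := by
  have h : (t • a).1 Y = algebraMap ℝ C t • a.1 Y := by
    rw [algebraMap_smul]; rfl
  rw [comp, h, map_smul, algebraMap_smul]; rfl

theorem dirComp_add (p : ℕ) (a b : SM C) (Y Z : VF C) :
    dirComp p (a + b) Y Z = dirComp p a Y Z + dirComp p b Y Z := by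
  rw [dirComp_eq (α := tensor p a + tensor p b) (fun Y => by simp [tensor_diag, comp_add])]
  simp [dirComp, Finset.sum_add_distrib]

theorem dirComp_smul (p : ℕ) (t : ℝ) (a : SM C) (Y Z : VF C) :
    dirComp p (t • a) Y Z = t • dirComp p a Y Z := by
  rw [dirComp_eq (α := algebraMap ℝ C t • tensor p a)
    (fun Y => by
    rw [comp_smul, smul_apply, tensor_diag, algebraMap_smul])]
  simp [dirComp, Finset.mul_sum, Algebra.smul_def]

theorem SM_ext {a b : SM C} (h : ∀ p Y, comp p a Y = comp p b Y) : a = b :=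
  Subtype.ext (funext fun Y => PowerSeries.ext fun p => h p Y)

/-- The fibrewise derivative `∂_Z = Zⁱ ∂/∂yⁱ` of sections of `SM`. -/
def vertDer (Z : VF C) : SM C →ₗ[ℝ] SM C where
  toFun a := ofComp (fun p Y => dirComp (p + 1) a Y Z) fun p =>
    ⟨∑ i, (tensor (p + 1) a).curryMid i Z, fun Y => by
      rw [dirComp, MultilinearMap.linearDeriv_apply, sum_apply]
      refine Finset.sum_congr rfl fun i _ => ?_
      rw [MultilinearMap.curryMid_apply_apply]
      congr 1
      funext j
      refine Fin.succAboveCases i ?_ (fun k => ?_) j <;> simp⟩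
  map_add' a b := SM_ext fun p Y => by
    simp only [comp_ofComp, comp_add, dirComp_add]
  map_smul' t a := SM_ext fun p Y => by
    simp only [comp_ofComp, comp_smul, dirComp_smul, RingHom.id_apply]

/-- A torsion-free affine connection, as a map on vector fields. -/
structure TorsionFreeConnection (C : Type*) [CommRing C] [Algebra ℝ C] where
  cov : VF C →ₗ[C] VF C →ₗ[ℝ] VF C
  leibniz : ∀ (X : VF C) (f : C) (Y : VF C), cov X (f • Y) = X f • Y + f • cov X Y
  torsion : ∀ X Y : VF C, cov X Y - cov Y X = ⁅X, Y⁆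

/-- The covariant derivative of a covariant tensor. -/
def covTensor (nabla : TorsionFreeConnection C) (X : VF C) {p : ℕ}
    (α : MultilinearMap C (fun _ : Fin p => VF C) C) :
    MultilinearMap C (fun _ : Fin p => VF C) C where
  toFun v := X (α v) - ∑ i, α (Function.update v i (nabla.cov X (v i)))
  map_update_add' := by
    intro inst v i Y Z
    obtain rfl : inst = instDecidableEqFin p := Subsingleton.elim _ _
    have h : ∀ j, α (Function.update (Function.update v i (Y + Z)) j
          (nabla.cov X (Function.update v i (Y + Z) j))) =
        α (Function.update (Function.update v i Y) j
          (nabla.cov X (Function.update v i Y j))) +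
        α (Function.update (Function.update v i Z) j
          (nabla.cov X (Function.update v i Z j))) := by
      intro j
      by_cases hj : j = i
      · subst hj; simp
      · simp [Function.update_comm (Ne.symm hj), Function.update_of_ne hj]
    simp only [α.map_update_add, map_add, h, Finset.sum_add_distrib]
    abel
  map_update_smul' := by
    intro inst v i f Y
    obtain rfl : inst = instDecidableEqFin p := Subsingleton.elim _ _
    have h : ∀ j, α (Function.update (Function.update v i (f • Y)) j
          (nabla.cov X (Function.update v i (f • Y) j))) =
        f * α (Function.update (Function.update v i Y) j
          (nabla.cov X (Function.update v i Y j))) +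
        if j = i then X f * α (Function.update v i Y) else 0 := by
      intro j
      by_cases hj : j = i
      · subst hj; simp [nabla.leibniz, add_comm]
      · simp [Function.update_comm (Ne.symm hj), hj]
    simp only [α.map_update_smul, smul_eq_mul, Derivation.leibniz, h, Finset.sum_add_distrib,
      Finset.sum_ite_eq', Finset.mem_univ, if_true, ← Finset.mul_sum]
    ring

/-- The covariant derivative `∇_X = Xⁱ (∂/∂xⁱ - Γᵏᵢⱼ yʲ ∂/∂yᵏ)` on sections of `SM`. -/
def covS (nabla : TorsionFreeConnection C) (X : VF C) : SM C →ₗ[ℝ] SM C where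
  toFun a := ofComp (fun p Y => X (comp p a Y) - dirComp p a Y (nabla.cov X Y)) fun p =>
    ⟨covTensor nabla X (tensor p a), fun Y => by
      simp [covTensor, tensor_diag, dirComp]⟩
  map_add' a b := SM_ext fun p Y => by
    simp only [comp_ofComp, comp_add, dirComp_add, map_add]; abel
  map_smul' t a := SM_ext fun p Y => by
    simp only [comp_ofComp, comp_smul, dirComp_smul, RingHom.id_apply, Derivation.map_smul,
      smul_sub]

/-! ### Fedosov differentials -/

/-- A section of `SM` that is homogeneous of degree `1` in `y`, that is, a `1`-form. -/
def IsLinear (a : SM C) : Prop := ∀ p, p ≠ 1 → ∀ Y, comp p a Y = 0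

/-- Fibrewise vector fields (elements of `Γ(𝒯⁰)`) are the `C`-linear derivations of `Γ(SM)`;
this is the space `Ω¹(M, 𝒯⁰)` of `1`-forms with values in them. -/
abbrev OneForm (C : Type*) [CommRing C] [Algebra ℝ C] : Type _ :=
  VF C →ₗ[C] Derivation C (SM C) (SM C)

/-- `A = ∑_{p ≥ 2} dxᵏ Aʲ_{k i₁…iₚ}(x) y^{i₁} ⋯ y^{iₚ} ∂/∂yʲ`: the coefficients, obtained by
applying `A` to linear sections, have components of degree `≥ 2` in `y` only. -/
def IsAdmissible (A : OneForm C) : Prop :=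
  ∀ (X : VF C) (a : SM C), IsLinear a → ∀ p < 2, ∀ Y, comp p (A X a) Y = 0

/-- The restriction of scalars of `A_X` to `ℝ`. -/
def oneFormAt (A : OneForm C) (X : VF C) : SM C →ₗ[ℝ] SM C :=
  (A X).toLinearMap.restrictScalars ℝ

/-- The component `∇_X - Xⁱ ∂/∂yⁱ + A_X` of `D = ∇ - δ + A` along a vector field `X`. -/
def fedosovD (nabla : TorsionFreeConnection C) (A : OneForm C) (X : VF C) : SM C →ₗ[ℝ] SM C :=
  covS nabla X - vertDer X + oneFormAt A X

/-- The value at `(X, Y)` of the square of a differential on `Ω(M, SM)` with components `D_X`. -/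
def curvature (D : VF C → SM C →ₗ[ℝ] SM C) (X Y : VF C) : SM C →ₗ[ℝ] SM C :=
  D X ∘ₗ D Y - D Y ∘ₗ D X - D ⁅X, Y⁆

/-- `A = δ⁻¹ (R + ∇A + ½ [A, A])`. The `2`-form in the parentheses is `(∇ + A)²`, its coefficients
are obtained by applying it to linear sections, and `δ⁻¹` turns coefficients of degree `p` in `y`
of a `2`-form `ω` into `(p + 2)⁻¹ yᵏ ω (∂/∂xᵏ, •)`, of degree `p + 1`. -/
def SolvesFedosovEquation (nabla : TorsionFreeConnection C) (A : OneForm C) : Prop :=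
  ∀ (X : VF C) (a : SM C), IsLinear a → ∀ Y,
    comp 0 (A X a) Y = 0 ∧
    ∀ p : ℕ, comp (p + 1) (A X a) Y =
      ((p : ℝ) + 2)⁻¹ • comp p (curvature (fun Z => covS nabla Z + oneFormAt A Z) Y X a) Y

/-! ### Forms with values in fibrewise operators -/

/-- Maps taking `q` vector fields to an operator of `n` arguments on `Γ(SM)`. -/
abbrev Form (C : Type*) [CommRing C] [Algebra ℝ C] (q n : ℕ) : Type _ :=
  (Fin q → VF C) → Op (SM C) n

/-- The exterior `q`-forms with values in the union of an increasing sequence of spaces of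
fibrewise operators. -/
def formsIn {n : ℕ} (F : ℕ → Submodule C (Op (SM C) n)) (hF : Monotone F) (q : ℕ) :
    Submodule ℝ (Form C q n) where
  carrier := {a | (∃ w : VF C [⋀^Fin q]→ₗ[C] Op (SM C) n, ⇑w = a) ∧ ∃ N, ∀ X, a X ∈ F N}
  add_mem' := by
    rintro _ _ ⟨⟨w, rfl⟩, N, h⟩ ⟨⟨w', rfl⟩, N', h'⟩
    exact ⟨⟨w + w', rfl⟩, max N N', fun X =>
      add_mem (hF (le_max_left N N') (h X)) (hF (le_max_right N N') (h' X))⟩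
  zero_mem' := ⟨⟨0, rfl⟩, 0, fun _ => zero_mem _⟩
  smul_mem' := by
    rintro t _ ⟨⟨w, rfl⟩, N, h⟩
    refine ⟨⟨algebraMap ℝ C t • w, ?_⟩, N, fun X => ?_⟩
    · funext X; simp
    · have := Submodule.smul_mem _ (algebraMap ℝ C t) (h X)
      rwa [algebraMap_smul] at this

/-- `Ω^q(M, 𝒯_poly)`, in degree `n - 1`. -/
def formsT (C : Type*) [CommRing C] [Algebra ℝ C] (q n : ℕ) : Submodule ℝ (Form C q n) :=
  formsIn (fun _ => polyVect C (SM C) n) monotone_const q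

/-- `Ω^q(M, 𝒟_poly)`, in degree `n - 1`. -/
def formsD (C : Type*) [CommRing C] [Algebra ℝ C] (q n : ℕ) : Submodule ℝ (Form C q n) :=
  formsIn (polyDiffLE C (SM C) n) (polyDiffLE_mono C (SM C) n) q

/-- The exterior covariant differential
`(D a)(X₀, …, X_q) = ∑ᵢ (-1)ⁱ D_{Xᵢ} (a (…, X̂ᵢ, …)) + ∑_{i<j} (-1)^{i+j} a ([Xᵢ, Xⱼ], …, X̂ᵢ, …, X̂ⱼ, …)`
with components `D_X`, acting on operators by commutators. In the second sum `[Xᵢ, Xⱼ]` has been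
moved to the position of `Xᵢ`. -/
def extD (D : VF C → SM C →ₗ[ℝ] SM C) {q n : ℕ} : Form C q n →ₗ[ℝ] Form C (q + 1) n where
  toFun a := fun X =>
    ∑ i : Fin (q + 1), (-1 : ℝ) ^ (i : ℕ) • opDer (D (X i)) (a (i.removeNth X)) +
    ∑ j : Fin (q + 1), ∑ i : Fin q,
      if i.castSucc < j then
        (-1 : ℝ) ^ (j : ℕ) • a (Function.update (j.removeNth X) i ⁅X i.castSucc, X j⁆)
      else 0
  map_add' a b := by
    funext X
    simp only [Pi.add_apply, map_add, smul_add, Finset.sum_add_distrib, ← Finset.sum_filter]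
    abel
  map_smul' t a := by
    funext X
    simp only [Pi.smul_apply, map_smul, RingHom.id_apply, smul_add, Finset.smul_sum,
      ← Finset.sum_filter, smul_comm t]

/-- The bracket of forms with values in operators that is induced by a bracket of operators,
`[α P, β Q] = (-1)^{k q'} α ∧ β [P, Q]` for `P` of degree `k = n - 1` and a `q'`-form `β`. -/
def formBracket (br : ∀ n n' : ℕ, Op (SM C) n → Op (SM C) n' → Op (SM C) (n + n' - 1))
    {q n q' n' : ℕ} (a : Form C q n) (b : Form C q' n') : Form C (q + q') (n + n' - 1) :=
  fun X => ((-1 : ℝ) ^ ((n + 1) * q') * ((q.factorial * q'.factorial : ℕ) : ℝ)⁻¹) •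
    ∑ σ : Equiv.Perm (Fin (q + q')), (Equiv.Perm.sign σ : ℤ) •
      br n n' (a fun i => X (σ (Fin.castAdd q' i))) (b fun j => X (σ (Fin.natAdd q j)))

/-- The differential on forms with values in operators that is induced by a differential of degree
`1` on operators. -/
def formDiff (d : ∀ n : ℕ, Op (SM C) n → Op (SM C) (n + 1)) {q n : ℕ} (a : Form C q n) :
    Form C q (n + 1) :=
  fun X => (-1 : ℝ) ^ q • d n (a X)

/-! ### Cohomology -/

/-- `D`-closed forms. -/
def cocycles (Ω : ∀ q n : ℕ, Submodule ℝ (Form C q n)) (D : VF C → SM C →ₗ[ℝ] SM C) (q n : ℕ) :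
    Submodule ℝ (Form C q n) :=
  Ω q n ⊓ LinearMap.ker (extD D)

/-- `D`-exact forms. -/
def coboundaries (Ω : ∀ q n : ℕ, Submodule ℝ (Form C q n)) (D : VF C → SM C →ₗ[ℝ] SM C) :
    ∀ q n : ℕ, Submodule ℝ (Form C q n)
  | 0, _ => ⊥
  | q + 1, n => (Ω q n).map (extD D)

/-- The cohomology of the complex `(Ω^•, D)`. -/
def Cohomology (Ω : ∀ q n : ℕ, Submodule ℝ (Form C q n)) (D : VF C → SM C →ₗ[ℝ] SM C)
    (q n : ℕ) : Type _ :=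
  ↥(cocycles Ω D q n) ⧸ (coboundaries Ω D q n).submoduleOf (cocycles Ω D q n)

instance (Ω : ∀ q n : ℕ, Submodule ℝ (Form C q n)) (D : VF C → SM C →ₗ[ℝ] SM C) (q n : ℕ) :
    AddCommGroup (Cohomology Ω D q n) :=
  inferInstanceAs (AddCommGroup
    (↥(cocycles Ω D q n) ⧸ (coboundaries Ω D q n).submoduleOf (cocycles Ω D q n)))

instance (Ω : ∀ q n : ℕ, Submodule ℝ (Form C q n)) (D : VF C → SM C →ₗ[ℝ] SM C) (q n : ℕ) :
    Module ℝ (Cohomology Ω D q n) :=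
  inferInstanceAs (Module ℝ
    (↥(cocycles Ω D q n) ⧸ (coboundaries Ω D q n).submoduleOf (cocycles Ω D q n)))

/-- The cohomology class of a closed form. -/
def cls (Ω : ∀ q n : ℕ, Submodule ℝ (Form C q n)) (D : VF C → SM C →ₗ[ℝ] SM C) {q n : ℕ}
    (a : cocycles Ω D q n) : Cohomology Ω D q n :=
  Submodule.Quotient.mk a

/-! ### The maps `σ`, `τ` and `μ` -/

/-- A fibrewise operator regarded as a form of exterior degree `0`. -/
def constForm (C : Type*) [CommRing C] [Algebra ℝ C] (n : ℕ) : Op (SM C) n →ₗ[ℝ] Form C 0 n where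
  toFun P := fun _ => P
  map_add' _ _ := rfl
  map_smul' _ _ := rfl

/-- The space `F⁰` of fibrewise operators in `Ω⁰` with constant coefficients in `y`, that is,
which commute with all `∂/∂yⁱ`. -/
def constCoeff (Ω : ∀ q n : ℕ, Submodule ℝ (Form C q n)) (n : ℕ) : Submodule ℝ (Op (SM C) n) :=
  (Ω 0 n).comap (constForm C n) ⊓ ⨅ Z : VF C, LinearMap.ker (opDer (vertDer Z))

/-- The projection `σ P = P|_{y = 0}`: the operator whose coefficients are constant in `y` and
equal to those of `P` at `y = 0`, so that `P` and `σ P` have the same values at `y = 0`. -/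
def sigma {n : ℕ} (P : Op (SM C) n) : Op (SM C) n :=
  Classical.epsilon fun P₀ => (∀ Z, opDer (vertDer Z) P₀ = 0) ∧ ∀ s, atZero (P₀ s) = atZero (P s)

/-- `τ f` is the `D`-closed section of `SM` with `τ f |_{y = 0} = f`. -/
def tau (D : VF C → SM C →ₗ[ℝ] SM C) (f : C) : SM C :=
  Classical.epsilon fun F => (∀ X, D X F = 0) ∧ atZero F = f

/-- `μ(P)(f₁, …, fₙ) = P (τ f₁, …, τ fₙ) |_{y = 0}`. -/
def mu (D : VF C → SM C →ₗ[ℝ] SM C) {n : ℕ} (P : Op (SM C) n) : Op C n :=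
  fun f => atZero (P fun i => tau D (f i))

/-- Every smooth function has exactly one lift `τ f` to a `D`-closed section of `SM`. -/
def HasFlatLifts (D : VF C → SM C →ₗ[ℝ] SM C) : Prop :=
  ∀ f : C, (∀ X, D X (tau D f) = 0) ∧ atZero (tau D f) = f ∧
    ∀ F : SM C, (∀ X, D X F = 0) → atZero F = f → F = tau D f

/-- The complex `(Ω, D)`, with the bracket and differential of forms induced by those of fibrewise
operators, is a resolution of the DGLA `L` of operators on `C` via `μ`. -/
structure IsDGLAResolution (D : VF C → SM C →ₗ[ℝ] SM C)
    (Ω : ∀ q n : ℕ, Submodule ℝ (Form C q n))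
    (brS : ∀ n n' : ℕ, Op (SM C) n → Op (SM C) n' → Op (SM C) (n + n' - 1))
    (dS : ∀ n : ℕ, Op (SM C) n → Op (SM C) (n + 1))
    (L : ∀ n : ℕ, Submodule ℝ (Op C n))
    (brC : ∀ n n' : ℕ, Op C n → Op C n' → Op C (n + n' - 1))
    (dC : ∀ n : ℕ, Op C n → Op C (n + 1)) : Prop where
  /-- `Ω` is closed under `D`, the bracket and the differential, and `D² = 0`. -/
  extD_mem : ∀ {q n} (a : Form C q n), a ∈ Ω q n → extD D a ∈ Ω (q + 1) n
  bracket_mem : ∀ {q n q' n'} (a : Form C q n) (b : Form C q' n'), a ∈ Ω q n → b ∈ Ω q' n' →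
    formBracket brS a b ∈ Ω (q + q') (n + n' - 1)
  diff_mem : ∀ {q n} (a : Form C q n), a ∈ Ω q n → formDiff dS a ∈ Ω q (n + 1)
  extD_extD : ∀ {q n} (a : Form C q n), a ∈ Ω q n → extD D (extD D a) = 0
  /-- The cohomology vanishes in positive exterior degree. -/
  acyclic : ∀ q n, Subsingleton (Cohomology Ω D (q + 1) n)
  /-- `σ P` exists and is unique. -/
  sigma_spec : ∀ {n} (P : Op (SM C) n), constForm C n P ∈ Ω 0 n →
    sigma P ∈ constCoeff Ω n ∧ (∀ s, atZero (sigma P s) = atZero (P s)) ∧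
      ∀ P₀ ∈ constCoeff Ω n, (∀ s, atZero (P₀ s) = atZero (P s)) → P₀ = sigma P
  /-- The bracket and the differential of forms descend to cohomology; `σ` and `μ` induce
  isomorphisms `H⁰ ≃ F⁰ ≃ L`; and the bracket and the differential on cohomology are those of `L`
  transported along these isomorphisms. -/
  cohomology_iso :
    ∃ (brH : ∀ {q n q' n' : ℕ}, Cohomology Ω D q n →ₗ[ℝ] Cohomology Ω D q' n' →ₗ[ℝ]
          Cohomology Ω D (q + q') (n + n' - 1))
      (dH : ∀ {q n : ℕ}, Cohomology Ω D q n →ₗ[ℝ] Cohomology Ω D q (n + 1))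
      (sigmaH : ∀ n : ℕ, Cohomology Ω D 0 n ≃ₗ[ℝ] constCoeff Ω n)
      (muF : ∀ n : ℕ, constCoeff Ω n ≃ₗ[ℝ] L n),
      (∀ {q n q' n'} (a : cocycles Ω D q n) (b : cocycles Ω D q' n'),
        ∃ h : formBracket brS a.1 b.1 ∈ cocycles Ω D (q + q') (n + n' - 1),
          brH (cls Ω D a) (cls Ω D b) = cls Ω D ⟨_, h⟩) ∧
      (∀ {q n} (a : cocycles Ω D q n), ∃ h : formDiff dS a.1 ∈ cocycles Ω D q (n + 1),
          dH (cls Ω D a) = cls Ω D ⟨_, h⟩) ∧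
      (∀ {n} (a : cocycles Ω D 0 n), (sigmaH n (cls Ω D a)).1 = sigma (a.1 ![])) ∧
      (∀ {n} (P : constCoeff Ω n), (muF n P).1 = mu D P.1) ∧
      (∀ {n n'} (u : Cohomology Ω D 0 n) (v : Cohomology Ω D 0 n'),
        (muF _ (sigmaH _ (brH u v))).1 = brC n n' (muF n (sigmaH n u)).1 (muF n' (sigmaH n' v)).1) ∧
      (∀ {n} (u : Cohomology Ω D 0 n),
        (muF _ (sigmaH _ (dH u))).1 = dC n (muF n (sigmaH n u)).1)
  /-- `μ ∘ σ` is an isomorphism from the closed elements of exterior degree `0` to `L`, which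
  respects brackets and differentials. -/
  cocycle_iso :
    ∃ Φ : ∀ n : ℕ, cocycles Ω D 0 n ≃ₗ[ℝ] L n,
      (∀ {n} (a : cocycles Ω D 0 n), (Φ n a).1 = mu D (sigma (a.1 ![]))) ∧
      (∀ {n n'} (a : cocycles Ω D 0 n) (b : cocycles Ω D 0 n'),
        ∃ h : formBracket brS a.1 b.1 ∈ cocycles Ω D 0 (n + n' - 1),
          (Φ _ ⟨_, h⟩).1 = brC n n' (Φ n a).1 (Φ n' b).1) ∧
      (∀ {n} (a : cocycles Ω D 0 n), ∃ h : formDiff dS a.1 ∈ cocycles Ω D 0 (n + 1),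
          (Φ _ ⟨_, h⟩).1 = dC n (Φ n a).1)

end Fedosov

end

set_option linter.unusedSectionVars false

/-! ### Formal power series along the fibres: products, derivatives, filtration. -/

noncomputable section

namespace Fedosov

section Basic

variable {C : Type*} [CommRing C] [Algebra ℝ C]

/-! ### Components of sections -/

/-! The algebra takes place over an arbitrary commutative ℝ-algebra C that has a `Frame`: finitely
many derivations eᵢ and elements xⁱ with X = ∑ X(xⁱ) eᵢ for all X. Geometry enters only through
`exists_frame`: an immersion of M into a Euclidean space gives a frame, with eᵢ the tangential part
of the i-th basis vector. The linear sections yⁱ = dxⁱ then serve as global, redundant fibre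
coordinates, and the Euler field ∑ yⁱ ∂_{eᵢ} multiplies the part of degree p in y by p.

The operator D is −δ plus terms that do not lower the degree in y (`IsConn`), so the main tool is
successive approximation in the y-adic filtration, which is separated and complete. Contraction κ
with the Euler field satisfies κδ + δκ = q + E on q-forms with q > 0, where E acts on coefficients
by the Euler field (`Frame.kappa_deltaForm`). On coefficients of order r, E is r up to higher order,
so a D-closed form of positive exterior degree acquires a primitive order by order
(`Frame.exists_primitive`). This gives acyclicity. Applied to DP it also gives a D-closed operator
with the same values at y = 0 as P (`Frame.exists_closed`); it is unique, because a closed operator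
vanishing at y = 0 vanishes (`Frame.eq_zero_of_closed`). The projection σ comes from the same
argument with −δ in place of D, and τ from the case of operators without arguments. For part (1),
the equation for A says exactly that κ kills D², the Bianchi identity says that D kills D², and the
homotopy formula then forces D² = 0.

On forms, D is the alternation of a covariant derivative, since the connection is torsion-free;
hence it preserves C-multilinear forms (`extD_mem`). Its square vanishes by Cartan calculus
(`extD_extD`).

Both brackets are finite combinations of insertions of one operator into another, with coefficients
that depend only on the numbers of arguments (`exists_gerstenhaberData`, `exists_schoutenData`). So
derivations act on them by the Leibniz rule, and anything intertwined by a linear map stays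
intertwined after a bracket. The map τ is a homomorphism of algebras, and a closed P satisfies
P(τf₁, …) = τ(μP(f₁, …)); therefore μ carries brackets of closed operators to brackets. That the
Schouten bracket of polyvector fields is again a derivation in each argument is a separate
cancellation (`leibnizDefect_schouten_cons`).

It remains to see that μ is bijective. It is injective on closed operators because the C-span of the
flat lifts is dense and operators of finite order are continuous (`Frame.mem_gr_one_of_mu_eq_zero`).
It is surjective on polyvector fields by an explicit formula in the frame, and on polydifferential
operators by induction on the order: N·Q − ∑ [Q, xⁱ] ∘ eᵢ has lower order than Q
(`Frame.orderLT_sub_symbolOp`). -/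

theorem comp_mul (p : ℕ) (a b : SM C) (Y : VF C) :
    comp p (a * b) Y = ∑ x ∈ Finset.HasAntidiagonal.antidiagonal p, comp x.1 a Y * comp x.2 b Y :=
  PowerSeries.coeff_mul p (a.1 Y) (b.1 Y)

theorem comp_csmul (p : ℕ) (c : C) (a : SM C) (Y : VF C) : comp p (c • a) Y = c * comp p a Y :=
  map_smul (PowerSeries.coeff p) c (a.1 Y)

theorem comp_zero (p : ℕ) (Y : VF C) : comp p (0 : SM C) Y = 0 :=
  map_zero (PowerSeries.coeff p)

/-- The component of degree `p` at `Y` as a linear map. -/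
def compL (p : ℕ) (Y : VF C) : SM C →ₗ[C] C where
  toFun a := comp p a Y
  map_add' a b := comp_add p a b Y
  map_smul' c a := comp_csmul p c a Y

theorem comp_sub (p : ℕ) (a b : SM C) (Y : VF C) : comp p (a - b) Y = comp p a Y - comp p b Y :=
  map_sub (compL p Y) a b

theorem comp_sum {ι : Type*} (p : ℕ) (s : Finset ι) (a : ι → SM C) (Y : VF C) :
    comp p (∑ i ∈ s, a i) Y = ∑ i ∈ s, comp p (a i) Y :=
  map_sum (compL p Y) a s

theorem comp_algebraMap (p : ℕ) (c : C) (Y : VF C) :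
    comp p (algebraMap C (SM C) c) Y = if p = 0 then c else 0 :=
  PowerSeries.coeff_C p c

theorem comp_one (p : ℕ) (Y : VF C) : comp p (1 : SM C) Y = if p = 0 then 1 else 0 := by
  rw [← map_one (algebraMap C (SM C)), comp_algebraMap]

/-- A tensor without arguments does not see Y, so the choice Y = 0 in `atZero` is immaterial. -/
theorem comp_zero_eq (a : SM C) (Y : VF C) : comp 0 a Y = atZero a := by
  rw [atZero, ← tensor_diag, ← tensor_diag]
  congr 1
  exact Subsingleton.elim _ _

/-- Restriction to `y = 0` as a homomorphism of algebras. -/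
def atZeroHom (C : Type*) [CommRing C] [Algebra ℝ C] : SM C →ₐ[C] C where
  toFun := atZero
  map_one' := by simp [atZero, comp_one]
  map_mul' a b := by simp [atZero, comp_mul]
  map_zero' := comp_zero 0 0
  map_add' a b := comp_add 0 a b 0
  commutes' c := by simp [atZero, comp_algebraMap]

theorem atZeroHom_apply (a : SM C) : atZeroHom C a = atZero a := rfl

/-! ### Fibrewise derivatives -/

/-- Real linear functionals separate the points of C; after applying one to the coefficients, the
claim is that a real polynomial is determined by its values. -/
theorem polynomial_eq_of_eval_real {q r : Polynomial C}
    (h : ∀ t : ℝ, q.eval (algebraMap ℝ C t) = r.eval (algebraMap ℝ C t)) : q = r := by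
  rw [← sub_eq_zero]
  ext n
  rw [Polynomial.coeff_zero, ← Module.forall_dual_apply_eq_zero_iff ℝ]
  intro φ
  set u := q - r
  let v : Polynomial ℝ := ∑ k ∈ Finset.range (u.natDegree + 1),
    Polynomial.C (φ (u.coeff k)) * Polynomial.X ^ k
  have hv : v = 0 := by
    refine Polynomial.funext fun t => ?_
    have h1 : u.eval (algebraMap ℝ C t) = 0 := by simp [u, h]
    rw [Polynomial.eval_eq_sum_range] at h1
    have h2 := congrArg φ h1
    rw [map_sum, map_zero] at h2
    simp only [v, Polynomial.eval_finsetSum, Polynomial.eval_mul, Polynomial.eval_C,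
      Polynomial.eval_pow, Polynomial.eval_X, Polynomial.eval_zero]
    rw [← h2]
    refine Finset.sum_congr rfl fun k _ => ?_
    rw [← map_pow, mul_comm (u.coeff k), ← Algebra.smul_def, map_smul, smul_eq_mul, mul_comm]
  by_cases hn : n ≤ u.natDegree
  · have hc := congrArg (fun r => Polynomial.coeff r n) hv
    simp only [v, Polynomial.finsetSum_coeff, Polynomial.coeff_C_mul, Polynomial.coeff_X_pow,
      Polynomial.coeff_zero, mul_ite, mul_one, mul_zero] at hc
    rw [Finset.sum_ite_eq] at hc
    simpa [Nat.lt_succ_of_le hn] using hc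
  · rw [Polynomial.coeff_eq_zero_of_natDegree_lt (not_le.1 hn), map_zero]

/-- The expansion of a component along a line. -/
theorem exists_expansion (p : ℕ) (a : SM C) (Y Z : VF C) :
    ∃ q : Polynomial C, (∀ t : ℝ, comp p a (Y + t • Z) = q.eval (algebraMap ℝ C t)) ∧
      q.coeff 0 = comp p a Y ∧ q.coeff 1 = dirComp p a Y Z := by
  classical
  set γ := tensor p a
  -- The set s collects the slots of the tensor that receive Z instead of Y. The empty set gives the
  -- constant term, the singletons the linear term.
  refine ⟨∑ s : Finset (Fin p), Polynomial.C (γ (s.piecewise (fun _ => Z) (fun _ => Y))) *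
    Polynomial.X ^ s.card, ?_, ?_, ?_⟩
  · intro t
    rw [← tensor_diag]
    have h2 := γ.map_add_univ (fun _ => t • Z) (fun _ => Y)
    have h3 : ((fun _ => t • Z) + (fun _ => Y) : Fin p → VF C) = fun _ => Y + t • Z := by
      funext i; simp [add_comm]
    rw [h3] at h2
    rw [h2, Polynomial.eval_finsetSum]
    refine Finset.sum_congr rfl fun s _ => ?_
    have h5 : s.piecewise (fun _ => t • Z) (fun _ => Y) =
        s.piecewise (fun i => (algebraMap ℝ C t) • s.piecewise (fun _ => Z) (fun _ => Y) i)
          (s.piecewise (fun _ => Z) (fun _ => Y)) := by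
      funext i
      by_cases hi : i ∈ s <;> simp [hi, algebraMap_smul]
    rw [h5, γ.map_piecewise_smul (fun _ => algebraMap ℝ C t), Finset.prod_const,
      Polynomial.eval_mul, Polynomial.eval_C, Polynomial.eval_pow, Polynomial.eval_X,
      smul_eq_mul, mul_comm]
  · rw [Polynomial.finsetSum_coeff, Finset.sum_eq_single ∅]
    · simp [γ, tensor_diag]
    · intro s _ hs
      rw [Polynomial.coeff_C_mul, Polynomial.coeff_X_pow, if_neg, mul_zero]
      exact (Finset.card_pos.2 (Finset.nonempty_iff_ne_empty.2 hs)).ne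
    · simp
  · simp only [Polynomial.finsetSum_coeff, Polynomial.coeff_C_mul, Polynomial.coeff_X_pow, mul_ite,
      mul_one, mul_zero]
    rw [← Finset.sum_filter, dirComp, MultilinearMap.linearDeriv_apply]
    symm
    refine Finset.sum_bij (fun i _ => {i}) (by simp) (by simp) ?_ ?_
    · intro s hs
      obtain ⟨i, hi⟩ := Finset.card_eq_one.1 (Finset.mem_filter.1 hs).2.symm
      exact ⟨i, Finset.mem_univ _, hi.symm⟩
    · intro i _
      rw [Finset.piecewise_singleton]

/-- Frees the derivative from the chosen tensor: it can be read off from any polynomial expansion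
along the line Y + tZ. The Leibniz rule then reduces to the product of polynomials. -/
theorem dirComp_eq_coeff {p : ℕ} {a : SM C} {Y Z : VF C} {q : Polynomial C}
    (h : ∀ t : ℝ, comp p a (Y + t • Z) = q.eval (algebraMap ℝ C t)) :
    dirComp p a Y Z = q.coeff 1 := by
  obtain ⟨r, h1, -, h2⟩ := exists_expansion p a Y Z
  rw [← h2, polynomial_eq_of_eval_real fun t => (h t).symm.trans (h1 t)]

theorem dirComp_mul (p : ℕ) (a b : SM C) (Y Z : VF C) :
    dirComp p (a * b) Y Z = ∑ x ∈ Finset.HasAntidiagonal.antidiagonal p,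
      (comp x.1 a Y * dirComp x.2 b Y Z + dirComp x.1 a Y Z * comp x.2 b Y) := by
  choose q h1 h2 h3 using fun i => exists_expansion i a Y Z
  choose r k1 k2 k3 using fun i => exists_expansion i b Y Z
  rw [dirComp_eq_coeff (q := ∑ x ∈ Finset.HasAntidiagonal.antidiagonal p, q x.1 * r x.2)]
  · rw [Polynomial.finsetSum_coeff]
    refine Finset.sum_congr rfl fun x _ => ?_
    rw [Polynomial.coeff_mul, Finset.Nat.antidiagonal_succ]
    simp [h2, h3, k2, k3]
  · intro t
    simp [comp_mul, Polynomial.eval_finsetSum, h1, k1]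

theorem dirComp_csmul (p : ℕ) (c : C) (a : SM C) (Y Z : VF C) :
    dirComp p (c • a) Y Z = c * dirComp p a Y Z := by
  rw [dirComp_eq (α := c • tensor p a)
    (fun Y => by rw [comp_csmul, smul_apply, tensor_diag, smul_eq_mul])]
  simp [dirComp, Finset.mul_sum]

theorem dirComp_self (p : ℕ) (a : SM C) (Y : VF C) :
    dirComp p a Y Y = p * comp p a Y := by
  simp [dirComp, MultilinearMap.linearDeriv_apply, tensor_diag]

theorem dirComp_zero_left (a : SM C) (Y Z : VF C) : dirComp 0 a Y Z = 0 := by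
  simp [dirComp]

/-- The derivative of a component, as a linear map in the direction. -/
def dirCompL (p : ℕ) (a : SM C) (Y : VF C) : VF C →ₗ[C] C where
  toFun Z := dirComp p a Y Z
  map_add' Z W := by
    simp only [dirComp]
    exact map_add ((tensor p a).linearDeriv fun _ => Y) (fun _ => Z) (fun _ => W)
  map_smul' c Z := by
    simp only [dirComp]
    exact map_smul ((tensor p a).linearDeriv fun _ => Y) c (fun _ => Z)

theorem comp_vertDer (p : ℕ) (Z : VF C) (a : SM C) (Y : VF C) :
    comp p (vertDer Z a) Y = dirComp (p + 1) a Y Z :=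
  PowerSeries.coeff_mk p fun p => dirComp (p + 1) a Y Z

theorem vertDer_mul (Z : VF C) (a b : SM C) :
    vertDer Z (a * b) = a * vertDer Z b + b * vertDer Z a := by
  refine SM_ext fun p Y => ?_
  rw [comp_add, comp_vertDer, dirComp_mul, comp_mul, comp_mul, Finset.sum_add_distrib]
  congr 1
  -- The antidiagonal of p + 1 loses the term in which the differentiated factor has degree 0, as
  -- its derivative vanishes; what remains is the antidiagonal of p.
  · rw [Finset.Nat.antidiagonal_succ']
    simp [dirComp_zero_left, comp_vertDer]
  · rw [Finset.Nat.antidiagonal_succ]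
    simp only [dirComp_zero_left, zero_mul, Finset.sum_cons, zero_add, Finset.sum_map]
    rw [← Finset.Nat.sum_antidiagonal_swap (f := fun x => comp x.1 b Y * comp x.2 (vertDer Z a) Y)]
    refine Finset.sum_congr rfl fun x _ => ?_
    simp [comp_vertDer, mul_comm]

theorem vertDer_csmul (Z : VF C) (c : C) (a : SM C) : vertDer Z (c • a) = c • vertDer Z a :=
  SM_ext fun p Y => by simp only [comp_vertDer, dirComp_csmul, comp_csmul]

theorem vertDer_add_left (Z W : VF C) (a : SM C) :
    vertDer (Z + W) a = vertDer Z a + vertDer W a :=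
  SM_ext fun p Y => by
    simp only [comp_vertDer, comp_add]; exact map_add (dirCompL (p + 1) a Y) Z W

theorem vertDer_smul_left (c : C) (Z : VF C) (a : SM C) : vertDer (c • Z) a = c • vertDer Z a :=
  SM_ext fun p Y => by
    simp only [comp_vertDer, comp_csmul]; exact map_smul (dirCompL (p + 1) a Y) c Z

/-- The fibrewise derivatives, as a `1`-form with values in derivations. -/
def vertDerForm (C : Type*) [CommRing C] [Algebra ℝ C] : OneForm C where
  toFun Z := Derivation.mk'
    { toFun := vertDer Z
      map_add' := map_add _
      map_smul' := vertDer_csmul Z } (vertDer_mul Z)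
  map_add' Z W := by ext a; exact vertDer_add_left Z W a
  map_smul' c Z := by ext a; exact vertDer_smul_left c Z a

theorem vertDerForm_apply (Z : VF C) (a : SM C) : vertDerForm C Z a = vertDer Z a := rfl

theorem vertDer_algebraMap (Z : VF C) (c : C) : vertDer Z (algebraMap C (SM C) c) = 0 :=
  (vertDerForm C Z).map_algebraMap c

/-! ### Covariant derivatives -/

theorem comp_covS (nabla : TorsionFreeConnection C) (X : VF C) (p : ℕ) (a : SM C) (Y : VF C) :
    comp p (covS nabla X a) Y = X (comp p a Y) - dirComp p a Y (nabla.cov X Y) :=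
  PowerSeries.coeff_mk p fun p => X (comp p a Y) - dirComp p a Y (nabla.cov X Y)

theorem covS_mul (nabla : TorsionFreeConnection C) (X : VF C) (a b : SM C) :
    covS nabla X (a * b) = a * covS nabla X b + b * covS nabla X a := by
  refine SM_ext fun p Y => ?_
  rw [comp_add, comp_mul, comp_mul, comp_covS, comp_mul, dirComp_mul, map_sum,
    ← Finset.sum_sub_distrib,
    ← Finset.Nat.sum_antidiagonal_swap (f := fun x => comp x.1 b Y * comp x.2 (covS nabla X a) Y),
    ← Finset.sum_add_distrib]
  refine Finset.sum_congr rfl fun x _ => ?_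
  simp only [comp_covS, Derivation.leibniz, smul_eq_mul, Prod.fst_swap, Prod.snd_swap]
  ring

theorem covS_algebraMap (nabla : TorsionFreeConnection C) (X : VF C) (c : C) :
    covS nabla X (algebraMap C (SM C) c) = algebraMap C (SM C) (X c) := by
  refine SM_ext fun p Y => ?_
  have h : dirComp p (algebraMap C (SM C) c) Y (nabla.cov X Y) = 0 := by
    cases p with
    | zero => exact dirComp_zero_left _ _ _
    | succ p => rw [← comp_vertDer, vertDer_algebraMap, comp_zero]
  rw [comp_covS, h, comp_algebraMap, comp_algebraMap]
  split_ifs <;> simp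

theorem covS_add_left (nabla : TorsionFreeConnection C) (X X' : VF C) (a : SM C) :
    covS nabla (X + X') a = covS nabla X a + covS nabla X' a := by
  refine SM_ext fun p Y => ?_
  have := map_add (dirCompL p a Y) (nabla.cov X Y) (nabla.cov X' Y)
  simp only [dirCompL, LinearMap.coe_mk, AddHom.coe_mk] at this
  simp only [comp_covS, comp_add, map_add, Derivation.add_apply, LinearMap.add_apply, this]
  abel

theorem covS_smul_left (nabla : TorsionFreeConnection C) (c : C) (X : VF C) (a : SM C) :
    covS nabla (c • X) a = c • covS nabla X a := by
  refine SM_ext fun p Y => ?_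
  have := map_smul (dirCompL p a Y) c (nabla.cov X Y)
  simp only [dirCompL, LinearMap.coe_mk, AddHom.coe_mk] at this
  simp only [comp_covS, comp_csmul, map_smul, Derivation.smul_apply, LinearMap.smul_apply, this,
    smul_eq_mul, mul_sub]

/-! ### The filtration by the degree in `y` -/

/-- The sections that vanish to order `r` at `y = 0`. -/
def Fil (C : Type*) [CommRing C] [Algebra ℝ C] (r : ℕ) : Ideal (SM C) where
  carrier := {s | ∀ p < r, ∀ Y, comp p s Y = 0}
  add_mem' ha hb p hp Y := by rw [comp_add, ha p hp, hb p hp, add_zero]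
  zero_mem' p _ Y := comp_zero p Y
  smul_mem' s a ha p hp Y := by
    rw [smul_eq_mul, comp_mul]
    refine Finset.sum_eq_zero fun x hx => ?_
    rw [ha x.2 (by have := Finset.HasAntidiagonal.mem_antidiagonal.1 hx; omega), mul_zero]

theorem mem_Fil {r : ℕ} {s : SM C} : s ∈ Fil C r ↔ ∀ p < r, ∀ Y, comp p s Y = 0 := Iff.rfl

theorem Fil_antitone : Antitone (Fil C) := fun _ _ h _ hs p hp Y => hs p (hp.trans_le h) Y

theorem mem_Fil_zero (s : SM C) : s ∈ Fil C 0 := fun p hp => absurd hp (Nat.not_lt_zero p)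

theorem Fil_csmul {r : ℕ} (c : C) {s : SM C} (hs : s ∈ Fil C r) : c • s ∈ Fil C r := by
  rw [Algebra.smul_def]; exact Ideal.mul_mem_left _ _ hs

theorem Fil_rsmul {r : ℕ} (c : ℝ) {s : SM C} (hs : s ∈ Fil C r) : c • s ∈ Fil C r := by
  rw [← algebraMap_smul C c s]; exact Fil_csmul _ hs

theorem mem_Fil_one {s : SM C} : s ∈ Fil C 1 ↔ atZero s = 0 := by
  refine ⟨fun h => h 0 one_pos 0, fun h p hp Y => ?_⟩
  obtain rfl : p = 0 := by omega
  rw [comp_zero_eq, h]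

theorem Fil_mul {k l : ℕ} {a b : SM C} (ha : a ∈ Fil C k) (hb : b ∈ Fil C l) :
    a * b ∈ Fil C (k + l) := by
  intro p hp Y
  rw [comp_mul]
  refine Finset.sum_eq_zero fun x hx => ?_
  have := Finset.HasAntidiagonal.mem_antidiagonal.1 hx
  by_cases h : x.1 < k
  · rw [ha _ h, zero_mul]
  · rw [hb _ (by omega), mul_zero]

theorem eq_zero_of_forall_mem_Fil {s : SM C} (h : ∀ r, s ∈ Fil C r) : s = 0 :=
  SM_ext fun p Y => by rw [h (p + 1) p (Nat.lt_succ_self p), comp_zero]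

theorem eq_of_forall_sub_mem_Fil {s t : SM C} (h : ∀ r, s - t ∈ Fil C r) : s = t :=
  sub_eq_zero.1 (eq_zero_of_forall_mem_Fil h)

/-- The representing tensor need not be zero, only its values on the diagonal are; by polarization
that suffices. -/
theorem dirComp_eq_zero {p : ℕ} {s : SM C} (h : ∀ Y, comp p s Y = 0) (Y Z : VF C) :
    dirComp p s Y Z = 0 :=
  linearDeriv_eq_zero _ (fun Y => by rw [tensor_diag, h]) Y Z

theorem vertDer_mem_Fil {r : ℕ} (Z : VF C) {s : SM C} (hs : s ∈ Fil C (r + 1)) :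
    vertDer Z s ∈ Fil C r := fun p hp Y => by
  rw [comp_vertDer, dirComp_eq_zero (hs (p + 1) (by omega))]

theorem covS_mem_Fil {r : ℕ} (nabla : TorsionFreeConnection C) (X : VF C) {s : SM C}
    (hs : s ∈ Fil C r) : covS nabla X s ∈ Fil C r := fun p hp Y => by
  rw [comp_covS, hs p hp, dirComp_eq_zero (hs p hp), map_zero, sub_zero]

/-- The sum of a series of sections that converges in the `y`-adic topology. -/
def seriesSum (u : ℕ → SM C) : SM C :=
  -- When `u r` has order at least r, the terms with r > p do not reach degree p, so each component
  -- is a finite sum.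
  ofComp (fun p Y => comp p (∑ r ∈ Finset.range (p + 1), u r) Y) fun p =>
    ⟨tensor p (∑ r ∈ Finset.range (p + 1), u r), fun _ => (tensor_diag _ _ _).symm⟩

theorem seriesSum_sub_mem {u : ℕ → SM C} (hu : ∀ r, u r ∈ Fil C r) (m : ℕ) :
    seriesSum u - ∑ r ∈ Finset.range m, u r ∈ Fil C m := by
  intro p hp Y
  rw [comp_sub, seriesSum, comp_ofComp, sub_eq_zero, comp_sum, comp_sum]
  refine Finset.sum_subset (by simpa using Nat.succ_le_of_lt hp) fun r _ hr => ?_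
  exact hu r p (by simpa using hr) Y

end Basic

end Fedosov

end

/-! ### Frames, fibre coordinates and connections. -/

noncomputable section

namespace Fedosov

/-- A finite family of vector fields and functions with `X = ∑ᵢ X(xⁱ) eᵢ` for all `X`. -/
structure Frame (C : Type*) [CommRing C] [Algebra ℝ C] (ι : Type*) [Fintype ι] where
  e : ι → VF C
  x : ι → C
  sum_eq : ∀ X : VF C, ∑ i, X (x i) • e i = X

section FrameSection

variable {C : Type*} [CommRing C] [Algebra ℝ C] {ι : Type*} [Fintype ι]

/-! ### Linear sections -/

/-- The linear section `dc`. -/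
def linSec (c : C) : SM C :=
  ofComp (fun p Y => if p = 1 then Y c else 0) fun p => by
    by_cases hp : p = 1
    · subst hp
      exact ⟨MultilinearMap.ofSubsingleton C (VF C) C (0 : Fin 1)
        { toFun := fun Y => Y c, map_add' := fun _ _ => rfl, map_smul' := fun _ _ => rfl },
        fun Y => by simp⟩
    · exact ⟨0, fun Y => by simp [hp]⟩

theorem comp_linSec (c : C) (p : ℕ) (Y : VF C) :
    comp p (linSec c) Y = if p = 1 then Y c else 0 :=
  PowerSeries.coeff_mk p fun p => if p = 1 then Y c else 0

theorem isLinear_linSec (c : C) : IsLinear (linSec c) := fun p hp Y => by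
  rw [comp_linSec, if_neg hp]

theorem IsLinear.mem_Fil {a : SM C} (ha : IsLinear a) : a ∈ Fil C 1 := fun p hp Y =>
  ha p (by omega) Y

theorem IsLinear.comp_mul_zero {a : SM C} (ha : IsLinear a) (s : SM C) (Y : VF C) :
    comp 0 (a * s) Y = 0 := by
  simp [comp_mul, ha 0 (by simp)]

theorem IsLinear.comp_mul_succ {a : SM C} (ha : IsLinear a) (p : ℕ) (s : SM C) (Y : VF C) :
    comp (p + 1) (a * s) Y = comp 1 a Y * comp p s Y := by
  rw [comp_mul, Finset.sum_eq_single (1, p)]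
  · rintro ⟨i, j⟩ hx hne
    have := Finset.HasAntidiagonal.mem_antidiagonal.1 hx
    simp only at this
    rw [ha i (by rintro rfl; exact hne (by simp; omega)), zero_mul]
  · intro h
    exact absurd (Finset.HasAntidiagonal.mem_antidiagonal.2 (by simp; omega)) h

theorem dirComp_one (a : SM C) (Y Z : VF C) : dirComp 1 a Y Z = comp 1 a Z := by
  rw [dirComp, MultilinearMap.linearDeriv_apply, ← tensor_diag, Fin.sum_univ_one]
  congr 1
  funext j
  rw [Subsingleton.elim j 0, Function.update_self]

theorem IsLinear.vertDer_eq {a : SM C} (ha : IsLinear a) (Z : VF C) :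
    vertDer Z a = algebraMap C (SM C) (comp 1 a Z) := by
  refine SM_ext fun p Y => ?_
  rw [comp_vertDer, comp_algebraMap]
  split_ifs with hp
  · subst hp; exact dirComp_one a Y Z
  · exact dirComp_eq_zero (ha (p + 1) (by omega)) Y Z

theorem IsLinear.covS_eq (nabla : TorsionFreeConnection C) {a : SM C} (ha : IsLinear a)
    (X : VF C) : IsLinear (covS nabla X a) := fun p hp Y => by
  rw [comp_covS, ha p hp, dirComp_eq_zero (ha p hp), map_zero, sub_zero]

namespace Frame

variable (fr : Frame C ι)

/-- The fibre coordinates. -/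
def y (i : ι) : SM C := linSec (fr.x i)

theorem isLinear_y (i : ι) : IsLinear (fr.y i) := isLinear_linSec _

theorem y_mem (i : ι) : fr.y i ∈ Fil C 1 := (fr.isLinear_y i).mem_Fil

theorem comp_y_mul_succ (i : ι) (p : ℕ) (s : SM C) (Y : VF C) :
    comp (p + 1) (fr.y i * s) Y = Y (fr.x i) * comp p s Y := by
  rw [(fr.isLinear_y i).comp_mul_succ, y, comp_linSec, if_pos rfl]

theorem comp_y_mul_zero (i : ι) (s : SM C) (Y : VF C) : comp 0 (fr.y i * s) Y = 0 :=
  (fr.isLinear_y i).comp_mul_zero s Y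

theorem vertDer_y (Z : VF C) (i : ι) : vertDer Z (fr.y i) = algebraMap C (SM C) (Z (fr.x i)) := by
  rw [(fr.isLinear_y i).vertDer_eq, y, comp_linSec, if_pos rfl]

theorem sum_map {N : Type*} [AddCommGroup N] [Module C N] (f : VF C →ₗ[C] N) (X : VF C) :
    ∑ i, X (fr.x i) • f (fr.e i) = f X := by
  conv_rhs => rw [← fr.sum_eq X]
  simp

/-- The Euler vector field multiplies the component of degree `p` by `p`. -/
theorem comp_euler (s : SM C) (p : ℕ) (Y : VF C) :
    comp p (∑ i, fr.y i * vertDer (fr.e i) s) Y = p * comp p s Y := by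
  rw [comp_sum]
  cases p with
  | zero => simp [comp_y_mul_zero]
  | succ p =>
    simp only [comp_y_mul_succ, comp_vertDer]
    rw [← dirComp_self]
    exact fr.sum_map (dirCompL (p + 1) s Y) Y

/-- The Euler field acts on the leading part, of degree r, as the scalar r. -/
theorem euler_sub_mem {r : ℕ} {s : SM C} (hs : s ∈ Fil C r) :
    ∑ i, fr.y i * vertDer (fr.e i) s - (r : ℝ) • s ∈ Fil C (r + 1) := by
  intro p hp Y
  rw [comp_sub, comp_euler, comp_smul]
  rcases Nat.lt_succ_iff_lt_or_eq.1 hp with h | rfl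
  · simp [hs p h]
  · simp [Algebra.smul_def]

/-- The `i`-th quotient in the division of a section by the fibre coordinates. -/
def quot (i : ι) (s : SM C) : SM C :=
  -- By Euler's identity the part of s of degree p + 1 is (p + 1)⁻¹ ∑ yⁱ ∂_{eᵢ} s, which explains
  -- the factor in degree p of the quotient.
  ofComp (fun p Y => ((p : ℝ) + 1)⁻¹ • comp p (vertDer (fr.e i) s) Y) fun p =>
    ⟨algebraMap ℝ C ((p : ℝ) + 1)⁻¹ • tensor p (vertDer (fr.e i) s), fun Y => by
      rw [smul_apply, tensor_diag, algebraMap_smul]⟩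

theorem comp_quot (i : ι) (s : SM C) (p : ℕ) (Y : VF C) :
    comp p (fr.quot i s) Y = ((p : ℝ) + 1)⁻¹ • comp p (vertDer (fr.e i) s) Y :=
  PowerSeries.coeff_mk p fun p => ((p : ℝ) + 1)⁻¹ • comp p (vertDer (fr.e i) s) Y

theorem quot_mem {r : ℕ} (i : ι) {s : SM C} (hs : s ∈ Fil C (r + 1)) : fr.quot i s ∈ Fil C r :=
  fun p hp Y => by rw [comp_quot, vertDer_mem_Fil _ hs p hp, smul_zero]

theorem eq_add_sum (s : SM C) :
    s = algebraMap C (SM C) (atZero s) + ∑ i, fr.y i * fr.quot i s := by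
  refine SM_ext fun p Y => ?_
  rw [comp_add, comp_algebraMap, comp_sum]
  cases p with
  | zero => simp only [comp_y_mul_zero]; simp [comp_zero_eq]
  | succ p =>
    have h := fr.comp_euler s (p + 1) Y
    rw [comp_sum] at h
    simp only [comp_y_mul_succ] at h
    simp only [Nat.succ_ne_zero, if_false, zero_add, comp_y_mul_succ, comp_quot, mul_smul_comm]
    rw [← Finset.smul_sum, h, Algebra.smul_def, ← mul_assoc, ← map_natCast (algebraMap ℝ C),
      ← map_mul]
    have : ((p : ℝ) + 1)⁻¹ * ((p + 1 : ℕ) : ℝ) = 1 := by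
      push_cast; exact inv_mul_cancel₀ (by positivity)
    rw [this, map_one, one_mul]

theorem eq_sum_of_mem {r : ℕ} {s : SM C} (hs : s ∈ Fil C (r + 1)) :
    s = ∑ i, fr.y i * fr.quot i s := by
  conv_lhs => rw [fr.eq_add_sum s]
  rw [mem_Fil_one.1 (Fil_antitone (by omega) hs), map_zero, zero_add]

/-- Dividing s by the yⁱ pulls a factor yⁱ out of B s, and this can be repeated, so B s has infinite
order. No continuity of B has to be assumed. Identities between fibrewise vector fields are checked
on the yⁱ by means of this lemma. -/
theorem derivation_eq_zero (B : Derivation C (SM C) (SM C)) (h : ∀ i, B (fr.y i) = 0) :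
    B = 0 := by
  have key : ∀ r s, B s ∈ Fil C r := by
    intro r
    induction r with
    | zero => exact fun s => mem_Fil_zero _
    | succ r ih =>
      intro s
      rw [fr.eq_add_sum s, map_add, B.map_algebraMap, zero_add, map_sum]
      refine Ideal.sum_mem _ fun i _ => ?_
      rw [B.leibniz, h, smul_zero, add_zero, smul_eq_mul, add_comm r]
      exact Fil_mul (fr.y_mem i) (ih _)
  ext s
  exact eq_zero_of_forall_mem_Fil fun r => key r s

theorem derivation_mem_Fil (B : Derivation C (SM C) (SM C)) (h : ∀ i, B (fr.y i) ∈ Fil C 2)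
    {r : ℕ} : ∀ {s : SM C}, s ∈ Fil C r → B s ∈ Fil C (r + 1) := by
  induction r with
  | zero =>
    intro s _
    have h0 : B s = ∑ i, B (fr.y i * fr.quot i s) := by
      conv_lhs => rw [fr.eq_add_sum s, map_add, B.map_algebraMap, zero_add, map_sum]
    rw [h0]
    refine Ideal.sum_mem _ fun i _ => ?_
    rw [B.leibniz]
    exact (Fil C 1).add_mem (Ideal.mul_mem_right _ _ (fr.y_mem i))
      (Ideal.mul_mem_left _ _ (Fil_antitone one_le_two (h i)))
  | succ r ih =>
    intro s hs
    rw [fr.eq_sum_of_mem hs, map_sum]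
    refine Ideal.sum_mem _ fun i _ => ?_
    rw [B.leibniz, smul_eq_mul, smul_eq_mul]
    have h1 := Fil_mul (fr.y_mem i) (ih (fr.quot_mem i hs))
    have h2 := Fil_mul (fr.quot_mem i hs) (h i)
    rw [add_comm 1] at h1
    exact add_mem h1 h2

/-- The commutator is a C-linear derivation that kills the yⁱ, since ∂_Z yⁱ is constant along the
fibres. -/
theorem vertDer_comm (fr : Frame C ι) (Y Z : VF C) (a : SM C) :
    vertDer Y (vertDer Z a) = vertDer Z (vertDer Y a) := by
  have h : ⁅vertDerForm C Y, vertDerForm C Z⁆ = 0 := fr.derivation_eq_zero _ fun i => by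
    simp [Derivation.commutator_apply, vertDerForm_apply, vertDer_y, vertDer_algebraMap]
  have := congrArg (fun B : Derivation C (SM C) (SM C) => B a) h
  simpa [Derivation.commutator_apply, vertDerForm_apply, sub_eq_zero] using this

end Frame

/-! ### Connections on sections -/

/-- The components of an operator of the form `∇ - δ + A` on sections of `SM`. -/
structure IsConn (D : VF C → SM C →ₗ[ℝ] SM C) : Prop where
  add_left : ∀ X Y a, D (X + Y) a = D X a + D Y a
  smul_left : ∀ (c : C) X a, D (c • X) a = c • D X a
  map_mul : ∀ X a b, D X (a * b) = a * D X b + b * D X a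
  map_algebraMap : ∀ X c, D X (algebraMap C (SM C) c) = algebraMap C (SM C) (X c)
  add_vertDer_mem : ∀ {r} X {s : SM C}, s ∈ Fil C r → D X s + vertDer X s ∈ Fil C r

theorem fedosovD_apply (nabla : TorsionFreeConnection C) (A : OneForm C) (X : VF C) (a : SM C) :
    fedosovD nabla A X a = covS nabla X a - vertDer X a + A X a := rfl

theorem Frame.admissible_mem (fr : Frame C ι) {A : OneForm C} (hA : IsAdmissible A) (X : VF C)
    {r : ℕ} {s : SM C} (hs : s ∈ Fil C r) : A X s ∈ Fil C (r + 1) :=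
  fr.derivation_mem_Fil (A X) (fun i => hA X _ (fr.isLinear_y i)) hs

theorem Frame.isConn (fr : Frame C ι) (nabla : TorsionFreeConnection C) {A : OneForm C}
    (hA : IsAdmissible A) : IsConn (fedosovD nabla A) where
  add_left X Y a := by
    simp only [fedosovD_apply, covS_add_left, vertDer_add_left, map_add, Derivation.add_apply]; abel
  smul_left c X a := by
    simp only [fedosovD_apply, covS_smul_left, vertDer_smul_left, map_smul, Derivation.smul_apply,
      smul_sub, smul_add]
  map_mul X a b := by
    simp only [fedosovD_apply, covS_mul, vertDer_mul, Derivation.leibniz, smul_eq_mul]; ring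
  map_algebraMap X c := by
    rw [fedosovD_apply, covS_algebraMap, vertDer_algebraMap, Derivation.map_algebraMap, sub_zero,
      add_zero]
  add_vertDer_mem {r} X s hs := by
    have : fedosovD nabla A X s + vertDer X s = covS nabla X s + A X s := by
      rw [fedosovD_apply]; abel
    rw [this]
    exact add_mem (covS_mem_Fil nabla X hs) (Fil_antitone (by omega) (fr.admissible_mem hA X hs))

/-- This is [∇_X, ∂_Z] = ∂_{∇_X Z}. The difference of the two sides is C-linear, because the terms
X(c) cancel, and a derivation, so it need only be tested on the yⁱ. -/
theorem Frame.covS_vertDer (fr : Frame C ι) (nabla : TorsionFreeConnection C) (X Z : VF C)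
    (a : SM C) :
    covS nabla X (vertDer Z a) = vertDer Z (covS nabla X a) + vertDer (nabla.cov X Z) a := by
  have hs : ∀ (c : C) (a : SM C), covS nabla X (c • a) = c • covS nabla X a + X c • a := by
    intro c a
    rw [Algebra.smul_def, covS_mul, covS_algebraMap, Algebra.smul_def, Algebra.smul_def,
      mul_comm a]
  let B : Derivation C (SM C) (SM C) := Derivation.mk'
    { toFun := fun a =>
        covS nabla X (vertDer Z a) - vertDer Z (covS nabla X a) - vertDer (nabla.cov X Z) a
      map_add' := fun a b => by simp only [map_add]; abel
      map_smul' := fun c a => by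
        simp only [hs, vertDer_csmul, map_add, RingHom.id_apply, smul_sub]; abel }
    (fun a b => by
      simp only [LinearMap.coe_mk, AddHom.coe_mk, vertDer_mul, covS_mul, map_add, smul_eq_mul]
      ring)
  have hB : B = 0 := fr.derivation_eq_zero B fun i => by
    change covS nabla X (vertDer Z (fr.y i)) - vertDer Z (covS nabla X (fr.y i)) -
      vertDer (nabla.cov X Z) (fr.y i) = 0
    rw [fr.vertDer_y, fr.vertDer_y, covS_algebraMap,
      ((fr.isLinear_y i).covS_eq nabla X).vertDer_eq, comp_covS, dirComp_one]
    simp only [Frame.y, comp_linSec, if_true, ← map_sub]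
    simp
  have := congrArg (fun B : Derivation C (SM C) (SM C) => B a) hB
  change covS nabla X (vertDer Z a) - vertDer Z (covS nabla X a) -
      vertDer (nabla.cov X Z) a = 0 at this
  rw [sub_sub, sub_eq_zero] at this
  exact this

end FrameSection

end Fedosov

end

/-! ### Derivations acting on operators; fibrewise operators. -/

noncomputable section

namespace Fedosov

/-! ### Maps of several arguments under endomorphisms of the arguments and the values -/

section DerAct

open Function

variable {V W : Type*} [AddCommGroup V] [AddCommGroup W] {n : ℕ}

/-- The action of a pair of endomorphisms on maps of several arguments. -/
def derAct (δV : V → V) (δW : W →+ W) (P : (Fin n → V) → W) : (Fin n → V) → W := fun a =>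
  δW (P a) - ∑ i, P (update a i (δV (a i)))

theorem derAct_apply (δV : V → V) (δW : W →+ W) (P : (Fin n → V) → W) (a : Fin n → V) :
    derAct δV δW P a = δW (P a) - ∑ i, P (update a i (δV (a i))) := rfl

theorem derAct_sub (δV : V → V) (δW : W →+ W) (P Q : (Fin n → V) → W) :
    derAct δV δW (P - Q) = derAct δV δW P - derAct δV δW Q := by
  funext a
  simp only [derAct_apply, Pi.sub_apply, map_sub, Finset.sum_sub_distrib]; abel

theorem derAct_update (δV : V → V) (δW : W →+ W) (P : (Fin n → V) → W) (a : Fin n → V) (i : Fin n)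
    (u : V) : derAct δV δW P (update a i u) = δW (P (update a i u)) - P (update a i (δV u)) -
      ∑ j ∈ Finset.univ.erase i, P (update (update a j (δV (a j))) i u) := by
  rw [derAct_apply, ← Finset.add_sum_erase _ _ (Finset.mem_univ i), sub_sub]
  congr 2
  · simp
  · refine Finset.sum_congr rfl fun j hj => ?_
    have hj := Finset.ne_of_mem_erase hj
    rw [update_of_ne hj, update_comm hj]

theorem update_sub_of_additive {P : (Fin n → V) → W}
    (hP : ∀ a i u v, P (update a i (u + v)) = P (update a i u) + P (update a i v)) (a : Fin n → V)
    (i : Fin n) (u v : V) : P (update a i (u - v)) = P (update a i u) - P (update a i v) := by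
  rw [eq_sub_iff_add_eq, ← hP, sub_add_cancel]

/-- In the composite, terms with the two endomorphisms in different slots, or one in a slot and one
on the value, are symmetric in 1 and 2 and cancel. Terms with both in one slot, or both on the
value, give the commutators. The argument spaces and value spaces may differ so that it serves both
operators and forms. -/
theorem derAct_commutator {P : (Fin n → V) → W} {δV : V → V} {δW : W →+ W} (δV₁ δV₂ : V → V)
    (δW₁ δW₂ : W →+ W)
    (hP : ∀ a i u v, P (update a i (u + v)) = P (update a i u) + P (update a i v))
    (hV : ∀ a, δV a = δV₁ (δV₂ a) - δV₂ (δV₁ a))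
    (hW : ∀ a, δW (P a) = δW₁ (δW₂ (P a)) - δW₂ (δW₁ (P a))) (a : Fin n → V) :
    derAct δV₁ δW₁ (derAct δV₂ δW₂ P) a - derAct δV₂ δW₂ (derAct δV₁ δW₁ P) a =
      derAct δV δW P a := by
  have key : ∀ (δV₁ δV₂ : V → V) (δW₁ δW₂ : W →+ W), derAct δV₁ δW₁ (derAct δV₂ δW₂ P) a =
      δW₁ (δW₂ (P a)) -
      ∑ i, δW₁ (P (update a i (δV₂ (a i)))) - ∑ i, δW₂ (P (update a i (δV₁ (a i)))) +
      ∑ i, P (update a i (δV₂ (δV₁ (a i)))) + ∑ i, ∑ j ∈ Finset.univ.erase i,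
        P (update (update a j (δV₂ (a j))) i (δV₁ (a i))) := by
    intro δV₁ δV₂ δW₁ δW₂
    rw [derAct_apply, derAct_apply, map_sub, map_sum]
    simp only [derAct_update δV₂ δW₂ P a, Finset.sum_sub_distrib]
    abel
  have hsymm : ∀ δ₁ δ₂ : V → V, ∑ i, ∑ j ∈ Finset.univ.erase i,
        P (update (update a j (δ₂ (a j))) i (δ₁ (a i))) = ∑ i, ∑ j ∈ Finset.univ.erase i,
        P (update (update a j (δ₁ (a j))) i (δ₂ (a i))) := by
    intro δ₁ δ₂
    rw [Finset.sum_sigma', Finset.sum_sigma']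
    refine Finset.sum_bij (fun x _ => ⟨x.2, x.1⟩) ?_ ?_ ?_ ?_
    · rintro ⟨i, j⟩ h
      simp only [Finset.mem_sigma, Finset.mem_univ, Finset.mem_erase, and_true, true_and] at h ⊢
      exact Ne.symm h
    · rintro ⟨i, j⟩ _ ⟨i', j'⟩ _ h
      simp only [Sigma.mk.injEq, heq_eq_eq] at h
      simp [h]
    · rintro ⟨i, j⟩ h
      refine ⟨⟨j, i⟩, ?_, rfl⟩
      simp only [Finset.mem_sigma, Finset.mem_univ, Finset.mem_erase, and_true, true_and] at h ⊢
      exact Ne.symm h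
    · rintro ⟨i, j⟩ h
      simp only [Finset.mem_sigma, Finset.mem_univ, Finset.mem_erase, and_true, true_and] at h
      simp only
      rw [update_comm h]
  rw [key δV₁ δV₂, key δV₂ δV₁, hsymm δV₁ δV₂, derAct_apply, hW]
  simp only [hV, update_sub_of_additive hP, Finset.sum_sub_distrib]
  abel

/-- With aᵢ = aⱼ, only the terms that alter slot i or slot j survive, and these two differ by the
transposition of i and j. -/
theorem derAct_eq_zero (δV : V → V) (δW : W →+ W) {P : (Fin n → V) → W}
    (hP : ∀ a i j, a i = a j → i ≠ j → P a = 0)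
    (hswap : ∀ a i j, i ≠ j → P (a ∘ Equiv.swap i j) = -P a)
    (a : Fin n → V) (i j : Fin n) (hij : a i = a j) (hne : i ≠ j) : derAct δV δW P a = 0 := by
  rw [derAct_apply, hP a i j hij hne, map_zero, zero_sub, neg_eq_zero,
    ← Finset.sum_subset (Finset.subset_univ {i, j}), Finset.sum_pair hne]
  · have e : update a j (δV (a j)) = update a i (δV (a i)) ∘ Equiv.swap i j := by
      funext k
      by_cases hki : k = i
      · subst hki
        simp [hij, hne, hne.symm]
      · by_cases hkj : k = j
        · subst hkj; simp [hij]
        · simp [Equiv.swap_apply_of_ne_of_ne hki hkj, hki, hkj]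
    rw [e, hswap _ i j hne, add_neg_cancel]
  · intro k _ hk
    simp only [Finset.mem_insert, Finset.mem_singleton, not_or] at hk
    refine hP _ i j ?_ hne
    rw [update_of_ne (Ne.symm hk.1), update_of_ne (Ne.symm hk.2), hij]

end DerAct

section Operators

open Function

variable {R A : Type*} [CommRing R] [CommRing A] [Algebra R A] {n : ℕ}

/-! ### Multilinear operators, multiderivations, orders -/

theorem mem_multilinearOps {P : Op A n} : P ∈ multilinearOps R A n ↔
    (∀ a i u v, P (update a i (u + v)) = P (update a i u) + P (update a i v)) ∧
      ∀ a i (c : R) u, P (update a i (c • u)) = c • P (update a i u) := by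
  constructor
  · rintro ⟨f, rfl⟩
    exact ⟨fun a i u v => f.map_update_add a i u v, fun a i c u => f.map_update_smul a i c u⟩
  · rintro ⟨h1, h2⟩
    refine ⟨{ toFun := P, map_update_add' := ?_, map_update_smul' := ?_ }, rfl⟩
    · intro inst a i u v
      obtain rfl : inst = instDecidableEqFin n := Subsingleton.elim _ _
      exact h1 a i u v
    · intro inst a i c u
      obtain rfl : inst = instDecidableEqFin n := Subsingleton.elim _ _
      exact h2 a i c u

theorem mem_polyVect {P : Op A n} : P ∈ polyVect R A n ↔
    P ∈ multilinearOps R A n ∧ (∀ a i j, a i = a j → i ≠ j → P a = 0) ∧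
      ∀ (i : Fin n) (a : Fin n → A) (s t : A),
        P (update a i (s * t)) = s * P (update a i t) + t * P (update a i s) := by
  constructor
  · rintro ⟨⟨f, rfl⟩, h⟩
    exact ⟨⟨f.toMultilinearMap, rfl⟩, fun a i j hij hne => f.map_eq_zero_of_eq a hij hne, h⟩
  · rintro ⟨⟨f, rfl⟩, h, h'⟩
    exact ⟨⟨{ f with map_eq_zero_of_eq' := fun a i j => h a i j }, rfl⟩, h'⟩

theorem polyVect_le_multilinearOps : polyVect R A n ≤ multilinearOps R A n := fun _ h =>
  (mem_polyVect.1 h).1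

theorem polyDiffLE_le_multilinearOps (N : ℕ) : polyDiffLE R A n N ≤ multilinearOps R A n :=
  fun _ h => h.1

theorem update_zero_of_mem {P : Op A n} (hP : P ∈ multilinearOps R A n) (a : Fin n → A)
    (i : Fin n) : P (update a i 0) = 0 := by
  have := (mem_multilinearOps.1 hP).2 a i 0 0
  simpa using this

theorem update_sub_of_mem {P : Op A n} (hP : P ∈ multilinearOps R A n) (a : Fin n → A)
    (i : Fin n) (u v : A) : P (update a i (u - v)) = P (update a i u) - P (update a i v) := by
  rw [eq_sub_iff_add_eq, ← (mem_multilinearOps.1 hP).1, sub_add_cancel]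

theorem update_sum_of_mem {P : Op A n} (hP : P ∈ multilinearOps R A n) (a : Fin n → A)
    (i : Fin n) {κ : Type*} (s : Finset κ) (u : κ → A) :
    P (update a i (∑ k ∈ s, u k)) = ∑ k ∈ s, P (update a i (u k)) := by
  classical
  induction s using Finset.induction_on with
  | empty => simp [update_zero_of_mem hP]
  | insert k s hk ih =>
    rw [Finset.sum_insert hk, Finset.sum_insert hk, (mem_multilinearOps.1 hP).1, ih]

theorem smul_mem_multilinearOps (s : A) {P : Op A n} (hP : P ∈ multilinearOps R A n) :
    s • P ∈ multilinearOps R A n := by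
  rw [mem_multilinearOps] at hP ⊢
  refine ⟨fun a i u v => ?_, fun a i c u => ?_⟩
  · simp only [Pi.smul_apply, hP.1, smul_add]
  · simp only [Pi.smul_apply, hP.2, smul_comm s c]

theorem adAt_mem_multilinearOps (i : Fin n) (s : A) {P : Op A n}
    (hP : P ∈ multilinearOps R A n) : adAt i s P ∈ multilinearOps R A n := by
  rw [mem_multilinearOps] at hP ⊢
  refine ⟨fun a j u v => ?_, fun a j c u => ?_⟩
  · by_cases hj : j = i
    · subst hj; simp only [adAt, update_self, update_idem, mul_add, hP.1]; ring
    · simp only [adAt, update_comm hj, update_of_ne (Ne.symm hj), hP.1]; ring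
  · by_cases hj : j = i
    · subst hj
      simp only [adAt, update_self, update_idem, mul_smul_comm, hP.2, smul_sub]
    · simp only [adAt, update_comm hj, update_of_ne (Ne.symm hj), hP.2, smul_sub, mul_smul_comm]

theorem adAt_smul_left (i : Fin n) (s t : A) (P : Op A n) :
    adAt i s (t • P) = t • adAt i s P := by
  funext a; simp only [adAt, Pi.smul_apply, smul_eq_mul]; ring

theorem adAt_comm (i j : Fin n) (s t : A) (P : Op A n) :
    adAt i s (adAt j t P) = adAt j t (adAt i s P) := by
  funext a
  by_cases h : i = j
  · subst h
    simp only [adAt, update_self, update_idem, mul_left_comm s t]; ring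
  · simp only [adAt, update_of_ne h, update_of_ne (Ne.symm h), update_comm h]; ring

theorem OrderLT.smul_left {i : Fin n} {N : ℕ} (s : A) :
    ∀ {P : Op A n}, OrderLT i N P → OrderLT i N (s • P) := by
  induction N with
  | zero => intro P hP; simp only [OrderLT] at *; rw [hP, smul_zero]
  | succ N ih => intro P hP t; rw [adAt_smul_left]; exact ih (hP t)

theorem OrderLT.adAt_mem {i : Fin n} {N : ℕ} (j : Fin n) (t : A) :
    ∀ {P : Op A n}, OrderLT i N P → OrderLT i N (adAt j t P) := by
  induction N with
  | zero =>
    intro P hP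
    simp only [OrderLT] at *
    subst hP
    funext a; simp [adAt]
  | succ N ih => intro P hP s; rw [adAt_comm]; exact ih (hP s)

theorem OrderLT.neg {i : Fin n} {N : ℕ} {P : Op A n} (hP : OrderLT i N P) :
    OrderLT i N (-P) := by
  have : -P = (-1 : A) • P := by simp
  rw [this]; exact hP.smul_left _

theorem OrderLT.sub {i : Fin n} {N : ℕ} {P Q : Op A n} (hP : OrderLT i N P)
    (hQ : OrderLT i N Q) : OrderLT i N (P - Q) := by
  rw [sub_eq_add_neg]; exact hP.add hQ.neg

theorem OrderLT.sum {i : Fin n} {N : ℕ} {κ : Type*} (s : Finset κ) {P : κ → Op A n}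
    (hP : ∀ k ∈ s, OrderLT i N (P k)) : OrderLT i N (∑ k ∈ s, P k) := by
  classical
  induction s using Finset.induction_on with
  | empty => simpa using OrderLT.zero
  | insert k s hk ih =>
    rw [Finset.sum_insert hk]
    exact (hP k (by simp)).add (ih fun k hk => hP k (by simp [hk]))

/-- For a derivation in the i-th argument, the commutator with s depends on that argument only
through multiplication by aᵢ, hence commutes with multiplications. -/
theorem polyVect_le_polyDiffLE : polyVect R A n ≤ polyDiffLE R A n 1 := by
  intro P hP
  refine ⟨polyVect_le_multilinearOps hP, fun i s => ?_⟩
  have h : adAt i s P = fun a => a i * P (update a i s) := by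
    funext a; rw [adAt, (mem_polyVect.1 hP).2.2, update_eq_self]; ring
  rw [h]
  intro t
  funext a
  simp [adAt, mul_assoc]

/-! ### Action of derivations on operators -/

variable [Algebra ℝ A]

theorem opDer_apply (δ : A →ₗ[ℝ] A) (P : Op A n) (a : Fin n → A) :
    opDer δ P a = δ (P a) - ∑ i, P (update a i (δ (a i))) := rfl

theorem opDer_update (δ : A →ₗ[ℝ] A) (P : Op A n) (a : Fin n → A) (i : Fin n) (u : A) :
    opDer δ P (update a i u) = δ (P (update a i u)) - P (update a i (δ u)) -
      ∑ j ∈ Finset.univ.erase i, P (update (update a j (δ (a j))) i u) :=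
  derAct_update δ δ.toAddMonoidHom P a i u

theorem opDer_smul {δ : A →ₗ[ℝ] A} (hδ : ∀ a b, δ (a * b) = a * δ b + b * δ a) (s : A)
    (P : Op A n) : opDer δ (s • P) = s • opDer δ P + δ s • P := by
  funext a
  simp only [opDer_apply, Pi.smul_apply, Pi.add_apply, smul_eq_mul, hδ, ← Finset.mul_sum]
  ring

theorem opDer_add_left {P : Op A n} (hP : P ∈ multilinearOps R A n) {δ δ₁ δ₂ : A →ₗ[ℝ] A}
    (h : ∀ a, δ a = δ₁ a + δ₂ a) : opDer δ P = opDer δ₁ P + opDer δ₂ P := by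
  funext a
  simp only [opDer_apply, Pi.add_apply, h, (mem_multilinearOps.1 hP).1, Finset.sum_add_distrib]
  abel

theorem opDer_smul_left {P : Op A n} (hP : P ∈ multilinearOps R A n) {δ δ₁ : A →ₗ[ℝ] A} {c : R}
    (h : ∀ a, δ a = c • δ₁ a) : opDer δ P = c • opDer δ₁ P := by
  funext a
  simp only [opDer_apply, Pi.smul_apply, h, (mem_multilinearOps.1 hP).2, smul_sub,
    Finset.smul_sum]

theorem opDer_commutator {P : Op A n} (hP : P ∈ multilinearOps R A n) {δ₁ δ₂ δ : A →ₗ[ℝ] A}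
    (h : ∀ a, δ a = δ₁ (δ₂ a) - δ₂ (δ₁ a)) :
    opDer δ₁ (opDer δ₂ P) - opDer δ₂ (opDer δ₁ P) = opDer δ P :=
  funext fun a => derAct_commutator (δV := δ) (δW := δ.toAddMonoidHom) δ₁ δ₂ δ₁.toAddMonoidHom
    δ₂.toAddMonoidHom (mem_multilinearOps.1 hP).1 h (fun a => h (P a)) a

/-- Jacobi identity for δ, P and multiplication by s, as [δ, s] = δ(s). It is why derivations do not
raise the order. -/
theorem adAt_opDer {P : Op A n} (hP : P ∈ multilinearOps R A n) {δ : A →ₗ[ℝ] A}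
    (hδ : ∀ a b, δ (a * b) = a * δ b + b * δ a) (i : Fin n) (s : A) :
    adAt i s (opDer δ P) = opDer δ (adAt i s P) - adAt i (δ s) P := by
  funext a
  have h1 := opDer_update δ P a i (s * a i)
  have h2 := opDer_update δ P a i (a i)
  have h3 := opDer_update δ (adAt i s P) a i (a i)
  rw [update_eq_self] at h2 h3
  rw [Pi.sub_apply, h3]
  simp only [adAt]
  rw [h1, h2, hδ, (mem_multilinearOps.1 hP).1]
  simp only [update_self, update_idem, Finset.sum_sub_distrib, map_sub, hδ,
    ← Finset.mul_sum, mul_sub, mul_comm (a i)]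
  ring

theorem OrderLT.opDer_mem {δ : A →ₗ[ℝ] A} (hδ : ∀ a b, δ (a * b) = a * δ b + b * δ a)
    {i : Fin n} {N : ℕ} : ∀ {P : Op A n}, P ∈ multilinearOps R A n → OrderLT i N P →
      OrderLT i N (opDer δ P) := by
  induction N with
  | zero => intro P _ hP; simp only [OrderLT] at *; rw [hP, map_zero]
  | succ N ih =>
    intro P hm hP s
    rw [adAt_opDer hm hδ]
    exact (ih (adAt_mem_multilinearOps i s hm) (hP s)).sub (hP (δ s))

end Operators

/-! ### Fibrewise operators -/

section Fibrewise

open Function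

variable {C : Type*} [CommRing C] [Algebra ℝ C] {n : ℕ}

/-- A derivation of `Γ(SM)` over a vector field. -/
structure IsDerOver (δ : SM C →ₗ[ℝ] SM C) (X : VF C) : Prop where
  map_mul : ∀ a b, δ (a * b) = a * δ b + b * δ a
  map_algebraMap : ∀ c, δ (algebraMap C (SM C) c) = algebraMap C (SM C) (X c)

theorem IsConn.isDerOver {D : VF C → SM C →ₗ[ℝ] SM C} (hD : IsConn D) (X : VF C) :
    IsDerOver (D X) X := ⟨hD.map_mul X, hD.map_algebraMap X⟩

theorem isDerOver_vertDer (Z : VF C) : IsDerOver (vertDer Z) 0 :=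
  ⟨vertDer_mul Z, fun c => by rw [vertDer_algebraMap]; simp⟩

theorem IsDerOver.map_csmul {δ : SM C →ₗ[ℝ] SM C} {X : VF C} (h : IsDerOver δ X) (c : C)
    (a : SM C) : δ (c • a) = c • δ a + X c • a := by
  rw [Algebra.smul_def, h.map_mul, h.map_algebraMap, Algebra.smul_def, Algebra.smul_def,
    mul_comm a]

theorem opDer_csmul {δ : SM C →ₗ[ℝ] SM C} {X : VF C} (h : IsDerOver δ X) (c : C)
    (P : Op (SM C) n) : opDer δ (c • P) = c • opDer δ P + X c • P := by
  have := opDer_smul h.map_mul (algebraMap C (SM C) c) P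
  rwa [h.map_algebraMap, algebraMap_smul, algebraMap_smul, algebraMap_smul] at this

theorem IsDerOver.opDer_mem_multilinearOps {δ : SM C →ₗ[ℝ] SM C} {X : VF C} (h : IsDerOver δ X)
    {P : Op (SM C) n} (hP : P ∈ multilinearOps C (SM C) n) :
    opDer δ P ∈ multilinearOps C (SM C) n := by
  rw [mem_multilinearOps] at hP ⊢
  refine ⟨fun a i u v => ?_, fun a i c u => ?_⟩
  · simp only [opDer_update, map_add, hP.1, Finset.sum_add_distrib]; abel
  · simp only [opDer_update, h.map_csmul, hP.1, hP.2, ← Finset.smul_sum, smul_sub]; abel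

/-- A space of fibrewise operators of `n` arguments that is a module over `Γ(SM)`, stable under
derivations, and closed in the `y`-adic topology. -/
structure IsFibrewise (F : Submodule C (Op (SM C) n)) : Prop where
  le_multilinearOps : F ≤ multilinearOps C (SM C) n
  smul_mem : ∀ (s : SM C) {P}, P ∈ F → s • P ∈ F
  opDer_mem : ∀ {δ : SM C →ₗ[ℝ] SM C} {X P}, IsDerOver δ X → P ∈ F → opDer δ P ∈ F
  closed : ∀ {P : Op (SM C) n}, (∀ m, ∃ Q ∈ F, ∀ s, P s - Q s ∈ Fil C m) → P ∈ F

/-- Each identity holds for the approximants, hence for P modulo every power of the filtration,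
hence exactly. The closedness statements that follow have the same reason. -/
theorem multilinearOps_closed {P : Op (SM C) n}
    (h : ∀ m, ∃ Q ∈ multilinearOps C (SM C) n, ∀ s, P s - Q s ∈ Fil C m) :
    P ∈ multilinearOps C (SM C) n := by
  rw [mem_multilinearOps]
  refine ⟨fun a i u v => eq_of_forall_sub_mem_Fil fun m => ?_,
    fun a i c u => eq_of_forall_sub_mem_Fil fun m => ?_⟩
  · obtain ⟨Q, hQ, hm⟩ := h m
    have e : P (update a i (u + v)) - (P (update a i u) + P (update a i v)) =
        (P (update a i (u + v)) - Q (update a i (u + v))) - (P (update a i u) - Q (update a i u)) -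
          (P (update a i v) - Q (update a i v)) := by
      rw [(mem_multilinearOps.1 hQ).1]; ring
    rw [e]
    exact sub_mem (sub_mem (hm _) (hm _)) (hm _)
  · obtain ⟨Q, hQ, hm⟩ := h m
    have e : P (update a i (c • u)) - c • P (update a i u) =
        (P (update a i (c • u)) - Q (update a i (c • u))) -
          c • (P (update a i u) - Q (update a i u)) := by
      rw [(mem_multilinearOps.1 hQ).2, smul_sub]; ring
    rw [e]
    exact sub_mem (hm _) (Fil_csmul c (hm _))

theorem OrderLT.closed {i : Fin n} {N : ℕ} : ∀ {P : Op (SM C) n},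
    (∀ m, ∃ Q, OrderLT i N Q ∧ ∀ s, P s - Q s ∈ Fil C m) → OrderLT i N P := by
  induction N with
  | zero =>
    intro P h
    funext s
    refine eq_of_forall_sub_mem_Fil fun m => ?_
    obtain ⟨Q, hQ, hm⟩ := h m
    simp only [OrderLT] at hQ
    subst hQ
    exact hm s
  | succ N ih =>
    intro P h t
    refine ih fun m => ?_
    obtain ⟨Q, hQ, hm⟩ := h m
    refine ⟨adAt i t Q, hQ t, fun s => ?_⟩
    have e : adAt i t P s - adAt i t Q s = (P (update s i (t * s i)) - Q (update s i (t * s i))) -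
        t * (P s - Q s) := by simp only [adAt]; ring
    rw [e]
    exact sub_mem (hm _) (Ideal.mul_mem_left _ _ (hm _))

theorem isFibrewise_polyVect : IsFibrewise (polyVect C (SM C) n) where
  le_multilinearOps := polyVect_le_multilinearOps
  smul_mem s P hP := by
    obtain ⟨h1, h2, h3⟩ := mem_polyVect.1 hP
    refine mem_polyVect.2 ⟨smul_mem_multilinearOps s h1, fun a i j hij hne => ?_,
      fun i a u v => ?_⟩
    · rw [Pi.smul_apply, h2 a i j hij hne, smul_zero]
    · simp only [Pi.smul_apply, h3, smul_eq_mul]; ring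
  opDer_mem {δ X P} hδ hP := by
    obtain ⟨h1, h2, h3⟩ := mem_polyVect.1 hP
    refine mem_polyVect.2 ⟨hδ.opDer_mem_multilinearOps h1, fun a i j hij hne => ?_,
      fun i a u v => ?_⟩
    · obtain ⟨⟨f, rfl⟩, -⟩ := hP
      exact derAct_eq_zero δ δ.toAddMonoidHom h2 (fun a i j hne => f.map_swap a hne) a i j hij hne
    · simp only [opDer_update, h3, hδ.map_mul, (mem_multilinearOps.1 h1).1, map_add,
        Finset.sum_add_distrib, ← Finset.mul_sum]
      ring
  closed {P} h := by
    refine mem_polyVect.2 ⟨multilinearOps_closed fun m => ?_, fun a i j hij hne => ?_,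
      fun i a s t => ?_⟩
    · obtain ⟨Q, hQ, hm⟩ := h m
      exact ⟨Q, polyVect_le_multilinearOps hQ, hm⟩
    · refine eq_of_forall_sub_mem_Fil fun m => ?_
      obtain ⟨Q, hQ, hm⟩ := h m
      rw [← (mem_polyVect.1 hQ).2.1 a i j hij hne]
      exact hm a
    · refine eq_of_forall_sub_mem_Fil fun m => ?_
      obtain ⟨Q, hQ, hm⟩ := h m
      have e : P (update a i (s * t)) - (s * P (update a i t) + t * P (update a i s)) =
          (P (update a i (s * t)) - Q (update a i (s * t))) -
          s * (P (update a i t) - Q (update a i t)) -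
          t * (P (update a i s) - Q (update a i s)) := by
        rw [(mem_polyVect.1 hQ).2.2]; ring
      rw [e]
      exact sub_mem (sub_mem (hm _) (Ideal.mul_mem_left _ _ (hm _)))
        (Ideal.mul_mem_left _ _ (hm _))

theorem isFibrewise_polyDiffLE (N : ℕ) : IsFibrewise (polyDiffLE C (SM C) n N) where
  le_multilinearOps := polyDiffLE_le_multilinearOps N
  smul_mem s _ hP := ⟨smul_mem_multilinearOps s hP.1, fun i => (hP.2 i).smul_left s⟩
  opDer_mem hδ hP := ⟨hδ.opDer_mem_multilinearOps hP.1, fun i => (hP.2 i).opDer_mem hδ.map_mul hP.1⟩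
  closed h := by
    refine ⟨multilinearOps_closed fun m => ?_, fun i => OrderLT.closed fun m => ?_⟩
    · obtain ⟨Q, hQ, hm⟩ := h m
      exact ⟨Q, hQ.1, hm⟩
    · obtain ⟨Q, hQ, hm⟩ := h m
      exact ⟨Q, hQ.2 i, hm⟩

end Fibrewise

end Fedosov

end

/-! ### Forms with values in operators; the Poincaré lemma along the fibres. -/

noncomputable section

namespace Fedosov

section Forms

open Function

variable {C : Type*} [CommRing C] [Algebra ℝ C] {ι : Type*} [Fintype ι] {n q : ℕ}

/-! ### Forms with values in a space of operators -/

/-- The exterior `q`-forms with values in a space of fibrewise operators. -/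
abbrev forms (F : Submodule C (Op (SM C) n)) (q : ℕ) : Submodule ℝ (Form C q n) :=
  formsIn (fun _ => F) monotone_const q

theorem exists_forms {F : Submodule C (Op (SM C) n)} {a : Form C q n} (ha : a ∈ forms F q) :
    (∃ w : VF C [⋀^Fin q]→ₗ[C] Op (SM C) n, ⇑w = a) ∧ ∀ X, a X ∈ F :=
  ⟨ha.1, fun X => ha.2.choose_spec X⟩

theorem mem_formsIn {F : ℕ → Submodule C (Op (SM C) n)} {hF : Monotone F} {a : Form C q n} :
    a ∈ formsIn F hF q ↔ ∃ N, a ∈ forms (F N) q :=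
  ⟨fun ⟨hw, N, h⟩ => ⟨N, hw, 0, h⟩, fun ⟨N, hw, _, h⟩ => ⟨hw, N, h⟩⟩

theorem mem_forms {F : Submodule C (Op (SM C) n)} {a : Form C q n} : a ∈ forms F q ↔
    (∀ X i u v, a (update X i (u + v)) = a (update X i u) + a (update X i v)) ∧
    (∀ X i (c : C) u, a (update X i (c • u)) = c • a (update X i u)) ∧
    (∀ X i j, X i = X j → i ≠ j → a X = 0) ∧ ∀ X, a X ∈ F := by
  constructor
  · intro ha
    obtain ⟨⟨w, rfl⟩, h⟩ := exists_forms ha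
    exact ⟨fun X i u v => w.map_update_add X i u v, fun X i c u => w.map_update_smul X i c u,
      fun X i j hij hne => w.map_eq_zero_of_eq X hij hne, h⟩
  · rintro ⟨h1, h2, h3, h4⟩
    refine ⟨⟨{ toFun := a
               map_update_add' := ?_
               map_update_smul' := ?_
               map_eq_zero_of_eq' := fun X i j => h3 X i j }, rfl⟩, 0, h4⟩
    · intro inst X i u v
      obtain rfl : inst = instDecidableEqFin q := Subsingleton.elim _ _
      exact h1 X i u v
    · intro inst X i c u
      obtain rfl : inst = instDecidableEqFin q := Subsingleton.elim _ _
      exact h2 X i c u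

/-- The operators with coefficients vanishing to order `r` at `y = 0`. -/
def gr (C : Type*) [CommRing C] [Algebra ℝ C] (n r : ℕ) : Submodule (SM C) (Op (SM C) n) where
  carrier := {P | ∀ s, P s ∈ Fil C r}
  add_mem' hP hQ s := add_mem (hP s) (hQ s)
  zero_mem' _ := zero_mem _
  smul_mem' t _ hP s := Ideal.mul_mem_left _ t (hP s)

theorem mem_gr {r : ℕ} {P : Op (SM C) n} : P ∈ gr C n r ↔ ∀ s, P s ∈ Fil C r := Iff.rfl

theorem gr_antitone : Antitone (gr C n) := fun _ _ h _ hP s => Fil_antitone h (hP s)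

theorem gr_rsmul {r : ℕ} (c : ℝ) {P : Op (SM C) n} (hP : P ∈ gr C n r) : c • P ∈ gr C n r :=
  fun s => Fil_rsmul c (hP s)

theorem gr_csmul {r : ℕ} (c : C) {P : Op (SM C) n} (hP : P ∈ gr C n r) : c • P ∈ gr C n r :=
  fun s => Fil_csmul c (hP s)

theorem mem_gr_zero (P : Op (SM C) n) : P ∈ gr C n 0 := fun _ => mem_Fil_zero _

theorem gr_smul {k r : ℕ} {s : SM C} (hs : s ∈ Fil C k) {P : Op (SM C) n} (hP : P ∈ gr C n r) :
    s • P ∈ gr C n (k + r) := fun t => Fil_mul hs (hP t)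

theorem eq_zero_of_forall_mem_gr {P : Op (SM C) n} (h : ∀ r, P ∈ gr C n r) : P = 0 :=
  funext fun s => eq_zero_of_forall_mem_Fil fun r => h r s

theorem opDer_vertDer_mem_gr {r : ℕ} (Z : VF C) {P : Op (SM C) n} (hP : P ∈ gr C n (r + 1)) :
    opDer (vertDer Z) P ∈ gr C n r := fun s =>
  sub_mem (vertDer_mem_Fil Z (hP s)) (Ideal.sum_mem _ fun _ _ => Fil_antitone (by omega) (hP _))

/-- Only the term in which D acts on the value of P could lower the order, and −∂_Z is the part of D
that does so. Terms with D inside an argument are values of P again, hence of order r whatever the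
argument. -/
theorem IsConn.opDer_add_mem_gr {D : VF C → SM C →ₗ[ℝ] SM C} (hD : IsConn D) {r : ℕ} (Z : VF C)
    {P : Op (SM C) n} (hP : P ∈ gr C n r) :
    opDer (D Z) P + opDer (vertDer Z) P ∈ gr C n r := fun s => by
  have e : (opDer (D Z) P + opDer (vertDer Z) P) s = (D Z (P s) + vertDer Z (P s)) -
      ((∑ i, P (update s i (D Z (s i)))) + ∑ i, P (update s i (vertDer Z (s i)))) := by
    simp only [Pi.add_apply, opDer_apply]; abel
  rw [e]
  exact sub_mem (hD.add_vertDer_mem Z (hP s))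
    (add_mem (Ideal.sum_mem _ fun _ _ => hP _) (Ideal.sum_mem _ fun _ _ => hP _))

theorem forms_closed {F : Submodule C (Op (SM C) n)} (hF : IsFibrewise F) {a : Form C q n}
    (h : ∀ m, ∃ b ∈ forms F q, ∀ X, a X - b X ∈ gr C n m) : a ∈ forms F q := by
  have eq0 : ∀ P : Op (SM C) n, (∀ m, P ∈ gr C n m) → P = 0 := fun P => eq_zero_of_forall_mem_gr
  refine mem_forms.2 ⟨fun X i u v => sub_eq_zero.1 (eq0 _ fun m => ?_),
    fun X i c u => sub_eq_zero.1 (eq0 _ fun m => ?_), fun X i j hij hne => eq0 _ fun m => ?_,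
    fun X => hF.closed fun m => ?_⟩
  · obtain ⟨b, hb, hm⟩ := h m
    have e : a (update X i (u + v)) - (a (update X i u) + a (update X i v)) =
        (a (update X i (u + v)) - b (update X i (u + v))) - (a (update X i u) - b (update X i u)) -
          (a (update X i v) - b (update X i v)) := by
      rw [(mem_forms.1 hb).1]; abel
    rw [e]
    exact sub_mem (sub_mem (hm _) (hm _)) (hm _)
  · obtain ⟨b, hb, hm⟩ := h m
    have e : a (update X i (c • u)) - c • a (update X i u) =
        (a (update X i (c • u)) - b (update X i (c • u))) -
          c • (a (update X i u) - b (update X i u)) := by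
      rw [(mem_forms.1 hb).2.1, smul_sub]; abel
    rw [e]
    exact sub_mem (hm _) (gr_csmul c (hm _))
  · obtain ⟨b, hb, hm⟩ := h m
    have := hm X
    rwa [(mem_forms.1 hb).2.2.1 X i j hij hne, sub_zero] at this
  · obtain ⟨b, hb, hm⟩ := h m
    exact ⟨b X, (exists_forms hb).2 X, hm X⟩

/-! ### Homotopy -/

theorem succ_removeNth_cons {V : Type*} {k : ℕ} (i : Fin (k + 1)) (X : V) (Z : Fin (k + 1) → V) :
    (i.succ).removeNth (Fin.cons X Z : Fin (k + 2) → V) = Fin.cons X (i.removeNth Z) := by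
  funext j
  refine Fin.cases ?_ (fun j => ?_) j <;> simp [Fin.removeNth]

theorem zero_removeNth_cons {V : Type*} {k : ℕ} (X : V) (Z : Fin k → V) :
    (0 : Fin (k + 1)).removeNth (Fin.cons X Z : Fin (k + 1) → V) = Z := by
  funext j; simp [Fin.removeNth]

/-- The fibrewise de Rham differential `δ = dxⁱ ∂/∂yⁱ`. -/
def deltaForm (a : Form C q n) : Form C (q + 1) n := fun X =>
  ∑ i : Fin (q + 1), (-1 : ℝ) ^ (i : ℕ) • opDer (vertDer (X i)) (a (i.removeNth X))

theorem deltaForm_mem_gr {r : ℕ} {a : Form C q n} (ha : ∀ X, a X ∈ gr C n (r + 1))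
    (X : Fin (q + 1) → VF C) : deltaForm a X ∈ gr C n r :=
  sum_mem fun _ _ => gr_rsmul _ (opDer_vertDer_mem_gr _ (ha _))

theorem deltaForm_sub (a b : Form C q n) : deltaForm (a - b) = deltaForm a - deltaForm b := by
  funext X
  simp only [deltaForm, Pi.sub_apply, map_sub, smul_sub, Finset.sum_sub_distrib]

theorem deltaForm_smul (c : ℝ) (a : Form C q n) : deltaForm (c • a) = c • deltaForm a := by
  funext X
  simp only [deltaForm, Pi.smul_apply, map_smul, Finset.smul_sum, smul_comm c]

namespace Frame

variable (fr : Frame C ι)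

/-- The contraction with the fibrewise Euler vector field `yᵏ ∂/∂xᵏ`. -/
def kappa (a : Form C (q + 1) n) : Form C q n := fun X =>
  ∑ i, fr.y i • a (Fin.cons (fr.e i) X)

theorem kappa_mem {F : Submodule C (Op (SM C) n)} (hF : IsFibrewise F) {a : Form C (q + 1) n}
    (ha : a ∈ forms F (q + 1)) : fr.kappa a ∈ forms F q := by
  obtain ⟨h1, h2, h3, h4⟩ := mem_forms.1 ha
  refine mem_forms.2 ⟨fun X i u v => ?_, fun X i c u => ?_, fun X i j hij hne => ?_, fun X => ?_⟩
  · simp only [kappa, Fin.cons_update, h1, smul_add, Finset.sum_add_distrib]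
  · simp only [kappa, Fin.cons_update, h2, Finset.smul_sum, smul_comm c]
  · refine Finset.sum_eq_zero fun k _ => ?_
    rw [h3 _ i.succ j.succ (by simpa using hij) (by simpa using hne), smul_zero]
  · exact sum_mem fun k _ => hF.smul_mem _ (h4 _)

theorem kappa_mem_gr {r : ℕ} {a : Form C (q + 1) n} (ha : ∀ X, a X ∈ gr C n r)
    (X : Fin q → VF C) : fr.kappa a X ∈ gr C n (r + 1) := by
  refine sum_mem fun i _ => ?_
  rw [add_comm]
  exact gr_smul (fr.y_mem i) (ha _)

/-- The action of the fibrewise Euler vector field on coefficients. -/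
def eulerOp (P : Op (SM C) n) : Op (SM C) n := ∑ i, fr.y i • opDer (vertDer (fr.e i)) P

/-- The action on values is r up to higher order; the terms that act on arguments carry an extra
factor yⁱ. -/
theorem eulerOp_sub_mem {r : ℕ} {P : Op (SM C) n} (hP : P ∈ gr C n r) :
    fr.eulerOp P - (r : ℝ) • P ∈ gr C n (r + 1) := by
  intro s
  have e : (fr.eulerOp P - (r : ℝ) • P) s =
      (∑ i, fr.y i * vertDer (fr.e i) (P s) - (r : ℝ) • P s) -
        ∑ i, fr.y i * ∑ j, P (update s j (vertDer (fr.e i) (s j))) := by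
    simp only [eulerOp, Pi.sub_apply, Pi.smul_apply, Finset.sum_apply, opDer_apply, smul_eq_mul,
      mul_sub, Finset.sum_sub_distrib]
    abel
  rw [e]
  refine sub_mem (fr.euler_sub_mem (hP s)) (Ideal.sum_mem _ fun i _ => ?_)
  rw [add_comm]
  exact Fil_mul (fr.y_mem i) (Ideal.sum_mem _ fun j _ => hP _)

/-- The homotopy formula `κ δ + δ κ = q + ε` on `q`-forms. -/
theorem kappa_deltaForm {F : Submodule C (Op (SM C) n)}
    {a : Form C (q + 1) n} (ha : a ∈ forms F (q + 1)) (X : Fin (q + 1) → VF C) :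
    fr.kappa (deltaForm a) X + deltaForm (fr.kappa a) X =
      ((q : ℝ) + 1) • a X + fr.eulerOp (a X) := by
  obtain ⟨⟨w, rfl⟩, -⟩ := exists_forms ha
  have h1 : fr.kappa (deltaForm w) X = fr.eulerOp (w X) - ∑ k, ∑ i : Fin (q + 1),
      (-1 : ℝ) ^ (i : ℕ) • fr.y k • opDer (vertDer (X i)) (w (Fin.cons (fr.e k) (i.removeNth X))) := by
    simp only [kappa, deltaForm, eulerOp]
    rw [← Finset.sum_sub_distrib]
    refine Finset.sum_congr rfl fun k _ => ?_
    rw [Fin.sum_univ_succ, zero_removeNth_cons, smul_add, sub_eq_add_neg]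
    congr 1
    · simp
    · rw [Finset.smul_sum, ← Finset.sum_neg_distrib]
      refine Finset.sum_congr rfl fun i _ => ?_
      rw [succ_removeNth_cons, smul_comm (fr.y k), Fin.cons_succ, Fin.val_succ, pow_succ]
      simp
  -- The double sums in `h1` and `h2` cancel. The extra sum here comes from the derivatives of the
  -- yᵏ: as ∂_{Xᵢ} yᵏ = Xᵢ(xᵏ), the frame identity puts Xᵢ in the first slot.
  have h2 : deltaForm (fr.kappa w) X = (∑ i : Fin (q + 1), (-1 : ℝ) ^ (i : ℕ) •
      w (Fin.cons (X i) (i.removeNth X))) + ∑ k, ∑ i : Fin (q + 1),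
      (-1 : ℝ) ^ (i : ℕ) • fr.y k • opDer (vertDer (X i)) (w (Fin.cons (fr.e k) (i.removeNth X))) := by
    rw [Finset.sum_comm, ← Finset.sum_add_distrib]
    simp only [kappa, deltaForm]
    refine Finset.sum_congr rfl fun i _ => ?_
    rw [← Finset.smul_sum, ← smul_add, map_sum]
    congr 1
    simp only [opDer_smul (vertDer_mul _), vertDer_y, algebraMap_smul]
    rw [Finset.sum_add_distrib, add_comm]
    congr 1
    have := fr.sum_map
      { toFun := fun Y => w (Fin.cons Y (i.removeNth X))
        map_add' := fun Y Z => by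
          have := w.map_update_add (Fin.cons 0 (i.removeNth X)) 0 Y Z
          simpa only [Fin.update_cons_zero] using this
        map_smul' := fun c Y => by
          have := w.map_update_smul (Fin.cons 0 (i.removeNth X)) 0 c Y
          simpa only [Fin.update_cons_zero, RingHom.id_apply] using this : VF C →ₗ[C] Op (SM C) n } (X i)
    simpa using this
  -- Moving Xᵢ back to its place costs exactly the sign, so the q + 1 terms all equal `w X`.
  have h3 : ∀ i : Fin (q + 1), (-1 : ℝ) ^ (i : ℕ) • w (Fin.cons (X i) (i.removeNth X)) = w X := by
    intro i
    have := w.neg_one_pow_smul_map_insertNth i (X i) (i.removeNth X)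
    rw [Fin.insertNth_self_removeNth] at this
    change _ • w (Matrix.vecCons (X i) (i.removeNth X)) = _
    rw [← this]
    rcases neg_one_pow_eq_or ℝ (i : ℕ) with h | h <;>
      rcases neg_one_pow_eq_or ℤ (i : ℕ) with h' | h' <;> rw [h, h'] <;> try simp
    all_goals
      have e : ((-1 : ℝ) ^ (i : ℕ)) = (((-1 : ℤ) ^ (i : ℕ) : ℤ) : ℝ) := by push_cast; rfl
      rw [h, h'] at e
      norm_num at e
  rw [h1, h2]
  simp only [h3]
  rw [Finset.sum_const, Finset.card_univ, Fintype.card_fin, ← Nat.cast_smul_eq_nsmul ℝ]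
  push_cast
  abel

/-- The Poincaré lemma for differentials of the form `-δ + ⋯`. -/
theorem exists_primitive (fr : Frame C ι) {F : Submodule C (Op (SM C) n)} (hF : IsFibrewise F)
    (d : Form C q n →ₗ[ℝ] Form C (q + 1) n) (d' : Form C (q + 1) n →ₗ[ℝ] Form C (q + 2) n)
    (hd : ∀ b ∈ forms F q, d b ∈ forms F (q + 1))
    (hgr : ∀ r, ∀ b ∈ forms F q, (∀ X, b X ∈ gr C n r) → ∀ X, d b X + deltaForm b X ∈ gr C n r)
    (hgr' : ∀ r, ∀ a ∈ forms F (q + 1), (∀ X, a X ∈ gr C n r) →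
      ∀ X, d' a X + deltaForm a X ∈ gr C n r)
    (hdd : ∀ b ∈ forms F q, d' (d b) = 0) {r : ℕ} {a : Form C (q + 1) n}
    (ha : a ∈ forms F (q + 1)) (har : ∀ X, a X ∈ gr C n r) (hda : d' a = 0) :
    ∃ b ∈ forms F q, (∀ X, b X ∈ gr C n (r + 1)) ∧ d b = a := by
  -- One step of the approximation. On (q + 1)-forms of order r, κδ + δκ is the scalar q + 1 + r
  -- modulo order r + 1, and δa has order r because a is closed, so κδa is negligible. Hence a
  -- agrees with δκa / (q + 1 + r); the minus sign in the primitive is that of d = −δ + ⋯.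
  have step : ∀ (r : ℕ) (a : Form C (q + 1) n), a ∈ forms F (q + 1) → (∀ X, a X ∈ gr C n r) →
      d' a = 0 → ∃ b ∈ forms F q, (∀ X, b X ∈ gr C n (r + 1)) ∧
        ∀ X, (a - d b) X ∈ gr C n (r + 1) := by
    intro r a ha har hda
    set c : ℝ := ((q : ℝ) + 1 + r)⁻¹ with hc
    have hc0 : ((q : ℝ) + 1 + r) ≠ 0 := by positivity
    have hb : -c • fr.kappa a ∈ forms F q := Submodule.smul_mem _ _ (fr.kappa_mem hF ha)
    have hbr : ∀ X, (-c • fr.kappa a) X ∈ gr C n (r + 1) := fun X =>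
      gr_rsmul _ (fr.kappa_mem_gr har X)
    refine ⟨-c • fr.kappa a, hb, hbr, fun X => ?_⟩
    have hδ : ∀ X, deltaForm a X ∈ gr C n r := fun X => by
      have := hgr' r a ha har X
      rwa [hda, Pi.zero_apply, zero_add] at this
    have e : (a - d (-c • fr.kappa a)) X =
        -(d (-c • fr.kappa a) X + deltaForm (-c • fr.kappa a) X) -
        c • (fr.eulerOp (a X) - (r : ℝ) • a X) + c • fr.kappa (deltaForm a) X := by
      have h1 := fr.kappa_deltaForm ha X
      have h2 : deltaForm (-c • fr.kappa a) X = -c • deltaForm (fr.kappa a) X := by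
        rw [deltaForm_smul]; rfl
      have h3 : deltaForm (fr.kappa a) X = ((q : ℝ) + 1) • a X + fr.eulerOp (a X) -
          fr.kappa (deltaForm a) X := by rw [← h1]; abel
      have h4 : a X = c • (((q : ℝ) + 1 + r) • a X) := by
        rw [smul_smul, hc, inv_mul_cancel₀ hc0, one_smul]
      rw [h2, h3, Pi.sub_apply]
      conv_lhs => rw [h4]
      module
    rw [e]
    refine add_mem (sub_mem (neg_mem (hgr _ _ hb hbr X)) (gr_rsmul _ (fr.eulerOp_sub_mem (har X))))
      (gr_rsmul _ (fr.kappa_mem_gr hδ X))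
  have mapd : ∀ (m : ℕ) (b : Form C q n), b ∈ forms F q → (∀ X, b X ∈ gr C n (m + 1)) →
      ∀ X, d b X ∈ gr C n m := by
    intro m b hb hbm X
    have := sub_mem (gr_antitone (Nat.le_succ m) (hgr _ b hb hbm X)) (deltaForm_mem_gr hbm X)
    rwa [add_sub_cancel_right] at this
  choose! β hβ1 hβ2 hβ3 using step
  -- The remainder of a after m corrections, of order r + m.
  let A : ℕ → Form C (q + 1) n := fun m => Nat.rec a (fun k x => x - d (β (r + k) x)) m
  have hA : ∀ m, A m ∈ forms F (q + 1) ∧ (∀ X, A m X ∈ gr C n (r + m)) ∧ d' (A m) = 0 := by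
    intro m
    induction m with
    | zero => exact ⟨ha, har, hda⟩
    | succ m ih =>
      obtain ⟨i1, i2, i3⟩ := ih
      have hb := hβ1 _ _ i1 i2 i3
      exact ⟨sub_mem i1 (hd _ hb), hβ3 _ _ i1 i2 i3, by
        change d' (A m - d (β (r + m) (A m))) = 0
        rw [map_sub, i3, hdd _ hb, sub_zero]⟩
  let b : ℕ → Form C q n := fun m => β (r + m) (A m)
  have hb : ∀ m, b m ∈ forms F q := fun m => hβ1 _ _ (hA m).1 (hA m).2.1 (hA m).2.2
  have hbr : ∀ m X, b m X ∈ gr C n (r + m + 1) := fun m => hβ2 _ _ (hA m).1 (hA m).2.1 (hA m).2.2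
  have hsum : ∀ m, a - d (∑ k ∈ Finset.range m, b k) = A m := by
    intro m
    induction m with
    | zero => simp [A]
    | succ m ih =>
      rw [Finset.sum_range_succ, map_add, ← sub_sub, ih]
  let B : Form C q n := fun X s => seriesSum fun m => b m X s
  have hS : ∀ m, ∑ k ∈ Finset.range m, b k ∈ forms F q := fun m => sum_mem fun k _ => hb k
  have hB : ∀ m X, (B - ∑ k ∈ Finset.range m, b k) X ∈ gr C n m := by
    intro m X s
    have := seriesSum_sub_mem (u := fun m => b m X s)
      (fun k => Fil_antitone (by omega) (hbr k X s)) m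
    simpa only [Pi.sub_apply, Finset.sum_apply, B] using this
  have hBF : B ∈ forms F q := forms_closed hF fun m => ⟨_, hS m, hB m⟩
  refine ⟨B, hBF, fun X => ?_, ?_⟩
  · have h1 := hB (r + 1) X
    have h2 : (∑ k ∈ Finset.range (r + 1), b k) X ∈ gr C n (r + 1) := by
      rw [Finset.sum_apply]
      exact sum_mem fun k _ => gr_antitone (by omega) (hbr k X)
    have := add_mem h1 h2
    rwa [Pi.sub_apply, sub_add_cancel] at this
  -- Truncate the series after m + 1 terms: the tail has order m + 1, so its image under d has order
  -- m, as d lowers the order by at most one.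
  · funext X
    rw [← sub_eq_zero]
    refine eq_zero_of_forall_mem_gr fun m => ?_
    have h1 := mapd m _ (sub_mem hBF (hS (m + 1))) (hB (m + 1)) X
    have h2 : (a - d (∑ k ∈ Finset.range (m + 1), b k)) X ∈ gr C n m := by
      rw [hsum]; exact gr_antitone (by omega) ((hA (m + 1)).2.1 X)
    have e : d B X - a X = d (B - ∑ k ∈ Finset.range (m + 1), b k) X -
        (a - d (∑ k ∈ Finset.range (m + 1), b k)) X := by
      rw [map_sub, Pi.sub_apply, Pi.sub_apply]; abel
    rw [e]
    exact sub_mem h1 h2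

/-- If P has order r > 0 and no ∂_Z lowers this, then EP has order r + 1; but EP is rP modulo that
order, so P itself has order r + 1. The start at order 1 makes r invertible. -/
theorem eq_zero_of_opDer_vertDer_mem (fr : Frame C ι) {P : Op (SM C) n} (hP : P ∈ gr C n 1)
    (h : ∀ r, P ∈ gr C n r → ∀ Z, opDer (vertDer Z) P ∈ gr C n r) : P = 0 := by
  have key : ∀ r, P ∈ gr C n (r + 1) := by
    intro r
    induction r with
    | zero => exact hP
    | succ r ih =>
      have h1 : fr.eulerOp P ∈ gr C n (r + 1 + 1) := by
        refine sum_mem fun i _ => ?_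
        rw [add_comm]
        exact gr_smul (fr.y_mem i) (h _ ih _)
      have h2 := sub_mem h1 (fr.eulerOp_sub_mem ih)
      rw [sub_sub_cancel] at h2
      have h3 := gr_rsmul (((r + 1 : ℕ) : ℝ)⁻¹) h2
      rwa [smul_smul, inv_mul_cancel₀ (by positivity), one_smul] at h3
  exact eq_zero_of_forall_mem_gr fun r => gr_antitone (Nat.le_succ r) (key r)

theorem eq_zero_of_closed (fr : Frame C ι) {D : VF C → SM C →ₗ[ℝ] SM C} (hD : IsConn D) {P : Op (SM C) n}
    (hP : P ∈ gr C n 1) (h : ∀ Z, opDer (D Z) P = 0) : P = 0 :=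
  fr.eq_zero_of_opDer_vertDer_mem hP fun r hr Z => by
    have := hD.opDer_add_mem_gr Z hr
    rwa [h, zero_add] at this

end Frame

end Forms

end Fedosov

end

/-! ### The exterior covariant differential and Cartan calculus. -/

noncomputable section

namespace Fedosov

section ExtD

open Function

variable {C : Type*} [CommRing C] [Algebra ℝ C] {ι : Type*} [Fintype ι] {n q : ℕ}
  {D : VF C → SM C →ₗ[ℝ] SM C}

theorem extD_apply (D : VF C → SM C →ₗ[ℝ] SM C) (a : Form C q n) (X : Fin (q + 1) → VF C) :
    extD D a X = ∑ i : Fin (q + 1), (-1 : ℝ) ^ (i : ℕ) • opDer (D (X i)) (a (i.removeNth X)) +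
      ∑ j : Fin (q + 1), ∑ i : Fin q, if i.castSucc < j then
        (-1 : ℝ) ^ (j : ℕ) • a (update (j.removeNth X) i ⁅X i.castSucc, X j⁆) else 0 := rfl

theorem neg_one_pow_zsmul_eq {W : Type*} [AddCommGroup W] [Module ℝ W] (k : ℕ) (P : W) :
    (-1 : ℤ) ^ k • P = (-1 : ℝ) ^ k • P := by
  rw [← Int.cast_smul_eq_zsmul ℝ]; push_cast; rfl

/-- The action of a derivation over `X` on forms, with an action on vector fields that is also a
derivation over `X`. -/
theorem derAct_mem_forms {F : Submodule C (Op (SM C) n)} (hF : IsFibrewise F)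
    {δ : SM C →ₗ[ℝ] SM C} {X : VF C} (hδ : IsDerOver δ X) (δV : VF C →+ VF C)
    (hV : ∀ (c : C) Y, δV (c • Y) = c • δV Y + X c • Y) {a : Form C q n} (ha : a ∈ forms F q) :
    derAct δV (opDer δ : Op (SM C) n →ₗ[ℝ] Op (SM C) n).toAddMonoidHom a ∈ forms F q := by
  obtain ⟨h1, h2, h3, h4⟩ := mem_forms.1 ha
  obtain ⟨⟨w, hw⟩, -⟩ := exists_forms ha
  refine mem_forms.2 ⟨fun X i u v => ?_, fun X i c u => ?_, ?_, fun X => ?_⟩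
  · simp only [derAct_update, h1, map_add, Finset.sum_add_distrib]; abel
  · simp only [derAct_update, h1, h2, hV, LinearMap.toAddMonoidHom_coe, opDer_csmul hδ,
      ← Finset.smul_sum, smul_sub]
    abel
  · exact derAct_eq_zero _ _ h3 (fun X i j hne => by subst hw; exact w.map_swap X hne)
  · exact sub_mem (hF.opDer_mem hδ (h4 X)) (sum_mem fun i _ => h4 _)

/-- The total covariant derivative of a form. -/
def covForm (nabla : TorsionFreeConnection C) (D : VF C → SM C →ₗ[ℝ] SM C) (X : VF C)
    (a : Form C q n) : Form C q n :=
  derAct (nabla.cov X) (opDer (D X) : Op (SM C) n →ₗ[ℝ] Op (SM C) n).toAddMonoidHom a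

/-- The Lie derivative of a form. -/
def lieForm (D : VF C → SM C →ₗ[ℝ] SM C) (X : VF C) (a : Form C q n) : Form C q n :=
  derAct (fun Y => ⁅X, Y⁆) (opDer (D X) : Op (SM C) n →ₗ[ℝ] Op (SM C) n).toAddMonoidHom a

theorem covForm_apply (nabla : TorsionFreeConnection C) (D : VF C → SM C →ₗ[ℝ] SM C) (X : VF C)
    (a : Form C q n) (Z : Fin q → VF C) : covForm nabla D X a Z =
      opDer (D X) (a Z) - ∑ i, a (update Z i (nabla.cov X (Z i))) := rfl

theorem lieForm_apply (D : VF C → SM C →ₗ[ℝ] SM C) (X : VF C)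
    (a : Form C q n) (Z : Fin q → VF C) : lieForm D X a Z =
      opDer (D X) (a Z) - ∑ i, a (update Z i ⁅X, Z i⁆) := rfl

theorem covForm_mem {F : Submodule C (Op (SM C) n)} (hF : IsFibrewise F) (hD : IsConn D)
    (nabla : TorsionFreeConnection C) (X : VF C) {a : Form C q n} (ha : a ∈ forms F q) :
    covForm nabla D X a ∈ forms F q :=
  derAct_mem_forms hF (hD.isDerOver X) (nabla.cov X).toAddMonoidHom
    (fun c Y => by
      simp only [LinearMap.toAddMonoidHom_coe]
      rw [nabla.leibniz, add_comm]) ha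

theorem lieForm_mem {F : Submodule C (Op (SM C) n)} (hF : IsFibrewise F) (hD : IsConn D)
    (X : VF C) {a : Form C q n} (ha : a ∈ forms F q) :
    lieForm D X a ∈ forms F q :=
  derAct_mem_forms hF (hD.isDerOver X)
    { toFun := fun Y => ⁅X, Y⁆, map_zero' := lie_zero X, map_add' := lie_add X }
    (fun c Y => by
      change ⁅X, c • Y⁆ = c • ⁅X, Y⁆ + X c • Y
      ext f
      simp [Derivation.commutator_apply, mul_sub]) ha

/-- The exterior covariant differential is the alternation of the total covariant derivative. -/
theorem extD_eq_sum_covForm (nabla : TorsionFreeConnection C)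
    (w : VF C [⋀^Fin q]→ₗ[C] Op (SM C) n) (X : Fin (q + 1) → VF C) :
    extD D (w : Form C q n) X =
      ∑ i : Fin (q + 1), (-1 : ℝ) ^ (i : ℕ) • covForm nabla D (X i) w (i.removeNth X) := by
  rw [extD_apply]
  simp only [covForm_apply, smul_sub, Finset.sum_sub_distrib]
  rw [sub_eq_add_neg]
  congr 1
  simp only [Finset.smul_sum, ← Finset.sum_neg_distrib]
  -- Both sides are values on the same list, in which W replaces Xᵢ and X_{k+1} is dropped or the
  -- other way round. They are compared through the (q + 1)-tuple with W in both places, for which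
  -- an alternating map satisfies a two-term relation.
  have hsign : ∀ (i : Fin (q + 1)) (k : Fin q) (W : VF C), i ≤ k.castSucc →
      ∀ i' : Fin q, i'.castSucc = i →
      -((-1 : ℝ) ^ (i : ℕ) • w (update (i.removeNth X) k W)) =
        (-1 : ℝ) ^ (k.succ : ℕ) • w (update (k.succ.removeNth X) i' W) := by
    rintro i k W hik i' rfl
    have hne : i'.castSucc ≠ k.succ := (Fin.castSucc_lt_succ_iff.2 (Fin.castSucc_le_castSucc_iff.1 hik)).ne
    have h1 : i'.castSucc.removeNth (update (update X i'.castSucc W) k.succ W) =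
        update (i'.castSucc.removeNth X) k W := by
      funext m
      have hk : i'.castSucc.succAbove k = k.succ := Fin.succAbove_of_le_castSucc _ _ hik
      simp only [Fin.removeNth]
      by_cases hm : m = k
      · subst hm; rw [hk]; simp
      · rw [update_of_ne hm, update_of_ne, update_of_ne (Fin.succAbove_ne _ _)]
        · rfl
        · rw [← hk]; exact fun h => hm (Fin.succAbove_right_injective h)
    have h2 : k.succ.removeNth (update (update X i'.castSucc W) k.succ W) =
        update (k.succ.removeNth X) i' W := by
      funext m
      have hk : k.succ.succAbove i' = i'.castSucc := Fin.succAbove_of_castSucc_lt _ _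
        (Fin.castSucc_lt_succ_iff.2 (Fin.castSucc_le_castSucc_iff.1 hik))
      simp only [Fin.removeNth]
      rw [update_of_ne (Fin.succAbove_ne _ _)]
      by_cases hm : m = i'
      · subst hm; rw [hk]; simp
      · rw [update_of_ne hm, update_of_ne]
        · rfl
        · rw [← hk]; exact fun h => hm (Fin.succAbove_right_injective h)
    have h3 := w.neg_one_pow_smul_map_removeNth_add_eq_zero_of_eq
      (v := update (update X i'.castSucc W) k.succ W) (i := i'.castSucc) (j := k.succ)
      (by simp [update_of_ne hne]) hne
    rw [h1, h2, neg_one_pow_zsmul_eq, neg_one_pow_zsmul_eq] at h3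
    rw [neg_eq_iff_add_eq_zero]; exact h3
  symm
  calc ∑ i : Fin (q + 1), ∑ k : Fin q, -((-1 : ℝ) ^ (i : ℕ) •
        w (update (i.removeNth X) k (nabla.cov (X i) (i.removeNth X k))))
      = (∑ i : Fin (q + 1), ∑ k : Fin q, if k.castSucc < i then -((-1 : ℝ) ^ (i : ℕ) •
        w (update (i.removeNth X) k (nabla.cov (X i) (X k.castSucc)))) else 0) +
        ∑ i : Fin (q + 1), ∑ k : Fin q, if k.castSucc < i then 0 else -((-1 : ℝ) ^ (i : ℕ) •
        w (update (i.removeNth X) k (nabla.cov (X i) (X k.succ)))) := by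
        simp only [← Finset.sum_add_distrib]
        refine Finset.sum_congr rfl fun i _ => Finset.sum_congr rfl fun k _ => ?_
        split_ifs with h
        · rw [add_zero, Fin.removeNth, Fin.succAbove_of_castSucc_lt _ _ h]
        · rw [zero_add, Fin.removeNth, Fin.succAbove_of_le_castSucc _ _ (not_lt.1 h)]
    _ = (∑ i : Fin (q + 1), ∑ k : Fin q, if k.castSucc < i then -((-1 : ℝ) ^ (i : ℕ) •
        w (update (i.removeNth X) k (nabla.cov (X i) (X k.castSucc)))) else 0) +
        ∑ i : Fin (q + 1), ∑ k : Fin q, if k.castSucc < i then ((-1 : ℝ) ^ (i : ℕ) •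
        w (update (i.removeNth X) k (nabla.cov (X k.castSucc) (X i)))) else 0 := by
        congr 1
        rw [← Finset.sum_product', ← Finset.sum_product', ← Finset.sum_filter,
          Finset.sum_ite, Finset.sum_const_zero, zero_add]
        -- The pair (i, k) with i ≤ k goes to (k + 1, i). The minimum is i; it is written so only to
        -- stay below q without the hypothesis.
        refine Finset.sum_bij' (fun p _ => (p.2.succ, ⟨min (p.1 : ℕ) p.2, by have := p.2.2; omega⟩))
          (fun p _ => (p.2.castSucc, ⟨(p.1 : ℕ) - 1, by have := p.1.2; have := p.2.2; omega⟩))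
          ?_ ?_ ?_ ?_ ?_
        · rintro ⟨i, k⟩ h
          simp only [Finset.mem_filter, Finset.mem_product, Finset.mem_univ, true_and, not_lt,
            Fin.lt_def, Fin.val_castSucc, Fin.val_succ] at h ⊢
          omega
        · rintro ⟨i, k⟩ h
          simp only [Finset.mem_filter, Finset.mem_product, Finset.mem_univ, true_and, not_lt,
            Fin.lt_def, Fin.val_castSucc] at h ⊢
          omega
        · rintro ⟨i, k⟩ h
          simp only [Finset.mem_filter, Finset.mem_product, Finset.mem_univ, true_and, not_lt,
            Fin.le_def, Fin.val_castSucc] at h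
          simp only [Prod.mk.injEq, Fin.ext_iff, Fin.val_castSucc, Fin.val_succ]
          omega
        · rintro ⟨i, k⟩ h
          simp only [Finset.mem_filter, Finset.mem_product, Finset.mem_univ, true_and,
            Fin.lt_def, Fin.val_castSucc] at h
          simp only [Prod.mk.injEq, Fin.ext_iff, Fin.val_castSucc, Fin.val_succ]
          omega
        · rintro ⟨i, k⟩ h
          simp only [Finset.mem_filter, Finset.mem_product, Finset.mem_univ, true_and, not_lt] at h
          have h' : (i : ℕ) ≤ k := h
          have hi : (⟨min (i : ℕ) k, by have := k.2; omega⟩ : Fin q).castSucc = i := by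
            simp only [Fin.ext_iff, Fin.val_castSucc]; omega
          simp only
          rw [hsign i k _ h _ hi, hi]
    _ = _ := by
        rw [← Finset.sum_add_distrib]
        refine Finset.sum_congr rfl fun j _ => ?_
        rw [← Finset.sum_add_distrib]
        refine Finset.sum_congr rfl fun i _ => ?_
        split_ifs with h
        -- Here vanishing torsion turns the two covariant derivatives into the bracket of vector
        -- fields.
        · rw [← nabla.torsion, w.map_update_sub, smul_sub]; abel
        · rw [add_zero]

/-- Neither sum in the definition of `extD` is C-linear in the vector fields by itself. The total
covariant derivative is, in all its q + 1 arguments, and `extD` is its alternation. -/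
theorem extD_mem {F : Submodule C (Op (SM C) n)} (hF : IsFibrewise F) (hD : IsConn D)
    (nabla : TorsionFreeConnection C) {a : Form C q n} (ha : a ∈ forms F q) :
    extD D a ∈ forms F (q + 1) := by
  obtain ⟨⟨w, rfl⟩, h4⟩ := exists_forms ha
  choose v hv using fun X => (exists_forms (covForm_mem hF hD nabla X ha)).1
  have hwm := fun Z => hF.le_multilinearOps (h4 Z)
  let f : VF C →ₗ[C] VF C [⋀^Fin q]→ₗ[C] Op (SM C) n :=
    { toFun := v
      map_add' := fun X Y => by
        ext Z : 1
        rw [AlternatingMap.add_apply, hv, hv, hv]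
        simp only [covForm_apply, map_add, LinearMap.add_apply, w.map_update_add,
          Finset.sum_add_distrib]
        rw [opDer_add_left (hwm Z) (hD.add_left X Y)]
        abel
      map_smul' := fun c X => by
        ext Z : 1
        rw [AlternatingMap.smul_apply, hv, hv]
        simp only [covForm_apply, map_smul, LinearMap.smul_apply, w.map_update_smul,
          ← Finset.smul_sum, RingHom.id_apply]
        rw [opDer_smul_left (hwm Z) (hD.smul_left c X), smul_sub] }
  have hf : ⇑(AlternatingMap.alternatizeUncurryFin f) = extD D (w : Form C q n) := by
    funext X
    rw [AlternatingMap.alternatizeUncurryFin_apply, extD_eq_sum_covForm nabla w]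
    refine Finset.sum_congr rfl fun i _ => ?_
    rw [neg_one_pow_zsmul_eq]
    exact congrArg _ (congrFun (hv (X i)) _)
  refine ⟨⟨_, hf⟩, 0, fun X => ?_⟩
  rw [extD_eq_sum_covForm nabla w]
  have hr : ∀ (c : ℝ) {P : Op (SM C) n}, P ∈ F → c • P ∈ F := fun c P hP => by
    rw [← algebraMap_smul C c P]; exact Submodule.smul_mem _ _ hP
  exact sum_mem fun i _ => hr _ ((exists_forms (covForm_mem hF hD nabla (X i) ha)).2 _)

/-- The terms with brackets of vector fields are values of the form and keep the order, so the
leading part of the exterior differential is −δ. -/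
theorem IsConn.extD_add_deltaForm_mem (hD : IsConn D) {r : ℕ} {a : Form C q n}
    (ha : ∀ X, a X ∈ gr C n r) (X : Fin (q + 1) → VF C) :
    extD D a X + deltaForm a X ∈ gr C n r := by
  have e : extD D a X + deltaForm a X =
      ∑ i : Fin (q + 1), (-1 : ℝ) ^ (i : ℕ) • (opDer (D (X i)) (a (i.removeNth X)) +
        opDer (vertDer (X i)) (a (i.removeNth X))) +
      ∑ j : Fin (q + 1), ∑ i : Fin q, if i.castSucc < j then
        (-1 : ℝ) ^ (j : ℕ) • a (update (j.removeNth X) i ⁅X i.castSucc, X j⁆) else 0 := by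
    simp only [extD_apply, deltaForm, smul_add, Finset.sum_add_distrib]; abel
  rw [e]
  refine add_mem (sum_mem fun i _ => gr_rsmul _ (hD.opDer_add_mem_gr _ (ha _)))
    (sum_mem fun j _ => sum_mem fun i _ => ?_)
  split_ifs
  · exact gr_rsmul _ (ha _)
  · exact zero_mem _

/-! ### The square of the exterior covariant differential -/

/-- Contraction of the first argument with a vector field. -/
def contract (X : VF C) (a : Form C (q + 1) n) : Form C q n := fun Z => a (Fin.cons X Z)

theorem contract_mem {F : Submodule C (Op (SM C) n)} (X : VF C) {a : Form C (q + 1) n}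
    (ha : a ∈ forms F (q + 1)) : contract X a ∈ forms F q := by
  obtain ⟨h1, h2, h3, h4⟩ := mem_forms.1 ha
  refine mem_forms.2 ⟨fun Z i u v => ?_, fun Z i c u => ?_, fun Z i j hij hne => ?_, fun Z => h4 _⟩
  · simp only [contract, Fin.cons_update, h1]
  · simp only [contract, Fin.cons_update, h2]
  · exact h3 _ i.succ j.succ (by simpa using hij) (by simpa using hne)

theorem form_ext {a b : Form C (q + 1) n} (h : ∀ X, contract X a = contract X b) : a = b := by
  funext X
  rw [← Fin.cons_self_tail X]
  exact congrFun (h (X 0)) (Fin.tail X)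

theorem contract_extD_zero (D : VF C → SM C →ₗ[ℝ] SM C) (X : VF C) (a : Form C 0 n) :
    contract X (extD D a) = lieForm D X a := by
  funext Z
  simp [contract, extD_apply, lieForm_apply]

/-- Cartan's formula. -/
theorem contract_extD (D : VF C → SM C →ₗ[ℝ] SM C) (X : VF C) {F : Submodule C (Op (SM C) n)}
    {a : Form C (q + 1) n} (ha : a ∈ forms F (q + 1)) :
    contract X (extD D a) = lieForm D X a - extD D (contract X a) := by
  obtain ⟨⟨w, rfl⟩, -⟩ := exists_forms ha
  funext Z
  rw [Pi.sub_apply, lieForm_apply, contract, extD_apply, extD_apply, Fin.sum_univ_succ,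
    zero_removeNth_cons]
  have h1 : ∑ i : Fin (q + 1), (-1 : ℝ) ^ (i.succ : ℕ) •
      opDer (D ((Fin.cons X Z : Fin (q + 2) → VF C) i.succ))
        (w (i.succ.removeNth (Fin.cons X Z : Fin (q + 2) → VF C))) =
      -∑ i : Fin (q + 1), (-1 : ℝ) ^ (i : ℕ) • opDer (D (Z i)) (contract X w (i.removeNth Z)) := by
    rw [← Finset.sum_neg_distrib]
    refine Finset.sum_congr rfl fun i _ => ?_
    rw [succ_removeNth_cons, Fin.cons_succ, Fin.val_succ, pow_succ, mul_neg_one, neg_smul]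
    rfl
  have h2 : ∀ j : Fin (q + 1), (-1 : ℝ) ^ (j.succ : ℕ) • w (Fin.cons ⁅X, Z j⁆ (j.removeNth Z)) =
      -w (update Z j ⁅X, Z j⁆) := by
    intro j
    have := w.neg_one_pow_smul_map_insertNth j ⁅X, Z j⁆ (j.removeNth Z)
    rw [Fin.insertNth_removeNth, neg_one_pow_zsmul_eq] at this
    change _ • w (Matrix.vecCons _ _) = _
    rw [← this, Fin.val_succ, pow_succ, mul_neg_one, neg_smul, smul_smul, ← mul_pow]
    simp
  have h3 : ∑ j : Fin (q + 2), ∑ i : Fin (q + 1), (if i.castSucc < j then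
        (-1 : ℝ) ^ (j : ℕ) • w (update (j.removeNth (Fin.cons X Z : Fin (q + 2) → VF C)) i
          ⁅(Fin.cons X Z : Fin (q + 2) → VF C) i.castSucc,
            (Fin.cons X Z : Fin (q + 2) → VF C) j⁆) else 0) =
      -(∑ j, w (update Z j ⁅X, Z j⁆)) - ∑ j : Fin (q + 1), ∑ i : Fin q, if i.castSucc < j then
        (-1 : ℝ) ^ (j : ℕ) • contract X w (update (j.removeNth Z) i ⁅Z i.castSucc, Z j⁆) else 0 := by
    rw [Fin.sum_univ_succ]
    simp only [Fin.not_lt_zero, if_false, Finset.sum_const_zero, zero_add, Fin.cons_succ,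
      succ_removeNth_cons]
    rw [← Finset.sum_neg_distrib, ← Finset.sum_sub_distrib]
    refine Finset.sum_congr rfl fun j _ => ?_
    rw [Fin.sum_univ_succ, sub_eq_add_neg, ← Finset.sum_neg_distrib]
    congr 1
    · rw [if_pos (by simp), Fin.castSucc_zero, Fin.cons_zero, Fin.update_cons_zero, h2]
    · refine Finset.sum_congr rfl fun i _ => ?_
      rw [Fin.castSucc_succ, Fin.cons_succ, ← Fin.cons_update]
      simp only [Fin.succ_lt_succ_iff]
      split_ifs
      · rw [Fin.val_succ, pow_succ, mul_neg_one, neg_smul]; rfl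
      · rw [neg_zero]
  rw [h1, h3]
  simp only [Fin.val_zero, pow_zero, one_smul, Fin.cons_zero]
  abel

theorem contract_lieForm (D : VF C → SM C →ₗ[ℝ] SM C) (X Y : VF C) (a : Form C (q + 1) n) :
    contract Y (lieForm D X a) = lieForm D X (contract Y a) - contract ⁅X, Y⁆ a := by
  funext Z
  simp only [contract, lieForm_apply, Pi.sub_apply, Fin.sum_univ_succ, Fin.cons_zero, Fin.cons_succ,
    Fin.update_cons_zero, Fin.cons_update]
  abel

theorem lieForm_sub (D : VF C → SM C →ₗ[ℝ] SM C) (X : VF C) (a b : Form C q n) :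
    lieForm D X (a - b) = lieForm D X a - lieForm D X b := derAct_sub _ _ a b

/-- On arguments this is the Jacobi identity for vector fields, on values the flatness of D. -/
theorem lieForm_commutator {F : Submodule C (Op (SM C) n)} (hF : IsFibrewise F)
    (hflat : ∀ X Y, curvature D X Y = 0) (X Y : VF C) {a : Form C q n} (ha : a ∈ forms F q) :
    lieForm D X (lieForm D Y a) - lieForm D Y (lieForm D X a) = lieForm D ⁅X, Y⁆ a := by
  obtain ⟨h1, h2, h3, h4⟩ := mem_forms.1 ha
  funext Z
  refine derAct_commutator _ _ _ _ h1 (fun W => lie_lie X Y W) (fun W => ?_) Z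
  refine (opDer_commutator (hF.le_multilinearOps (h4 W)) fun s => ?_).symm
  have := congrArg (fun f => f s) (hflat X Y)
  simp only [curvature, LinearMap.sub_apply, LinearMap.comp_apply, LinearMap.zero_apply] at this
  exact (sub_eq_zero.1 this).symm

/-- A form is determined by its contractions ι_Y. These reduce the claim by ι_Y D = L_Y − D ι_Y and
ι_Y L_X = L_X ι_Y − ι_{[X,Y]} to a lower exterior degree and to [L_X, L_Y] = L_{[X,Y]}. -/
theorem extD_lieForm {F : Submodule C (Op (SM C) n)} (hF : IsFibrewise F) (hD : IsConn D)
    (hflat : ∀ X Y, curvature D X Y = 0) :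
    ∀ {q : ℕ} (X : VF C) {a : Form C q n}, a ∈ forms F q →
      extD D (lieForm D X a) = lieForm D X (extD D a) := by
  intro q
  induction q with
  | zero =>
    intro X a ha
    refine form_ext fun Y => ?_
    rw [contract_extD_zero, contract_lieForm, contract_extD_zero, contract_extD_zero,
      ← lieForm_commutator hF hflat X Y ha, sub_sub_cancel]
  | succ q ih =>
    intro X a ha
    refine form_ext fun Y => ?_
    rw [contract_extD D Y (lieForm_mem hF hD X ha), contract_lieForm, map_sub,
      ih X (contract_mem Y ha), contract_lieForm, contract_extD D Y ha,
      contract_extD D _ ha, lieForm_sub, ← lieForm_commutator hF hflat X Y ha]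
    abel

/-- Applying Cartan's formula twice, ι_X D² = L_X D − D L_X + D² ι_X. The first two terms cancel,
and the last vanishes by induction on the exterior degree. -/
theorem extD_extD {F : Submodule C (Op (SM C) n)} (hF : IsFibrewise F) (hD : IsConn D)
    (nabla : TorsionFreeConnection C) (hflat : ∀ X Y, curvature D X Y = 0) :
    ∀ {q : ℕ} {a : Form C q n}, a ∈ forms F q → extD D (extD D a) = 0 := by
  intro q
  induction q with
  | zero =>
    intro a ha
    refine form_ext fun X => ?_
    rw [contract_extD D X (extD_mem hF hD nabla ha), contract_extD_zero,
      extD_lieForm hF hD hflat X ha, sub_self]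
    rfl
  | succ q ih =>
    intro a ha
    refine form_ext fun X => ?_
    rw [contract_extD D X (extD_mem hF hD nabla ha), contract_extD D X ha, map_sub,
      extD_lieForm hF hD hflat X ha, ih (contract_mem X ha), sub_zero, sub_self]
    rfl

end ExtD

end Fedosov

end

/-! ### Closed operators, constant coefficients, flat lifts; the Fedosov equation. -/

noncomputable section

namespace Fedosov

section Lifts

open Function

variable {C : Type*} [CommRing C] [Algebra ℝ C] {ι : Type*} [Fintype ι] {n q : ℕ}
  {D : VF C → SM C →ₗ[ℝ] SM C}

theorem Frame.exists_extD_primitive (fr : Frame C ι) {F : Submodule C (Op (SM C) n)}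
    (hF : IsFibrewise F) (hD : IsConn D) (nabla : TorsionFreeConnection C)
    (hflat : ∀ X Y, curvature D X Y = 0) {r : ℕ} {a : Form C (q + 1) n}
    (ha : a ∈ forms F (q + 1)) (har : ∀ X, a X ∈ gr C n r) (hda : extD D a = 0) :
    ∃ b ∈ forms F q, (∀ X, b X ∈ gr C n (r + 1)) ∧ extD D b = a :=
  fr.exists_primitive hF (extD D) (extD D) (fun _ hb => extD_mem hF hD nabla hb)
    (fun _ _ _ h => hD.extD_add_deltaForm_mem h) (fun _ _ _ h => hD.extD_add_deltaForm_mem h)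
    (fun _ hb => extD_extD hF hD nabla hflat hb) ha har hda

/-! ### Forms of exterior degree zero -/

theorem constForm_apply (P : Op (SM C) n) (X : Fin 0 → VF C) : constForm C n P X = P := rfl

theorem form_zero_eq (a : Form C 0 n) (X : Fin 0 → VF C) : a = constForm C n (a X) := by
  funext Z; rw [constForm_apply, Subsingleton.elim Z X]

theorem constForm_mem_forms {F : Submodule C (Op (SM C) n)} {P : Op (SM C) n} :
    constForm C n P ∈ forms F 0 ↔ P ∈ F :=
  ⟨fun h => (exists_forms h).2 ![], fun h => mem_forms.2
    ⟨fun _ i => i.elim0, fun _ i => i.elim0, fun _ i => i.elim0, fun _ => h⟩⟩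

theorem extD_constForm (D : VF C → SM C →ₗ[ℝ] SM C) (P : Op (SM C) n) (X : Fin 1 → VF C) :
    extD D (constForm C n P) X = opDer (D (X 0)) P := by
  simp [extD_apply, constForm_apply]

theorem extD_constForm_eq_zero {P : Op (SM C) n} :
    extD D (constForm C n P) = 0 ↔ ∀ Z, opDer (D Z) P = 0 := by
  refine ⟨fun h Z => ?_, fun h => ?_⟩
  · have := congrFun h (fun _ => Z)
    rwa [extD_constForm] at this
  · funext X; rw [extD_constForm, h]; rfl

/-- Every fibrewise operator has the same values at `y = 0` as a closed one. -/
theorem Frame.exists_closed (fr : Frame C ι) {F : Submodule C (Op (SM C) n)}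
    (hF : IsFibrewise F) (hD : IsConn D) (nabla : TorsionFreeConnection C)
    (hflat : ∀ X Y, curvature D X Y = 0) {P : Op (SM C) n} (hP : P ∈ F) :
    ∃ Q ∈ F, (∀ Z, opDer (D Z) Q = 0) ∧ Q - P ∈ gr C n 1 := by
  have h0 := constForm_mem_forms.2 hP
  -- DP is an exact, hence closed 1-form of order 0, so it has a primitive b of order 1; then P − b
  -- is closed and agrees with P at y = 0.
  obtain ⟨b, hb, hb1, hdb⟩ := fr.exists_extD_primitive hF hD nabla hflat (r := 0)
    (extD_mem hF hD nabla h0) (fun _ => mem_gr_zero _) (extD_extD hF hD nabla hflat h0)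
  refine ⟨P - b ![], sub_mem hP ((exists_forms hb).2 _), ?_, ?_⟩
  · rw [← extD_constForm_eq_zero, map_sub, ← form_zero_eq, map_sub, hdb, sub_self]
  · rw [sub_sub_cancel_left]; exact neg_mem (hb1 _)

/-- Every fibrewise operator has the same values at `y = 0` as one with constant coefficients. -/
theorem Frame.exists_constCoeff (fr : Frame C ι) {F : Submodule C (Op (SM C) n)}
    (hF : IsFibrewise F) {P : Op (SM C) n} (hP : P ∈ F) :
    ∃ Q ∈ F, (∀ Z, opDer (vertDer Z) Q = 0) ∧ Q - P ∈ gr C n 1 := by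
  -- The argument for closed operators with the differential −δ, whose square vanishes because the
  -- fibrewise derivatives commute.
  let d : ∀ q, Form C q n →ₗ[ℝ] Form C (q + 1) n := fun q =>
    { toFun := fun a => -deltaForm a
      map_add' := fun a b => by
        have := deltaForm_sub a (-b)
        have h2 := deltaForm_sub (0 : Form C q n) b
        have h3 := deltaForm_smul (0 : ℝ) (0 : Form C q n)
        rw [zero_smul, zero_smul] at h3
        rw [zero_sub, h3, zero_sub] at h2
        rw [sub_neg_eq_add, h2] at this
        rw [this]; abel
      map_smul' := fun c a => by rw [deltaForm_smul, RingHom.id_apply, smul_neg] }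
  have hδ0 : ∀ (b : Form C 0 n) X, deltaForm b X = opDer (vertDer (X 0)) (b ![]) := by
    intro b X
    simp [deltaForm, Subsingleton.elim (Fin.removeNth 0 X) ![]]
  have hmem : ∀ b ∈ forms F 0, d 0 b ∈ forms F 1 := by
    intro b hb
    have h4 := (exists_forms hb).2
    have hm := hF.le_multilinearOps (h4 ![])
    refine neg_mem (mem_forms.2 ⟨fun X i u v => ?_, fun X i c u => ?_, fun X i j hij hne => ?_,
      fun X => ?_⟩)
    · obtain rfl : i = 0 := Subsingleton.elim _ _
      simp only [hδ0, update_self]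
      exact opDer_add_left hm (vertDer_add_left u v)
    · obtain rfl : i = 0 := Subsingleton.elim _ _
      simp only [hδ0, update_self]
      exact opDer_smul_left hm (vertDer_smul_left c u)
    · exact absurd (Subsingleton.elim i j) hne
    · rw [hδ0]; exact hF.opDer_mem (isDerOver_vertDer _) (h4 _)
  have hdd : ∀ b ∈ forms F 0, d 1 (d 0 b) = 0 := by
    intro b hb
    have hm := hF.le_multilinearOps ((exists_forms hb).2 ![])
    funext X
    have h1 := opDer_commutator hm (δ₁ := vertDer (X 0)) (δ₂ := vertDer (X 1)) (δ := 0)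
      fun s => by rw [fr.vertDer_comm, sub_self]; rfl
    have h2 : opDer (0 : SM C →ₗ[ℝ] SM C) (b ![]) = 0 := by
      funext s; simp [opDer_apply, update_zero_of_mem hm]
    rw [h2] at h1
    change -deltaForm (-deltaForm b) X = 0
    simp only [deltaForm, Pi.neg_apply, map_neg, Fin.removeNth,
      Subsingleton.elim (fun i : Fin 0 => _) (![] : Fin 0 → VF C)]
    simpa [eq_comm, ← sub_eq_add_neg] using h1
  have h0 := constForm_mem_forms.2 hP
  obtain ⟨b, hb, hb1, hdb⟩ := fr.exists_primitive hF (d 0) (d 1) hmem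
    (fun r b _ _ X => by simp [d]) (fun r b _ _ X => by simp [d]) hdd (r := 0)
    (hmem _ h0) (fun _ => mem_gr_zero _) (hdd _ h0)
  refine ⟨P - b ![], sub_mem hP ((exists_forms hb).2 _), fun Z => ?_, ?_⟩
  · have := congrFun hdb fun _ => Z
    change -deltaForm b _ = -deltaForm _ _ at this
    rw [hδ0, hδ0, neg_inj] at this
    rw [map_sub, this, sub_eq_zero]; rfl
  · rw [sub_sub_cancel_left]; exact neg_mem (hb1 _)

theorem mem_gr_one {P Q : Op (SM C) n} :
    P - Q ∈ gr C n 1 ↔ ∀ s, atZero (P s) = atZero (Q s) := by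
  simp only [mem_gr, mem_Fil_one, Pi.sub_apply, ← atZeroHom_apply, map_sub, sub_eq_zero]

theorem Frame.constCoeff_ext (fr : Frame C ι) {P Q : Op (SM C) n}
    (hP : ∀ Z, opDer (vertDer Z) P = 0) (hQ : ∀ Z, opDer (vertDer Z) Q = 0)
    (h : ∀ s, atZero (P s) = atZero (Q s)) : P = Q :=
  sub_eq_zero.1 <| fr.eq_zero_of_opDer_vertDer_mem (mem_gr_one.2 h) fun r _ Z => by
    rw [map_sub, hP, hQ, sub_zero]; exact zero_mem _

theorem Frame.closed_ext (fr : Frame C ι) (hD : IsConn D) {P Q : Op (SM C) n}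
    (hP : ∀ Z, opDer (D Z) P = 0) (hQ : ∀ Z, opDer (D Z) Q = 0)
    (h : ∀ s, atZero (P s) = atZero (Q s)) : P = Q :=
  sub_eq_zero.1 <| fr.eq_zero_of_closed hD (mem_gr_one.2 h) fun Z => by
    rw [map_sub, hP, hQ, sub_zero]

/-- The choice in `sigma` ranges over all operators. Uniqueness identifies the chosen one with the
one constructed in F, so it is a fibrewise operator of the same kind and order. -/
theorem Frame.sigma_spec (fr : Frame C ι) {F : Submodule C (Op (SM C) n)} (hF : IsFibrewise F)
    {P : Op (SM C) n} (hP : P ∈ F) : sigma P ∈ F ∧ (∀ Z, opDer (vertDer Z) (sigma P) = 0) ∧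
      ∀ s, atZero (sigma P s) = atZero (P s) := by
  obtain ⟨Q, hQF, hQ, h⟩ := fr.exists_constCoeff hF hP
  have hs : (∀ Z, opDer (vertDer Z) (sigma P) = 0) ∧ ∀ s, atZero (sigma P s) = atZero (P s) :=
    Classical.epsilon_spec (p := fun P₀ : Op (SM C) n => (∀ Z, opDer (vertDer Z) P₀ = 0) ∧
      ∀ s, atZero (P₀ s) = atZero (P s)) ⟨Q, hQ, mem_gr_one.1 h⟩
  have : sigma P = Q := fr.constCoeff_ext hs.1 hQ fun s => by rw [hs.2, mem_gr_one.1 h]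
  exact ⟨this ▸ hQF, hs⟩

/-! ### Flat lifts of functions -/

theorem polyDiffLE_zero_args (N : ℕ) (P : Op (SM C) 0) : P ∈ polyDiffLE C (SM C) 0 N :=
  ⟨mem_multilinearOps.2 ⟨fun _ i => i.elim0, fun _ i => i.elim0⟩, fun i => i.elim0⟩

theorem opDer_zero_args (δ : SM C →ₗ[ℝ] SM C) (P : Op (SM C) 0) (a : Fin 0 → SM C) :
    opDer δ P a = δ (P a) := by simp [opDer_apply]

/-- Sections are operators without arguments, on which D acts as on sections; this is the case n = 0
of existence and uniqueness of closed operators. -/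
theorem Frame.hasFlatLifts (fr : Frame C ι) (hD : IsConn D) (nabla : TorsionFreeConnection C)
    (hflat : ∀ X Y, curvature D X Y = 0) : HasFlatLifts D := by
  intro f
  have huniq : ∀ F G : SM C, (∀ X, D X F = 0) → (∀ X, D X G = 0) → atZero F = atZero G → F = G := by
    intro F G hF hG h
    have := fr.closed_ext (n := 0) hD (P := fun _ => F) (Q := fun _ => G)
      (fun Z => funext fun a => (opDer_zero_args _ _ _).trans (hF Z))
      (fun Z => funext fun a => (opDer_zero_args _ _ _).trans (hG Z)) fun _ => h
    exact congrFun this ![]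
  have hex : ∃ F : SM C, (∀ X, D X F = 0) ∧ atZero F = f := by
    obtain ⟨Q, -, hQ, h⟩ := fr.exists_closed (isFibrewise_polyDiffLE 0) hD nabla hflat
      (polyDiffLE_zero_args 0 fun _ => algebraMap C (SM C) f)
    refine ⟨Q ![], fun X => ?_, ?_⟩
    · rw [← opDer_zero_args, hQ]; rfl
    · rw [mem_gr_one.1 h, ← atZeroHom_apply, AlgHom.commutes]; rfl
  have hs := Classical.epsilon_spec (p := fun F => (∀ X, D X F = 0) ∧ atZero F = f) hex
  exact ⟨hs.1, hs.2, fun F hF hFf => huniq F _ hF hs.1 (hFf.trans hs.2.symm)⟩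

end Lifts

/-! ### Solutions of the Fedosov equation -/

section Equation

open Function

variable {C : Type*} [CommRing C] [Algebra ℝ C] {ι : Type*} [Fintype ι]
  {D : VF C → SM C →ₗ[ℝ] SM C}

/-- The components of a covariant derivative on sections of `SM`. -/
structure IsCovariant (D : VF C → SM C →ₗ[ℝ] SM C) : Prop where
  add_left : ∀ X Y a, D (X + Y) a = D X a + D Y a
  smul_left : ∀ (c : C) X a, D (c • X) a = c • D X a
  isDerOver : ∀ X, IsDerOver (D X) X

theorem IsConn.isCovariant (hD : IsConn D) : IsCovariant D :=
  ⟨hD.add_left, hD.smul_left, hD.isDerOver⟩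

theorem curvature_apply (D : VF C → SM C →ₗ[ℝ] SM C) (X Y : VF C) (a : SM C) :
    curvature D X Y a = D X (D Y a) - D Y (D X a) - D ⁅X, Y⁆ a := rfl

theorem lie_smul_left (c : C) (X Y : VF C) : ⁅c • X, Y⁆ = c • ⁅X, Y⁆ - Y c • X := by
  ext f
  simp [Derivation.commutator_apply, mul_sub]
  ring

namespace IsCovariant

variable (hD : IsCovariant D)

include hD

theorem zero_left (a : SM C) : D 0 a = 0 := by simpa using hD.smul_left 0 0 a

theorem neg_left (X : VF C) (a : SM C) : D (-X) a = -D X a := by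
  rw [eq_neg_iff_add_eq_zero, ← hD.add_left, neg_add_cancel, hD.zero_left]

theorem sub_left (X Y : VF C) (a : SM C) : D (X - Y) a = D X a - D Y a := by
  rw [sub_eq_add_neg, hD.add_left, hD.neg_left, sub_eq_add_neg]

theorem curvature_self (X : VF C) (a : SM C) : curvature D X X a = 0 := by
  rw [curvature_apply, lie_self, hD.zero_left]; simp

theorem curvature_swap (X Y : VF C) (a : SM C) : curvature D X Y a = -curvature D Y X a := by
  rw [curvature_apply, curvature_apply, ← lie_skew, hD.neg_left]; abel

theorem curvature_add_left (X Y Z : VF C) (a : SM C) :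
    curvature D (X + Y) Z a = curvature D X Z a + curvature D Y Z a := by
  simp only [curvature_apply, hD.add_left, add_lie, map_add]; abel

theorem curvature_smul_left (c : C) (X Y : VF C) (a : SM C) :
    curvature D (c • X) Y a = c • curvature D X Y a := by
  simp only [curvature_apply, hD.smul_left, (hD.isDerOver Y).map_csmul, lie_smul_left, hD.sub_left,
    smul_sub]
  abel

/-- The curvature as a derivation over functions. -/
def curvDer (X Y : VF C) : Derivation C (SM C) (SM C) :=
  Derivation.mk'
    { toFun := curvature D X Y
      map_add' := map_add _
      map_smul' := fun c a => by
        simp only [curvature_apply, (hD.isDerOver _).map_csmul, map_add, RingHom.id_apply,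
          smul_sub, Derivation.commutator_apply, sub_smul]
        abel }
    fun a b => by
      change curvature D X Y (a * b) = a * curvature D X Y b + b * curvature D X Y a
      simp only [curvature_apply, (hD.isDerOver _).map_mul, map_add]
      ring

theorem curvDer_apply (X Y : VF C) (a : SM C) : hD.curvDer X Y a = curvature D X Y a := rfl

end IsCovariant

/-- The curvature as a form. -/
def curvForm (D : VF C → SM C →ₗ[ℝ] SM C) : Form C 2 1 := fun X s => curvature D (X 0) (X 1) (s 0)

theorem derivation_mem_polyVect (B : Derivation C (SM C) (SM C)) :
    (fun s => B (s 0)) ∈ polyVect C (SM C) 1 := by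
  refine mem_polyVect.2 ⟨mem_multilinearOps.2 ⟨fun a i u v => ?_, fun a i c u => ?_⟩,
    fun a i j _ hne => absurd (Subsingleton.elim i j) hne, fun i a s t => ?_⟩ <;>
    obtain rfl : i = 0 := Subsingleton.elim _ _ <;> simp

theorem IsCovariant.curvForm_mem (hD : IsCovariant D) :
    curvForm D ∈ forms (polyVect C (SM C) 1) 2 := by
  have h2 : ∀ (X Y Z : VF C) (a : SM C),
      curvature D X (Y + Z) a = curvature D X Y a + curvature D X Z a := fun X Y Z a => by
    rw [hD.curvature_swap, hD.curvature_add_left, hD.curvature_swap X Y, hD.curvature_swap X Z,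
      neg_add]
  have h3 : ∀ (c : C) (X Y : VF C) (a : SM C),
      curvature D X (c • Y) a = c • curvature D X Y a := fun c X Y a => by
    rw [hD.curvature_swap, hD.curvature_smul_left, hD.curvature_swap X Y, smul_neg]
  refine mem_forms.2 ⟨fun X i u v => ?_, fun X i c u => ?_, fun X i j hij hne => ?_, fun X => ?_⟩
  · funext s
    fin_cases i <;> simp [curvForm, h2, hD.curvature_add_left]
  · funext s
    fin_cases i <;> simp [curvForm, h3, hD.curvature_smul_left]
  · have h01 : X 0 = X 1 := by
      fin_cases i <;> fin_cases j <;> simp_all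
    funext s
    simp only [curvForm, h01, hD.curvature_self, Pi.zero_apply]
  · exact derivation_mem_polyVect (hD.curvDer (X 0) (X 1))

/-- The Bianchi identity. -/
theorem IsCovariant.extD_curvForm (hD : IsCovariant D) : extD D (curvForm D) = 0 := by
  funext X s
  -- Antisymmetry and the Jacobi identity bring the nested brackets of vector fields to a common
  -- basis; after that all terms cancel formally.
  have hJ : D ⁅X 0, ⁅X 2, X 1⁆⁆ (s 0) = -D ⁅X 0, ⁅X 1, X 2⁆⁆ (s 0) := by
    rw [← lie_skew (X 2) (X 1), lie_neg, hD.neg_left]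
  have hK : D ⁅X 2, ⁅X 0, X 1⁆⁆ (s 0) = D ⁅X 1, ⁅X 0, X 2⁆⁆ (s 0) - D ⁅X 0, ⁅X 1, X 2⁆⁆ (s 0) := by
    rw [← lie_skew, hD.neg_left, lie_lie, hD.sub_left, neg_sub]
  have u0 : ∀ U V W : VF C, update (![U, V] : Fin 2 → VF C) 0 W = ![W, V] := fun U V W => by
    funext k; fin_cases k <;> simp
  have u1 : ∀ U V W : VF C, update (![U, V] : Fin 2 → VF C) 1 W = ![U, W] := fun U V W => by
    funext k; fin_cases k <;> simp
  have r0 : (0 : Fin 3).removeNth X = ![X 1, X 2] := by funext k; fin_cases k <;> rfl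
  have r1 : (1 : Fin 3).removeNth X = ![X 0, X 2] := by funext k; fin_cases k <;> rfl
  have r2 : (2 : Fin 3).removeNth X = ![X 0, X 1] := by funext k; fin_cases k <;> rfl
  rw [extD_apply, Fin.sum_univ_three, Fin.sum_univ_three]
  simp only [Fin.sum_univ_two, r0, r1, r2, Fin.isValue, Fin.castSucc_zero, Fin.castSucc_one,
    Fin.lt_def, Fin.val_zero, Fin.val_one, Fin.val_two, u0, u1]
  norm_num [opDer_apply, curvForm, curvature_apply]
  simp only [hD.sub_left, hJ, hK]
  abel

/-- The covariant derivative `∇ + A`. -/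
def covPlus (nabla : TorsionFreeConnection C) (A : OneForm C) (X : VF C) : SM C →ₗ[ℝ] SM C :=
  covS nabla X + oneFormAt A X

theorem covPlus_apply (nabla : TorsionFreeConnection C) (A : OneForm C) (X : VF C) (a : SM C) :
    covPlus nabla A X a = covS nabla X a + A X a := rfl

theorem isCovariant_covPlus (nabla : TorsionFreeConnection C) (A : OneForm C) :
    IsCovariant (covPlus nabla A) where
  add_left X Y a := by
    simp only [covPlus_apply, covS_add_left, map_add, Derivation.add_apply]; abel
  smul_left c X a := by
    simp only [covPlus_apply, covS_smul_left, map_smul, Derivation.smul_apply, smul_add]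
  isDerOver X := ⟨fun a b => by
      simp only [covPlus_apply, covS_mul, Derivation.leibniz, smul_eq_mul]; ring,
    fun c => by rw [covPlus_apply, covS_algebraMap, Derivation.map_algebraMap, add_zero]⟩

/-- Expansion of (∇ − δ + A)² as (∇ + A)² − [δ, A]: δ² drops out since fibrewise derivatives
commute, and the mixed terms of ∇ and δ drop out since the torsion vanishes. -/
theorem Frame.curvature_fedosovD (fr : Frame C ι) (nabla : TorsionFreeConnection C)
    (A : OneForm C) (X Y : VF C) (a : SM C) :
    curvature (fedosovD nabla A) X Y a = curvature (covPlus nabla A) X Y a -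
      (vertDer X (A Y a) - A Y (vertDer X a)) + (vertDer Y (A X a) - A X (vertDer Y a)) := by
  have h : vertDer ⁅X, Y⁆ a = vertDer (nabla.cov X Y) a - vertDer (nabla.cov Y X) a := by
    rw [← nabla.torsion]
    exact congrArg (fun B : Derivation C (SM C) (SM C) => B a)
      (map_sub (vertDerForm C) (nabla.cov X Y) (nabla.cov Y X))
  simp only [curvature_apply, fedosovD_apply, covPlus_apply, map_add, map_sub, h,
    fr.covS_vertDer nabla X Y, fr.covS_vertDer nabla Y X, fr.vertDer_comm X Y]
  abel

/-- The derivative of `A_Z a (Z) = 0`. -/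
theorem dirComp_oneForm (A : OneForm C) (a : SM C) (p : ℕ) (h : ∀ Z, comp p (A Z a) Z = 0)
    (Y X : VF C) : dirComp p (A Y a) Y X = -comp p (A X a) Y := by
  obtain ⟨q, q1, -, q3⟩ := exists_expansion p (A Y a) Y X
  obtain ⟨r, r1, r2, -⟩ := exists_expansion p (A X a) Y X
  -- Evaluate A_Y a at Y + tX and write Y as (Y + tX) − tX: the first part vanishes by hypothesis,
  -- the second is −t times A_X a.
  have e : q + Polynomial.X * r = 0 := by
    refine polynomial_eq_of_eval_real fun t => ?_
    rw [Polynomial.eval_add, Polynomial.eval_mul, Polynomial.eval_X, ← q1, ← r1,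
      Polynomial.eval_zero, ← h (Y + t • X), map_add, ← algebraMap_smul C t X, map_smul,
      Derivation.add_apply, Derivation.smul_apply, comp_add, comp_csmul]
  have := congrArg (fun P => Polynomial.coeff P 1) e
  simp only [Polynomial.coeff_add, Polynomial.coeff_X_mul, Polynomial.coeff_zero] at this
  rw [← q3, ← r2, eq_neg_iff_add_eq_zero, this]

theorem derivation_sum_apply (B : ι → Derivation C (SM C) (SM C)) (a : SM C) :
    (∑ i, B i) a = ∑ i, B i a := by
  change Derivation.coeFnAddMonoidHom (∑ i, B i) a = _
  rw [map_sum, Finset.sum_apply]; rfl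

/-- The content of A = δ⁻¹((∇ + A)²). The contraction of D² is a derivation, so it is tested on yᵏ,
where its part of degree p + 1 at Y is the part of degree p of the curvature for (Y, X). There (∇ +
A)² contributes (p + 2) A_X yᵏ by the equation, −∂_Y A_X yᵏ contributes −(p + 1) A_X yᵏ by Euler,
and ∂_X A_Y yᵏ contributes −A_X yᵏ. -/
theorem Frame.kappa_curvForm (fr : Frame C ι) (nabla : TorsionFreeConnection C) {A : OneForm C}
    (hA : IsAdmissible A) (h : SolvesFedosovEquation nabla A) :
    fr.kappa (curvForm (fedosovD nabla A)) = 0 := by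
  have hD := (fr.isConn nabla hA).isCovariant
  funext X s
  let B : Derivation C (SM C) (SM C) := ∑ i, fr.y i • hD.curvDer (fr.e i) (X 0)
  have hB : B = 0 := by
    refine fr.derivation_eq_zero B fun k => SM_ext fun p Y => ?_
    have e : B (fr.y k) = ∑ i, fr.y i * curvature (fedosovD nabla A) (fr.e i) (X 0) (fr.y k) := by
      simp [B, derivation_sum_apply, hD.curvDer_apply]
    rw [e, comp_sum, comp_zero]
    cases p with
    | zero => simp only [comp_y_mul_zero, Finset.sum_const_zero]
    | succ p =>
      simp only [comp_y_mul_succ]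
      have h1 := fr.sum_map
        { toFun := fun Z => comp p (curvature (fedosovD nabla A) Z (X 0) (fr.y k)) Y
          map_add' := fun Z W => by rw [hD.curvature_add_left, comp_add]
          map_smul' := fun c Z => by rw [hD.curvature_smul_left, comp_csmul]; rfl : VF C →ₗ[C] C } Y
      simp only [LinearMap.coe_mk, AddHom.coe_mk, smul_eq_mul] at h1
      rw [h1, fr.curvature_fedosovD]
      have h2 := (h (X 0) _ (fr.isLinear_y k) Y).2 p
      -- The equation gives the normalization δ⁻¹A = 0 for free, as the curvature is alternating.
      have h3 : ∀ Z, comp (p + 1) (A Z (fr.y k)) Z = 0 := fun Z => by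
        rw [(h Z _ (fr.isLinear_y k) Z).2 p]
        have := (isCovariant_covPlus nabla A).curvature_self Z (fr.y k)
        change curvature (fun Z => covS nabla Z + oneFormAt A Z) Z Z (fr.y k) = 0 at this
        rw [this, comp_zero, smul_zero]
      have h4 : comp p (curvature (covPlus nabla A) Y (X 0) (fr.y k)) Y =
          ((p : ℝ) + 2) • comp (p + 1) (A (X 0) (fr.y k)) Y := by
        rw [h2, smul_smul, mul_inv_cancel₀ (by positivity), one_smul]; rfl
      simp only [fr.vertDer_y, Derivation.map_algebraMap, sub_zero]
      rw [comp_add, comp_sub, comp_vertDer, comp_vertDer, h4, dirComp_self,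
        dirComp_oneForm A _ _ h3, Algebra.smul_def]
      simp only [map_add, map_natCast, map_ofNat]
      push_cast
      ring
  have h5 : B (s 0) = 0 := by rw [hB]; rfl
  simpa [B, derivation_sum_apply, hD.curvDer_apply, kappa, curvForm] using h5

theorem Frame.curvature_eq_zero (fr : Frame C ι) (nabla : TorsionFreeConnection C) {A : OneForm C}
    (hA : IsAdmissible A) (h : SolvesFedosovEquation nabla A) (X Y : VF C) :
    curvature (fedosovD nabla A) X Y = 0 := by
  have hD := fr.isConn nabla hA
  have hκ := fr.kappa_curvForm nabla hA h
  have hmem := hD.isCovariant.curvForm_mem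
  have hB := hD.isCovariant.extD_curvForm
  set Θ := curvForm (fedosovD nabla A)
  -- The order of the curvature Θ rises indefinitely. If it is r, then δΘ, which is −DΘ = 0 up to
  -- order r, has order r too; with κΘ = 0 the homotopy formula reads κδΘ = (2 + E)Θ, whose left
  -- side has order r + 1, while E is r up to that order.
  have key : ∀ r X, Θ X ∈ gr C 1 r := by
    intro r
    induction r with
    | zero => exact fun X => mem_gr_zero _
    | succ r ih =>
      intro X
      have h1 : ∀ X, deltaForm Θ X ∈ gr C 1 r := fun X => by
        have := hD.extD_add_deltaForm_mem ih X
        rwa [hB, Pi.zero_apply, zero_add] at this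
      have h2 := fr.kappa_deltaForm hmem X
      have h3 : deltaForm (0 : Form C 1 1) = 0 := by
        have := deltaForm_smul (0 : ℝ) (0 : Form C 1 1)
        rwa [zero_smul, zero_smul] at this
      rw [hκ, h3, Pi.zero_apply, add_zero] at h2
      have h4 := sub_mem (fr.kappa_mem_gr h1 X) (fr.eulerOp_sub_mem (ih X))
      have h5 := gr_rsmul ((2 + r : ℝ)⁻¹) h4
      have e : (2 + r : ℝ)⁻¹ • (fr.kappa (deltaForm Θ) X - (fr.eulerOp (Θ X) - (r : ℝ) • Θ X)) =
          Θ X := by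
        have e2 : fr.kappa (deltaForm Θ) X - (fr.eulerOp (Θ X) - (r : ℝ) • Θ X) =
            (2 + r : ℝ) • Θ X := by
          rw [h2]; push_cast; module
        rw [e2, smul_smul, inv_mul_cancel₀ (by positivity), one_smul]
      rwa [e] at h5
  ext a
  have := congrFun (eq_zero_of_forall_mem_gr fun r => key r ![X, Y]) ![a]
  simpa [Θ, curvForm] using this

end Equation

end Fedosov

end

/-! ### Insertion of one operator into another. -/

noncomputable section

namespace Fedosov

section Graft

open Function

variable {R A B : Type*} [CommRing R] [CommRing A] [Algebra R A] [Algebra ℝ A] [CommRing B]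
  [Algebra ℝ B] {n n' l : ℕ}

/-! ### Insertion of one operator into another -/

/-- The arguments of `P` when `Q` is inserted at `i`. -/
def graftArgs (i : Fin n) (e : Fin n' ⊕ {j : Fin n // j ≠ i} ≃ Fin l) (v : A) (a : Fin l → A) :
    Fin n → A := fun j => if h : j = i then v else a (e (Sum.inr ⟨j, h⟩))

/-- The insertion of `Q` into the `i`-th argument of `P`, the other arguments being distributed
according to `e`. -/
def graft (P : Op A n) (Q : Op A n') (i : Fin n)
    (e : Fin n' ⊕ {j : Fin n // j ≠ i} ≃ Fin l) : Op A l := fun a =>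
  P (graftArgs i e (Q fun r => a (e (Sum.inl r))) a)

theorem graftArgs_self (i : Fin n) (e : Fin n' ⊕ {j : Fin n // j ≠ i} ≃ Fin l) (v : A)
    (a : Fin l → A) : graftArgs i e v a i = v := by simp [graftArgs]

theorem graftArgs_of_ne (i : Fin n) (e : Fin n' ⊕ {j : Fin n // j ≠ i} ≃ Fin l) (v : A)
    (a : Fin l → A) (j : {j : Fin n // j ≠ i}) :
    graftArgs i e v a j = a (e (Sum.inr j)) := by simp [graftArgs, j.2]

theorem graftArgs_eq_update (i : Fin n) (e : Fin n' ⊕ {j : Fin n // j ≠ i} ≃ Fin l) (v w : A)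
    (a : Fin l → A) : graftArgs i e v a = update (graftArgs i e w a) i v := by
  funext j
  by_cases h : j = i
  · subst h; simp [graftArgs]
  · simp [graftArgs, h]

theorem graftArgs_update_inl (i : Fin n) (e : Fin n' ⊕ {j : Fin n // j ≠ i} ≃ Fin l) (v u : A)
    (a : Fin l → A) (r : Fin n') :
    graftArgs i e v (update a (e (Sum.inl r)) u) = graftArgs i e v a := by
  funext j
  simp [graftArgs]

theorem graftArgs_update_inr (i : Fin n) (e : Fin n' ⊕ {j : Fin n // j ≠ i} ≃ Fin l) (v u : A)
    (a : Fin l → A) (j : {j : Fin n // j ≠ i}) :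
    graftArgs i e v (update a (e (Sum.inr j)) u) = update (graftArgs i e v a) j u := by
  funext k
  by_cases hk : k = j
  · subst hk; simp [graftArgs, j.2]
  · by_cases h : k = i
    · subst h; simp [graftArgs, Ne.symm j.2]
    · have : (⟨k, h⟩ : {j : Fin n // j ≠ i}) ≠ j := fun h' => hk (by rw [← h'])
      simp [graftArgs, hk, h, this]

theorem inner_update_inl (i : Fin n) (e : Fin n' ⊕ {j : Fin n // j ≠ i} ≃ Fin l) (u : A)
    (a : Fin l → A) (r : Fin n') :
    (fun r' => update a (e (Sum.inl r)) u (e (Sum.inl r'))) =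
      update (fun r' => a (e (Sum.inl r'))) r u := by
  funext k
  by_cases hk : k = r
  · subst hk; simp
  · simp [hk]

theorem inner_update_inr (i : Fin n) (e : Fin n' ⊕ {j : Fin n // j ≠ i} ≃ Fin l) (u : A)
    (a : Fin l → A) (j : {j : Fin n // j ≠ i}) :
    (fun r' => update a (e (Sum.inr j)) u (e (Sum.inl r'))) = fun r' => a (e (Sum.inl r')) := by
  funext k; simp

theorem graft_update_inl (P : Op A n) (Q : Op A n') (i : Fin n)
    (e : Fin n' ⊕ {j : Fin n // j ≠ i} ≃ Fin l) (a : Fin l → A) (r : Fin n') (u : A) :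
    graft P Q i e (update a (e (Sum.inl r)) u) =
      P (graftArgs i e (Q (update (fun r => a (e (Sum.inl r))) r u)) a) := by
  rw [graft, inner_update_inl, graftArgs_update_inl]

theorem graft_update_inr (P : Op A n) (Q : Op A n') (i : Fin n)
    (e : Fin n' ⊕ {j : Fin n // j ≠ i} ≃ Fin l) (a : Fin l → A) (j : {j : Fin n // j ≠ i}) (u : A) :
    graft P Q i e (update a (e (Sum.inr j)) u) =
      P (update (graftArgs i e (Q (fun r => a (e (Sum.inl r)))) a) j u) := by
  rw [graft, inner_update_inr, graftArgs_update_inr]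

theorem apply_graftArgs_add {P : Op A n} (hP : P ∈ multilinearOps R A n) (i : Fin n)
    (e : Fin n' ⊕ {j : Fin n // j ≠ i} ≃ Fin l) (u v : A) (a : Fin l → A) :
    P (graftArgs i e (u + v) a) = P (graftArgs i e u a) + P (graftArgs i e v a) := by
  rw [graftArgs_eq_update i e (u + v) 0, (mem_multilinearOps.1 hP).1,
    ← graftArgs_eq_update i e u 0, ← graftArgs_eq_update i e v 0]

theorem apply_graftArgs_smul {P : Op A n} (hP : P ∈ multilinearOps R A n) (i : Fin n)
    (e : Fin n' ⊕ {j : Fin n // j ≠ i} ≃ Fin l) (c : R) (v : A) (a : Fin l → A) :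
    P (graftArgs i e (c • v) a) = c • P (graftArgs i e v a) := by
  rw [graftArgs_eq_update i e (c • v) 0, (mem_multilinearOps.1 hP).2,
    ← graftArgs_eq_update i e v 0]

theorem graft_mem_multilinearOps {P : Op A n} {Q : Op A n'} (hP : P ∈ multilinearOps R A n)
    (hQ : Q ∈ multilinearOps R A n') (i : Fin n) (e : Fin n' ⊕ {j : Fin n // j ≠ i} ≃ Fin l) :
    graft P Q i e ∈ multilinearOps R A l := by
  refine mem_multilinearOps.2 ⟨fun a k u v => ?_, fun a k c u => ?_⟩ <;>
  obtain ⟨k | k, rfl⟩ := e.surjective k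
  · simp only [graft_update_inl, (mem_multilinearOps.1 hQ).1, apply_graftArgs_add hP]
  · simp only [graft_update_inr, (mem_multilinearOps.1 hP).1]
  · simp only [graft_update_inl, (mem_multilinearOps.1 hQ).2, apply_graftArgs_smul hP]
  · simp only [graft_update_inr, (mem_multilinearOps.1 hP).2]

theorem graft_add_left (P P' : Op A n) (Q : Op A n') (i : Fin n)
    (e : Fin n' ⊕ {j : Fin n // j ≠ i} ≃ Fin l) :
    graft (P + P') Q i e = graft P Q i e + graft P' Q i e := rfl

theorem graft_smul_left (c : R) (P : Op A n) (Q : Op A n') (i : Fin n)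
    (e : Fin n' ⊕ {j : Fin n // j ≠ i} ≃ Fin l) :
    graft (c • P) Q i e = c • graft P Q i e := rfl

theorem graft_add_right {P : Op A n} (hP : P ∈ multilinearOps R A n) (Q Q' : Op A n') (i : Fin n)
    (e : Fin n' ⊕ {j : Fin n // j ≠ i} ≃ Fin l) :
    graft P (Q + Q') i e = graft P Q i e + graft P Q' i e := by
  funext a; exact apply_graftArgs_add hP i e _ _ a

theorem graft_smul_right {P : Op A n} (hP : P ∈ multilinearOps R A n) (c : R) (Q : Op A n')
    (i : Fin n) (e : Fin n' ⊕ {j : Fin n // j ≠ i} ≃ Fin l) :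
    graft P (c • Q) i e = c • graft P Q i e := by
  funext a; exact apply_graftArgs_smul hP i e _ _ a

/-- The term P(…, δ(Q), …) occurs in both summands on the right with opposite signs; the remaining
terms are δ on the value and on each argument of the composite. -/
theorem opDer_graft {P : Op A n} (hP : P ∈ multilinearOps R A n) (Q : Op A n') (i : Fin n)
    (e : Fin n' ⊕ {j : Fin n // j ≠ i} ≃ Fin l) (δ : A →ₗ[ℝ] A) :
    opDer δ (graft P Q i e) = graft (opDer δ P) Q i e + graft P (opDer δ Q) i e := by
  funext a
  set q := Q fun r => a (e (Sum.inl r)) with hq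
  have h1 : opDer δ (graft P Q i e) a = δ (P (graftArgs i e q a)) -
      ((∑ r, P (graftArgs i e (Q (update (fun r => a (e (Sum.inl r))) r
        (δ (a (e (Sum.inl r)))))) a)) +
      ∑ j : {j : Fin n // j ≠ i}, P (update (graftArgs i e q a) j (δ (a (e (Sum.inr j)))))) := by
    rw [opDer_apply, ← e.sum_comp, Fintype.sum_sum_type]
    simp only [graft_update_inl, graft_update_inr]
    rfl
  have h2 : graft (opDer δ P) Q i e a = δ (P (graftArgs i e q a)) -
      (P (graftArgs i e (δ q) a) +
      ∑ j : {j : Fin n // j ≠ i}, P (update (graftArgs i e q a) j (δ (a (e (Sum.inr j)))))) := by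
    rw [graft, opDer_apply, ← hq, Fintype.sum_eq_add_sum_subtype_ne _ i]
    congr 2
    · rw [graftArgs_self, ← graftArgs_eq_update]
    · refine Finset.sum_congr rfl fun j _ => ?_
      rw [graftArgs_of_ne]
  have h3 : graft P (opDer δ Q) i e a = P (graftArgs i e (δ q) a) -
      ∑ r, P (graftArgs i e (Q (update (fun r => a (e (Sum.inl r))) r
        (δ (a (e (Sum.inl r)))))) a) := by
    rw [graft, opDer_apply, graftArgs_eq_update i e _ 0, update_sub_of_mem hP,
      update_sum_of_mem hP]
    simp only [← graftArgs_eq_update]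
    rfl
  rw [Pi.add_apply, h1, h2, h3]
  abel

theorem adAt_graft_inr (P : Op A n) (Q : Op A n') (i : Fin n)
    (e : Fin n' ⊕ {j : Fin n // j ≠ i} ≃ Fin l) (j : {j : Fin n // j ≠ i}) (s : A) :
    adAt (e (Sum.inr j)) s (graft P Q i e) = graft (adAt j s P) Q i e := by
  funext a
  rw [adAt, graft_update_inr, graft, graft, adAt, graftArgs_of_ne]

theorem adAt_graft_inl {P : Op A n} (hP : P ∈ multilinearOps R A n) (Q : Op A n') (i : Fin n)
    (e : Fin n' ⊕ {j : Fin n // j ≠ i} ≃ Fin l) (r : Fin n') (s : A) :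
    adAt (e (Sum.inl r)) s (graft P Q i e) =
      graft P (adAt r s Q) i e + graft (adAt i s P) Q i e := by
  funext a
  rw [adAt, graft_update_inl, Pi.add_apply, graft, graft, graft, adAt, adAt, graftArgs_self,
    graftArgs_eq_update i e (_ - _) 0, update_sub_of_mem hP, ← graftArgs_eq_update,
    ← graftArgs_eq_update, ← graftArgs_eq_update]
  ring

theorem OrderLT.graft_inr {N : ℕ} (Q : Op A n') (i : Fin n)
    (e : Fin n' ⊕ {j : Fin n // j ≠ i} ≃ Fin l) (j : {j : Fin n // j ≠ i}) :
    ∀ {P : Op A n}, OrderLT (j : Fin n) N P → OrderLT (e (Sum.inr j)) N (graft P Q i e) := by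
  induction N with
  | zero => intro P hP; simp only [OrderLT] at *; subst hP; rfl
  | succ N ih => intro P hP s; rw [adAt_graft_inr]; exact ih (hP s)

theorem graft_zero_right {P : Op A n} (hP : P ∈ multilinearOps R A n) (i : Fin n)
    (e : Fin n' ⊕ {j : Fin n // j ≠ i} ≃ Fin l) : graft P (0 : Op A n') i e = 0 := by
  have := graft_add_right hP (0 : Op A n') 0 i e
  rwa [add_zero, left_eq_add] at this

/-- A commutator with a multiplication in an argument of Q falls either on Q or on the slot of P
that holds Q, so it lowers one of the two orders. The case of order < 0 is that of a zero operator.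
-/
theorem OrderLT.graft_inl (i : Fin n) (e : Fin n' ⊕ {j : Fin n // j ≠ i} ≃ Fin l) (r : Fin n')
    {K : ℕ} : ∀ {M N : ℕ} {P : Op A n} {Q : Op A n'}, P ∈ multilinearOps R A n → M + N ≤ K →
      OrderLT i M P → OrderLT r N Q → OrderLT (e (Sum.inl r)) K (graft P Q i e) := by
  induction K with
  | zero =>
    intro M N P Q _ hK hP _
    obtain rfl : M = 0 := by omega
    simp only [OrderLT] at *; subst hP; rfl
  | succ K ih =>
    intro M N P Q hm hK hP hQ s
    rw [adAt_graft_inl hm]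
    refine OrderLT.add ?_ ?_
    · cases N with
      | zero =>
        simp only [OrderLT] at hQ
        subst hQ
        have : adAt r s (0 : Op A n') = 0 := by funext a; simp [adAt]
        rw [this, graft_zero_right hm]
        exact OrderLT.zero
      | succ N => exact ih hm (by omega) hP (hQ s)
    · cases M with
      | zero =>
        simp only [OrderLT] at hP
        subst hP
        have : adAt i s (0 : Op A n) = 0 := by funext a; simp [adAt]
        rw [this]
        exact OrderLT.zero
      | succ M => exact ih (adAt_mem_multilinearOps i s hm) (by omega) (hP s) hQ

/-- The bound is one more than the expected N + N'. Any bound that depends only on N and N' will do.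
-/
theorem graft_mem_polyDiffLE {P : Op A n} {Q : Op A n'} {N N' : ℕ} (hP : P ∈ polyDiffLE R A n N)
    (hQ : Q ∈ polyDiffLE R A n' N') (i : Fin n) (e : Fin n' ⊕ {j : Fin n // j ≠ i} ≃ Fin l) :
    graft P Q i e ∈ polyDiffLE R A l (N + N' + 1) := by
  refine ⟨graft_mem_multilinearOps hP.1 hQ.1 i e, fun k => ?_⟩
  obtain ⟨k | k, rfl⟩ := e.surjective k
  · exact OrderLT.graft_inl i e k hP.1 (by omega) (hP.2 i) (hQ.2 k)
  · exact (OrderLT.graft_inr Q i e k (hP.2 k)).mono (by omega)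

theorem graft_map (ρ : A → B) {P : Op A n} {P' : Op B n} {Q : Op A n'} {Q' : Op B n'}
    (hP : ∀ a, P' (ρ ∘ a) = ρ (P a)) (hQ : ∀ a, Q' (ρ ∘ a) = ρ (Q a)) (i : Fin n)
    (e : Fin n' ⊕ {j : Fin n // j ≠ i} ≃ Fin l) (a : Fin l → A) :
    graft P' Q' i e (ρ ∘ a) = ρ (graft P Q i e a) := by
  rw [graft, graft, ← hP]
  congr 1
  funext j
  by_cases h : j = i
  · simp only [graftArgs, h, dite_true, comp_apply]
    exact hQ _
  · simp [graftArgs, h]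

/-! ### Finite combinations of insertions -/

/-- A finite linear combination of insertions of an operator of `n'` arguments into an operator of
`n` arguments. -/
structure GraftData (n n' l : ℕ) where
  κ : Type
  fintype : Fintype κ
  coeff : κ → ℝ
  slot : κ → Fin n
  args : ∀ k, Fin n' ⊕ {j : Fin n // j ≠ slot k} ≃ Fin l

attribute [instance] GraftData.fintype

/-- The operator given by a combination of insertions. -/
def GraftData.op (d : GraftData n n' l) (P : Op A n) (Q : Op A n') : Op A l :=
  ∑ k, d.coeff k • graft P Q (d.slot k) (d.args k)

/-- The operations on two operators that are combinations of insertions of one into the other. -/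
structure BracketData (n n' l : ℕ) where
  fst : GraftData n n' l
  snd : GraftData n' n l

/-- The value of such an operation. -/
def BracketData.op (d : BracketData n n' l) (P : Op A n) (Q : Op A n') : Op A l :=
  d.fst.op P Q + d.snd.op Q P

end Graft

end Fedosov

end

/-! ### The brackets as universal combinations of insertions. -/

noncomputable section

namespace Fedosov

section BracketData

open Function

universe u

variable {R A B : Type*} [CommRing R] [CommRing A] [Algebra R A] [Algebra ℝ A] [CommRing B]
  [Algebra ℝ B] {n n' l : ℕ}

theorem GraftData.op_apply (d : GraftData n n' l) (P : Op A n) (Q : Op A n') (a : Fin l → A) :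
    d.op P Q a = ∑ k, d.coeff k • graft P Q (d.slot k) (d.args k) a := by
  simp [GraftData.op]

theorem GraftData.op_mem (d : GraftData n n' l) (P : Op A n) (Q : Op A n')
    (S : Submodule ℝ (Op A l)) (h : ∀ k, graft P Q (d.slot k) (d.args k) ∈ S) : d.op P Q ∈ S :=
  sum_mem fun k _ => S.smul_mem _ (h k)

theorem GraftData.op_add_left (d : GraftData n n' l) (P P' : Op A n) (Q : Op A n') :
    d.op (P + P') Q = d.op P Q + d.op P' Q := by
  simp only [GraftData.op, graft_add_left, smul_add, Finset.sum_add_distrib]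

theorem GraftData.op_add_right (d : GraftData n n' l) {P : Op A n} (hP : P ∈ multilinearOps ℝ A n)
    (Q Q' : Op A n') : d.op P (Q + Q') = d.op P Q + d.op P Q' := by
  simp only [GraftData.op, graft_add_right hP, smul_add, Finset.sum_add_distrib]

theorem GraftData.op_smul_left [Algebra ℝ R] [IsScalarTower ℝ R A] (d : GraftData n n' l) (c : R)
    (P : Op A n) (Q : Op A n') : d.op (c • P) Q = c • d.op P Q := by
  simp only [GraftData.op, graft_smul_left, Finset.smul_sum, smul_algebra_smul_comm]

theorem GraftData.op_smul_right [Algebra ℝ R] [IsScalarTower ℝ R A] (d : GraftData n n' l)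
    {P : Op A n} (hP : P ∈ multilinearOps R A n) (c : R) (Q : Op A n') :
    d.op P (c • Q) = c • d.op P Q := by
  simp only [GraftData.op, graft_smul_right hP, Finset.smul_sum, smul_algebra_smul_comm]

theorem GraftData.opDer_op (d : GraftData n n' l) {P : Op A n} (hP : P ∈ multilinearOps ℝ A n)
    (Q : Op A n') (δ : A →ₗ[ℝ] A) :
    opDer δ (d.op P Q) = d.op (opDer δ P) Q + d.op P (opDer δ Q) := by
  simp only [GraftData.op, map_sum, map_smul, opDer_graft hP, smul_add, Finset.sum_add_distrib]

theorem GraftData.map_op (d : GraftData n n' l) (ρ : A →ₗ[ℝ] B) {P : Op A n} {P' : Op B n}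
    {Q : Op A n'} {Q' : Op B n'} (hP : ∀ a, P' (ρ ∘ a) = ρ (P a))
    (hQ : ∀ a, Q' (ρ ∘ a) = ρ (Q a)) (a : Fin l → A) :
    d.op P' Q' (ρ ∘ a) = ρ (d.op P Q a) := by
  simp only [GraftData.op_apply, map_sum, map_smul, graft_map ρ hP hQ]

namespace BracketData

variable (d : BracketData n n' l)

theorem op_add_left {Q : Op A n'} (hQ : Q ∈ multilinearOps ℝ A n') (P P' : Op A n) :
    d.op (P + P') Q = d.op P Q + d.op P' Q := by
  simp only [op, GraftData.op_add_left, GraftData.op_add_right _ hQ]; abel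

theorem op_add_right {P : Op A n} (hP : P ∈ multilinearOps ℝ A n) (Q Q' : Op A n') :
    d.op P (Q + Q') = d.op P Q + d.op P Q' := by
  simp only [op, GraftData.op_add_left, GraftData.op_add_right _ hP]; abel

theorem op_smul_left [Algebra ℝ R] [IsScalarTower ℝ R A] {Q : Op A n'}
    (hQ : Q ∈ multilinearOps R A n') (c : R) (P : Op A n) : d.op (c • P) Q = c • d.op P Q := by
  simp only [op, GraftData.op_smul_left, GraftData.op_smul_right _ hQ, smul_add]

theorem op_smul_right [Algebra ℝ R] [IsScalarTower ℝ R A] {P : Op A n}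
    (hP : P ∈ multilinearOps R A n) (c : R) (Q : Op A n') : d.op P (c • Q) = c • d.op P Q := by
  simp only [op, GraftData.op_smul_left, GraftData.op_smul_right _ hP, smul_add]

theorem opDer_op {P : Op A n} (hP : P ∈ multilinearOps ℝ A n) {Q : Op A n'}
    (hQ : Q ∈ multilinearOps ℝ A n') (δ : A →ₗ[ℝ] A) :
    opDer δ (d.op P Q) = d.op (opDer δ P) Q + d.op P (opDer δ Q) := by
  simp only [op, map_add, GraftData.opDer_op _ hP, GraftData.opDer_op _ hQ]; abel

theorem map_op (ρ : A →ₗ[ℝ] B) {P : Op A n} {P' : Op B n}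
    {Q : Op A n'} {Q' : Op B n'} (hP : ∀ a, P' (ρ ∘ a) = ρ (P a))
    (hQ : ∀ a, Q' (ρ ∘ a) = ρ (Q a)) (a : Fin l → A) :
    d.op P' Q' (ρ ∘ a) = ρ (d.op P Q a) := by
  simp only [op, Pi.add_apply, map_add, GraftData.map_op _ ρ hP hQ, GraftData.map_op _ ρ hQ hP]

theorem op_mem_multilinearOps [Algebra ℝ R] [IsScalarTower ℝ R A] {P : Op A n}
    (hP : P ∈ multilinearOps R A n) {Q : Op A n'} (hQ : Q ∈ multilinearOps R A n') :
    d.op P Q ∈ multilinearOps R A l :=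
  add_mem
    (d.fst.op_mem P Q ((multilinearOps R A l).restrictScalars ℝ)
      fun _ => graft_mem_multilinearOps hP hQ _ _)
    (d.snd.op_mem Q P ((multilinearOps R A l).restrictScalars ℝ)
      fun _ => graft_mem_multilinearOps hQ hP _ _)

theorem op_mem_polyDiffLE [Algebra ℝ R] [IsScalarTower ℝ R A] {P : Op A n} {N N' : ℕ}
    (hP : P ∈ polyDiffLE R A n N) {Q : Op A n'} (hQ : Q ∈ polyDiffLE R A n' N') :
    d.op P Q ∈ polyDiffLE R A l (N + N' + 1) := by
  refine add_mem
    (d.fst.op_mem P Q ((polyDiffLE R A l (N + N' + 1)).restrictScalars ℝ)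
      fun _ => graft_mem_polyDiffLE hP hQ _ _)
    (d.snd.op_mem Q P ((polyDiffLE R A l (N + N' + 1)).restrictScalars ℝ)
      fun _ => ?_)
  rw [add_comm N N']
  exact graft_mem_polyDiffLE hQ hP _ _

end BracketData

/-! ### The Gerstenhaber and the Schouten-Nijenhuis brackets as combinations of insertions -/

/-- The position in the arguments of `P (…, Q (…), …)` of the arguments of `Q` and of the other
arguments of `P`, where `Q` stands in the `i`-th place. -/
def insertFun (i : Fin n) (h : l + 1 = n + n') : Fin n' ⊕ {j : Fin n // j ≠ i} → Fin l
  | Sum.inl r => ⟨i + r, by omega⟩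
  | Sum.inr j => ⟨if (j : ℕ) < i then j else j + n' - 1, by
      have : ((j : Fin n) : ℕ) ≠ i := fun h' => j.2 (Fin.ext h')
      split_ifs <;> omega⟩

theorem insertFun_bijective (i : Fin n) (h : l + 1 = n + n') :
    Bijective (insertFun (n' := n') i h) := by
  rw [Fintype.bijective_iff_injective_and_card]
  refine ⟨?_, ?_⟩
  · have key : ∀ j : {j : Fin n // j ≠ i}, ((j : Fin n) : ℕ) ≠ i := fun j h' => j.2 (Fin.ext h')
    rintro (r | j) (r' | j') hh <;> simp only [insertFun, Fin.mk.injEq] at hh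
    · exact congrArg _ (Fin.ext (by omega))
    · have := key j'; split_ifs at hh <;> omega
    · have := key j; split_ifs at hh <;> omega
    · have := key j; have := key j'
      refine congrArg _ (Subtype.ext (Fin.ext ?_))
      split_ifs at hh <;> omega
  · have := i.2
    simp only [Fintype.card_sum, Fintype.card_fin, ne_eq, Fintype.card_subtype_compl,
      Fintype.card_subtype_eq]
    omega

/-- The positions of the arguments as an equivalence. -/
def insertEquiv (i : Fin n) (h : l + 1 = n + n') : Fin n' ⊕ {j : Fin n // j ≠ i} ≃ Fin l :=
  Equiv.ofBijective _ (insertFun_bijective i h)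

/-- The trivial permutation serves the Gerstenhaber bracket, all permutations with i = 0 the
Schouten bracket. -/
theorem insertAt_comp_perm (h : l + 1 = n + n') (P : Op A n) (Q : Op A n') (i : Fin n)
    (σ : Equiv.Perm (Fin l)) (a : Fin l → A) :
    insertAt l P Q i (a ∘ σ) = graft P Q i ((insertEquiv i h).trans σ) a := by
  unfold insertAt graft
  congr 1
  funext j
  by_cases hj : j = i
  · subst hj
    simp only [lt_irrefl, if_false, if_true, graftArgs, dite_true]
    congr 1
    funext r
    have : (j : ℕ) + r < l := by omega
    simp [argAt, this, insertEquiv, insertFun]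
  · have h1 : (j : ℕ) ≠ i := fun h' => hj (Fin.ext h')
    simp only [hj, if_false, graftArgs, dite_false, Equiv.trans_apply]
    split_ifs with h2
    · have : (j : ℕ) < l := by omega
      simp [argAt, this, insertEquiv, insertFun, h2]
    · have : (j : ℕ) + n' - 1 < l := by omega
      simp [argAt, this, insertEquiv, insertFun, h2]

theorem insertAt_eq_graft (h : l + 1 = n + n') (P : Op A n) (Q : Op A n') (i : Fin n) :
    insertAt l P Q i = graft P Q i (insertEquiv i h) := by
  funext a
  exact insertAt_comp_perm h P Q i 1 a

/-- The combination of no insertions. -/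
def GraftData.empty (n n' l : ℕ) : GraftData n n' l where
  κ := Empty
  fintype := inferInstance
  coeff := Empty.elim
  slot := fun k => k.elim
  args := fun k => k.elim

theorem GraftData.empty_op (P : Op A n) (Q : Op A n') : (GraftData.empty n n' l).op P Q = 0 := by
  simp only [op]
  exact Finset.sum_of_isEmpty (ι := Empty) _

/-- `c ∑ᵢ (-1)^(i k') P (…, Q (…), …)`. -/
def gerstenhaberGrafts (h : l + 1 = n + n') (c : ℝ) : GraftData n n' l where
  κ := Fin n
  fintype := inferInstance
  coeff i := c * (-1) ^ ((i : ℕ) * (n' + 1))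
  slot i := i
  args i := insertEquiv i h

theorem neg_one_pow_mul_eq (k : ℕ) (x : A) : (-1 : A) ^ k * x = ((-1 : ℝ) ^ k) • x := by
  rcases Nat.even_or_odd k with h | h <;> simp [h.neg_one_pow]

/-- The Gerstenhaber bracket as a combination of insertions. -/
def gerstenhaberData (h : l + 1 = n + n') : BracketData n n' l where
  fst := gerstenhaberGrafts h 1
  snd := gerstenhaberGrafts (by omega) (-(-1) ^ ((n + 1) * (n' + 1)))

theorem gerstenhaberData_op (h : l + 1 = n + n') (P : Op A n) (Q : Op A n') :
    (gerstenhaberData h).op P Q = gerstenhaber l P Q := by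
  funext a
  simp only [gerstenhaberData, BracketData.op, Pi.add_apply, GraftData.op_apply,
    gerstenhaberGrafts, gerstenhaber, neg_one_pow_mul_eq, insertAt_eq_graft h,
    insertAt_eq_graft (show l + 1 = n' + n by omega), one_mul, Finset.smul_sum, sub_eq_add_neg,
    neg_mul, neg_smul, Finset.sum_neg_distrib]
  simp only [smul_eq_mul, mul_smul]

/-- `c ∑ sgn σ • P (Q (a_{σ 0}, …, a_{σ (n'-1)}), a_{σ n'}, …)`. -/
def shuffleGrafts (h : l + 1 = n + n') (hn : 0 < n) (c : ℝ) : GraftData n n' l where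
  κ := Equiv.Perm (Fin l)
  fintype := inferInstance
  coeff σ := c * (Equiv.Perm.sign σ : ℤ)
  slot _ := ⟨0, hn⟩
  args σ := (insertEquiv ⟨0, hn⟩ h).trans σ

theorem shuffleInsert_eq (l : ℕ) (hn : 0 < n) (P : Op A n) (Q : Op A n') (a : Fin l → A) :
    shuffleInsert l P Q a = ((n'.factorial * (n - 1).factorial : ℕ) : ℝ)⁻¹ •
      ∑ σ : Equiv.Perm (Fin l), (Equiv.Perm.sign σ : ℤ) • insertAt l P Q ⟨0, hn⟩ (a ∘ σ) := by
  rw [shuffleInsert, if_neg hn.ne']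
  congr 1
  refine Finset.sum_congr rfl fun σ _ => ?_
  congr 1
  unfold insertAt
  congr 1
  funext j
  by_cases hj : (j : ℕ) = 0
  · have : j = ⟨0, hn⟩ := Fin.ext hj
    subst this
    simp only [if_true, lt_irrefl, if_false, zero_add]
    rfl
  · have : j ≠ ⟨0, hn⟩ := fun h' => hj (by rw [h'])
    simp only [hj, this, if_false, not_lt_zero]
    rfl

theorem shuffleGrafts_op (h : l + 1 = n + n') (hn : 0 < n) (c : ℝ) (P : Op A n) (Q : Op A n') :
    (shuffleGrafts h hn (c * ((n'.factorial * (n - 1).factorial : ℕ) : ℝ)⁻¹)).op P Q =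
      c • shuffleInsert l P Q := by
  funext a
  rw [Pi.smul_apply, shuffleInsert_eq l hn, GraftData.op_apply, smul_smul, Finset.smul_sum]
  change ∑ σ : Equiv.Perm (Fin l),
    (c * ((n'.factorial * (n - 1).factorial : ℕ) : ℝ)⁻¹ * ((Equiv.Perm.sign σ : ℤ) : ℝ)) •
      graft P Q ⟨0, hn⟩ ((insertEquiv ⟨0, hn⟩ h).trans σ) a = _
  refine Finset.sum_congr rfl fun σ _ => ?_
  rw [insertAt_comp_perm h, mul_smul, Int.cast_smul_eq_zsmul]

theorem shuffleInsert_of_eq_zero (l : ℕ) (hn : ¬0 < n) (P : Op A n) (Q : Op A n') :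
    shuffleInsert l P Q = 0 := by
  funext a
  rw [shuffleInsert, if_pos (by omega), Pi.zero_apply]

/-- The combination of insertions that gives `c • shuffleInsert l P Q`. -/
def shuffleData (h : l + 1 = n + n') (c : ℝ) : GraftData n n' l :=
  if hn : 0 < n then shuffleGrafts h hn (c * ((n'.factorial * (n - 1).factorial : ℕ) : ℝ)⁻¹)
  else GraftData.empty n n' l

theorem shuffleData_op (h : l + 1 = n + n') (c : ℝ) (P : Op A n) (Q : Op A n') :
    (shuffleData h c).op P Q = c • shuffleInsert l P Q := by
  unfold shuffleData
  split_ifs with hn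
  · exact shuffleGrafts_op h hn c P Q
  · rw [GraftData.empty_op, shuffleInsert_of_eq_zero l hn, smul_zero]

/-- The Schouten-Nijenhuis bracket as a combination of insertions. -/
def schoutenData (h : l + 1 = n + n') : BracketData n n' l where
  fst := shuffleData h ((-1) ^ ((n + 1) * (n' + 1)))
  snd := shuffleData (by omega) (-1)

theorem schoutenData_op (h : l + 1 = n + n') (P : Op A n) (Q : Op A n') :
    (schoutenData h).op P Q = schouten l P Q := by
  funext a
  simp only [schoutenData, BracketData.op, shuffleData_op, schouten, neg_one_pow_mul_eq,
    Pi.add_apply, Pi.smul_apply, Pi.neg_apply, neg_smul, one_smul, sub_eq_add_neg]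

/-- The combination is chosen before the algebra, so the same one gives the bracket on Γ(SM) and on
C. The case n = n' = 0 is apart because the subtraction is truncated there; no insertion is possible
and the bracket is 0. -/
theorem exists_gerstenhaberData (n n' : ℕ) : ∃ d : BracketData n n' (n + n' - 1),
    ∀ {A : Type u} [CommRing A] [Algebra ℝ A] (P : Op A n) (Q : Op A n'),
      d.op P Q = gerstenhaber (n + n' - 1) P Q := by
  by_cases h : n + n' = 0
  · obtain ⟨rfl, rfl⟩ : n = 0 ∧ n' = 0 := by omega
    refine ⟨⟨GraftData.empty _ _ _, GraftData.empty _ _ _⟩, fun P Q => ?_⟩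
    funext a
    simp [BracketData.op, GraftData.empty_op, gerstenhaber]
  · exact ⟨gerstenhaberData (by omega), fun P Q => gerstenhaberData_op _ P Q⟩

theorem exists_schoutenData (n n' : ℕ) : ∃ d : BracketData n n' (n + n' - 1),
    ∀ {A : Type u} [CommRing A] [Algebra ℝ A] (P : Op A n) (Q : Op A n'),
      d.op P Q = schouten (n + n' - 1) P Q := by
  by_cases h : n + n' = 0
  · obtain ⟨rfl, rfl⟩ : n = 0 ∧ n' = 0 := by omega
    refine ⟨⟨GraftData.empty _ _ _, GraftData.empty _ _ _⟩, fun P Q => ?_⟩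
    funext a
    simp [BracketData.op, GraftData.empty_op, schouten, shuffleInsert]
  · exact ⟨schoutenData (by omega), fun P Q => schoutenData_op _ P Q⟩

/-! ### The multiplication as an operator -/

theorem mulOp_mem_polyDiffLE (R A : Type*) [CommRing R] [CommRing A] [Algebra R A] :
    mulOp A ∈ polyDiffLE R A 2 0 := by
  refine ⟨mem_multilinearOps.2 ⟨fun a i u v => ?_, fun a i c u => ?_⟩, fun i s => ?_⟩
  · fin_cases i <;> simp [mulOp, add_mul, mul_add]
  · fin_cases i <;> simp [mulOp]
  · funext a
    fin_cases i <;> simp [mulOp, adAt] <;> ring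

theorem opDer_mulOp {δ : A →ₗ[ℝ] A} (hδ : ∀ s t, δ (s * t) = s * δ t + t * δ s) :
    opDer δ (mulOp A) = 0 := by
  funext a
  simp [opDer_apply, mulOp, hδ, Fin.sum_univ_two]
  ring

end BracketData

end Fedosov

end

/-! ### The Schouten bracket of polyvector fields is a polyvector field. -/

noncomputable section

namespace Fedosov

section Schouten

open Function Equiv

variable {R A : Type*} [CommRing R] [CommRing A] [Algebra R A] [Algebra ℝ A] 
  {n n' l : ℕ}

/-! ### Alternating sums -/

/-- The alternating sum `∑ sgn σ • T (a ∘ σ)`. -/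
def altSum {α G : Type*} [AddCommGroup G] (T : (Fin l → α) → G) : (Fin l → α) → G := fun a =>
  ∑ σ : Perm (Fin l), (Perm.sign σ : ℤ) • T (a ∘ σ)

theorem altSum_comp_perm {α G : Type*} [AddCommGroup G] (T : (Fin l → α) → G) (a : Fin l → α)
    (τ : Perm (Fin l)) : altSum T (a ∘ τ) = (Perm.sign τ : ℤ) • altSum T a := by
  rw [altSum, altSum, Finset.smul_sum,
    ← Equiv.sum_comp (Equiv.mulLeft τ) fun σ => (Perm.sign τ : ℤ) • (Perm.sign σ : ℤ) • T (a ∘ σ)]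
  refine Finset.sum_congr rfl fun σ _ => ?_
  rw [Equiv.coe_mulLeft, Perm.sign_mul, smul_smul, ← Units.val_mul, ← mul_assoc,
    Int.units_mul_self, one_mul]
  rfl

theorem altSum_eq_zero_of_eq {α G : Type*} [AddCommGroup G] (T : (Fin l → α) → G) (a : Fin l → α)
    {i j : Fin l} (h : a i = a j) (hij : i ≠ j) : altSum T a = 0 := by
  refine Finset.sum_involution (fun σ _ => swap i j * σ) (fun σ _ => ?_) (fun σ _ _ h' => ?_)
    (fun _ _ => Finset.mem_univ _) (fun σ _ => by rw [← mul_assoc, swap_mul_self, one_mul])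
  · have : a ∘ ⇑(swap i j * σ) = a ∘ σ := by
      funext x
      simp only [comp_apply, Perm.mul_apply]
      rw [swap_apply_def]
      split_ifs with h1 h2
      · rw [← h, h1]
      · rw [h, h2]
      · rfl
    rw [this, Perm.sign_mul, Perm.sign_swap hij]
    simp
  · rw [mul_eq_right, swap_eq_one_iff] at h'
    exact hij h'

theorem altSum_update {α G : Type*} [AddCommGroup G] (T : (Fin l → α) → G) (a : Fin l → α)
    (k : Fin l) (u : α) : altSum T (update a k u) =
      ∑ σ : Perm (Fin l), (Perm.sign σ : ℤ) • T (update (a ∘ σ) (σ.symm k) u) := by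
  refine Finset.sum_congr rfl fun σ _ => ?_
  rw [update_comp_equiv]

/-! ### The Schouten-Nijenhuis bracket of polyvector fields is a polyvector field -/

/-- `P (Q (a₀, …), aₙ', …)`. -/
def headInsert {m : ℕ} (h : l = n' + m) (P : Op A (m + 1)) (Q : Op A n') : Op A l := fun a =>
  P (Fin.cons (Q fun r => a ⟨r, by omega⟩) fun j => a ⟨n' + j, by omega⟩)

theorem shuffleInsert_eq_altSum {m : ℕ} (h : l = n' + m) (P : Op A (m + 1)) (Q : Op A n')
    (a : Fin l → A) : shuffleInsert l P Q a = ((n'.factorial * m.factorial : ℕ) : ℝ)⁻¹ •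
      altSum (headInsert h P Q) a := by
  rw [shuffleInsert_eq l m.succ_pos]
  congr 1
  refine Finset.sum_congr rfl fun σ _ => ?_
  congr 1
  unfold insertAt headInsert
  congr 1
  funext j
  refine Fin.cases ?_ (fun j => ?_) j
  · have : (0 : Fin (m + 1)) = ⟨0, m.succ_pos⟩ := rfl
    simp only [this, lt_irrefl, if_false, if_true]
    congr 1
    funext r
    have : (r : ℕ) < l := by omega
    simp [argAt, this]
  · have h1 : j.succ ≠ ⟨0, m.succ_pos⟩ := Fin.succ_ne_zero j
    have h2 : (j : ℕ) + 1 + n' - 1 < l := by omega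
    simp only [h1, Fin.val_succ, not_lt_zero, if_false, Fin.cons_succ, argAt, h2, dite_true]
    congr 1
    exact Fin.ext (by simp; omega)

theorem decomposeFin_symm_eq_mul {L : ℕ} (p : Fin (L + 1)) (e : Perm (Fin L)) :
    Perm.decomposeFin.symm (p, e) = swap 0 p * Perm.decomposeFin.symm (0, e) := by
  ext x
  refine Fin.cases ?_ (fun x => ?_) x
  · simp
  · simp

/-- Permutations are sorted by p = σ⁻¹(0), the slot in which the distinguished first argument lands.
-/
theorem sum_perm_succ {L : ℕ} {G : Type*} [AddCommGroup G] (f : Perm (Fin (L + 1)) → G) :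
    ∑ σ, f σ = ∑ p : Fin (L + 1), ∑ e : Perm (Fin L),
      f (Perm.decomposeFin.symm (0, e) * swap 0 p) := by
  have h : ∀ e : Perm (Fin L), Perm.decomposeFin.symm ((0 : Fin (L + 1)), e⁻¹) =
      (Perm.decomposeFin.symm ((0 : Fin (L + 1)), e))⁻¹ := by
    intro e
    rw [eq_inv_iff_mul_eq_one]
    ext x
    refine Fin.cases ?_ (fun x => ?_) x <;> simp
  rw [← Equiv.sum_comp (Equiv.inv _), ← Equiv.sum_comp Perm.decomposeFin.symm, Fintype.sum_prod_type]
  refine Finset.sum_congr rfl fun p _ => ?_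
  rw [← Equiv.sum_comp (Equiv.inv _)]
  refine Finset.sum_congr rfl fun e _ => ?_
  rw [Equiv.inv_apply, Equiv.inv_apply, decomposeFin_symm_eq_mul, h, mul_inv_rev, inv_inv,
    swap_inv]

theorem cons_comp_decomposeFin {L : ℕ} {α : Type*} (u : α) (b : Fin L → α) (e : Perm (Fin L)) :
    (Fin.cons u b : Fin (L + 1) → α) ∘ ⇑(Perm.decomposeFin.symm ((0 : Fin (L + 1)), e)) =
      (Fin.cons u (b ∘ e) : Fin (L + 1) → α) := by
  funext x
  refine Fin.cases ?_ (fun x => ?_) x <;> simp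

/-- The exchange of two blocks is a power of the cyclic rotation, from which its sign is computed.
-/
theorem exists_rotation {m m' L : ℕ} (hL : L = m + m') : ∃ β : Perm (Fin L), (Perm.sign β = (-1) ^ (m * m')) ∧
    (∀ j : Fin m, β ⟨j, by omega⟩ = ⟨m' + j, by omega⟩) ∧
    ∀ j : Fin m', β ⟨m + j, by omega⟩ = ⟨j, by omega⟩ := by
  have key : ∀ (L k : ℕ) (x : Fin (L + 1)),
      (((finRotate (L + 1)) ^ k) x : ℕ) = (x + k) % (L + 1) := by
    intro L k x
    induction k with
    | zero => simp [Nat.mod_eq_of_lt x.2]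
    | succ k ih =>
      rw [pow_succ', Perm.mul_apply, finRotate_apply, Fin.val_add, ih, Fin.val_one']
      simp [add_assoc]
  rcases L with _ | L
  · refine ⟨1, ?_, fun j => ?_, fun j => ?_⟩
    · simp [show m = 0 by omega]
    · have := j.2; omega
    · have := j.2; omega
  · refine ⟨finRotate (L + 1) ^ m', ?_, fun j => ?_, fun j => ?_⟩
    · rw [map_pow, sign_finRotate, ← pow_mul, Nat.add_sub_cancel]
      have h1 : Even (L * m' + m * m') := by
        rw [← add_mul, show L + m = 2 * m + m' - 1 by omega]
        rcases Nat.even_or_odd m' with h | h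
        · exact h.mul_left _
        · exact Even.mul_right (by obtain ⟨r, hr⟩ := h; exact ⟨m + r, by omega⟩) _
      rw [Nat.even_add] at h1
      by_cases h2 : Even (m * m')
      · rw [h2.neg_one_pow, (h1.2 h2).neg_one_pow]
      · rw [(Nat.not_even_iff_odd.1 h2).neg_one_pow,
          (Nat.not_even_iff_odd.1 fun h3 => h2 (h1.1 h3)).neg_one_pow]
    · refine Fin.ext ?_
      rw [key, Nat.mod_eq_of_lt] <;> simp <;> omega
    · refine Fin.ext ?_
      rw [key]
      simp only
      rw [show m + j + m' = j + (L + 1) by omega, Nat.add_mod_right, Nat.mod_eq_of_lt (by omega)]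

/-- The failure of the Leibniz rule. -/
def leibnizDefect (F : A → A) (s t : A) : A := F (s * t) - (s * F t + t * F s)

theorem leibnizDefect_zsmul (F : A → A) (c : ℤ) (s t : A) :
    leibnizDefect (fun u => c • F u) s t = c • leibnizDefect F s t := by
  simp only [leibnizDefect, smul_sub, smul_add, mul_smul_comm]

theorem leibnizDefect_smul (F : A → A) (c : ℝ) (s t : A) :
    leibnizDefect (fun u => c • F u) s t = c • leibnizDefect F s t := by
  simp only [leibnizDefect, smul_sub, smul_add, mul_smul_comm]

theorem leibnizDefect_sum {ι : Type*} [Fintype ι] (F : ι → A → A) (s t : A) :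
    leibnizDefect (fun u => ∑ i, F i u) s t = ∑ i, leibnizDefect (F i) s t := by
  simp only [leibnizDefect, Finset.sum_sub_distrib, Finset.sum_add_distrib, Finset.mul_sum]

theorem leibnizDefect_update {P : Op A n} (hP : P ∈ polyVect R A n) (a : Fin n → A) (i : Fin n)
    (s t : A) : leibnizDefect (fun u => P (update a i u)) s t = 0 :=
  sub_eq_zero.2 ((mem_polyVect.1 hP).2.2 i a s t)

/-- `P (s, c_{m'}, …) Q (t, c₀, …, c_{m'-1})`. -/
def crossTerm {m m' L : ℕ} (hL : L = m + m') (P : Op A (m + 1)) (Q : Op A (m' + 1)) (s t : A)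
    (c : Fin L → A) : A :=
  P (Fin.cons s fun j : Fin m => c ⟨m' + j, by omega⟩) *
    Q (Fin.cons t fun j : Fin m' => c ⟨j, by omega⟩)

theorem headInsert_cons {m m' L : ℕ} (hL : L = m + m') (h : L + 1 = m' + 1 + m) (P : Op A (m + 1))
    (Q : Op A (m' + 1)) (u : A) (c : Fin L → A) : headInsert h P Q (Fin.cons u c) =
      P (Fin.cons (Q (Fin.cons u fun j : Fin m' => c ⟨j, by omega⟩))
        fun j : Fin m => c ⟨m' + j, by omega⟩) := by
  unfold headInsert
  congr 2
  · congr 1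
    funext r
    refine Fin.cases rfl (fun r => ?_) r
    rw [Fin.cons_succ]
    exact Fin.cons_succ (α := fun _ => A) u c ⟨r, by omega⟩
  · funext j
    have : (⟨m' + 1 + j, by omega⟩ : Fin (L + 1)) = Fin.succ ⟨m' + j, by omega⟩ :=
      Fin.ext (by simp; omega)
    rw [this, Fin.cons_succ]

/-- A composite of two derivations is of second order: P(Q(st)) expands to the Leibniz terms and the
two products in which P and Q act on different factors. -/
theorem leibnizDefect_headInsert {m m' L : ℕ} (hL : L = m + m') (h : L + 1 = m' + 1 + m)
    {P : Op A (m + 1)} (hP : P ∈ polyVect R A (m + 1)) {Q : Op A (m' + 1)}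
    (hQ : Q ∈ polyVect R A (m' + 1)) (s t : A) (c : Fin L → A) :
    leibnizDefect (fun u => headInsert h P Q (Fin.cons u c)) s t =
      crossTerm hL P Q s t c + crossTerm hL P Q t s c := by
  have hQ' : ∀ v : Fin m' → A, Q (Fin.cons (s * t) v) =
      s * Q (Fin.cons t v) + t * Q (Fin.cons s v) := by
    intro v
    have := (mem_polyVect.1 hQ).2.2 0 (Fin.cons 0 v) s t
    simpa only [Fin.update_cons_zero] using this
  have hP' : ∀ (x y : A) (v : Fin m → A), P (Fin.cons (x * y) v) =
      x * P (Fin.cons y v) + y * P (Fin.cons x v) := by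
    intro x y v
    have := (mem_polyVect.1 hP).2.2 0 (Fin.cons 0 v) x y
    simpa only [Fin.update_cons_zero] using this
  have hadd : ∀ (x y : A) (v : Fin m → A), P (Fin.cons (x + y) v) =
      P (Fin.cons x v) + P (Fin.cons y v) := by
    intro x y v
    have := (mem_multilinearOps.1 (mem_polyVect.1 hP).1).1 (Fin.cons 0 v) 0 x y
    simpa only [Fin.update_cons_zero] using this
  simp only [leibnizDefect, headInsert_cons hL, hQ', hadd, hP', crossTerm]
  ring

theorem headInsert_comp_swap {m m' L : ℕ} (h : L + 1 = m' + 1 + m)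
    {P : Op A (m + 1)} (hP : P ∈ polyVect R A (m + 1)) {Q : Op A (m' + 1)}
    (hQ : Q ∈ polyVect R A (m' + 1)) (a : Fin (L + 1) → A) (p : Fin (L + 1))
    (hp : (p : ℕ) < m' + 1) : headInsert h P Q (a ∘ swap 0 p) =
      (Perm.sign (swap 0 p) : ℤ) • headInsert h P Q a := by
  by_cases hp0 : p = 0
  · subst hp0; simp
  rw [Perm.sign_swap (Ne.symm hp0)]
  have h1 : (Q fun r => (a ∘ swap 0 p) ⟨r, by omega⟩) = -Q fun r => a ⟨r, by omega⟩ := by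
    obtain ⟨⟨f, rfl⟩, -⟩ := hQ
    have hp' : (0 : Fin (m' + 1)) ≠ ⟨p, hp⟩ := fun h' => hp0 (Fin.ext (by
      have := congrArg Fin.val h'
      simpa using this.symm))
    rw [← f.map_swap (fun r => a ⟨r, by omega⟩) hp']
    congr 1
    funext r
    simp only [comp_apply]
    congr 1
    simp only [swap_apply_def, Fin.ext_iff, Fin.val_zero]
    split_ifs <;> simp_all
  have h2 : ∀ j : Fin m, (a ∘ swap 0 p) ⟨m' + 1 + j, by omega⟩ = a ⟨m' + 1 + j, by omega⟩ := by
    intro j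
    rw [comp_apply, swap_apply_of_ne_of_ne]
    · simp [Fin.ext_iff]
    · simp only [ne_eq, Fin.ext_iff]; omega
  have h3 : ∀ (x : A) (v : Fin m → A), P (Fin.cons (-x) v) = -P (Fin.cons x v) := by
    intro x v
    have := (mem_multilinearOps.1 (mem_polyVect.1 hP).1).2 (Fin.cons 0 v) 0 (-1) x
    simpa only [Fin.update_cons_zero, neg_smul, one_smul] using this
  simp only [headInsert]
  rw [h1, h3]
  simp only [h2, Units.val_neg, Units.val_one, neg_smul, one_smul]

theorem leibnizDefect_headInsert_of_le {m : ℕ} (h : l = n' + m) {P : Op A (m + 1)}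
    (hP : P ∈ polyVect R A (m + 1)) (Q : Op A n') (a : Fin l → A) (p : Fin l)
    (hp : n' ≤ p) (s t : A) :
    leibnizDefect (fun u => headInsert h P Q (update a p u)) s t = 0 := by
  have : ∀ u, headInsert h P Q (update a p u) = P (update
      (Fin.cons (Q fun r => a ⟨r, by omega⟩) fun j : Fin m => a ⟨n' + j, by omega⟩)
      (Fin.succ ⟨p - n', by omega⟩) u) := by
    intro u
    rw [← Fin.cons_update]
    unfold headInsert
    congr 2
    · congr 1
      funext r
      exact update_of_ne (by simp only [ne_eq, Fin.ext_iff]; omega) _ _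
    · funext j
      by_cases hj : j = ⟨p - n', by omega⟩
      · subst hj
        have : (⟨n' + (p - n'), by omega⟩ : Fin l) = p := Fin.ext (by simp; omega)
        rw [update_self, this, update_self]
      · rw [update_of_ne hj, update_of_ne]
        intro h'
        have := congrArg Fin.val h'
        simp only at this
        exact hj (Fin.ext (by simp only; omega))
  simp only [this]
  exact leibnizDefect_update hP _ _ s t

/-- Permutations that put the product into a slot of P give no defect, by
`leibnizDefect_headInsert_of_le`. Each of the m' + 1 slots of Q gives the same defect, because
antisymmetry moves the product to the first slot of Q; hence the factor. -/
theorem leibnizDefect_altSum {m m' L : ℕ} (hL : L = m + m') (h : L + 1 = m' + 1 + m)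
    {P : Op A (m + 1)} (hP : P ∈ polyVect R A (m + 1)) {Q : Op A (m' + 1)}
    (hQ : Q ∈ polyVect R A (m' + 1)) (s t : A) (b : Fin L → A) :
    leibnizDefect (fun u => altSum (headInsert h P Q) (Fin.cons u b)) s t =
      (m' + 1 : ℝ) • (altSum (crossTerm hL P Q s t) b + altSum (crossTerm hL P Q t s) b) := by
  have hkey : ∀ (p : Fin (L + 1)) (e : Perm (Fin L)),
      leibnizDefect (fun u => (Perm.sign (Perm.decomposeFin.symm (0, e) * swap 0 p) : ℤ) •
        headInsert h P Q ((Fin.cons u b : Fin (L + 1) → A) ∘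
          ⇑(Perm.decomposeFin.symm (0, e) * swap 0 p))) s t =
      if (p : ℕ) < m' + 1 then (Perm.sign e : ℤ) • (crossTerm hL P Q s t (b ∘ e) +
        crossTerm hL P Q t s (b ∘ e)) else 0 := by
    intro p e
    rw [leibnizDefect_zsmul]
    have h1 : ∀ u, (Fin.cons u b : Fin (L + 1) → A) ∘
          ⇑(Perm.decomposeFin.symm (0, e) * swap 0 p) =
        (Fin.cons u (b ∘ e) : Fin (L + 1) → A) ∘ swap 0 p := by
      intro u
      rw [Perm.coe_mul, ← comp_assoc, cons_comp_decomposeFin]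
    simp only [h1]
    split_ifs with hp
    · simp only [headInsert_comp_swap h hP hQ _ p hp]
      rw [leibnizDefect_zsmul, leibnizDefect_headInsert hL h hP hQ, smul_smul, ← Units.val_mul,
        Perm.sign_mul, mul_assoc, Int.units_mul_self, mul_one, Perm.decomposeFin.symm_sign]
      simp
    · have h2 : ∀ u, (Fin.cons u (b ∘ e) : Fin (L + 1) → A) ∘ swap 0 p =
          update ((Fin.cons 0 (b ∘ e) : Fin (L + 1) → A) ∘ swap 0 p) p u := by
        intro u
        rw [← Fin.update_cons_zero (α := fun _ => A) 0 (b ∘ e) u, update_comp_equiv, symm_swap, swap_apply_left]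
      have h3 : (fun u => headInsert h P Q
            ((Fin.cons u (b ∘ e) : Fin (L + 1) → A) ∘ swap 0 p)) = fun u => headInsert h P Q
            (update ((Fin.cons 0 (b ∘ e) : Fin (L + 1) → A) ∘ swap 0 p) p u) := by
        funext u; rw [h2]
      rw [h3, leibnizDefect_headInsert_of_le h hP Q _ p (by omega), smul_zero]
  have h0 : ∀ u, altSum (headInsert h P Q) (Fin.cons u b) = ∑ p : Fin (L + 1), ∑ e : Perm (Fin L),
      (Perm.sign (Perm.decomposeFin.symm (0, e) * swap 0 p) : ℤ) •
        headInsert h P Q ((Fin.cons u b : Fin (L + 1) → A) ∘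
          ⇑(Perm.decomposeFin.symm (0, e) * swap 0 p)) := fun u => sum_perm_succ _
  simp only [h0, leibnizDefect_sum, hkey]
  have h3 : ∀ p : Fin (L + 1), (∑ e : Perm (Fin L),
      if (p : ℕ) < m' + 1 then (Perm.sign e : ℤ) • (crossTerm hL P Q s t (b ∘ e) +
        crossTerm hL P Q t s (b ∘ e)) else 0) =
      if (p : ℕ) < m' + 1 then
        altSum (crossTerm hL P Q s t) b + altSum (crossTerm hL P Q t s) b else 0 := by
    intro p
    split_ifs
    · simp only [smul_add, Finset.sum_add_distrib]; rfl
    · simp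
  simp only [h3]
  rw [← Finset.sum_filter, Finset.sum_const, ← Nat.cast_smul_eq_nsmul ℝ]
  congr 1
  have : ((Finset.univ.filter fun p : Fin (L + 1) => (p : ℕ) < m' + 1).card) = m' + 1 := by
    rw [Fin.card_filter_val_lt]; omega
  rw [this]
  push_cast
  ring

theorem altSum_crossTerm_comm {m m' L : ℕ} (hL : L = m + m') (P : Op A (m + 1))
    (Q : Op A (m' + 1)) (s t : A) (b : Fin L → A) :
    altSum (crossTerm (show L = m' + m by omega) Q P s t) b =
      (-1 : ℝ) ^ (m * m') • altSum (crossTerm hL P Q t s) b := by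
  obtain ⟨β, hβ, h1, h2⟩ := exists_rotation hL
  rw [altSum, ← Equiv.sum_comp (Equiv.mulRight β), altSum, Finset.smul_sum]
  refine Finset.sum_congr rfl fun e _ => ?_
  rw [Equiv.coe_mulRight, Perm.sign_mul, hβ]
  have h3 : crossTerm (show L = m' + m by omega) Q P s t (b ∘ ⇑(e * β)) =
      crossTerm hL P Q t s (b ∘ e) := by
    simp only [crossTerm, comp_apply, Perm.mul_apply, h1, h2]
    rw [mul_comm]
  rw [h3, mul_comm, Units.val_mul, mul_smul, ← Int.cast_smul_eq_zsmul ℝ]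
  simp

theorem schouten_mem_multilinearOps [Algebra ℝ R] [IsScalarTower ℝ R A] (h : l + 1 = n + n')
    {P : Op A n} (hP : P ∈ polyVect R A n) {Q : Op A n'} (hQ : Q ∈ polyVect R A n') :
    schouten l P Q ∈ multilinearOps R A l := by
  rw [← schoutenData_op h]
  exact (schoutenData h).op_mem_multilinearOps (mem_polyVect.1 hP).1 (mem_polyVect.1 hQ).1

theorem shuffleInsert_comp_perm (h : l + 1 = n + n') (P : Op A n) (Q : Op A n') (a : Fin l → A)
    (τ : Perm (Fin l)) :
    shuffleInsert l P Q (a ∘ τ) = (Perm.sign τ : ℤ) • shuffleInsert l P Q a := by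
  rcases n with _ | m
  · simp [shuffleInsert_of_eq_zero l (lt_irrefl 0)]
  · rw [shuffleInsert_eq_altSum (show l = n' + m by omega), shuffleInsert_eq_altSum
      (show l = n' + m by omega), altSum_comp_perm, smul_comm]

theorem shuffleInsert_eq_zero_of_eq (h : l + 1 = n + n') (P : Op A n) (Q : Op A n')
    (a : Fin l → A) {i j : Fin l} (hij : a i = a j) (hne : i ≠ j) : shuffleInsert l P Q a = 0 := by
  rcases n with _ | m
  · simp [shuffleInsert_of_eq_zero l (lt_irrefl 0)]
  · rw [shuffleInsert_eq_altSum (show l = n' + m by omega), altSum_eq_zero_of_eq _ a hij hne,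
      smul_zero]

theorem leibnizDefect_shuffleInsert_zero (h : l + 1 = n) {P : Op A n}
    (hP : P ∈ polyVect R A n) (Q : Op A 0) (a : Fin l → A) (k : Fin l) (s t : A) :
    leibnizDefect (fun u => shuffleInsert l P Q (update a k u)) s t = 0 := by
  subst h
  simp only [shuffleInsert_eq_altSum (show l = 0 + l by omega), altSum_update,
    leibnizDefect_smul, leibnizDefect_sum, leibnizDefect_zsmul,
    leibnizDefect_headInsert_of_le _ hP Q _ _ (Nat.zero_le _)]
  simp

theorem leibnizDefect_sub (F G : A → A) (s t : A) :
    leibnizDefect (fun u => F u - G u) s t = leibnizDefect F s t - leibnizDefect G s t := by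
  simp only [leibnizDefect]; ring

/-- The two halves of the bracket have the same cross terms with the roles of P and Q exchanged. The
exchange costs the sign (−1)^{mm'}, which is the sign in front of the first half, so the defects
cancel. -/
theorem leibnizDefect_schouten_cons {m m' L : ℕ} (hL : L = m + m')
    {P : Op A (m + 1)} (hP : P ∈ polyVect R A (m + 1)) {Q : Op A (m' + 1)}
    (hQ : Q ∈ polyVect R A (m' + 1)) (s t : A) (b : Fin L → A) :
    leibnizDefect (fun u => schouten (L + 1) P Q (Fin.cons u b)) s t = 0 := by
  -- The number of slots of the inner operator cancels against its factorial, after which both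
  -- halves have the normalization 1 / (m! m'!).
  have c1 : ∀ k k' : ℕ, (((k + 1).factorial * k'.factorial : ℕ) : ℝ)⁻¹ * (k + 1 : ℝ) =
      ((k.factorial * k'.factorial : ℕ) : ℝ)⁻¹ := by
    intro k k'
    rw [Nat.factorial_succ]
    push_cast
    have h1 : (k.factorial : ℝ) ≠ 0 := by positivity
    have h2 : (k'.factorial : ℝ) ≠ 0 := by positivity
    have h3 : (k + 1 : ℝ) ≠ 0 := by positivity
    field_simp
  have c2 : (-1 : ℝ) ^ ((m + 1 + 1) * (m' + 1 + 1)) = (-1) ^ (m * m') := by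
    rw [show (m + 1 + 1) * (m' + 1 + 1) = m * m' + 2 * (m + m' + 2) by ring, pow_add, pow_mul]
    simp
  simp only [schouten, neg_one_pow_mul_eq, leibnizDefect_sub, leibnizDefect_smul,
    shuffleInsert_eq_altSum (show L + 1 = m' + 1 + m by omega),
    shuffleInsert_eq_altSum (show L + 1 = m + 1 + m' by omega),
    leibnizDefect_altSum hL _ hP hQ, leibnizDefect_altSum (show L = m' + m by omega) _ hQ hP,
    altSum_crossTerm_comm hL P Q]
  rw [smul_smul (((m' + 1).factorial * m.factorial : ℕ) : ℝ)⁻¹,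
    smul_smul (((m + 1).factorial * m'.factorial : ℕ) : ℝ)⁻¹, c1, c1, c2, ← smul_add,
    smul_comm, mul_comm m.factorial, add_comm (altSum (crossTerm hL P Q s t) b), sub_self]

theorem schouten_mem_polyVect [Algebra ℝ R] [IsScalarTower ℝ R A] (h : l + 1 = n + n') {P : Op A n}
    (hP : P ∈ polyVect R A n) {Q : Op A n'} (hQ : Q ∈ polyVect R A n') :
    schouten l P Q ∈ polyVect R A l := by
  refine mem_polyVect.2 ⟨schouten_mem_multilinearOps h hP hQ, fun a i j hij hne => ?_,
    fun k a s t => sub_eq_zero.1 ?_⟩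
  · rw [schouten, shuffleInsert_eq_zero_of_eq h _ _ _ hij hne,
      shuffleInsert_eq_zero_of_eq (by omega) _ _ _ hij hne, mul_zero, sub_zero]
  · change leibnizDefect (fun u => schouten l P Q (update a k u)) s t = 0
    rcases n with _ | m
    · simp only [schouten, shuffleInsert_of_eq_zero l (lt_irrefl 0), neg_one_pow_mul_eq,
        leibnizDefect_sub, leibnizDefect_smul, Pi.zero_apply]
      rw [leibnizDefect_shuffleInsert_zero (by omega) hQ]
      simp [leibnizDefect]
    rcases n' with _ | m'
    · simp only [schouten, shuffleInsert_of_eq_zero l (lt_irrefl 0), neg_one_pow_mul_eq,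
        leibnizDefect_sub, leibnizDefect_smul, Pi.zero_apply]
      rw [leibnizDefect_shuffleInsert_zero (by omega) hP]
      simp [leibnizDefect]
    -- Both operators have arguments now; the bracket is alternating, so the argument k may be moved
    -- to the first place.
    obtain ⟨L, rfl⟩ : ∃ L, l = L + 1 := ⟨m + m', by omega⟩
    have h1 : ∀ u, schouten (L + 1) P Q (update a k u) = (Perm.sign (swap 0 k) : ℤ) •
        schouten (L + 1) P Q (Fin.cons u (Fin.tail (a ∘ swap 0 k))) := by
      intro u
      have h2 : update a k u =
          (Fin.cons u (Fin.tail (a ∘ swap 0 k)) : Fin (L + 1) → A) ∘ swap 0 k := by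
        have h3 : (Fin.cons u (Fin.tail (a ∘ swap 0 k)) : Fin (L + 1) → A) =
            update (a ∘ swap 0 k) 0 u := by
          rw [← Fin.update_cons_zero (α := fun _ => A) ((a ∘ swap 0 k) 0), Fin.cons_self_tail]
        rw [h3, update_comp_equiv, symm_swap, swap_apply_left, comp_assoc, ← Perm.coe_mul,
          swap_mul_self, Perm.coe_one, comp_id]
      rw [h2, schouten, schouten, shuffleInsert_comp_perm h, shuffleInsert_comp_perm (by omega),
        smul_sub, mul_smul_comm]
    simp only [h1, leibnizDefect_zsmul]
    rw [leibnizDefect_schouten_cons (by omega) hP hQ, smul_zero]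

end Schouten

end Fedosov

end

/-! ### Alternating sums and the bracket of forms. -/

noncomputable section

namespace Fedosov

section AltSum

open Function Equiv

variable {α G H K : Type*} [AddCommGroup G] [AddCommGroup H] [AddCommGroup K] {p p' m : ℕ}

theorem altSum_add (T T' : (Fin m → α) → G) : altSum (T + T') = altSum T + altSum T' := by
  funext X
  simp only [altSum, Pi.add_apply, smul_add, Finset.sum_add_distrib]

theorem altSum_comp (φ : G →+ H) (T : (Fin m → α) → G) (X : Fin m → α) :
    altSum (fun Y => φ (T Y)) X = φ (altSum T X) := by
  simp only [altSum, map_sum, map_zsmul]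

/-- An alternating sum vanishes if its partial sum over the permutations of some of the arguments
does. -/
theorem altSum_pair_eq_zero [Module ℝ K] (f : (Fin p → α) → G) (g : (Fin p' → α) → H)
    (β : G → H → K) (hβ : ∀ Y x x', β (x + x') (g Y) = β x (g Y) + β x' (g Y))
    (i₁ : Fin p ↪ Fin m) (i₂ : Fin p' → Fin m) (h : ∀ i j, i₁ i ≠ i₂ j) (hf : altSum f = 0) :
    altSum (fun X => β (f (X ∘ i₁)) (g (X ∘ i₂))) = 0 := by
  funext X
  set T : (Fin m → α) → K := fun X => β (f (X ∘ i₁)) (g (X ∘ i₂)) with hT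
  -- Reindex by a permutation τ of the first block alone. Summing over all τ shows that p! times the
  -- alternating sum contains `altSum f` as a factor.
  have h1 : ∀ τ : Perm (Fin p), altSum T X = ∑ σ : Perm (Fin m), (Perm.sign σ : ℤ) •
      (Perm.sign τ : ℤ) • β (f (X ∘ σ ∘ i₁ ∘ τ)) (g (X ∘ σ ∘ i₂)) := by
    intro τ
    rw [altSum, ← Equiv.sum_comp (Equiv.mulRight (τ.viaFintypeEmbedding i₁))]
    refine Finset.sum_congr rfl fun σ _ => ?_
    rw [Equiv.coe_mulRight, Perm.sign_mul, Perm.viaFintypeEmbedding_sign, Units.val_mul, mul_smul,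
      hT]
    have e1 : (X ∘ ⇑(σ * τ.viaFintypeEmbedding i₁)) ∘ i₁ = X ∘ σ ∘ i₁ ∘ τ := by
      funext x
      simp [Perm.viaFintypeEmbedding_apply_image]
    have e2 : (X ∘ ⇑(σ * τ.viaFintypeEmbedding i₁)) ∘ i₂ = X ∘ σ ∘ i₂ := by
      funext x
      simp only [comp_apply, Perm.mul_apply]
      rw [Perm.viaFintypeEmbedding_apply_notMem_range]
      rintro ⟨y, hy⟩
      exact h y x hy
    simp only [e1, e2]
  have h2 : (Fintype.card (Perm (Fin p))) • altSum T X = 0 := by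
    rw [← Finset.card_univ, ← Finset.sum_const, Finset.sum_congr rfl fun τ _ => h1 τ,
      Finset.sum_comm]
    refine Finset.sum_eq_zero fun σ _ => ?_
    have h3 := altSum_comp (AddMonoidHom.mk' (fun x => β x (g (X ∘ σ ∘ i₂))) (hβ _)) f (X ∘ σ ∘ i₁)
    rw [hf, Pi.zero_apply, map_zero] at h3
    rw [← Finset.smul_sum]
    exact (congrArg ((Perm.sign σ : ℤ) • ·) h3).trans (smul_zero _)
  rw [← Nat.cast_smul_eq_nsmul ℝ, smul_eq_zero] at h2
  exact h2.resolve_left (Nat.cast_ne_zero.2 Fintype.card_ne_zero)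

/-- Here permutations are sorted by k = σ(0); the cycle that brings 0 to k has sign (−1)^k, which
produces the signs of the exterior differential. -/
theorem sum_perm_succAbove (f : Perm (Fin (m + 1)) → G) :
    ∑ σ, f σ = ∑ k : Fin (m + 1), ∑ e : Perm (Fin m),
      f (k.cycleRange.symm * Perm.decomposeFin.symm (0, e)) := by
  rw [← Fintype.sum_prod_type'
    (fun (k : Fin (m + 1)) (e : Perm (Fin m)) =>
      f (k.cycleRange.symm * Perm.decomposeFin.symm (0, e)))]
  refine (Fintype.sum_bijective
    (fun x : Fin (m + 1) × Perm (Fin m) => x.1.cycleRange.symm * Perm.decomposeFin.symm (0, x.2))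
    ?_ _ _ fun _ => rfl).symm
  rw [Fintype.bijective_iff_injective_and_card]
  refine ⟨?_, Fintype.card_congr Perm.decomposeFin.symm⟩
  rintro ⟨k, e⟩ ⟨k', e'⟩ hh
  have h0 := congrArg (fun σ : Perm (Fin (m + 1)) => σ 0) hh
  simp only [Perm.mul_apply, Perm.decomposeFin_symm_apply_zero, Fin.cycleRange_symm_zero] at h0
  subst h0
  simpa using hh

theorem altSum_cons (Ψ : α → (Fin m → α) → G) (X : Fin (m + 1) → α) :
    altSum (fun Y => Ψ (Y 0) (Fin.tail Y)) X =
      ∑ k : Fin (m + 1), (-1 : ℤ) ^ (k : ℕ) • altSum (Ψ (X k)) (k.removeNth X) := by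
  rw [altSum, sum_perm_succAbove]
  refine Finset.sum_congr rfl fun k _ => ?_
  rw [altSum, Finset.smul_sum]
  refine Finset.sum_congr rfl fun e _ => ?_
  have h1 : Perm.sign (k.cycleRange.symm * Perm.decomposeFin.symm (0, e)) =
      (-1) ^ (k : ℕ) * Perm.sign e := by
    rw [Perm.sign_mul, Perm.sign_symm, Fin.sign_cycleRange, Perm.decomposeFin.symm_sign, if_pos rfl,
      one_mul]
  have h2 : Fin.tail (X ∘ ⇑(k.cycleRange.symm * Perm.decomposeFin.symm (0, e))) =
      k.removeNth X ∘ e := by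
    funext x
    simp [Fin.tail, Fin.removeNth]
  simp only [h1, h2, Units.val_mul, mul_smul]
  simp

theorem altSum_coe {R : Type*} [CommRing R] [Module R G] [AddCommGroup α] [Module R α] [Module ℝ G]
    (w : α [⋀^Fin m]→ₗ[R] G) : altSum ⇑w = (m.factorial : ℝ) • ⇑w := by
  funext X
  have : ∀ σ : Perm (Fin m), (Perm.sign σ : ℤ) • w (X ∘ σ) = w X := by
    intro σ
    rw [w.map_perm, Units.smul_def, smul_smul, ← Units.val_mul, Int.units_mul_self, Units.val_one,
      one_smul]
  simp only [altSum, this, Finset.sum_const, Finset.card_univ, Fintype.card_perm,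
    Fintype.card_fin, Pi.smul_apply, Nat.cast_smul_eq_nsmul]

/-- The inclusion of `0` and the successors of the values of an embedding. -/
def consEmb (f : Fin p ↪ Fin m) : Fin (p + 1) ↪ Fin (m + 1) :=
  ⟨Fin.cons 0 (Fin.succ ∘ f), Fin.cons_injective_iff.2
    ⟨by rintro ⟨x, hx⟩; exact Fin.succ_ne_zero _ hx, (Fin.succ_injective _).comp f.injective⟩⟩

theorem consEmb_ne (f : Fin p ↪ Fin m) (g : Fin p' → Fin m) (h : ∀ i j, f i ≠ g j)
    (i : Fin (p + 1)) (j : Fin p') : consEmb f i ≠ Fin.succ (g j) := by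
  refine Fin.cases ?_ (fun i => ?_) i
  · exact (Fin.succ_ne_zero _).symm
  · simpa [consEmb] using h i j

end AltSum

section FormBracket

open Function Equiv

variable {C : Type*} [CommRing C] [Algebra ℝ C] {n n' q q' : ℕ}

theorem covForm_altSum (nabla : TorsionFreeConnection C) (D : VF C → SM C →ₗ[ℝ] SM C) (X : VF C)
    (T : Form C q n) : covForm nabla D X (altSum T) = altSum (covForm nabla D X T) := by
  funext Z
  rw [covForm_apply]
  simp only [altSum_update]
  rw [Finset.sum_comm, altSum, map_sum, ← Finset.sum_sub_distrib]
  refine Finset.sum_congr rfl fun σ _ => ?_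
  rw [covForm_apply, smul_sub, map_zsmul, ← Finset.smul_sum, ← Equiv.sum_comp σ]
  simp

/-- Covariant derivatives commute with permutations of the arguments, so alternating first in the
old arguments and then in the new one alternates in all of them. -/
theorem altSum_covForm (nabla : TorsionFreeConnection C) (D : VF C → SM C →ₗ[ℝ] SM C)
    (T : Form C q n) (h : ∃ w : VF C [⋀^Fin q]→ₗ[C] Op (SM C) n, ⇑w = altSum T) :
    altSum (fun X : Fin (q + 1) → VF C => covForm nabla D (X 0) T (Fin.tail X)) =
      extD D (altSum T) := by
  obtain ⟨w, hw⟩ := h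
  funext X
  rw [altSum_cons fun Z Y => covForm nabla D Z T Y, ← hw, extD_eq_sum_covForm nabla w X]
  refine Finset.sum_congr rfl fun k _ => ?_
  rw [hw, covForm_altSum, neg_one_pow_zsmul_eq]

/-- A bracket and a differential on operators that induce a bracket and a differential on forms with
values in the union of the spaces `F n N`. -/
structure IsFormDGLA (F : ∀ n : ℕ, ℕ → Submodule C (Op (SM C) n))
    (br : ∀ n n' : ℕ, Op (SM C) n → Op (SM C) n' → Op (SM C) (n + n' - 1))
    (d : ∀ n : ℕ, Op (SM C) n → Op (SM C) (n + 1)) : Prop where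
  mono : ∀ n, Monotone (F n)
  fibrewise : ∀ n N, IsFibrewise (F n N)
  add_left : ∀ {n n'} (P P' : Op (SM C) n) {Q : Op (SM C) n'}, Q ∈ multilinearOps C (SM C) n' →
    br n n' (P + P') Q = br n n' P Q + br n n' P' Q
  add_right : ∀ {n n'} {P : Op (SM C) n} (Q Q' : Op (SM C) n'), P ∈ multilinearOps C (SM C) n →
    br n n' P (Q + Q') = br n n' P Q + br n n' P Q'
  smul_left : ∀ {n n'} (c : C) (P : Op (SM C) n) {Q : Op (SM C) n'},
    Q ∈ multilinearOps C (SM C) n' → br n n' (c • P) Q = c • br n n' P Q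
  smul_right : ∀ {n n'} (c : C) {P : Op (SM C) n} (Q : Op (SM C) n'),
    P ∈ multilinearOps C (SM C) n → br n n' P (c • Q) = c • br n n' P Q
  opDer_bracket : ∀ {n n'} {P : Op (SM C) n} {Q : Op (SM C) n'}, P ∈ multilinearOps C (SM C) n →
    Q ∈ multilinearOps C (SM C) n' → ∀ δ : SM C →ₗ[ℝ] SM C,
      opDer δ (br n n' P Q) = br n n' (opDer δ P) Q + br n n' P (opDer δ Q)
  bracket_mem : ∀ n n' N N', ∃ N'', ∀ P ∈ F n N, ∀ Q ∈ F n' N', br n n' P Q ∈ F (n + n' - 1) N''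
  diff_add : ∀ {n} (P P' : Op (SM C) n), d n (P + P') = d n P + d n P'
  diff_smul : ∀ {n} (c : C) (P : Op (SM C) n), d n (c • P) = c • d n P
  opDer_diff : ∀ {n} {P : Op (SM C) n}, P ∈ multilinearOps C (SM C) n →
    ∀ {δ : SM C →ₗ[ℝ] SM C}, (∀ s t, δ (s * t) = s * δ t + t * δ s) →
      opDer δ (d n P) = d n (opDer δ P)
  diff_mem : ∀ n N, ∃ N', ∀ P ∈ F n N, d n P ∈ F (n + 1) N'

/-- The summands of the bracket of forms. -/
def bracketTerm (br : ∀ n n' : ℕ, Op (SM C) n → Op (SM C) n' → Op (SM C) (n + n' - 1))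
    (a : Form C q n) (b : Form C q' n') : Form C (q + q') (n + n' - 1) := fun X =>
  br n n' (a (X ∘ Fin.castAdd q')) (b (X ∘ Fin.natAdd q))

theorem formBracket_eq_altSum
    (br : ∀ n n' : ℕ, Op (SM C) n → Op (SM C) n' → Op (SM C) (n + n' - 1))
    (a : Form C q n) (b : Form C q' n') : formBracket br a b =
      ((-1 : ℝ) ^ ((n + 1) * q') * ((q.factorial * q'.factorial : ℕ) : ℝ)⁻¹) •
        altSum (bracketTerm br a b) := rfl

theorem update_comp_castAdd {α : Type*} (X : Fin (q + q') → α) (i : Fin q) (u : α) :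
    update X (Fin.castAdd q' i) u ∘ Fin.castAdd q' = update (X ∘ Fin.castAdd q') i u :=
  update_comp_eq_of_injective _ (Fin.castAdd_injective q q') i u

theorem update_comp_natAdd {α : Type*} (X : Fin (q + q') → α) (i : Fin q') (u : α) :
    update X (Fin.natAdd q i) u ∘ Fin.natAdd q = update (X ∘ Fin.natAdd q) i u :=
  update_comp_eq_of_injective _ (Fin.natAdd_injective q' q) i u

theorem update_castAdd_comp_natAdd {α : Type*} (X : Fin (q + q') → α) (i : Fin q) (u : α) :
    update X (Fin.castAdd q' i) u ∘ Fin.natAdd q = X ∘ Fin.natAdd q :=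
  update_comp_eq_of_notMem_range _ _ (by
    rintro ⟨j, hj⟩
    have := congrArg Fin.val hj
    simp at this; omega)

theorem update_natAdd_comp_castAdd {α : Type*} (X : Fin (q + q') → α) (i : Fin q') (u : α) :
    update X (Fin.natAdd q i) u ∘ Fin.castAdd q' = X ∘ Fin.castAdd q' :=
  update_comp_eq_of_notMem_range _ _ (by
    rintro ⟨j, hj⟩
    have := congrArg Fin.val hj
    simp at this; omega)

variable {F : ∀ n : ℕ, ℕ → Submodule C (Op (SM C) n)}
    {br : ∀ n n' : ℕ, Op (SM C) n → Op (SM C) n' → Op (SM C) (n + n' - 1)}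
    {d : ∀ n : ℕ, Op (SM C) n → Op (SM C) (n + 1)}

namespace IsFormDGLA

variable (h : IsFormDGLA F br d)
include h

theorem altSum_bracketTerm_mem {N N' N'' : ℕ}
    (hN : ∀ P ∈ F n N, ∀ Q ∈ F n' N', br n n' P Q ∈ F (n + n' - 1) N'') {a : Form C q n}
    {b : Form C q' n'} (ha : a ∈ forms (F n N) q) (hb : b ∈ forms (F n' N') q') :
    altSum (bracketTerm br a b) ∈ forms (F (n + n' - 1) N'') (q + q') := by
  obtain ⟨a1, a2, a3, a4⟩ := mem_forms.1 ha
  obtain ⟨b1, b2, b3, b4⟩ := mem_forms.1 hb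
  have ma := fun X => (h.fibrewise n N).le_multilinearOps (a4 X)
  have mb := fun X => (h.fibrewise n' N').le_multilinearOps (b4 X)
  have t1 : ∀ X i u v, bracketTerm br a b (update X i (u + v)) =
      bracketTerm br a b (update X i u) + bracketTerm br a b (update X i v) := by
    intro X i u v
    refine Fin.addCases (fun i => ?_) (fun i => ?_) i
    · simp only [bracketTerm, update_comp_castAdd, update_castAdd_comp_natAdd, a1,
        h.add_left _ _ (mb _)]
    · simp only [bracketTerm, update_comp_natAdd, update_natAdd_comp_castAdd, b1,
        h.add_right _ _ (ma _)]
  have t2 : ∀ X i (c : C) u, bracketTerm br a b (update X i (c • u)) =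
      c • bracketTerm br a b (update X i u) := by
    intro X i c u
    refine Fin.addCases (fun i => ?_) (fun i => ?_) i
    · simp only [bracketTerm, update_comp_castAdd, update_castAdd_comp_natAdd, a2,
        h.smul_left _ _ (mb _)]
    · simp only [bracketTerm, update_comp_natAdd, update_natAdd_comp_castAdd, b2,
        h.smul_right _ _ (ma _)]
  refine mem_forms.2 ⟨fun X i u v => ?_, fun X i c u => ?_,
    fun X i j hij hne => altSum_eq_zero_of_eq _ X hij hne, fun X => ?_⟩
  · simp only [altSum_update, t1, smul_add, Finset.sum_add_distrib]
  · simp only [altSum_update, t2, Finset.smul_sum]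
    exact Finset.sum_congr rfl fun σ _ => smul_comm _ _ _
  · exact sum_mem fun σ _ => zsmul_mem (hN _ (a4 _) _ (b4 _)) _

theorem formBracket_mem {a : Form C q n} {b : Form C q' n'} (ha : a ∈ formsIn (F n) (h.mono n) q)
    (hb : b ∈ formsIn (F n') (h.mono n') q') :
    formBracket br a b ∈ formsIn (F (n + n' - 1)) (h.mono _) (q + q') := by
  obtain ⟨N, ha⟩ := mem_formsIn.1 ha
  obtain ⟨N', hb⟩ := mem_formsIn.1 hb
  obtain ⟨N'', hN⟩ := h.bracket_mem n n' N N'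
  exact mem_formsIn.2 ⟨N'', Submodule.smul_mem _ _ (h.altSum_bracketTerm_mem hN ha hb)⟩

theorem covForm_bracketTerm (nabla : TorsionFreeConnection C) (D : VF C → SM C →ₗ[ℝ] SM C)
    (Z : VF C) {a : Form C q n} {b : Form C q' n'}
    (ma : ∀ X, a X ∈ multilinearOps C (SM C) n) (mb : ∀ X, b X ∈ multilinearOps C (SM C) n') :
    covForm nabla D Z (bracketTerm br a b) =
      bracketTerm br (covForm nabla D Z a) b + bracketTerm br a (covForm nabla D Z b) := by
  funext X
  have hl : ∀ (P P' : Op (SM C) n) Y, br n n' (P - P') (b Y) =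
      br n n' P (b Y) - br n n' P' (b Y) := fun P P' Y =>
    map_sub (AddMonoidHom.mk' (fun P => br n n' P (b Y)) fun P P' => h.add_left P P' (mb Y)) P P'
  have hls : ∀ (f : Fin q → Op (SM C) n) Y, br n n' (∑ i, f i) (b Y) = ∑ i, br n n' (f i) (b Y) :=
    fun f Y => map_sum
      (AddMonoidHom.mk' (fun P => br n n' P (b Y)) fun P P' => h.add_left P P' (mb Y)) f _
  have hr : ∀ (P P' : Op (SM C) n') Y, br n n' (a Y) (P - P') =
      br n n' (a Y) P - br n n' (a Y) P' := fun P P' Y =>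
    map_sub (AddMonoidHom.mk' (fun P => br n n' (a Y) P) fun P P' => h.add_right P P' (ma Y)) P P'
  have hrs : ∀ (f : Fin q' → Op (SM C) n') Y,
      br n n' (a Y) (∑ i, f i) = ∑ i, br n n' (a Y) (f i) :=
    fun f Y => map_sum
      (AddMonoidHom.mk' (fun P => br n n' (a Y) P) fun P P' => h.add_right P P' (ma Y)) f _
  rw [Pi.add_apply, covForm_apply, Fin.sum_univ_add]
  simp only [bracketTerm, update_comp_castAdd, update_castAdd_comp_natAdd, update_comp_natAdd,
    update_natAdd_comp_castAdd, covForm_apply, hl, hls, hr, hrs, h.opDer_bracket (ma _) (mb _),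
    comp_apply]
  abel

/-- The differential is the alternation of ∇a · b + a · ∇b. The partial alternation of ∇a alone is
q! Da = 0, and likewise for b, so `altSum_pair_eq_zero` kills both summands. A signed Leibniz rule
for D is not needed, since only closed forms matter. -/
theorem extD_altSum_bracketTerm (nabla : TorsionFreeConnection C) {D : VF C → SM C →ₗ[ℝ] SM C}
    {N N' : ℕ} {a : Form C q n} {b : Form C q' n'} (ha : a ∈ forms (F n N) q)
    (hb : b ∈ forms (F n' N') q') (hDa : extD D a = 0) (hDb : extD D b = 0) :
    extD D (altSum (bracketTerm br a b)) = 0 := by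
  obtain ⟨N'', hN⟩ := h.bracket_mem n n' N N'
  have ma := fun X => (h.fibrewise n N).le_multilinearOps ((exists_forms ha).2 X)
  have mb := fun X => (h.fibrewise n' N').le_multilinearOps ((exists_forms hb).2 X)
  rw [← altSum_covForm nabla D _ (exists_forms (h.altSum_bracketTerm_mem hN ha hb)).1]
  have hne : ∀ (i : Fin q) (j : Fin q'), Fin.castAdd q' i ≠ Fin.natAdd q j := by
    intro i j h'
    have := congrArg Fin.val h'
    simp at this; omega
  have z : ∀ {q n : ℕ} {F : Submodule C (Op (SM C) n)} {a : Form C q n}, a ∈ forms F q →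
      extD D a = 0 →
      altSum (fun X : Fin (q + 1) → VF C => covForm nabla D (X 0) a (Fin.tail X)) = 0 := by
    intro q n F a ha hDa
    obtain ⟨w, rfl⟩ := (exists_forms ha).1
    rw [altSum_covForm, altSum_coe, map_smul, hDa, smul_zero]
    exact ⟨(q.factorial : C) • w, by
      rw [altSum_coe]; funext X; simp [Nat.cast_smul_eq_nsmul]⟩
  simp only [h.covForm_bracketTerm nabla D _ ma mb, Pi.add_apply]
  refine (altSum_add _ _).trans ?_
  have e1 := altSum_pair_eq_zero (fun X => covForm nabla D (X 0) a (Fin.tail X)) b (br n n')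
    (fun Y x x' => h.add_left x x' (mb Y)) (consEmb (Fin.castAddEmb q'))
    (fun j => (Fin.natAdd q j).succ) (consEmb_ne (Fin.castAddEmb q') _ hne) (z ha hDa)
  have e2 := altSum_pair_eq_zero (fun X => covForm nabla D (X 0) b (Fin.tail X)) a
    (fun x y => br n n' y x)
    (fun Y x x' => h.add_right x x' (ma Y)) (consEmb (Fin.natAddEmb q))
    (fun j => (Fin.castAdd q' j).succ)
    (consEmb_ne (Fin.natAddEmb q) _ fun i j => (hne j i).symm) (z hb hDb)
  exact (congrArg₂ (· + ·) e1 e2).trans (add_zero 0)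

theorem extD_formBracket (nabla : TorsionFreeConnection C) {D : VF C → SM C →ₗ[ℝ] SM C}
    {a : Form C q n} {b : Form C q' n'} (ha : a ∈ formsIn (F n) (h.mono n) q)
    (hb : b ∈ formsIn (F n') (h.mono n') q') (hDa : extD D a = 0) (hDb : extD D b = 0) :
    extD D (formBracket br a b) = 0 := by
  obtain ⟨N, ha⟩ := mem_formsIn.1 ha
  obtain ⟨N', hb⟩ := mem_formsIn.1 hb
  rw [formBracket_eq_altSum, map_smul, h.extD_altSum_bracketTerm nabla ha hb hDa hDb, smul_zero]

theorem diff_rsmul (c : ℝ) (P : Op (SM C) n) : d n (c • P) = c • d n P := by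
  rw [← algebraMap_smul C c P, h.diff_smul, algebraMap_smul]

/-- The differential of operators as a linear map. -/
def diffHom (n : ℕ) : Op (SM C) n →ₗ[ℝ] Op (SM C) (n + 1) where
  toFun := d n
  map_add' := h.diff_add
  map_smul' := h.diff_rsmul

theorem formDiff_mem {a : Form C q n} (ha : a ∈ formsIn (F n) (h.mono n) q) :
    formDiff d a ∈ formsIn (F (n + 1)) (h.mono _) q := by
  obtain ⟨N, ha⟩ := mem_formsIn.1 ha
  obtain ⟨N', hN⟩ := h.diff_mem n N
  obtain ⟨a1, a2, a3, a4⟩ := mem_forms.1 ha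
  have : (fun X => d n (a X)) ∈ forms (F (n + 1) N') q := by
    refine mem_forms.2 ⟨fun X i u v => ?_, fun X i c u => ?_, fun X i j hij hne => ?_,
      fun X => hN _ (a4 X)⟩
    · rw [a1, h.diff_add]
    · rw [a2, h.diff_smul]
    · rw [a3 X i j hij hne]; exact map_zero (h.diffHom n)
  exact mem_formsIn.2 ⟨N', Submodule.smul_mem _ _ this⟩

theorem extD_formDiff {D : VF C → SM C →ₗ[ℝ] SM C} (hD : IsConn D) {a : Form C q n}
    (ha : a ∈ formsIn (F n) (h.mono n) q) (hDa : extD D a = 0) : extD D (formDiff d a) = 0 := by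
  obtain ⟨N, ha⟩ := mem_formsIn.1 ha
  have ma := fun X => (h.fibrewise n N).le_multilinearOps ((exists_forms ha).2 X)
  have e : formDiff d a = (-1 : ℝ) ^ q • fun X => h.diffHom n (a X) := rfl
  have e2 : extD D (fun X => h.diffHom n (a X)) = fun X => h.diffHom n (extD D a X) := by
    funext X
    simp only [extD_apply, map_add, map_sum, map_smul, apply_ite (h.diffHom n), map_zero]
    refine congrArg (· + _) (Finset.sum_congr rfl fun i _ => ?_)
    exact congrArg _ (h.opDer_diff (ma _) (hD.map_mul _))
  rw [e, map_smul, e2, hDa]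
  funext X
  simp

end IsFormDGLA

end FormBracket

end Fedosov

end

/-! ### The two differential graded Lie algebras of forms. -/

noncomputable section

namespace Fedosov

section Instances

open Function

theorem multilinearOps_real {R A : Type*} [CommRing R] [CommRing A] [Algebra R A] [Algebra ℝ A]
    [Algebra ℝ R] [IsScalarTower ℝ R A] {n : ℕ} {P : Op A n} (hP : P ∈ multilinearOps R A n) :
    P ∈ multilinearOps ℝ A n := by
  obtain ⟨h1, h2⟩ := mem_multilinearOps.1 hP
  refine mem_multilinearOps.2 ⟨h1, fun a i c u => ?_⟩
  rw [← algebraMap_smul R c u, h2, algebraMap_smul]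

universe u

variable (C : Type u) [CommRing C] [Algebra ℝ C]

theorem isFormDGLA_schouten : IsFormDGLA (C := C) (fun n _ => polyVect C (SM C) n)
    (fun n n' => schouten (n + n' - 1)) (fun _ _ => 0) where
  mono _ := monotone_const
  fibrewise n _ := isFibrewise_polyVect
  add_left {n n'} P P' Q hQ := by
    obtain ⟨e, he⟩ := exists_schoutenData.{u} n n'
    simp only [← he, e.op_add_left (multilinearOps_real hQ)]
  add_right {n n'} P Q Q' hP := by
    obtain ⟨e, he⟩ := exists_schoutenData.{u} n n'
    simp only [← he, e.op_add_right (multilinearOps_real hP)]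
  smul_left {n n'} c P Q hQ := by
    obtain ⟨e, he⟩ := exists_schoutenData.{u} n n'
    simp only [← he, e.op_smul_left hQ]
  smul_right {n n'} c P Q hP := by
    obtain ⟨e, he⟩ := exists_schoutenData.{u} n n'
    simp only [← he, e.op_smul_right hP]
  opDer_bracket {n n'} P Q hP hQ δ := by
    obtain ⟨e, he⟩ := exists_schoutenData.{u} n n'
    simp only [← he, e.opDer_op (multilinearOps_real hP) (multilinearOps_real hQ)]
  bracket_mem n n' _ _ := by
    refine ⟨0, fun P hP Q hQ => ?_⟩
    by_cases h : n + n' = 0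
    · obtain ⟨rfl, rfl⟩ : n = 0 ∧ n' = 0 := by omega
      have : schouten (0 + 0 - 1) P Q = 0 := by
        funext a
        simp [schouten, shuffleInsert]
      rw [this]
      exact zero_mem _
    · exact schouten_mem_polyVect (by omega) hP hQ
  diff_add _ _ := (add_zero 0).symm
  diff_smul _ _ := (smul_zero _).symm
  opDer_diff _ _ _ := map_zero _
  diff_mem _ _ := ⟨0, fun _ _ => zero_mem _⟩

theorem hochschild_eq {A : Type*} [CommRing A] [Algebra ℝ A] {n : ℕ} (P : Op A n) :
    hochschild P = (gerstenhaberData (show n + 1 + 1 = 2 + n by omega)).op (mulOp A) P :=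
  (gerstenhaberData_op _ _ _).symm

theorem isFormDGLA_gerstenhaber : IsFormDGLA (C := C) (polyDiffLE C (SM C))
    (fun n n' => gerstenhaber (n + n' - 1)) (fun _ => hochschild) where
  mono n := polyDiffLE_mono C (SM C) n
  fibrewise n N := isFibrewise_polyDiffLE N
  add_left {n n'} P P' Q hQ := by
    obtain ⟨e, he⟩ := exists_gerstenhaberData.{u} n n'
    simp only [← he, e.op_add_left (multilinearOps_real hQ)]
  add_right {n n'} P Q Q' hP := by
    obtain ⟨e, he⟩ := exists_gerstenhaberData.{u} n n'
    simp only [← he, e.op_add_right (multilinearOps_real hP)]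
  smul_left {n n'} c P Q hQ := by
    obtain ⟨e, he⟩ := exists_gerstenhaberData.{u} n n'
    simp only [← he, e.op_smul_left hQ]
  smul_right {n n'} c P Q hP := by
    obtain ⟨e, he⟩ := exists_gerstenhaberData.{u} n n'
    simp only [← he, e.op_smul_right hP]
  opDer_bracket {n n'} P Q hP hQ δ := by
    obtain ⟨e, he⟩ := exists_gerstenhaberData.{u} n n'
    simp only [← he, e.opDer_op (multilinearOps_real hP) (multilinearOps_real hQ)]
  bracket_mem n n' N N' := by
    obtain ⟨e, he⟩ := exists_gerstenhaberData.{u} n n'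
    refine ⟨N + N' + 1, fun P hP Q hQ => ?_⟩
    rw [← he]
    exact e.op_mem_polyDiffLE hP hQ
  diff_add P P' := by
    simp only [hochschild_eq, BracketData.op_add_right _ (mulOp_mem_polyDiffLE ℝ (SM C)).1]
  diff_smul c P := by
    simp only [hochschild_eq, BracketData.op_smul_right _ (mulOp_mem_polyDiffLE C (SM C)).1]
  opDer_diff {n P} hP δ hδ := by
    rw [hochschild_eq, hochschild_eq, BracketData.opDer_op _ (mulOp_mem_polyDiffLE ℝ (SM C)).1
      (multilinearOps_real hP), opDer_mulOp hδ]
    have := BracketData.op_smul_left (gerstenhaberData (show n + 1 + 1 = 2 + n by omega))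
      hP (0 : C) (mulOp (SM C))
    rw [zero_smul, zero_smul] at this
    rw [this, zero_add]
  diff_mem n N := ⟨0 + N + 1, fun P hP => by
    rw [hochschild_eq]
    exact BracketData.op_mem_polyDiffLE _ (mulOp_mem_polyDiffLE C (SM C)) hP⟩

end Instances

end Fedosov

end

/-! ### Flat lifts; injectivity of μ. -/

noncomputable section

namespace Fedosov

section Tau

open Function

variable {C : Type*} [CommRing C] [Algebra ℝ C] {ι : Type*} [Fintype ι] {n : ℕ}
  {D : VF C → SM C →ₗ[ℝ] SM C}

/-! ### The flat lift of functions -/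

theorem atZero_algebraMap (c : C) : atZero (algebraMap C (SM C) c) = c :=
  (atZeroHom C).commutes c

theorem atZero_mul (a b : SM C) : atZero (a * b) = atZero a * atZero b := map_mul (atZeroHom C) a b

theorem atZero_add (a b : SM C) : atZero (a + b) = atZero a + atZero b := map_add (atZeroHom C) a b

theorem atZero_sub (a b : SM C) : atZero (a - b) = atZero a - atZero b := map_sub (atZeroHom C) a b

theorem atZero_smul (c : C) (a : SM C) : atZero (c • a) = c * atZero a := map_smul (atZeroHom C) c a

/-- The flat lift as a homomorphism of algebras. -/
def tauHom (hD : IsConn D) (hfl : HasFlatLifts D) : C →ₐ[ℝ] SM C where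
  toFun := tau D
  map_one' := ((hfl 1).2.2 1 (fun X => by
    rw [← map_one (algebraMap C (SM C)), hD.map_algebraMap]; simp) (map_one (atZeroHom C))).symm
  map_mul' f g := ((hfl (f * g)).2.2 _ (fun X => by
    rw [hD.map_mul, (hfl f).1, (hfl g).1, mul_zero, mul_zero, add_zero])
    (by rw [atZero_mul, (hfl f).2.1, (hfl g).2.1])).symm
  map_zero' := ((hfl 0).2.2 0 (fun X => map_zero _) (map_zero (atZeroHom C))).symm
  map_add' f g := ((hfl (f + g)).2.2 _ (fun X => by
    rw [map_add, (hfl f).1, (hfl g).1, add_zero])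
    (by rw [atZero_add, (hfl f).2.1, (hfl g).2.1])).symm
  commutes' r := ((hfl (algebraMap ℝ C r)).2.2 _ (fun X => by
    rw [IsScalarTower.algebraMap_apply ℝ C (SM C), hD.map_algebraMap]; simp)
    (by rw [IsScalarTower.algebraMap_apply ℝ C (SM C), atZero_algebraMap])).symm

variable (hD : IsConn D) (hfl : HasFlatLifts D)

theorem tauHom_apply (f : C) : tauHom hD hfl f = tau D f := rfl

theorem mu_apply (P : Op (SM C) n) (f : Fin n → C) :
    mu D P f = atZero (P (tauHom hD hfl ∘ f)) := rfl

/-- A closed operator maps flat lifts to flat lifts. -/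
theorem closed_apply_tau {P : Op (SM C) n} (hm : P ∈ multilinearOps C (SM C) n)
    (hP : ∀ Z, opDer (D Z) P = 0) (f : Fin n → C) :
    P (tauHom hD hfl ∘ f) = tauHom hD hfl (mu D P f) := by
  refine (hfl (mu D P f)).2.2 _ (fun X => ?_) rfl
  have := congrFun (hP X) (tauHom hD hfl ∘ f)
  rw [opDer_apply, Pi.zero_apply] at this
  rw [sub_eq_zero.1 this]
  refine Finset.sum_eq_zero fun i _ => ?_
  rw [comp_apply, tauHom_apply, (hfl (f i)).1, update_zero_of_mem hm]

include hD hfl in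
-- As τf − f has order 1, so does (D_X + ∂_X)(τf − f); since D_X τf = 0 and D_X f = X f, its value
-- at y = 0 is the claim.
theorem atZero_vertDer_tau (X : VF C) (f : C) : atZero (vertDer X (tau D f)) = X f := by
  have h1 : tau D f - algebraMap C (SM C) f ∈ Fil C 1 := by
    rw [mem_Fil_one, atZero_sub, (hfl f).2.1, atZero_algebraMap, sub_self]
  have h2 := mem_Fil_one.1 (hD.add_vertDer_mem X h1)
  rw [map_sub, map_sub, (hfl f).1, hD.map_algebraMap, vertDer_algebraMap, sub_zero, zero_sub,
    atZero_add, ← atZeroHom_apply, map_neg, atZeroHom_apply, atZero_algebraMap] at h2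
  rwa [neg_add_eq_zero, eq_comm] at h2

/-- The span of the flat lifts. -/
def tauSpan : Submodule C (SM C) := Submodule.span C (Set.range (tauHom hD hfl))

theorem tau_mem_tauSpan (f : C) : tauHom hD hfl f ∈ tauSpan hD hfl :=
  Submodule.subset_span ⟨f, rfl⟩

theorem algebraMap_mem_tauSpan (c : C) : algebraMap C (SM C) c ∈ tauSpan hD hfl := by
  rw [Algebra.algebraMap_eq_smul_one, ← map_one (tauHom hD hfl)]
  exact Submodule.smul_mem _ _ (tau_mem_tauSpan hD hfl 1)

theorem mul_mem_tauSpan {a b : SM C} (ha : a ∈ tauSpan hD hfl) (hb : b ∈ tauSpan hD hfl) :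
    a * b ∈ tauSpan hD hfl := by
  have := Submodule.mul_mem_mul ha hb
  rw [tauSpan, Submodule.span_mul_span] at this
  refine Submodule.span_mono ?_ this
  rintro _ ⟨_, ⟨f, rfl⟩, _, ⟨g, rfl⟩, rfl⟩
  exact ⟨f * g, map_mul _ _ _⟩

/-- τxⁱ = xⁱ + yⁱ + O(y²), so the fibre coordinates are flat lifts up to constants and higher order.
This is the source of density. -/
theorem Frame.tau_x_sub_mem (fr : Frame C ι) (i : ι) :
    tauHom hD hfl (fr.x i) - algebraMap C (SM C) (fr.x i) - fr.y i ∈ Fil C 2 := by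
  intro p hp Y
  have h1 : atZero (tauHom hD hfl (fr.x i)) = fr.x i := (hfl _).2.1
  obtain rfl | rfl : p = 0 ∨ p = 1 := by omega
  · rw [comp_zero_eq, atZero_sub, atZero_sub, h1, atZero_algebraMap, mem_Fil_one.1 (fr.y_mem i)]
    simp
  · have h2 := atZero_vertDer_tau hD hfl Y (fr.x i)
    rw [← comp_zero_eq _ 0, comp_vertDer, dirComp_one] at h2
    rw [comp_sub, comp_sub, tauHom_apply, h2, comp_algebraMap, if_neg one_ne_zero, Frame.y,
      comp_linSec, if_pos rfl]
    simp

/-- Write s = ∑ yⁱ sᵢ, approximate each sᵢ by induction, and replace yⁱ by τxⁱ − xⁱ; the span is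
closed under products because τ is multiplicative. -/
theorem Frame.exists_tauSpan_sub_mem (fr : Frame C ι) : ∀ (r : ℕ) {s : SM C}, s ∈ Fil C r →
    ∃ t ∈ tauSpan hD hfl, s - t ∈ Fil C (r + 1) := by
  intro r
  induction r with
  | zero =>
    intro s _
    refine ⟨_, algebraMap_mem_tauSpan hD hfl (atZero s), ?_⟩
    rw [zero_add, mem_Fil_one, atZero_sub, atZero_algebraMap, sub_self]
  | succ r ih =>
    intro s hs
    choose t ht hst using fun i => ih (fr.quot_mem i hs)
    set η : ι → SM C := fun i => tauHom hD hfl (fr.x i) - algebraMap C (SM C) (fr.x i) with hη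
    refine ⟨∑ i, η i * t i, sum_mem fun i _ => mul_mem_tauSpan hD hfl
      (sub_mem (tau_mem_tauSpan hD hfl _) (algebraMap_mem_tauSpan hD hfl _)) (ht i), ?_⟩
    have e : s - ∑ i, η i * t i =
        ∑ i, (fr.y i * (fr.quot i s - t i) - (η i - fr.y i) * t i) := by
      conv_lhs => rw [fr.eq_sum_of_mem hs]
      rw [← Finset.sum_sub_distrib]
      exact Finset.sum_congr rfl fun i _ => by ring
    rw [e]
    refine sum_mem fun i _ => sub_mem ?_ ?_
    · rw [add_comm]
      exact Fil_mul (fr.y_mem i) (hst i)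
    · have h1 : t i ∈ Fil C r := by
        have := sub_mem (fr.quot_mem i hs) (Fil_antitone (Nat.le_succ r) (hst i))
        rwa [sub_sub_cancel] at this
      rw [show r + 1 + 1 = 2 + r by omega]
      exact Fil_mul (fr.tau_x_sub_mem hD hfl i) h1

theorem Frame.tauSpan_dense (fr : Frame C ι) (s : SM C) (r : ℕ) :
    ∃ t ∈ tauSpan hD hfl, s - t ∈ Fil C r := by
  induction r with
  | zero => exact ⟨0, zero_mem _, mem_Fil_zero _⟩
  | succ r ih =>
    obtain ⟨t, ht, hst⟩ := ih
    obtain ⟨u, hu, h⟩ := fr.exists_tauSpan_sub_mem hD hfl r hst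
    exact ⟨t + u, add_mem ht hu, by rwa [← sub_sub]⟩

/-- An operator of order < N lowers the order of vanishing by at most N. Pulling out yᵏ leaves yᵏ
P(…), handled by induction on r, and a commutator, handled by induction on N. -/
theorem Frame.orderLT_continuous (fr : Frame C ι) {i : Fin n} {N : ℕ} :
    ∀ {P : Op (SM C) n}, P ∈ multilinearOps C (SM C) n → OrderLT i N P →
      ∀ {r : ℕ} {s : SM C} (a : Fin n → SM C), s ∈ Fil C (r + N) → P (update a i s) ∈ Fil C r := by
  induction N with
  | zero =>
    intro P _ hP r s a _
    simp only [OrderLT] at hP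
    subst hP
    exact zero_mem _
  | succ N ihN =>
    intro P hm hP r
    induction r with
    | zero => intro s a _; exact mem_Fil_zero _
    | succ r ihr =>
      intro s a hs
      have hs' : s ∈ Fil C ((r + 1 + N) + 1) := hs
      rw [fr.eq_sum_of_mem hs', update_sum_of_mem hm]
      refine sum_mem fun k _ => ?_
      have e : P (update a i (fr.y k * fr.quot k s)) =
          adAt i (fr.y k) P (update a i (fr.quot k s)) +
            fr.y k * P (update a i (fr.quot k s)) := by
        simp [adAt]
      rw [e]
      refine add_mem (ihN (adAt_mem_multilinearOps _ _ hm) (hP _) a (fr.quot_mem k hs')) ?_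
      rw [add_comm r 1]
      refine Fil_mul (fr.y_mem k) (ihr a ?_)
      have := fr.quot_mem k hs'
      rwa [show r + 1 + N = r + (N + 1) by omega] at this

include hD hfl in
/-- A fibrewise differential operator that vanishes at `y = 0` on flat lifts vanishes at `y = 0`. -/
theorem Frame.mem_gr_one_of_mu_eq_zero (fr : Frame C ι) {N : ℕ} {P : Op (SM C) n}
    (hP : P ∈ polyDiffLE C (SM C) n N) (h : mu D P = 0) : P ∈ gr C n 1 := by
  have hm := mem_multilinearOps.1 hP.1
  -- The arguments outside S are flat lifts. They are freed one at a time: first within the C-span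
  -- by linearity, then everywhere by density and continuity.
  have key : ∀ (S : Finset (Fin n)) (a : Fin n → SM C),
      (∀ i ∉ S, a i ∈ Set.range (tauHom hD hfl)) → P a ∈ Fil C 1 := by
    intro S
    induction S using Finset.induction_on with
    | empty =>
      intro a ha
      choose f hf using fun i => ha i (Finset.notMem_empty i)
      have : a = tauHom hD hfl ∘ f := funext fun i => (hf i).symm
      rw [this, mem_Fil_one]
      exact congrFun h f
    | insert i S _ ih =>
      intro a ha
      have h1 : ∀ t ∈ tauSpan hD hfl, P (update a i t) ∈ Fil C 1 := by
        intro t ht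
        induction ht using Submodule.span_induction with
        | mem t ht =>
          refine ih _ fun j hj => ?_
          by_cases hji : j = i
          · subst hji; simpa using ht
          · rw [update_of_ne hji]
            exact ha j (by simp [hj, hji])
        | zero => rw [update_zero_of_mem hP.1]; exact zero_mem _
        | add u v _ _ hu hv => rw [hm.1]; exact add_mem hu hv
        | smul c u _ hu => rw [hm.2]; exact Fil_csmul c hu
      -- P has order < N + 1, so an error of order N + 2 in the argument becomes an error of order 1
      -- in the value.
      obtain ⟨t, ht, hst⟩ := fr.tauSpan_dense hD hfl (a i) (1 + (N + 1))
      have e : P a = P (update a i t) + P (update a i (a i - t)) := by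
        rw [← hm.1, add_sub_cancel, update_eq_self]
      rw [e]
      exact add_mem (h1 t ht) (fr.orderLT_continuous hP.1 (hP.2 i) a hst)
  exact fun s => key Finset.univ s fun i hi => absurd (Finset.mem_univ i) hi

include hD hfl in
theorem Frame.eq_zero_of_mu_eq_zero (fr : Frame C ι) {N : ℕ} {P : Op (SM C) n}
    (hP : P ∈ polyDiffLE C (SM C) n N) (hcl : ∀ Z, opDer (D Z) P = 0) (h : mu D P = 0) : P = 0 :=
  fr.eq_zero_of_closed hD (fr.mem_gr_one_of_mu_eq_zero hD hfl hP h) hcl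

theorem tau_comp_update (f : Fin n → C) (i : Fin n) (u : C) :
    tauHom hD hfl ∘ update f i u = update (tauHom hD hfl ∘ f) i (tauHom hD hfl u) :=
  comp_update _ _ _ _

include hD hfl in
theorem mu_mem_multilinearOps {P : Op (SM C) n} (hP : P ∈ multilinearOps C (SM C) n) :
    mu D P ∈ multilinearOps ℝ C n := by
  have h1 := mem_multilinearOps.1 hP
  have h2 := mem_multilinearOps.1 (multilinearOps_real hP)
  refine mem_multilinearOps.2 ⟨fun a i u v => ?_, fun a i c u => ?_⟩ <;>
    simp only [mu_apply hD hfl, tau_comp_update, map_add, map_smul]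
  · rw [h1.1, atZero_add]
  · rw [h2.2, ← atZeroHom_apply, ← algebraMap_smul C c, map_smul, algebraMap_smul]; rfl

theorem adAt_mu (P : Op (SM C) n) (i : Fin n) (g : C) :
    adAt i g (mu D P) = mu D (adAt i (tauHom hD hfl g) P) := by
  funext f
  simp only [adAt, mu_apply hD hfl, tau_comp_update, map_mul, atZero_sub, atZero_mul, comp_apply]
  congr 2
  exact (hfl g).2.1.symm

include hD hfl in
theorem OrderLT.mu_mem {i : Fin n} {N : ℕ} : ∀ {P : Op (SM C) n}, OrderLT i N P →
    OrderLT i N (mu D P) := by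
  induction N with
  | zero =>
    intro P hP
    simp only [OrderLT] at *
    subst hP
    funext f
    exact map_zero (atZeroHom C)
  | succ N ih => intro P hP g; rw [adAt_mu hD hfl]; exact ih (hP _)

include hD hfl in
theorem mu_mem_polyDiffLE {N : ℕ} {P : Op (SM C) n} (hP : P ∈ polyDiffLE C (SM C) n N) :
    mu D P ∈ polyDiffLE ℝ C n N :=
  ⟨mu_mem_multilinearOps hD hfl hP.1, fun i => OrderLT.mu_mem hD hfl (hP.2 i)⟩

include hD hfl in
theorem mu_mem_polyVect {P : Op (SM C) n} (hP : P ∈ polyVect C (SM C) n) :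
    mu D P ∈ polyVect ℝ C n := by
  obtain ⟨h1, h2, h3⟩ := mem_polyVect.1 hP
  refine mem_polyVect.2 ⟨mu_mem_multilinearOps hD hfl h1, fun a i j hij hne => ?_,
    fun i a s t => ?_⟩
  · rw [mu_apply hD hfl, h2 _ i j (congrArg (tauHom hD hfl) hij) hne]
    exact map_zero (atZeroHom C)
  · simp only [mu_apply hD hfl, tau_comp_update, map_mul, h3, atZero_add, atZero_mul]
    simp only [tauHom_apply, (hfl _).2.1]

theorem mu_congr {P Q : Op (SM C) n} (h : ∀ s, atZero (P s) = atZero (Q s)) : mu D P = mu D Q :=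
  funext fun _ => h _

theorem mu_add (P Q : Op (SM C) n) : mu D (P + Q) = mu D P + mu D Q :=
  funext fun _ => atZero_add _ _

theorem mu_smul (c : C) (P : Op (SM C) n) : mu D (c • P) = c • mu D P :=
  funext fun _ => atZero_smul _ _

theorem mu_rsmul (c : ℝ) (P : Op (SM C) n) : mu D (c • P) = c • mu D P := by
  rw [← algebraMap_smul C c, mu_smul, algebraMap_smul]

include hD hfl in
-- Closed operators satisfy P ∘ τ = τ ∘ μP, and combinations of insertions inherit this; evaluation
-- at y = 0 then undoes τ.
theorem mu_bracket {n' l : ℕ} (e : BracketData n n' l) {P : Op (SM C) n} {Q : Op (SM C) n'}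
    (hm : P ∈ multilinearOps C (SM C) n) (hP : ∀ Z, opDer (D Z) P = 0)
    (hm' : Q ∈ multilinearOps C (SM C) n') (hQ : ∀ Z, opDer (D Z) Q = 0) :
    mu D (e.op P Q) = e.op (mu D P) (mu D Q) := by
  funext f
  rw [mu_apply hD hfl, ← (hfl (e.op (mu D P) (mu D Q) f)).2.1]
  exact congrArg atZero (e.map_op (tauHom hD hfl).toLinearMap (closed_apply_tau hD hfl hm hP)
    (closed_apply_tau hD hfl hm' hQ) f)

include hD hfl in
theorem mu_hochschild {P : Op (SM C) n} (hm : P ∈ multilinearOps C (SM C) n)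
    (hP : ∀ Z, opDer (D Z) P = 0) : mu D (hochschild P) = hochschild (mu D P) := by
  have h : mu D (mulOp (SM C)) = mulOp C := by
    funext f
    simp only [mu, mulOp, atZero_mul, (hfl _).2.1]
  rw [hochschild_eq, mu_bracket hD hfl _ (mulOp_mem_polyDiffLE C (SM C)).1
    (fun Z => opDer_mulOp (hD.map_mul Z)) hm hP, h, hochschild_eq]

end Tau

end Fedosov

end

/-! ### Surjectivity of μ. -/

noncomputable section

namespace Fedosov

section ProdOp

open Function

variable {A : Type*} [CommRing A] {n : ℕ}

/-- `∏ B_k (a_k)`. -/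
def prodOp (B : Fin n → A → A) : Op A n := fun a => ∏ k, B k (a k)

theorem prodOp_update (B : Fin n → A → A) (a : Fin n → A) (i : Fin n) (u : A) :
    prodOp B (update a i u) = B i u * ∏ k ∈ Finset.univ.erase i, B k (a k) := by
  rw [prodOp, ← Finset.mul_prod_erase _ _ (Finset.mem_univ i), update_self]
  congr 1
  refine Finset.prod_congr rfl fun k hk => ?_
  rw [update_of_ne (Finset.ne_of_mem_erase hk)]

theorem prodOp_mem_multilinearOps {R : Type*} [CommRing R] [Algebra R A] (B : Fin n → A →ₗ[R] A) :
    prodOp (fun k => ⇑(B k)) ∈ multilinearOps R A n := by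
  refine mem_multilinearOps.2 ⟨fun a i u v => ?_, fun a i c u => ?_⟩
  · simp only [prodOp_update, map_add, add_mul]
  · simp only [prodOp_update, map_smul, smul_mul_assoc]

end ProdOp

section SurjectiveT

open Function

variable {C : Type*} [CommRing C] [Algebra ℝ C] {ι : Type*} [Fintype ι] {n : ℕ}
  {D : VF C → SM C →ₗ[ℝ] SM C}

theorem Frame.sum_apply_eq (fr : Frame C ι) (X : VF C) (g : C) :
    ∑ i, X (fr.x i) * fr.e i g = X g := by
  have h := congrArg (fun Y : VF C => Y g) (fr.sum_eq X)
  rw [← h]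
  change _ = Derivation.coeFnAddMonoidHom (∑ i, X (fr.x i) • fr.e i) g
  rw [map_sum, Finset.sum_apply]
  rfl

/-- A derivation in one argument of an operator as a vector field. -/
def argDer (Q : Op C n) (i : Fin n) (a : Fin n → C)
    (h : (∀ u v, Q (update a i (u + v)) = Q (update a i u) + Q (update a i v)) ∧
      (∀ (c : ℝ) u, Q (update a i (c • u)) = c • Q (update a i u)) ∧
      ∀ s t, Q (update a i (s * t)) = s * Q (update a i t) + t * Q (update a i s)) : VF C :=
  Derivation.mk' { toFun := fun u => Q (update a i u), map_add' := h.1, map_smul' := h.2.1 }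
    fun s t => by simp [h.2.2]

/-- With all but the first argument frozen, Q is a vector field and can be expanded in the frame;
the other arguments follow by induction. -/
theorem Frame.multiderivation_eq_sum (fr : Frame C ι) : ∀ {n : ℕ} {Q : Op C n},
    Q ∈ multilinearOps ℝ C n →
    (∀ (i : Fin n) (a : Fin n → C) (s t : C),
      Q (update a i (s * t)) = s * Q (update a i t) + t * Q (update a i s)) → ∀ f,
    Q f = ∑ j : Fin n → ι, (∏ k, fr.e (j k) (f k)) * Q (fr.x ∘ j) := by
  intro n
  induction n with
  | zero =>
    intro Q _ _ f
    rw [Fintype.sum_unique]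
    simp
    exact congrArg Q (Subsingleton.elim _ _)
  | succ n ih =>
    intro Q hm hd f
    have hm' := mem_multilinearOps.1 hm
    have h1 : Q f = ∑ i, fr.e i (f 0) * Q (Fin.cons (fr.x i) (Fin.tail f)) := by
      let X : VF C := argDer Q 0 f ⟨hm'.1 f 0, hm'.2 f 0, hd 0 f⟩
      have h2 : ∀ u, X u = Q (Fin.cons u (Fin.tail f)) := fun u => by
        have : (Fin.cons u (Fin.tail f) : Fin (n + 1) → C) = update f 0 u := by
          rw [← Fin.cons_self_tail f, Fin.update_cons_zero, Fin.tail_cons]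
        rw [this]; rfl
      have h3 := fr.sum_apply_eq X (f 0)
      simp only [h2, Fin.cons_self_tail] at h3
      rw [← h3]
      exact Finset.sum_congr rfl fun i _ => mul_comm _ _
    rw [h1, ← (Fin.consEquiv fun _ => ι).sum_comp, Fintype.sum_prod_type]
    refine Finset.sum_congr rfl fun i _ => ?_
    have h4 := ih (Q := fun g => Q (Fin.cons (fr.x i) g))
      (mem_multilinearOps.2 ⟨fun a k u v => by simp only [Fin.cons_update, hm'.1],
        fun a k c u => by simp only [Fin.cons_update, hm'.2]⟩)
      (fun k a s t => by simp only [Fin.cons_update, hd]) (Fin.tail f)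
    rw [h4, Finset.mul_sum]
    refine Finset.sum_congr rfl fun j _ => ?_
    have h5 : fr.x ∘ (Fin.consEquiv fun _ => ι) (i, j) = Fin.cons (fr.x i) (fr.x ∘ j) := by
      funext k
      refine Fin.cases rfl (fun k => rfl) k
    rw [h5, Fin.prod_univ_succ, ← mul_assoc]
    rfl

/-- The fibrewise polyvector field with constant coefficients in `y` given by a polyvector field. -/
def Frame.liftVect (fr : Frame C ι) (Q : Op C n) : Op (SM C) n :=
  ∑ j : Fin n → ι, Q (fr.x ∘ j) • prodOp fun k => ⇑(vertDerForm C (fr.e (j k))).toLinearMap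

theorem Frame.liftVect_apply (fr : Frame C ι) (Q : Op C n) (a : Fin n → SM C) :
    fr.liftVect Q a = ∑ j : Fin n → ι, Q (fr.x ∘ j) • ∏ k, vertDer (fr.e (j k)) (a k) := by
  rw [liftVect, Finset.sum_apply]; rfl

theorem Frame.liftVect_mem_polyVect (fr : Frame C ι) {Q : Op C n} (hQ : Q ∈ polyVect ℝ C n) :
    fr.liftVect Q ∈ polyVect C (SM C) n := by
  refine mem_polyVect.2 ⟨sum_mem fun j _ => Submodule.smul_mem _ _ (prodOp_mem_multilinearOps _),
    fun a i j hij hne => ?_, fun i a s t => ?_⟩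
  · obtain ⟨⟨q, rfl⟩, -⟩ := hQ
    -- Reindexing by the transposition of i and j changes the sign of the coefficients of the
    -- alternating q and leaves the products alone, as aᵢ = aⱼ.
    have h1 : fr.liftVect (⇑q) a = -fr.liftVect (⇑q) a := by
      conv_lhs => rw [liftVect_apply, ← ((Equiv.swap i j).arrowCongr (Equiv.refl ι)).sum_comp]
      rw [liftVect_apply, ← Finset.sum_neg_distrib]
      refine Finset.sum_congr rfl fun m _ => ?_
      have h2 : fr.x ∘ ((Equiv.swap i j).arrowCongr (Equiv.refl ι)) m =
          (fr.x ∘ m) ∘ Equiv.swap i j := by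
        funext k; simp [Equiv.arrowCongr]
      have h3 : ∀ k, a (Equiv.swap i j k) = a k := by
        intro k
        rw [Equiv.swap_apply_def]
        split_ifs with h1 h2
        · rw [h1, hij]
        · rw [h2, hij]
        · rfl
      rw [h2, q.map_swap _ hne, neg_smul, ← Equiv.prod_comp (Equiv.swap i j)]
      congr 2
      refine Finset.prod_congr rfl fun k _ => ?_
      rw [h3]
      simp [Equiv.arrowCongr]
    have h4 : (2 : ℝ) • fr.liftVect (⇑q) a = 0 := by
      rw [two_smul]; nth_rewrite 1 [h1]; exact neg_add_cancel _
    exact (smul_eq_zero.1 h4).resolve_left two_ne_zero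
  · simp only [liftVect, Finset.sum_apply, Pi.smul_apply, prodOp_update, Finset.mul_sum,
      ← Finset.sum_add_distrib]
    refine Finset.sum_congr rfl fun j _ => ?_
    have : ∀ u, (vertDerForm C (fr.e (j i))).toLinearMap u = vertDer (fr.e (j i)) u := fun _ => rfl
    rw [this, this, this, vertDer_mul, mul_smul_comm, mul_smul_comm, ← smul_add]
    congr 1
    ring

theorem Frame.mu_liftVect (fr : Frame C ι) (hD : IsConn D) (hfl : HasFlatLifts D) {Q : Op C n}
    (hQ : Q ∈ polyVect ℝ C n) : mu D (fr.liftVect Q) = Q := by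
  funext f
  obtain ⟨h1, -, h3⟩ := mem_polyVect.1 hQ
  rw [fr.multiderivation_eq_sum h1 h3 f, mu, liftVect_apply, ← atZeroHom_apply, map_sum]
  refine Finset.sum_congr rfl fun j _ => ?_
  rw [map_smul, map_prod, smul_eq_mul, mul_comm]
  congr 1
  exact Finset.prod_congr rfl fun k _ => atZero_vertDer_tau hD hfl _ _

end SurjectiveT

section SurjectiveD

open Function

variable {C : Type*} [CommRing C] [Algebra ℝ C] {ι : Type*} [Fintype ι] {n : ℕ}
  {D : VF C → SM C →ₗ[ℝ] SM C}

/-- Composition with a map in one argument. -/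
def compAt {A : Type*} (j : Fin n) (e : A → A) (P : Op A n) : Op A n := fun a =>
  P (update a j (e (a j)))

theorem compAt_eq_graft {A : Type*} [CommRing A] (j : Fin n) (e : A → A) (P : Op A n) :
    compAt j e P = graft P (fun a : Fin 1 → A => e (a 0)) j (insertEquiv j rfl) := by
  funext a
  rw [compAt, graft]
  congr 1
  funext k
  by_cases hk : k = j
  · subst hk
    simp [graftArgs, insertEquiv, insertFun]
  · simp [graftArgs, hk, insertEquiv, insertFun]

theorem adAt_compAt {A : Type*} [CommRing A] [Algebra ℝ A] (j : Fin n) (e : Derivation ℝ A A)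
    {P : Op A n} (hP : P ∈ multilinearOps ℝ A n) (g : A) :
    adAt j g (compAt j e P) = compAt j e (adAt j g P) + adAt j (e g) P + e g • P := by
  funext a
  have h := (mem_multilinearOps.1 hP).1 a j (g * e (a j)) (e g * a j)
  simp only [adAt, compAt, update_self, update_idem, Pi.add_apply, Pi.smul_apply, smul_eq_mul,
    Derivation.leibniz]
  rw [mul_comm (a j), h]
  ring

theorem adAt_mul_left {A : Type*} [CommRing A] (j : Fin n) (g h : A) (P : Op A n) :
    adAt j (g * h) P = adAt j g (adAt j h P) + g • adAt j h P + h • adAt j g P := by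
  funext a
  simp only [adAt, Pi.add_apply, Pi.smul_apply, smul_eq_mul, update_self, update_idem]
  rw [mul_left_comm h g, mul_assoc g h]
  ring

theorem adAt_add_left {A : Type*} [CommRing A] [Algebra ℝ A] (j : Fin n) (g h : A) {P : Op A n}
    (hP : P ∈ multilinearOps ℝ A n) : adAt j (g + h) P = adAt j g P + adAt j h P := by
  funext a
  simp only [adAt, Pi.add_apply, add_mul, (mem_multilinearOps.1 hP).1]
  ring

theorem adAt_rsmul_left {A : Type*} [CommRing A] [Algebra ℝ A] (j : Fin n) (c : ℝ) (g : A)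
    {P : Op A n} (hP : P ∈ multilinearOps ℝ A n) : adAt j (c • g) P = c • adAt j g P := by
  funext a
  simp only [adAt, Pi.smul_apply, smul_mul_assoc, (mem_multilinearOps.1 hP).2, smul_sub]

theorem adAt_sum {A : Type*} [CommRing A] (j : Fin n) (g : A) {κ : Type*} (s : Finset κ)
    (P : κ → Op A n) : adAt j g (∑ k ∈ s, P k) = ∑ k ∈ s, adAt j g (P k) := by
  classical
  induction s using Finset.induction_on with
  | empty => funext a; simp [adAt]
  | insert k s hk ih => rw [Finset.sum_insert hk, Finset.sum_insert hk, adAt_add, ih]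

/-- Modulo lower order, g ↦ [Q, g] is a derivation, hence determined by its values on the xⁱ. For N
= 0 it is an honest one because double commutators vanish; the general case follows by taking
further commutators. -/
theorem Frame.orderLT_adAt_sub_sum (fr : Frame C ι) (j : Fin n) (g : C) {Q : Op C n} (N : ℕ)
    (hm : Q ∈ multilinearOps ℝ C n) (hQ : OrderLT j (N + 2) Q) :
    OrderLT j N (adAt j g Q - ∑ i, fr.e i g • adAt j (fr.x i) Q) := by
  induction N generalizing Q with
  | zero =>
    have h2 : ∀ g h : C, adAt j g (adAt j h Q) = 0 := fun g h => hQ h g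
    funext a
    let X : VF C := Derivation.mk'
      { toFun := fun u => adAt j u Q a
        map_add' := fun u v => by rw [adAt_add_left j u v hm]; rfl
        map_smul' := fun c u => by rw [adAt_rsmul_left j c u hm]; rfl }
      fun s t => by
        change adAt j (s * t) Q a = _
        rw [adAt_mul_left, h2, zero_add]; rfl
    have := fr.sum_apply_eq X g
    rw [Pi.sub_apply, Finset.sum_apply, Pi.zero_apply, sub_eq_zero]
    refine this.symm.trans (Finset.sum_congr rfl fun i _ => mul_comm _ _)
  | succ N ih =>
    intro s
    have e : adAt j s (adAt j g Q - ∑ i, fr.e i g • adAt j (fr.x i) Q) =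
        adAt j g (adAt j s Q) - ∑ i, fr.e i g • adAt j (fr.x i) (adAt j s Q) := by
      rw [sub_eq_add_neg, ← neg_one_smul C, adAt_add, adAt_smul_left, adAt_sum, adAt_comm]
      simp only [adAt_smul_left, adAt_comm j j s, neg_one_smul, ← sub_eq_add_neg]
    rw [e]
    exact ih (adAt_mem_multilinearOps j s hm) (hQ s)

/-- `∑ᵢ [Q, xⁱ] ∘ eᵢ`. -/
def Frame.symbolOp (fr : Frame C ι) (j : Fin n) (Q : Op C n) : Op C n :=
  ∑ i, compAt j (fr.e i) (adAt j (fr.x i) Q)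

theorem Frame.adAt_symbolOp (fr : Frame C ι) (j : Fin n) {Q : Op C n}
    (hm : Q ∈ multilinearOps ℝ C n) (g : C) : adAt j g (fr.symbolOp j Q) =
      fr.symbolOp j (adAt j g Q) + ∑ i, adAt j (fr.e i g) (adAt j (fr.x i) Q) +
        ∑ i, fr.e i g • adAt j (fr.x i) Q := by
  simp only [symbolOp, adAt_sum, adAt_compAt j _ (adAt_mem_multilinearOps j _ hm),
    Finset.sum_add_distrib, adAt_comm j j g]

/-- Euler's identity for principal symbols, which are homogeneous of degree N. It is proved by
commutators: [·, g] turns the statement for N + 1 into that for N applied to [Q, g], with [Q, g] − ∑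
eᵢ(g) [Q, xⁱ] and double commutators as errors of lower order. -/
theorem Frame.orderLT_sub_symbolOp (fr : Frame C ι) (j : Fin n) (N : ℕ) {Q : Op C n}
    (hm : Q ∈ multilinearOps ℝ C n) (hQ : OrderLT j (N + 1) Q) :
    OrderLT j N ((N : ℝ) • Q - fr.symbolOp j Q) := by
  induction N generalizing Q with
  | zero =>
    have h : ∀ g, adAt j g Q = 0 := hQ
    have h0 : ∀ e : C → C, compAt j e (0 : Op C n) = 0 := fun e => rfl
    change _ = _
    simp [symbolOp, h, h0]
  | succ N ih =>
    intro g
    have e : adAt j g (((N + 1 : ℕ) : ℝ) • Q - fr.symbolOp j Q) =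
        ((N : ℝ) • adAt j g Q - fr.symbolOp j (adAt j g Q)) +
        (adAt j g Q - ∑ i, fr.e i g • adAt j (fr.x i) Q) -
        ∑ i, adAt j (fr.e i g) (adAt j (fr.x i) Q) := by
      rw [sub_eq_add_neg, ← neg_one_smul C, adAt_add, adAt_smul_left, adAt_smul,
        fr.adAt_symbolOp j hm, neg_one_smul]
      push_cast
      rw [add_smul, one_smul]
      abel
    rw [e]
    refine ((ih (adAt_mem_multilinearOps j g hm) (hQ g)).add
      (fr.orderLT_adAt_sub_sum j g N hm hQ)).sub ?_
    exact OrderLT.sum _ fun i _ => hQ _ _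

/-- The operators that are given by fibrewise differential operators. -/
def muRange (D : VF C → SM C →ₗ[ℝ] SM C) (n : ℕ) : Submodule C (Op C n) where
  carrier := {Q | ∃ N, ∃ P ∈ polyDiffLE C (SM C) n N, mu D P = Q}
  add_mem' := by
    rintro _ _ ⟨N, P, hP, rfl⟩ ⟨N', P', hP', rfl⟩
    exact ⟨max N N', P + P', add_mem (polyDiffLE_mono C (SM C) n (le_max_left N N') hP)
      (polyDiffLE_mono C (SM C) n (le_max_right N N') hP'), mu_add _ _⟩
  zero_mem' := ⟨0, 0, zero_mem _, funext fun _ => map_zero (atZeroHom C)⟩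
  smul_mem' := by
    rintro c _ ⟨N, P, hP, rfl⟩
    exact ⟨N, c • P, Submodule.smul_mem _ _ hP, mu_smul _ _⟩

theorem Frame.exists_closed_of_mem_muRange (fr : Frame C ι) (hD : IsConn D)
    (nabla : TorsionFreeConnection C) (hflat : ∀ X Y, curvature D X Y = 0) {Q : Op C n}
    (hQ : Q ∈ muRange D n) :
    ∃ N, ∃ P ∈ polyDiffLE C (SM C) n N, (∀ Z, opDer (D Z) P = 0) ∧ mu D P = Q := by
  obtain ⟨N, P, hP, rfl⟩ := hQ
  obtain ⟨P', hP', h1, h2⟩ := fr.exists_closed (isFibrewise_polyDiffLE N) hD nabla hflat hP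
  exact ⟨N, P', hP', h1, mu_congr (mem_gr_one.1 h2)⟩

/-- A lift of a vector field to a fibrewise vector field that commutes with the connection. -/
theorem Frame.exists_flat_derivation (fr : Frame C ι) (hD : IsConn D) (hfl : HasFlatLifts D)
    (nabla : TorsionFreeConnection C) (hflat : ∀ X Y, curvature D X Y = 0) (X : VF C) :
    ∃ E ∈ polyVect C (SM C) 1, ∀ g, E (fun _ => tau D g) = tau D (X g) := by
  obtain ⟨E, hE, h1, h2⟩ := fr.exists_closed isFibrewise_polyVect hD nabla hflat
    (derivation_mem_polyVect (vertDerForm C X))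
  refine ⟨E, hE, fun g => ?_⟩
  have h3 := closed_apply_tau hD hfl (polyVect_le_multilinearOps hE) h1 fun _ => g
  refine h3.trans ?_
  rw [mu_congr (mem_gr_one.1 h2)]
  exact congrArg (tau D) (atZero_vertDer_tau hD hfl X g)

/-- If P is a lift of Q and E a flat lift of X, so that E ∘ τ = τ ∘ X, then inserting E into the
j-th argument of P lifts the composite. -/
theorem Frame.compAt_mem_muRange (fr : Frame C ι) (hD : IsConn D) (hfl : HasFlatLifts D)
    (nabla : TorsionFreeConnection C) (hflat : ∀ X Y, curvature D X Y = 0) (X : VF C) (j : Fin n)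
    {Q : Op C n} (hQ : Q ∈ muRange D n) : compAt j X Q ∈ muRange D n := by
  obtain ⟨N, P, hP, hcl, rfl⟩ := fr.exists_closed_of_mem_muRange hD nabla hflat hQ
  obtain ⟨E, hE, hEτ⟩ := fr.exists_flat_derivation hD hfl nabla hflat X
  refine ⟨N + 1 + 1, compAt j (fun s => E fun _ => s) P, ?_, ?_⟩
  · rw [compAt_eq_graft]
    have : (fun a : Fin 1 → SM C => E fun _ => a 0) = E := by
      funext a; congr 1; funext i; rw [Subsingleton.elim i 0]
    rw [this]
    exact graft_mem_polyDiffLE hP (polyVect_le_polyDiffLE hE) _ _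
  · funext f
    rw [mu_apply hD hfl, compAt, compAt, mu_apply hD hfl, tau_comp_update]
    congr 3
    exact hEτ (f j)

theorem prodOp_mem_muRange (hfl : HasFlatLifts D) : prodOp (fun _ : Fin n => id) ∈ muRange D n := by
  refine ⟨0, prodOp fun _ => id, ⟨prodOp_mem_multilinearOps fun _ => LinearMap.id,
    fun i s => ?_⟩, ?_⟩
  · funext a
    rw [adAt, prodOp_update, ← update_eq_self i a]
    simp only [prodOp_update, update_self, id]
    simp only [update_eq_self]
    exact sub_eq_zero.2 (mul_assoc _ _ _)
  · funext f
    rw [mu, prodOp, prodOp, ← atZeroHom_apply, map_prod]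
    exact Finset.prod_congr rfl fun k _ => (hfl _).2.1

theorem eq_smul_prodOp {Q : Op C n} (hQ : ∀ i, OrderLT i 1 Q) :
    Q = Q (fun _ => 1) • prodOp fun _ : Fin n => id := by
  have h : ∀ i s a, Q (update a i (s * a i)) = s * Q a := fun i s a =>
    sub_eq_zero.1 (congrFun (hQ i s : adAt i s Q = 0) a)
  have key : ∀ (S : Finset (Fin n)) (a : Fin n → C), (∀ i ∉ S, a i = 1) →
      Q a = (∏ i, a i) * Q fun _ => 1 := by
    intro S
    induction S using Finset.induction_on with
    | empty =>
      intro a ha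
      have : a = fun _ => 1 := funext fun i => ha i (Finset.notMem_empty i)
      subst this
      simp
    | insert i S _ ih =>
      intro a ha
      have h1 := h i (a i) (update a i 1)
      rw [update_self, mul_one, update_idem, update_eq_self] at h1
      rw [h1, ih (update a i 1) fun j hj => ?_, ← mul_assoc]
      · congr 1
        have h2 := prodOp_update (fun _ : Fin n => id) a i 1
        have h3 := prodOp_update (fun _ : Fin n => id) a i (a i)
        rw [update_eq_self] at h3
        simp only [prodOp, id] at h2 h3
        rw [h3, h2, one_mul]
      · by_cases hji : j = i
        · subst hji; simp
        · rw [update_of_ne hji]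
          exact ha j (by simp [hj, hji])
  funext a
  rw [key Finset.univ a fun i hi => absurd (Finset.mem_univ i) hi, mul_comm]
  rfl

theorem compAt_mem_multilinearOps (j : Fin n) (X : VF C) {Q : Op C n}
    (hm : Q ∈ multilinearOps ℝ C n) : compAt j X Q ∈ multilinearOps ℝ C n := by
  rw [compAt_eq_graft]
  refine graft_mem_multilinearOps hm (mem_multilinearOps.2
    ⟨fun a i u v => ?_, fun a i c u => ?_⟩) _ _ <;>
  obtain rfl : i = 0 := Subsingleton.elim _ _ <;> simp

theorem OrderLT.compAt_of_ne {j k : Fin n} (hk : k ≠ j) (e : C → C) {N : ℕ} {Q : Op C n}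
    (hQ : OrderLT k N Q) : OrderLT k N (compAt j e Q) := by
  rw [compAt_eq_graft]
  have := OrderLT.graft_inr (fun a : Fin 1 → C => e (a 0)) j (insertEquiv j rfl) ⟨k, hk⟩ hQ
  have h : (insertEquiv j rfl (Sum.inr ⟨k, hk⟩) : Fin n) = k := by
    refine Fin.ext ?_
    simp [insertEquiv, insertFun]
  rwa [h] at this

/-- Induction on the total order ∑ Nᵢ. Order 0 means a multiple of the product. Otherwise, in an
argument j of order m + 1, both [Q, xⁱ] and (m + 1) Q − ∑ [Q, xⁱ] ∘ eᵢ have smaller order there and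
no larger order elsewhere; composition with eᵢ stays in the range, and m + 1 is invertible. -/
theorem Frame.mem_muRange (fr : Frame C ι) (hD : IsConn D) (hfl : HasFlatLifts D)
    (nabla : TorsionFreeConnection C) (hflat : ∀ X Y, curvature D X Y = 0) :
    ∀ (K : ℕ) (N : Fin n → ℕ), ∑ i, N i = K → ∀ {Q : Op C n}, Q ∈ multilinearOps ℝ C n →
      (∀ i, OrderLT i (N i + 1) Q) → Q ∈ muRange D n := by
  intro K
  induction K with
  | zero =>
    intro N hN Q _ hQ
    have h0 : ∀ i, N i = 0 := fun i => (Finset.sum_eq_zero_iff.1 hN) i (Finset.mem_univ i)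
    rw [eq_smul_prodOp (Q := Q) fun i => by simpa [h0 i] using hQ i]
    exact Submodule.smul_mem _ _ (prodOp_mem_muRange hfl)
  | succ K ih =>
    intro N hN Q hm hQ
    obtain ⟨j, hj⟩ : ∃ j, N j ≠ 0 := by
      by_contra! h
      simp [h] at hN
    obtain ⟨m, hjm⟩ := Nat.exists_eq_succ_of_ne_zero hj
    have hN' : ∑ i, update N j m i = K := by
      rw [Finset.sum_update_of_mem (Finset.mem_univ j)]
      have := Finset.add_sum_erase Finset.univ N (Finset.mem_univ j)
      rw [Finset.sdiff_singleton_eq_erase]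
      omega
    have hupd : ∀ {R : Op C n}, OrderLT j (m + 1) R → (∀ i ≠ j, OrderLT i (N i + 1) R) →
        ∀ i, OrderLT i (update N j m i + 1) R := by
      intro R h1 h2 i
      by_cases hij : i = j
      · subst hij; simpa using h1
      · rw [update_of_ne hij]; exact h2 i hij
    have hQj : OrderLT j (m + 1 + 1) Q := by simpa [hjm] using hQ j
    have hm1 : ∀ i, adAt j (fr.x i) Q ∈ multilinearOps ℝ C n := fun i =>
      adAt_mem_multilinearOps j _ hm
    have h1 : fr.symbolOp j Q ∈ muRange D n := sum_mem fun i _ =>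
      fr.compAt_mem_muRange hD hfl nabla hflat _ j (ih _ hN' (hm1 i)
        (hupd (hQj _) fun k _ => (hQ k).adAt_mem j _))
    have h2 : ((m + 1 : ℕ) : ℝ) • Q - fr.symbolOp j Q ∈ muRange D n := by
      refine ih _ hN' (sub_mem (Submodule.smul_mem _ _ hm)
        (sum_mem fun i _ => compAt_mem_multilinearOps j _ (hm1 i)))
        (hupd (fr.orderLT_sub_symbolOp j (m + 1) hm hQj) fun k hk => ?_)
      exact ((hQ k).smul _).sub (OrderLT.sum _ fun i _ =>
        ((hQ k).adAt_mem j _).compAt_of_ne hk _)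
    have h3 := add_mem h2 h1
    rw [sub_add_cancel] at h3
    have h4 := Submodule.smul_mem (muRange D n) (algebraMap ℝ C ((m + 1 : ℕ) : ℝ)⁻¹) h3
    rwa [algebraMap_smul, inv_smul_smul₀ (by positivity)] at h4

end SurjectiveD

end Fedosov

end

/-! ### Assembly of the resolution. -/

noncomputable section

namespace Fedosov

section Resolution

open Function

variable {C : Type*} [CommRing C] [Algebra ℝ C] {ι : Type*} [Fintype ι]
  {D : VF C → SM C →ₗ[ℝ] SM C} {F : ∀ n : ℕ, ℕ → Submodule C (Op (SM C) n)}
  {br : ∀ n n' : ℕ, Op (SM C) n → Op (SM C) n' → Op (SM C) (n + n' - 1)}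
  {d : ∀ n : ℕ, Op (SM C) n → Op (SM C) (n + 1)}

/-! ### Cohomology in exterior degree zero -/

section Cohomology

variable (Ω : ∀ q n : ℕ, Submodule ℝ (Form C q n)) (D)

/-- In exterior degree zero the cohomology consists of the closed elements. -/
def cohomologyZeroEquiv (n : ℕ) : Cohomology Ω D 0 n ≃ₗ[ℝ] cocycles Ω D 0 n :=
  Submodule.quotEquivOfEqBot _ (by
    rw [coboundaries, Submodule.submoduleOf, Submodule.comap_bot, Submodule.ker_subtype])

theorem cohomologyZeroEquiv_cls {n : ℕ} (a : cocycles Ω D 0 n) :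
    cohomologyZeroEquiv D Ω n (cls Ω D a) = a :=
  Submodule.quotEquivOfEqBot_apply_mk _ _ a

end Cohomology

namespace IsFormDGLA

variable (h : IsFormDGLA F br d)

/-- The forms with values in the union of the spaces `F n N`. -/
abbrev Ω : ∀ q n : ℕ, Submodule ℝ (Form C q n) := fun q n => formsIn (F n) (h.mono n) q

theorem exists_mem_of_mem_cocycles {n : ℕ} (a : cocycles h.Ω D 0 n) :
    ∃ N, a.1 ![] ∈ F n N ∧ ∀ Z, opDer (D Z) (a.1 ![]) = 0 := by
  obtain ⟨N, hN⟩ := mem_formsIn.1 a.2.1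
  refine ⟨N, (exists_forms hN).2 _, extD_constForm_eq_zero.1 ?_⟩
  rw [← form_zero_eq]
  exact a.2.2

theorem constForm_mem {n N : ℕ} {P : Op (SM C) n} (hP : P ∈ F n N) : constForm C n P ∈ h.Ω 0 n :=
  mem_formsIn.2 ⟨N, constForm_mem_forms.2 hP⟩

theorem exists_mem_of_constForm_mem {n : ℕ} {P : Op (SM C) n} (hP : constForm C n P ∈ h.Ω 0 n) :
    ∃ N, P ∈ F n N := by
  obtain ⟨N, hN⟩ := mem_formsIn.1 hP
  exact ⟨N, constForm_mem_forms.1 hN⟩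

theorem constForm_mem_cocycles {n N : ℕ} {P : Op (SM C) n} (hP : P ∈ F n N)
    (hcl : ∀ Z, opDer (D Z) P = 0) : constForm C n P ∈ cocycles h.Ω D 0 n :=
  ⟨h.constForm_mem hP, extD_constForm_eq_zero.2 hcl⟩

theorem formBracket_zero {n n' : ℕ} (a : Form C 0 n) (b : Form C 0 n') (X : Fin 0 → VF C) :
    formBracket br a b X = br n n' (a ![]) (b ![]) := by
  simp only [formBracket, mul_zero, pow_zero, Nat.factorial_zero, mul_one, Nat.cast_one, inv_one,
    one_smul]
  have : Subsingleton (Fin (0 + 0)) := inferInstanceAs (Subsingleton (Fin 0))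
  rw [Fintype.sum_subsingleton _ 1]
  simp only [Equiv.Perm.sign_one, Units.val_one, one_smul]
  congr 2 <;> exact Subsingleton.elim _ _

theorem formBracket_mem_cocycles (nabla : TorsionFreeConnection C) {q n q' n' : ℕ}
    (a : cocycles h.Ω D q n) (b : cocycles h.Ω D q' n') :
    formBracket br a.1 b.1 ∈ cocycles h.Ω D (q + q') (n + n' - 1) :=
  ⟨h.formBracket_mem a.2.1 b.2.1, h.extD_formBracket nabla a.2.1 b.2.1 a.2.2 b.2.2⟩

theorem formDiff_mem_cocycles (hD : IsConn D) {q n : ℕ} (a : cocycles h.Ω D q n) :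
    formDiff d a.1 ∈ cocycles h.Ω D q (n + 1) :=
  ⟨h.formDiff_mem a.2.1, h.extD_formDiff hD a.2.1 a.2.2⟩

theorem extD_mem_formsIn (hD : IsConn D) (nabla : TorsionFreeConnection C) {q n : ℕ}
    {a : Form C q n} (ha : a ∈ h.Ω q n) : extD D a ∈ h.Ω (q + 1) n := by
  obtain ⟨N, hN⟩ := mem_formsIn.1 ha
  exact mem_formsIn.2 ⟨N, extD_mem (h.fibrewise n N) hD nabla hN⟩

theorem subsingleton_cohomology (fr : Frame C ι) (hD : IsConn D) (nabla : TorsionFreeConnection C)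
    (hflat : ∀ X Y, curvature D X Y = 0) (q n : ℕ) : Subsingleton (Cohomology h.Ω D (q + 1) n) := by
  refine Submodule.Quotient.subsingleton_iff.2 (eq_top_iff.2 fun a _ => ?_)
  obtain ⟨N, hN⟩ := mem_formsIn.1 a.2.1
  obtain ⟨b, hb, -, hab⟩ := fr.exists_extD_primitive (h.fibrewise n N) hD nabla hflat hN
    (fun _ => mem_gr_zero _) a.2.2
  exact ⟨b, mem_formsIn.2 ⟨N, hb⟩, hab⟩

theorem subsingleton_cohomology_of_ne_zero (fr : Frame C ι) (hD : IsConn D)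
    (nabla : TorsionFreeConnection C) (hflat : ∀ X Y, curvature D X Y = 0) {q : ℕ} (hq : q ≠ 0)
    (n : ℕ) : Subsingleton (Cohomology h.Ω D q n) := by
  obtain ⟨m, rfl⟩ := Nat.exists_eq_succ_of_ne_zero hq
  exact h.subsingleton_cohomology fr hD nabla hflat m n

/-- In total exterior degree 0 there are no coboundaries and the bracket is that of closed elements.
In positive degree the target vanishes by acyclicity, so the zero map has the required values. -/
theorem exists_cohomology_bracket (fr : Frame C ι) (hD : IsConn D)
    (nabla : TorsionFreeConnection C) (hflat : ∀ X Y, curvature D X Y = 0) (q n q' n' : ℕ) :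
    ∃ β : Cohomology h.Ω D q n →ₗ[ℝ] Cohomology h.Ω D q' n' →ₗ[ℝ]
      Cohomology h.Ω D (q + q') (n + n' - 1), ∀ (a : cocycles h.Ω D q n) (b : cocycles h.Ω D q' n'),
        β (cls h.Ω D a) (cls h.Ω D b) = cls h.Ω D ⟨_, h.formBracket_mem_cocycles nabla a b⟩ := by
  by_cases hq : q + q' = 0
  · obtain ⟨rfl, rfl⟩ : q = 0 ∧ q' = 0 := by omega
    have mm : ∀ {n : ℕ} (a : cocycles h.Ω D 0 n), a.1 ![] ∈ multilinearOps C (SM C) n := by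
      intro n a
      obtain ⟨N, hN, -⟩ := h.exists_mem_of_mem_cocycles a
      exact (h.fibrewise n N).le_multilinearOps hN
    let f : cocycles h.Ω D 0 n → cocycles h.Ω D 0 n' → cocycles h.Ω D 0 (n + n' - 1) :=
      fun a b => ⟨_, h.formBracket_mem_cocycles nabla a b⟩
    have hf : ∀ a b (X : Fin 0 → VF C), (f a b).1 X = br n n' (a.1 ![]) (b.1 ![]) := fun a b X =>
      formBracket_zero a.1 b.1 X
    have f1 : ∀ a a' b, f (a + a') b = f a b + f a' b := fun a a' b =>
      Subtype.ext <| funext fun X => (hf _ _ X).trans <| (h.add_left _ _ (mm b)).trans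
        (congrArg₂ (· + ·) (hf a b X) (hf a' b X)).symm
    have f2 : ∀ (c : ℝ) a b, f (c • a) b = c • f a b := fun c a b =>
      Subtype.ext <| funext fun X => (hf _ _ X).trans <| Eq.trans (by
        have := h.smul_left (algebraMap ℝ C c) (a.1 ![]) (mm b)
        rwa [algebraMap_smul, algebraMap_smul] at this) (congrArg (c • ·) (hf a b X)).symm
    have f3 : ∀ a b b', f a (b + b') = f a b + f a b' := fun a b b' =>
      Subtype.ext <| funext fun X => (hf _ _ X).trans <| (h.add_right _ _ (mm a)).trans
        (congrArg₂ (· + ·) (hf a b X) (hf a b' X)).symm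
    have f4 : ∀ (c : ℝ) a b, f a (c • b) = c • f a b := fun c a b =>
      Subtype.ext <| funext fun X => (hf _ _ X).trans <| Eq.trans (by
        have := h.smul_right (algebraMap ℝ C c) (b.1 ![]) (mm a)
        rwa [algebraMap_smul, algebraMap_smul] at this) (congrArg (c • ·) (hf a b X)).symm
    let β := LinearMap.mk₂ ℝ f f1 f2 f3 f4
    refine ⟨(β.compl₁₂ (cohomologyZeroEquiv D h.Ω n).toLinearMap
      (cohomologyZeroEquiv D h.Ω n').toLinearMap).compr₂
      (cohomologyZeroEquiv D h.Ω (n + n' - 1)).symm.toLinearMap, fun a b => ?_⟩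
    simp only [LinearMap.compr₂_apply, LinearMap.compl₁₂_apply, LinearEquiv.coe_coe,
      cohomologyZeroEquiv_cls]
    rfl
  · have := h.subsingleton_cohomology_of_ne_zero fr hD nabla hflat hq (n + n' - 1)
    exact ⟨0, fun a b => Subsingleton.elim _ _⟩

theorem exists_cohomology_diff (fr : Frame C ι) (hD : IsConn D)
    (nabla : TorsionFreeConnection C) (hflat : ∀ X Y, curvature D X Y = 0) (q n : ℕ) :
    ∃ β : Cohomology h.Ω D q n →ₗ[ℝ] Cohomology h.Ω D q (n + 1), ∀ a : cocycles h.Ω D q n,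
        β (cls h.Ω D a) = cls h.Ω D ⟨_, h.formDiff_mem_cocycles hD a⟩ := by
  by_cases hq : q = 0
  · subst hq
    let β : cocycles h.Ω D 0 n →ₗ[ℝ] cocycles h.Ω D 0 (n + 1) :=
      { toFun := fun a => ⟨_, h.formDiff_mem_cocycles hD a⟩
        map_add' := fun a b => Subtype.ext <| funext fun X => by
          change (-1 : ℝ) ^ 0 • d n (a.1 X + b.1 X) =
            (-1 : ℝ) ^ 0 • d n (a.1 X) + (-1 : ℝ) ^ 0 • d n (b.1 X)
          rw [h.diff_add, smul_add]
        map_smul' := fun c a => Subtype.ext <| funext fun X => by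
          change (-1 : ℝ) ^ 0 • d n (c • a.1 X) = c • (-1 : ℝ) ^ 0 • d n (a.1 X)
          rw [h.diff_rsmul, smul_comm] }
    refine ⟨(cohomologyZeroEquiv D h.Ω (n + 1)).symm.toLinearMap ∘ₗ β ∘ₗ
      (cohomologyZeroEquiv D h.Ω n).toLinearMap, fun a => ?_⟩
    simp only [LinearMap.comp_apply, LinearEquiv.coe_coe, cohomologyZeroEquiv_cls]
    rfl
  · have := h.subsingleton_cohomology_of_ne_zero fr hD nabla hflat hq (n + 1)
    exact ⟨0, fun a => Subsingleton.elim _ _⟩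

/-- The conditions under which `μ` identifies the closed elements of exterior degree `0` with a
DGLA of operators on functions. -/
structure IsResolvedBy (h : IsFormDGLA F br d) (D : VF C → SM C →ₗ[ℝ] SM C)
    (L : ∀ n : ℕ, Submodule ℝ (Op C n))
    (brC : ∀ n n' : ℕ, Op C n → Op C n' → Op C (n + n' - 1))
    (dC : ∀ n : ℕ, Op C n → Op C (n + 1)) : Prop where
  mu_mem : ∀ {n N} {P : Op (SM C) n}, P ∈ F n N → mu D P ∈ L n
  mu_injective : ∀ {n N} {P : Op (SM C) n}, P ∈ F n N → (∀ Z, opDer (D Z) P = 0) →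
    mu D P = 0 → P = 0
  mu_surjective : ∀ {n} {Q : Op C n}, Q ∈ L n → ∃ N, ∃ P ∈ F n N, mu D P = Q
  mu_bracket : ∀ {n N n' N'} {P : Op (SM C) n} {Q : Op (SM C) n'}, P ∈ F n N → Q ∈ F n' N' →
    (∀ Z, opDer (D Z) P = 0) → (∀ Z, opDer (D Z) Q = 0) →
      mu D (br n n' P Q) = brC n n' (mu D P) (mu D Q)
  mu_diff : ∀ {n N} {P : Op (SM C) n}, P ∈ F n N → (∀ Z, opDer (D Z) P = 0) →
    mu D (d n P) = dC n (mu D P)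

namespace IsResolvedBy

variable {L : ∀ n : ℕ, Submodule ℝ (Op C n)}
    {brC : ∀ n n' : ℕ, Op C n → Op C n' → Op C (n + n' - 1)}
    {dC : ∀ n : ℕ, Op C n → Op C (n + 1)} {h} (hL : h.IsResolvedBy D L brC dC) (fr : Frame C ι)
    (hD : IsConn D) (nabla : TorsionFreeConnection C) (hflat : ∀ X Y, curvature D X Y = 0)

/-- The isomorphism given by `μ` from the closed elements of exterior degree `0`. -/
def muCocycles (n : ℕ) : cocycles h.Ω D 0 n ≃ₗ[ℝ] L n :=
  LinearEquiv.ofBijective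
    { toFun := fun a => ⟨mu D (a.1 ![]), hL.mu_mem (h.exists_mem_of_mem_cocycles a).choose_spec.1⟩
      map_add' := fun a b => Subtype.ext (mu_add _ _)
      map_smul' := fun c a => Subtype.ext (mu_rsmul _ _) } (by
    constructor
    · refine (injective_iff_map_eq_zero _).2 fun a ha => ?_
      obtain ⟨N, hN, hcl⟩ := h.exists_mem_of_mem_cocycles a
      refine Subtype.ext ?_
      rw [form_zero_eq a.1 ![], hL.mu_injective hN hcl (congrArg Subtype.val ha)]
      rfl
    · rintro ⟨Q, hQ⟩
      obtain ⟨N, P, hP, rfl⟩ := hL.mu_surjective hQ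
      obtain ⟨P', hP', hcl, h1⟩ := fr.exists_closed (h.fibrewise n N) hD nabla hflat hP
      exact ⟨⟨_, h.constForm_mem_cocycles hP' hcl⟩, Subtype.ext (mu_congr (mem_gr_one.1 h1))⟩)

theorem muCocycles_apply {n : ℕ} (a : cocycles h.Ω D 0 n) :
    (hL.muCocycles fr hD nabla hflat n a).1 = mu D (a.1 ![]) := rfl

/-- The isomorphism given by `μ` from the operators with constant coefficients. -/
def muConst (n : ℕ) : constCoeff h.Ω n ≃ₗ[ℝ] L n :=
  LinearEquiv.ofBijective
    { toFun := fun P => ⟨mu D P.1, hL.mu_mem (h.exists_mem_of_constForm_mem P.2.1).choose_spec⟩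
      map_add' := fun a b => Subtype.ext (mu_add _ _)
      map_smul' := fun c a => Subtype.ext (mu_rsmul _ _) } (by
    constructor
    -- The closed operator with the values of P at y = 0 is killed by μ, hence zero. So P vanishes
    -- at y = 0 and, having constant coefficients, everywhere.
    · refine (injective_iff_map_eq_zero _).2 fun P hP => ?_
      obtain ⟨N, hN⟩ := h.exists_mem_of_constForm_mem P.2.1
      obtain ⟨P', hP', hcl, h1⟩ := fr.exists_closed (h.fibrewise n N) hD nabla hflat hN
      have h2 := hL.mu_injective hP' hcl ((mu_congr (mem_gr_one.1 h1)).trans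
        (congrArg Subtype.val hP))
      refine Subtype.ext (fr.constCoeff_ext (fun Z => ?_) (fun Z => map_zero _) fun s => ?_)
      · exact (Submodule.mem_iInf _).1 P.2.2 Z
      · rw [← mem_gr_one.1 h1 s, h2]; rfl
    · rintro ⟨Q, hQ⟩
      obtain ⟨N, P, hP, rfl⟩ := hL.mu_surjective hQ
      obtain ⟨h1, h2, h3⟩ := fr.sigma_spec (h.fibrewise n N) hP
      exact ⟨⟨sigma P, h.constForm_mem h1, (Submodule.mem_iInf _).2 h2⟩,
        Subtype.ext (mu_congr h3)⟩)

include hL fr hD nabla hflat in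
theorem isDGLAResolution : IsDGLAResolution D h.Ω br d L brC dC where
  extD_mem _ ha := h.extD_mem_formsIn hD nabla ha
  bracket_mem _ _ ha hb := h.formBracket_mem ha hb
  diff_mem _ ha := h.formDiff_mem ha
  extD_extD {q n} a ha := by
    obtain ⟨N, hN⟩ := mem_formsIn.1 ha
    exact Fedosov.extD_extD (h.fibrewise n N) hD nabla hflat hN
  acyclic := h.subsingleton_cohomology fr hD nabla hflat
  sigma_spec {n} P hP := by
    obtain ⟨N, hN⟩ := h.exists_mem_of_constForm_mem hP
    obtain ⟨h1, h2, h3⟩ := fr.sigma_spec (h.fibrewise n N) hN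
    exact ⟨⟨h.constForm_mem h1, (Submodule.mem_iInf _).2 h2⟩, h3, fun P₀ hP₀ h4 =>
      fr.constCoeff_ext (fun Z => (Submodule.mem_iInf _).1 hP₀.2 Z) h2 fun s => by rw [h4, h3]⟩
  cohomology_iso := by
    choose brH hbrH using h.exists_cohomology_bracket fr hD nabla hflat
    choose dH hdH using h.exists_cohomology_diff fr hD nabla hflat
    -- The isomorphism H⁰ → F⁰ is defined as μ⁻¹ ∘ μ through L, which makes it bijective at once. It
    -- is σ because μ only sees values at y = 0, and these are the same for P and σP.
    have key : ∀ {n} (u : Cohomology h.Ω D 0 n), hL.muConst fr hD nabla hflat n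
        (((cohomologyZeroEquiv D h.Ω n).trans ((hL.muCocycles fr hD nabla hflat n).trans
          (hL.muConst fr hD nabla hflat n).symm)) u) =
        hL.muCocycles fr hD nabla hflat n (cohomologyZeroEquiv D h.Ω n u) := fun u =>
      (hL.muConst fr hD nabla hflat _).apply_symm_apply _
    refine ⟨fun {q n q' n'} => brH q n q' n', fun {q n} => dH q n,
      fun n => (cohomologyZeroEquiv D h.Ω n).trans ((hL.muCocycles fr hD nabla hflat n).trans
        (hL.muConst fr hD nabla hflat n).symm), hL.muConst fr hD nabla hflat,
      fun a b => ⟨_, hbrH _ _ _ _ a b⟩, fun a => ⟨_, hdH _ _ a⟩, fun {n} a => ?_, fun P => rfl,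
      fun {n n'} u v => ?_, fun {n} u => ?_⟩
    · obtain ⟨N, hN, -⟩ := h.exists_mem_of_mem_cocycles a
      obtain ⟨h1, h2, h3⟩ := fr.sigma_spec (h.fibrewise n N) hN
      have h4 : (⟨sigma (a.1 ![]), h.constForm_mem h1, (Submodule.mem_iInf _).2 h2⟩ :
          constCoeff h.Ω n) = ((cohomologyZeroEquiv D h.Ω n).trans
          ((hL.muCocycles fr hD nabla hflat n).trans
          (hL.muConst fr hD nabla hflat n).symm)) (cls h.Ω D a) := by
        refine (hL.muConst fr hD nabla hflat n).injective ?_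
        rw [key, cohomologyZeroEquiv_cls]
        exact Subtype.ext (mu_congr h3)
      rw [← h4]
    · rw [key, key, key]
      obtain ⟨a, rfl⟩ := Submodule.Quotient.mk_surjective _ u
      obtain ⟨b, rfl⟩ := Submodule.Quotient.mk_surjective _ v
      obtain ⟨N, hN, hcl⟩ := h.exists_mem_of_mem_cocycles a
      obtain ⟨N', hN', hcl'⟩ := h.exists_mem_of_mem_cocycles b
      have h1 : brH 0 n 0 n' (cls h.Ω D a) (cls h.Ω D b) = _ := hbrH 0 n 0 n' a b
      change (hL.muCocycles fr hD nabla hflat (n + n' - 1) (cohomologyZeroEquiv D h.Ω _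
        (brH 0 n 0 n' (cls h.Ω D a) (cls h.Ω D b)))).1 = brC n n'
        (hL.muCocycles fr hD nabla hflat n (cohomologyZeroEquiv D h.Ω n (cls h.Ω D a))).1
        (hL.muCocycles fr hD nabla hflat n' (cohomologyZeroEquiv D h.Ω n' (cls h.Ω D b))).1
      rw [h1, cohomologyZeroEquiv_cls, cohomologyZeroEquiv_cls]
      refine (congrArg (fun a => (hL.muCocycles fr hD nabla hflat (n + n' - 1) a).1)
        (cohomologyZeroEquiv_cls D h.Ω _)).trans ?_
      rw [muCocycles_apply, muCocycles_apply, muCocycles_apply, cohomologyZeroEquiv_cls,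
        ← hL.mu_bracket hN hN' hcl hcl']
      exact congrArg _ (formBracket_zero _ _ _)
    · rw [key, key]
      obtain ⟨a, rfl⟩ := Submodule.Quotient.mk_surjective _ u
      obtain ⟨N, hN, hcl⟩ := h.exists_mem_of_mem_cocycles a
      have h1 : dH 0 n (cls h.Ω D a) = _ := hdH 0 n a
      change (hL.muCocycles fr hD nabla hflat (n + 1) (cohomologyZeroEquiv D h.Ω _
        (dH 0 n (cls h.Ω D a)))).1 = dC n
        (hL.muCocycles fr hD nabla hflat n (cohomologyZeroEquiv D h.Ω n (cls h.Ω D a))).1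
      rw [h1, cohomologyZeroEquiv_cls, cohomologyZeroEquiv_cls, muCocycles_apply, muCocycles_apply,
        ← hL.mu_diff hN hcl]
      simp only [formDiff, pow_zero, one_smul]
  cocycle_iso := by
    refine ⟨hL.muCocycles fr hD nabla hflat, fun {n} a => ?_, fun {n n'} a b =>
      ⟨h.formBracket_mem_cocycles nabla a b, ?_⟩, fun {n} a => ⟨h.formDiff_mem_cocycles hD a, ?_⟩⟩
    · obtain ⟨N, hN, -⟩ := h.exists_mem_of_mem_cocycles a
      exact (mu_congr (fr.sigma_spec (h.fibrewise n N) hN).2.2).symm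
    · obtain ⟨N, hN, hcl⟩ := h.exists_mem_of_mem_cocycles a
      obtain ⟨N', hN', hcl'⟩ := h.exists_mem_of_mem_cocycles b
      rw [muCocycles_apply, muCocycles_apply, muCocycles_apply, ← hL.mu_bracket hN hN' hcl hcl']
      exact congrArg _ (formBracket_zero _ _ _)
    · obtain ⟨N, hN, hcl⟩ := h.exists_mem_of_mem_cocycles a
      rw [muCocycles_apply, muCocycles_apply, ← hL.mu_diff hN hcl]
      simp only [formDiff, pow_zero, one_smul]

end IsResolvedBy

end IsFormDGLA

end Resolution

section Main

universe u

variable {C : Type u} [CommRing C] [Algebra ℝ C] {ι : Type*} [Fintype ι]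
  {D : VF C → SM C →ₗ[ℝ] SM C}

theorem Frame.isResolvedBy_schouten (fr : Frame C ι) (hD : IsConn D) (hfl : HasFlatLifts D) :
    (isFormDGLA_schouten C).IsResolvedBy D (polyVect ℝ C) (fun n n' => schouten (n + n' - 1))
      (fun _ _ => 0) where
  mu_mem hP := mu_mem_polyVect hD hfl hP
  mu_injective hP hcl h := fr.eq_zero_of_mu_eq_zero hD hfl (polyVect_le_polyDiffLE hP) hcl h
  mu_surjective {n Q} hQ := ⟨0, fr.liftVect Q, fr.liftVect_mem_polyVect hQ,
    fr.mu_liftVect hD hfl hQ⟩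
  mu_bracket {n N n' N' P Q} hP hQ hclP hclQ := by
    obtain ⟨e, he⟩ := exists_schoutenData.{u} n n'
    simp only [← he]
    exact mu_bracket hD hfl e (polyVect_le_multilinearOps hP) hclP
      (polyVect_le_multilinearOps hQ) hclQ
  mu_diff _ _ := funext fun _ => map_zero (atZeroHom C)

theorem Frame.isResolvedBy_gerstenhaber (fr : Frame C ι) (hD : IsConn D)
    (nabla : TorsionFreeConnection C) (hflat : ∀ X Y, curvature D X Y = 0) :
    (isFormDGLA_gerstenhaber C).IsResolvedBy D (polyDiff ℝ C)
      (fun n n' => gerstenhaber (n + n' - 1)) (fun _ => hochschild) where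
  mu_mem {n N P} hP := ⟨N, mu_mem_polyDiffLE hD (fr.hasFlatLifts hD nabla hflat) hP⟩
  mu_injective hP hcl h :=
    fr.eq_zero_of_mu_eq_zero hD (fr.hasFlatLifts hD nabla hflat) hP hcl h
  mu_surjective := by
    rintro n Q ⟨N, hm, hQ⟩
    exact fr.mem_muRange hD (fr.hasFlatLifts hD nabla hflat) nabla hflat _ (fun _ => N) rfl hm hQ
  mu_bracket {n N n' N' P Q} hP hQ hclP hclQ := by
    obtain ⟨e, he⟩ := exists_gerstenhaberData.{u} n n'
    simp only [← he]
    exact mu_bracket hD (fr.hasFlatLifts hD nabla hflat) e hP.1 hclP hQ.1 hclQ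
  mu_diff hP hcl := mu_hochschild hD (fr.hasFlatLifts hD nabla hflat) hP.1 hcl

/-- Fedosov resolutions over an algebra with a frame. -/
theorem Frame.fedosov_resolution (fr : Frame C ι) (nabla : TorsionFreeConnection C)
    (A : OneForm C) (hA : IsAdmissible A) :
    (SolvesFedosovEquation nabla A → ∀ X Y, curvature (fedosovD nabla A) X Y = 0) ∧
    ((∀ X Y, curvature (fedosovD nabla A) X Y = 0) →
      HasFlatLifts (fedosovD nabla A) ∧
      IsDGLAResolution (fedosovD nabla A) (formsT C)
        (fun n n' => schouten (n + n' - 1)) (fun _ _ => 0) (polyVect ℝ C)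
        (fun n n' => schouten (n + n' - 1)) (fun _ _ => 0) ∧
      IsDGLAResolution (fedosovD nabla A) (formsD C)
        (fun n n' => gerstenhaber (n + n' - 1)) (fun _ => hochschild) (polyDiff ℝ C)
        (fun n n' => gerstenhaber (n + n' - 1)) (fun _ => hochschild)) := by
  have hD := fr.isConn nabla hA
  refine ⟨fun h => fr.curvature_eq_zero nabla hA h, fun hflat => ?_⟩
  have hfl := fr.hasFlatLifts hD nabla hflat
  exact ⟨hfl, (fr.isResolvedBy_schouten hD hfl).isDGLAResolution fr hD nabla hflat,
    (fr.isResolvedBy_gerstenhaber hD nabla hflat).isDGLAResolution fr hD nabla hflat⟩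

end Main

end Fedosov

end

/-! ### Analytic tools: Hadamard's lemma and the pseudo-inverse. -/

noncomputable section

namespace Fedosov

section Hadamard

open MeasureTheory Set Filter Topology

variable {E F : Type*} [NormedAddCommGroup E] [NormedSpace ℝ E]
  [NormedAddCommGroup F] [NormedSpace ℝ F] [CompleteSpace F]

/-- Integrals over `[0, 1]` depend smoothly on parameters. -/
theorem contDiff_integral_param {G : E → ℝ → F}
    (hG : ContDiff ℝ ∞ fun q : E × ℝ => G q.1 q.2) :
    ContDiff ℝ ∞ fun u => ∫ t in (0 : ℝ)..1, G u t := by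
  -- The integral is the convolution, at 0, of the indicator φ of [−1, 0] with t ↦ G u t. The
  -- cut-off β equals 1 on [−2, 2], so it does not alter the integral over [0, 1], and it supplies
  -- the compact support that smoothness of a convolution requires.
  let β : ContDiffBump (0 : ℝ) := ⟨2, 3, by norm_num, by norm_num⟩
  let φ : ℝ → ℝ := indicator (Icc (-1) 0) fun _ => 1
  let g : E → ℝ → F := fun u t => β t • G u t
  have hg : ContDiffOn ℝ ∞ ↿g (univ ×ˢ univ) :=
    ((β.contDiff.comp contDiff_snd).smul hG).contDiffOn
  have hφ : LocallyIntegrable φ volume :=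
    ((integrable_indicator_iff measurableSet_Icc).2
      (integrableOn_const (by simp))).locallyIntegrable
  have key := contDiffOn_convolution_right_with_param (𝕜 := ℝ) (μ := volume) (n := ⊤) (f := φ)
    (ContinuousLinearMap.lsmul ℝ ℝ : ℝ →L[ℝ] F →L[ℝ] F) (g := g) isOpen_univ
    (isCompact_closedBall (0 : ℝ) 3)
    (fun u t _ ht => by
      have : β t = 0 := β.zero_of_le_dist (not_le.1 ht).le
      simp [g, this]) hφ hg
  rw [univ_prod_univ, contDiffOn_univ] at key
  convert key.comp (contDiff_id.prodMk (contDiff_const (c := (0 : ℝ)))) using 1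
  ext1 u
  have hint : ∀ t, φ t • (β (0 - t) • G u (0 - t)) =
      indicator (Icc (-1) 0) (fun t => G u (0 - t)) t := by
    intro t
    by_cases ht : t ∈ Icc (-1 : ℝ) 0
    · have : β (0 - t) = 1 := β.one_of_mem_closedBall (by
        rw [Metric.mem_closedBall, dist_zero_right, Real.norm_eq_abs, abs_le]
        change -2 ≤ 0 - t ∧ 0 - t ≤ 2
        constructor <;> linarith [ht.1, ht.2])
      rw [this]; simp [φ, indicator_of_mem ht]
    · simp [φ, indicator_of_notMem ht]
  simp only [Function.comp_apply, id, convolution_def, ContinuousLinearMap.lsmul_apply, g, hint]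
  rw [integral_indicator measurableSet_Icc, integral_Icc_eq_integral_Ioc,
    ← intervalIntegral.integral_of_le (by norm_num),
    intervalIntegral.integral_comp_sub_left (fun t => G u t)]
  norm_num

/-- Hadamard's lemma. -/
theorem exists_contDiff_sub_eq (g : E → F) (hg : ContDiff ℝ ∞ g) (c : E) :
    ∃ D : E → E →L[ℝ] F, ContDiff ℝ ∞ D ∧ D c = fderiv ℝ g c ∧
      ∀ u, g u - g c = D u (u - c) := by
  have hg' : ContDiff ℝ ∞ (fderiv ℝ g) := hg.fderiv_right (by simp)
  have hl : ContDiff ℝ ∞ fun q : E × ℝ => c + q.2 • (q.1 - c) := by fun_prop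
  refine ⟨fun u => ∫ t in (0 : ℝ)..1, fderiv ℝ g (c + t • (u - c)),
    contDiff_integral_param (hg'.comp hl), by simp, fun u => ?_⟩
  have hcont : Continuous fun t : ℝ => fderiv ℝ g (c + t • (u - c)) :=
    hg'.continuous.comp (by fun_prop)
  rw [ContinuousLinearMap.intervalIntegral_apply (hcont.intervalIntegrable _ _)]
  have := intervalIntegral.integral_eq_sub_of_hasDerivAt (a := 0) (b := 1)
    (f := fun t : ℝ => g (c + t • (u - c)))
    (f' := fun t : ℝ => fderiv ℝ g (c + t • (u - c)) (u - c))
    (fun t _ => by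
      have h1 : HasDerivAt (fun t : ℝ => c + t • (u - c)) (u - c) t := by
        simpa using ((hasDerivAt_id t).smul_const (u - c)).const_add c
      exact ((hg.differentiable (by simp)) _).hasFDerivAt.comp_hasDerivAt t h1)
    ((hcont.clm_apply continuous_const).intervalIntegrable _ _)
  rw [this]; simp

end Hadamard

section PseudoInverse

open ContinuousLinearMap Topology

variable {E F : Type*} [NormedAddCommGroup E] [InnerProductSpace ℝ E] [FiniteDimensional ℝ E]
  [CompleteSpace E] [NormedAddCommGroup F] [InnerProductSpace ℝ F] [CompleteSpace F]

/-- The Moore–Penrose inverse of an injective linear map. -/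
def pseudoInverse (J : E →L[ℝ] F) : F →L[ℝ] E :=
  (adjoint J ∘L J).inverse ∘L adjoint J

theorem isInvertible_adjoint_comp_self {J : E →L[ℝ] F}
    (hJ : Function.Injective J) : (adjoint J ∘L J).IsInvertible := by
  have h : Function.Injective (adjoint J ∘L J : E →L[ℝ] E) :=
    (adjoint_comp_self_injective_iff J).2 hJ
  exact ⟨(LinearEquiv.ofInjectiveEndo (adjoint J ∘L J : E →L[ℝ] E).toLinearMap h).toContinuousLinearEquiv,
    by ext; rfl⟩

theorem pseudoInverse_comp_self {J : E →L[ℝ] F} (hJ : Function.Injective J) (v : E) :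
    pseudoInverse J (J v) = v := by
  obtain ⟨e, he⟩ := isInvertible_adjoint_comp_self hJ
  have : pseudoInverse J (J v) = (adjoint J ∘L J).inverse ((adjoint J ∘L J) v) := rfl
  rw [this, ← he]
  simp

/-- The vector v = J⁺w solves the normal equation J*J v = J*w, which does not depend on the
coordinates on E. This makes tangential projections independent of charts. -/
theorem pseudoInverse_comp_equiv {J : E →L[ℝ] F} (hJ : Function.Injective J) (a : E ≃L[ℝ] E)
    (w : F) : a (pseudoInverse (J ∘L (a : E →L[ℝ] E)) w) = pseudoInverse J w := by
  obtain ⟨e, he⟩ := isInvertible_adjoint_comp_self hJ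
  obtain ⟨e', he'⟩ := isInvertible_adjoint_comp_self (J := J ∘L (a : E →L[ℝ] E))
    (hJ.comp a.injective)
  simp only [pseudoInverse, ← he, ← he', comp_apply, inverse_equiv,
    ContinuousLinearEquiv.coe_coe]
  rw [ContinuousLinearEquiv.eq_symm_apply, ← ContinuousLinearEquiv.coe_coe e, he]
  have h := e'.apply_symm_apply (adjoint (J ∘L (a : E →L[ℝ] E)) w)
  rw [← ContinuousLinearEquiv.coe_coe e', he', adjoint_comp] at h
  have ha : Function.Injective (adjoint (a : E →L[ℝ] E)) := by
    refine Function.LeftInverse.injective (g := adjoint (a.symm : E →L[ℝ] E)) fun v => ?_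
    rw [← comp_apply, ← adjoint_comp]
    rw [ContinuousLinearEquiv.coe_comp_coe_symm, ← adjoint_id]
    simp
  apply ha
  simpa using h

theorem contDiffAt_pseudoInverse {J : E →L[ℝ] F} (hJ : Function.Injective J) :
    ContDiffAt ℝ ∞ (pseudoInverse (E := E) (F := F)) J := by
  have hadj : ContDiff ℝ ∞ fun J : E →L[ℝ] F => adjoint J := by
    have : IsBoundedLinearMap ℝ fun J : E →L[ℝ] F => adjoint J :=
      ⟨⟨fun _ _ => map_add _ _ _, fun c J => by simp⟩, 1, one_pos, fun J => by simp⟩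
    exact this.contDiff
  obtain ⟨e, he⟩ := isInvertible_adjoint_comp_self hJ
  have h1 : ContDiffAt ℝ ∞ (inverse : (E →L[ℝ] E) → (E →L[ℝ] E)) (adjoint J ∘L J) := by
    rw [← he]; exact contDiffAt_map_inverse e
  have h2 : ContDiff ℝ ∞ fun J : E →L[ℝ] F => adjoint J ∘L J := hadj.clm_comp contDiff_id
  exact (ContDiffAt.comp (f := fun J => adjoint J ∘L J) J h1 h2.contDiffAt).clm_comp hadj.contDiffAt

end PseudoInverse

end Fedosov

end

/-! ### Derivations of the algebra of smooth functions are tangent vectors. -/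

noncomputable section

namespace Fedosov

section TangentVectors

open Set Filter Topology

variable {E : Type*} [NormedAddCommGroup E] [InnerProductSpace ℝ E] [FiniteDimensional ℝ E]
  {M : Type*} [TopologicalSpace M] [T2Space M] [ChartedSpace E M] [IsManifold 𝓘(ℝ, E) ∞ M]

/-- The derivative of `f` at `p` in the preferred chart at `p`. -/
def chartDeriv {F : Type*} [NormedAddCommGroup F] [NormedSpace ℝ F] (f : M → F) (p : M) :
    E →L[ℝ] F :=
  fderiv ℝ (f ∘ (extChartAt 𝓘(ℝ, E) p).symm) (extChartAt 𝓘(ℝ, E) p p)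

theorem chartDeriv_eq_mfderiv {F : Type*} [NormedAddCommGroup F] [NormedSpace ℝ F]
    {f : M → F} {p : M} (hf : MDifferentiableAt 𝓘(ℝ, E) 𝓘(ℝ, F) f p) :
    (chartDeriv f p : E →L[ℝ] F) = mfderiv 𝓘(ℝ, E) 𝓘(ℝ, F) f p := by
  rw [hf.mfderiv]
  simp only [ModelWithCorners.range_eq_univ, fderivWithin_univ]
  rfl

theorem contDiffAt_comp_symm {F : Type*} [NormedAddCommGroup F] [NormedSpace ℝ F]
    {f : M → F} (hf : ContMDiff 𝓘(ℝ, E) 𝓘(ℝ, F) ∞ f) (p : M) {u : E}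
    (hu : u ∈ (extChartAt 𝓘(ℝ, E) p).target) :
    ContDiffAt ℝ ∞ (f ∘ (extChartAt 𝓘(ℝ, E) p).symm) u := by
  rw [← contMDiffAt_iff_contDiffAt]
  exact hf.contMDiffAt.comp u ((contMDiffOn_extChartAt_symm p).contMDiffAt
    ((isOpen_extChartAt_target p).mem_nhds hu))

/-- Derivations of the algebra of smooth functions are vector fields. -/
theorem exists_apply_eq_chartDeriv (X : VF C^∞⟮𝓘(ℝ, E), M; ℝ⟯) (p : M) :
    ∃ v : E, ∀ f : C^∞⟮𝓘(ℝ, E), M; ℝ⟯, X f p = chartDeriv f p v := by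
  classical
  obtain ⟨χ⟩ : Nonempty (SmoothBumpFunction 𝓘(ℝ, E) p) := inferInstance
  let φ := extChartAt 𝓘(ℝ, E) p
  let c := φ p
  let ρ : E → ℝ := χ.toContDiffBump
  let b := Module.finBasis ℝ E
  have hφ : ContMDiffOn 𝓘(ℝ, E) 𝓘(ℝ, E) ∞ φ (chartAt E p).source := contMDiffOn_extChartAt
  let l (i) : E →L[ℝ] ℝ := LinearMap.toContinuousLinearMap (b.coord i)
  let ξ (i) : C^∞⟮𝓘(ℝ, E), M; ℝ⟯ := ⟨fun q => χ q • l i (φ q - c), χ.contMDiff_smul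
    ((l i).contMDiff.comp_contMDiffOn (hφ.sub contMDiffOn_const))⟩
  let χ' : C^∞⟮𝓘(ℝ, E), M; ℝ⟯ := ⟨χ, χ.contMDiff⟩
  have key : ∀ f : C^∞⟮𝓘(ℝ, E), M; ℝ⟯, X χ' p * f p + X f p =
      fderiv ℝ (fun u => ρ u * f (φ.symm u)) c (∑ i, X (ξ i) p • b i) := by
    intro f
    have hg : ContDiff ℝ ∞ fun u => ρ u * f (φ.symm u) := by
      refine contDiff_iff_contDiffAt.2 fun u => ?_
      by_cases hu : u ∈ tsupport ρ
      · have hu' : u ∈ φ.target := by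
          have h := χ.closedBall_subset
          rw [ModelWithCorners.range_eq_univ, inter_univ] at h
          exact h (by rwa [ContDiffBump.tsupport_eq] at hu)
        exact χ.toContDiffBump.contDiffAt.mul (contDiffAt_comp_symm f.contMDiff p hu')
      · refine contDiffAt_const (c := (0 : ℝ)).congr_of_eventuallyEq ?_
        filter_upwards [(isClosed_tsupport ρ).isOpen_compl.mem_nhds hu] with w hw
        rw [image_eq_zero_of_notMem_tsupport hw, zero_mul]
    obtain ⟨D, hD, hDc, hDu⟩ := exists_contDiff_sub_eq _ hg c
    let η (i) : C^∞⟮𝓘(ℝ, E), M; ℝ⟯ := ⟨fun q => χ q • D (φ q) (b i), χ.contMDiff_smul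
      ((hD.clm_apply contDiff_const).contMDiff.comp_contMDiffOn hφ)⟩
    have hρ : ρ c = 1 := χ.toContDiffBump.one_of_mem_closedBall
      (Metric.mem_closedBall_self χ.rIn_pos.le)
    have hχ : χ' p = 1 := χ.eq_one
    have hp : φ.symm c = p := extChartAt_to_inv p
    -- Hadamard's lemma for f in the chart, multiplied by cut-offs so that all factors are global
    -- smooth functions; outside the chart both sides vanish. At p the factors ξ vanish and η are
    -- the partial derivatives, so applying X gives `key`.
    have hsum : χ' * χ' * (χ' * f) - f p • (χ' * χ') = ∑ i, η i * ξ i := by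
      ext q
      have hs : (∑ i, η i * ξ i) q = ∑ i, η i q * ξ i q :=
        map_sum (ContMDiffMap.evalRingHom q) (fun i => η i * ξ i) Finset.univ
      rw [hs]
      change χ q * χ q * (χ q * f q) - f p * (χ q * χ q) =
        ∑ i, χ q * D (φ q) (b i) * (χ q * b.coord i (φ q - c))
      by_cases hq : q ∈ (chartAt E p).source
      · have h1 := hDu (φ q)
        have h2 : φ.symm (φ q) = q := φ.left_inv (by simpa [φ] using hq)
        have h3 : χ q = ρ (φ q) := χ.eqOn_source hq
        rw [hp, hρ, h2, ← h3] at h1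
        have h4 : D (φ q) (φ q - c) = ∑ i, b.coord i (φ q - c) * D (φ q) (b i) := by
          conv_lhs => rw [← b.sum_repr (φ q - c), map_sum]
          simp
        calc _ = χ q * χ q * (χ q * f q - 1 * f p) := by ring
          _ = _ := by
            rw [h1, h4, Finset.mul_sum]
            exact Finset.sum_congr rfl fun i _ => by ring
      · have : χ q = 0 := by
          by_contra h
          exact hq (χ.support_subset_source h)
        simp [this]
    have hX := congrArg (fun h => X h p) hsum
    have hXs : X (∑ i, η i * ξ i) p = ∑ i, X (η i * ξ i) p := by
      rw [map_sum]
      exact map_sum (ContMDiffMap.evalRingHom p) (fun i => X (η i * ξ i)) Finset.univ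
    have hX2 (g h : C^∞⟮𝓘(ℝ, E), M; ℝ⟯) : X (g * h) p = g p * X h p + h p * X g p := by
      rw [X.leibniz]; rfl
    have hX3 (h : C^∞⟮𝓘(ℝ, E), M; ℝ⟯) (r : ℝ) : X (r • h) p = r * X h p := by
      rw [X.map_smul]; rfl
    have hX4 (g h : C^∞⟮𝓘(ℝ, E), M; ℝ⟯) : X (g - h) p = X g p - X h p := by
      rw [map_sub]; rfl
    have hm (g h : C^∞⟮𝓘(ℝ, E), M; ℝ⟯) : (g * h) p = g p * h p := rfl
    have hξ (i) : ξ i p = 0 := by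
      change χ p * b.coord i (c - c) = 0
      simp
    have hη (i) : η i p = D c (b i) := by
      change χ p * D c (b i) = D c (b i)
      rw [χ.eq_one, one_mul]
    simp only [hXs, hX2, hX3, hX4, hm, hξ, hη, hχ] at hX
    rw [← hDc, map_sum]
    simp only [map_smul, smul_eq_mul]
    calc _ = _ := by linear_combination hX
      _ = _ := Finset.sum_congr rfl fun i _ => by ring
  have hρ : ρ =ᶠ[𝓝 c] fun _ => 1 := χ.toContDiffBump.eventuallyEq_one
  refine ⟨∑ i, X (ξ i) p • b i, fun f => ?_⟩
  -- The constant function 1 shows that X kills the bump function at p, which removes the unwanted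
  -- term from `key`.
  have h1 := key 1
  have h2 : (fun u => ρ u * (1 : C^∞⟮𝓘(ℝ, E), M; ℝ⟯) (φ.symm u)) =ᶠ[𝓝 c] fun _ => 1 := by
    filter_upwards [hρ] with u hu
    rw [hu]; exact one_mul _
  rw [h2.fderiv_eq, X.map_one_eq_zero] at h1
  have h3 : X χ' p = 0 := by simpa using h1
  have h4 := key f
  rw [h3, zero_mul, zero_add] at h4
  rw [h4, chartDeriv]
  refine congrArg (fun L : E →L[ℝ] ℝ => L _) (Filter.EventuallyEq.fderiv_eq ?_)
  filter_upwards [hρ] with u hu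
  rw [hu, one_mul]; rfl

end TangentVectors

end Fedosov

end

/-! ### From an immersion to a frame. -/

noncomputable section

namespace Fedosov

section Immersion

open Set Filter Topology

variable {E : Type*} [NormedAddCommGroup E] [InnerProductSpace ℝ E] [FiniteDimensional ℝ E]
  {M : Type*} [TopologicalSpace M] [T2Space M] [ChartedSpace E M] [IsManifold 𝓘(ℝ, E) ∞ M]

theorem differentiableAt_comp_symm {F : Type*} [NormedAddCommGroup F] [NormedSpace ℝ F]
    {f : M → F} (hf : ContMDiff 𝓘(ℝ, E) 𝓘(ℝ, F) ∞ f) {p q : M} (hq : q ∈ (chartAt E p).source) :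
    DifferentiableAt ℝ (f ∘ (extChartAt 𝓘(ℝ, E) p).symm) (extChartAt 𝓘(ℝ, E) p q) :=
  (contDiffAt_comp_symm hf p ((extChartAt 𝓘(ℝ, E) p).map_source (by simpa using hq))).differentiableAt
    (by simp)

/-- `chartDeriv` changes chart from point to point. Near p the chart at p can be used throughout, at
the cost of a linear isomorphism that does not depend on the map f. -/
theorem exists_chartDeriv_eq_comp {p q : M} (hq : q ∈ (chartAt E p).source) :
    ∃ a : E ≃L[ℝ] E, ∀ {F : Type} [NormedAddCommGroup F] [NormedSpace ℝ F] {f : M → F},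
      ContMDiff 𝓘(ℝ, E) 𝓘(ℝ, F) ∞ f → chartDeriv f q =
        fderiv ℝ (f ∘ (extChartAt 𝓘(ℝ, E) p).symm) (extChartAt 𝓘(ℝ, E) p q) ∘L
          (a : E →L[ℝ] E) := by
  have hq' : q ∈ (extChartAt 𝓘(ℝ, E) p).source := by simpa using hq
  obtain ⟨a, ha⟩ := isInvertible_mfderiv_extChartAt hq'
  refine ⟨a, fun {F} _ _ {f} hf => ?_⟩
  have h1 : f =ᶠ[𝓝 q] (f ∘ (extChartAt 𝓘(ℝ, E) p).symm) ∘ extChartAt 𝓘(ℝ, E) p := by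
    filter_upwards [(chartAt E p).open_source.mem_nhds hq] with w hw
    have : (extChartAt 𝓘(ℝ, E) p).symm (extChartAt 𝓘(ℝ, E) p w) = w :=
      (extChartAt 𝓘(ℝ, E) p).left_inv (by simpa using hw)
    rw [Function.comp_apply, Function.comp_apply, this]
  change (chartDeriv f q : E →L[ℝ] F) = _
  rw [chartDeriv_eq_mfderiv (hf.mdifferentiableAt (by simp)), h1.mfderiv_eq,
    mfderiv_comp q (differentiableAt_comp_symm hf hq).mdifferentiableAt
      ((contMDiffAt_extChartAt' hq).mdifferentiableAt (n := ∞) (by simp)), mfderiv_eq_fderiv, ← ha]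
  rfl

variable {F : Type} [NormedAddCommGroup F] [InnerProductSpace ℝ F]
  [CompleteSpace E] [CompleteSpace F]

/-- The derivative of `f` along the tangential component of the vector `w`. -/
def tangentialDerivative (x : M → F) (w : F) (f : M → ℝ) (p : M) : ℝ :=
  chartDeriv f p (pseudoInverse (chartDeriv (E := E) x p) w)

theorem tangentialDerivative_eq {x : M → F} (hx : ContMDiff 𝓘(ℝ, E) 𝓘(ℝ, F) ∞ x)
    (hinj : ∀ p, Function.Injective (chartDeriv (E := E) x p)) (w : F)
    {f : M → ℝ} (hf : ContMDiff 𝓘(ℝ, E) 𝓘(ℝ, ℝ) ∞ f) {p q : M}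
    (hq : q ∈ (chartAt E p).source) :
    tangentialDerivative (E := E) x w f q =
      fderiv ℝ (f ∘ (extChartAt 𝓘(ℝ, E) p).symm) (extChartAt 𝓘(ℝ, E) p q)
        (pseudoInverse (fderiv ℝ (x ∘ (extChartAt 𝓘(ℝ, E) p).symm)
          (extChartAt 𝓘(ℝ, E) p q)) w) := by
  obtain ⟨a, ha⟩ := exists_chartDeriv_eq_comp hq
  have h2 : Function.Injective
      (fderiv ℝ (x ∘ (extChartAt 𝓘(ℝ, E) p).symm) (extChartAt 𝓘(ℝ, E) p q)) := by
    have h := hinj q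
    rw [ha hx, ContinuousLinearMap.coe_comp] at h
    exact (Function.Injective.of_comp_iff' _ a.bijective).1 h
  rw [tangentialDerivative, ha hf, ha hx, ContinuousLinearMap.comp_apply]
  congr 1
  exact pseudoInverse_comp_equiv h2 a w

theorem contMDiff_tangentialDerivative {x : M → F} (hx : ContMDiff 𝓘(ℝ, E) 𝓘(ℝ, F) ∞ x)
    (hinj : ∀ p, Function.Injective (chartDeriv (E := E) x p)) (w : F)
    {f : M → ℝ} (hf : ContMDiff 𝓘(ℝ, E) 𝓘(ℝ, ℝ) ∞ f) :
    ContMDiff 𝓘(ℝ, E) 𝓘(ℝ, ℝ) ∞ (tangentialDerivative (E := E) x w f) := by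
  intro p
  have hp := mem_extChartAt_target (I := 𝓘(ℝ, E)) p
  have hJ : ContDiffAt ℝ ∞ (fderiv ℝ (x ∘ (extChartAt 𝓘(ℝ, E) p).symm))
      (extChartAt 𝓘(ℝ, E) p p) := (contDiffAt_comp_symm hx p hp).fderiv_right (by simp)
  have hP := ContDiffAt.comp (f := fderiv ℝ (x ∘ (extChartAt 𝓘(ℝ, E) p).symm)) _
    (contDiffAt_pseudoInverse (hinj p)) hJ
  have h := ((contDiffAt_comp_symm hf p hp).fderiv_right (m := ∞) (by simp)).clm_apply
    (hP.clm_apply (contDiffAt_const (c := w)))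
  refine (h.contMDiffAt.comp p (contMDiffAt_extChartAt (n := ∞))).congr_of_eventuallyEq ?_
  filter_upwards [(chartAt E p).open_source.mem_nhds (mem_chart_source E p)] with q hq
  exact tangentialDerivative_eq hx hinj w hf hq

/-- An immersion into a Euclidean space gives a frame. -/
theorem nonempty_frame_of_immersion {N : ℕ} {x : M → EuclideanSpace ℝ (Fin N)}
    (hx : ContMDiff 𝓘(ℝ, E) 𝓘(ℝ, EuclideanSpace ℝ (Fin N)) ∞ x)
    (hinj : ∀ p, Function.Injective (chartDeriv (E := E) x p)) :
    Nonempty (Frame C^∞⟮𝓘(ℝ, E), M; ℝ⟯ (Fin N)) := by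
  let ε (i : Fin N) : EuclideanSpace ℝ (Fin N) := EuclideanSpace.single i 1
  have hd (f : C^∞⟮𝓘(ℝ, E), M; ℝ⟯) (p : M) :
      DifferentiableAt ℝ (f ∘ (extChartAt 𝓘(ℝ, E) p).symm) (extChartAt 𝓘(ℝ, E) p p) :=
    differentiableAt_comp_symm f.contMDiff (mem_chart_source E p)
  -- The field eᵢ is the tangential part of the i-th basis vector. For v tangent, J⁺(Jv) = v, and
  -- expanding Jv in the standard basis gives the frame identity.
  let e (i : Fin N) : VF C^∞⟮𝓘(ℝ, E), M; ℝ⟯ := Derivation.mk'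
    { toFun := fun f => ⟨tangentialDerivative (E := E) x (ε i) f,
        contMDiff_tangentialDerivative hx hinj _ f.contMDiff⟩
      map_add' := fun f g => by
        ext p
        exact congrArg (fun L : E →L[ℝ] ℝ => L _) (fderiv_add (hd f p) (hd g p))
      map_smul' := fun r f => by
        ext p
        exact congrArg (fun L : E →L[ℝ] ℝ => L _) (fderiv_const_smul (hd f p) r) }
    fun f g => by
      ext p
      refine (congrArg (fun L : E →L[ℝ] ℝ => L _) (fderiv_mul (hd f p) (hd g p))).trans ?_
      simp only [Function.comp_apply, extChartAt_to_inv]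
      rfl
  let c (i : Fin N) : EuclideanSpace ℝ (Fin N) →L[ℝ] ℝ := EuclideanSpace.proj i
  let ξ (i : Fin N) : C^∞⟮𝓘(ℝ, E), M; ℝ⟯ := ⟨fun p => c i (x p), (c i).contMDiff.comp hx⟩
  refine ⟨⟨e, ξ, fun X => ?_⟩⟩
  ext f p
  obtain ⟨v, hv⟩ := exists_apply_eq_chartDeriv X p
  have h1 (i) : X (ξ i) p = chartDeriv (E := E) x p v i := by
    rw [hv]
    exact congrArg (fun L : E →L[ℝ] ℝ => L v) ((c i).hasFDerivAt.comp _
      (differentiableAt_comp_symm hx (mem_chart_source E p)).hasFDerivAt).fderiv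
  have h2 : (∑ i, X (ξ i) • e i) f p =
      ∑ i, X (ξ i) p * chartDeriv f p (pseudoInverse (chartDeriv (E := E) x p) (ε i)) := by
    rw [← Derivation.coeFnAddMonoidHom_apply, map_sum, Finset.sum_apply]
    exact map_sum (ContMDiffMap.evalRingHom p) (fun i => (X (ξ i) • e i) f) Finset.univ
  have h3 : chartDeriv (E := E) x p v = ∑ i, chartDeriv (E := E) x p v i • ε i := by
    ext j
    simp [ε, Pi.single_apply]
  rw [h2, hv]
  conv_rhs => rw [← pseudoInverse_comp_self (hinj p) v, h3]
  simp [h1]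

end Immersion

end Fedosov

end

/-! ### Existence of an immersion into a Euclidean space. -/

noncomputable section

namespace Fedosov

section Whitney

open Set Filter Topology Module

variable {E : Type} [NormedAddCommGroup E] [InnerProductSpace ℝ E] [FiniteDimensional ℝ E]
  {M : Type*} [TopologicalSpace M] [T2Space M] [ChartedSpace E M] [IsManifold 𝓘(ℝ, E) ∞ M]

theorem chartDeriv_clm_comp {F G : Type*} [NormedAddCommGroup F] [NormedSpace ℝ F]
    [NormedAddCommGroup G] [NormedSpace ℝ G] (L : F →L[ℝ] G) {x : M → F}
    (hx : ContMDiff 𝓘(ℝ, E) 𝓘(ℝ, F) ∞ x) (p : M) :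
    chartDeriv (fun q => L (x q)) p = L ∘L chartDeriv (E := E) x p :=
  (L.hasFDerivAt.comp _ (differentiableAt_comp_symm hx (mem_chart_source E p)).hasFDerivAt).fderiv

theorem chartDeriv_congr {F : Type*} [NormedAddCommGroup F] [NormedSpace ℝ F] {f g : M → F}
    {p : M} (h : f =ᶠ[𝓝 p] g) : chartDeriv (E := E) f p = chartDeriv g p := by
  refine Filter.EventuallyEq.fderiv_eq ?_
  have : Tendsto (extChartAt 𝓘(ℝ, E) p).symm (𝓝 (extChartAt 𝓘(ℝ, E) p p)) (𝓝 p) := by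
    have := (continuousAt_extChartAt_symm (I := 𝓘(ℝ, E)) p).tendsto
    rwa [extChartAt_to_inv] at this
  exact this.eventually h

/-- The tangent directions form a countable union of locally Lipschitz images of sets in E × E, one
for each chart of a countable cover. -/
theorem dimH_range_chartDeriv_le [SecondCountableTopology M] {F : Type} [NormedAddCommGroup F]
    [NormedSpace ℝ F] {x : M → F} (hx : ContMDiff 𝓘(ℝ, E) 𝓘(ℝ, F) ∞ x) :
    dimH {w | ∃ p v, chartDeriv (E := E) x p v = w} ≤ (2 * finrank ℝ E : ℕ) := by
  obtain ⟨s, hs, hcov⟩ := TopologicalSpace.countable_cover_nhds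
    fun p : M => (chartAt E p).open_source.mem_nhds (mem_chart_source E p)
  let Φ (k : M) (u : E × E) : F := fderiv ℝ (x ∘ (extChartAt 𝓘(ℝ, E) k).symm) u.1 u.2
  have hsub : {w | ∃ p v, chartDeriv (E := E) x p v = w} ⊆
      ⋃ k ∈ s, Φ k '' ((extChartAt 𝓘(ℝ, E) k).target ×ˢ univ) := by
    rintro _ ⟨p, v, rfl⟩
    obtain ⟨k, hk, hp⟩ := mem_iUnion₂.1 (hcov.ge (mem_univ p))
    obtain ⟨a, ha⟩ := exists_chartDeriv_eq_comp hp
    refine mem_iUnion₂.2 ⟨k, hk, (extChartAt 𝓘(ℝ, E) k p, a v), ⟨?_, mem_univ _⟩, ?_⟩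
    · exact (extChartAt 𝓘(ℝ, E) k).map_source (by simpa using hp)
    · rw [ha hx]; rfl
  refine (dimH_mono hsub).trans ?_
  rw [dimH_bUnion hs]
  refine iSup₂_le fun k _ => (dimH_image_le_of_locally_lipschitzOn fun u hu => ?_).trans
    ((dimH_mono (subset_univ _)).trans ?_)
  · have h : ContDiffAt ℝ ∞ (fderiv ℝ (x ∘ (extChartAt 𝓘(ℝ, E) k).symm)) u.1 :=
      (contDiffAt_comp_symm hx k hu.1).fderiv_right (by simp)
    have h' : ContDiffAt ℝ 1 (Φ k) u :=
      ((h.comp u contDiffAt_fst).clm_apply contDiffAt_snd).of_le (by simp)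
    obtain ⟨C, t, ht, hC⟩ := h'.exists_lipschitzOnWith
    exact ⟨C, t, mem_nhdsWithin_of_mem_nhds ht, hC⟩
  · rw [Real.dimH_univ_eq_finrank, finrank_prod, two_mul]

theorem exists_clm_ker_le_span {n : ℕ} {w : EuclideanSpace ℝ (Fin (n + 1))} (hw : w ≠ 0) :
    ∃ T : EuclideanSpace ℝ (Fin (n + 1)) →L[ℝ] EuclideanSpace ℝ (Fin n),
      ∀ z, T z = 0 → ∃ c : ℝ, c • w = z := by
  have hn : finrank ℝ (EuclideanSpace ℝ (Fin (n + 1)) ⧸ Submodule.span ℝ {w}) =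
      finrank ℝ (EuclideanSpace ℝ (Fin n)) := by
    have h := Submodule.finrank_quotient_add_finrank (Submodule.span ℝ {w})
    rw [finrank_span_singleton hw, finrank_euclideanSpace_fin] at h
    rw [finrank_euclideanSpace_fin]
    omega
  refine ⟨LinearMap.toContinuousLinearMap
    ((LinearEquiv.ofFinrankEq _ _ hn).toLinearMap ∘ₗ (Submodule.span ℝ {w}).mkQ), fun z hz => ?_⟩
  have : (Submodule.span ℝ {w}).mkQ z = 0 := by simpa using hz
  rw [Submodule.mkQ_apply, Submodule.Quotient.mk_eq_zero] at this
  exact Submodule.mem_span_singleton.1 this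

/-- Project along a line that is nowhere tangent. It exists because tangent directions have
Hausdorff dimension at most 2 dim E, less than that of the space. -/
theorem exists_projection_injective_chartDeriv [SecondCountableTopology M] {n : ℕ}
    (hn : 2 * finrank ℝ E < n + 1) {x : M → EuclideanSpace ℝ (Fin (n + 1))}
    (hx : ContMDiff 𝓘(ℝ, E) 𝓘(ℝ, EuclideanSpace ℝ (Fin (n + 1))) ∞ x) :
    ∃ T : EuclideanSpace ℝ (Fin (n + 1)) →L[ℝ] EuclideanSpace ℝ (Fin n),
      ∀ p, Function.Injective (chartDeriv (E := E) x p) →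
        Function.Injective (T ∘L chartDeriv (E := E) x p) := by
  have hd : Dense {w | ∃ p v, chartDeriv (E := E) x p v = w}ᶜ := by
    refine dense_compl_of_dimH_lt_finrank ((dimH_range_chartDeriv_le hx).trans_lt ?_)
    rw [finrank_euclideanSpace_fin]
    exact_mod_cast hn
  obtain ⟨w, hw0, hw⟩ := hd.inter_open_nonempty {0}ᶜ isOpen_compl_singleton
    ⟨_, (exists_ne (0 : EuclideanSpace ℝ (Fin (n + 1)))).choose_spec⟩
  obtain ⟨T, hT⟩ := exists_clm_ker_le_span hw0
  refine ⟨T, fun p hp => (injective_iff_map_eq_zero _).2 fun v hv => ?_⟩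
  obtain ⟨c, hc⟩ : ∃ c : ℝ, c • w = chartDeriv (E := E) x p v := hT _ hv
  by_cases hc0 : c = 0
  · rw [hc0, zero_smul] at hc
    exact hp (by rw [← hc, map_zero])
  · exact absurd ⟨p, c⁻¹ • v, by rw [map_smul, ← hc, inv_smul_smul₀ hc0]⟩ hw

/-- A target of fixed dimension 2 dim E + 1 is what allows infinitely many local maps to be added up
later. -/
theorem exists_clm_injective_chartDeriv [SecondCountableTopology M] {n : ℕ}
    {x : M → EuclideanSpace ℝ (Fin n)}
    (hx : ContMDiff 𝓘(ℝ, E) 𝓘(ℝ, EuclideanSpace ℝ (Fin n)) ∞ x) :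
    ∃ T : EuclideanSpace ℝ (Fin n) →L[ℝ] EuclideanSpace ℝ (Fin (2 * finrank ℝ E + 1)),
      ∀ p, Function.Injective (chartDeriv (E := E) x p) →
        Function.Injective (T ∘L chartDeriv (E := E) x p) := by
  rcases Nat.lt_or_ge n (2 * finrank ℝ E + 1) with hn | hn
  · obtain ⟨T, hT⟩ := Module.Free.exists_linearMap_injective_of_rank_lt (R := ℝ)
      (M := EuclideanSpace ℝ (Fin n)) (N := EuclideanSpace ℝ (Fin (2 * finrank ℝ E + 1)))
      (by rw [← finrank_eq_rank, ← finrank_eq_rank]; exact mod_cast (by simpa using hn))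
    exact ⟨LinearMap.toContinuousLinearMap T, fun p hp => hT.comp hp⟩
  · induction n, hn using Nat.le_induction with
    | base => exact ⟨ContinuousLinearMap.id ℝ _, fun p hp => hp⟩
    | succ n hn ih =>
      obtain ⟨T, hT⟩ := exists_projection_injective_chartDeriv (by omega) hx
      obtain ⟨T', hT'⟩ := ih (x := fun q => T (x q)) (T.contMDiff.comp hx)
      refine ⟨T' ∘L T, fun p hp => ?_⟩
      have := hT' p
      rw [chartDeriv_clm_comp T hx] at this
      exact this (hT p hp)

/-- A finite family of maps can be combined into a single map to a Euclidean space. -/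
theorem exists_map_of_finite_family {ι : Type*} {G : Type} [Fintype ι] [NormedAddCommGroup G]
    [NormedSpace ℝ G] [FiniteDimensional ℝ G] {z : ι → M → G}
    (hz : ∀ i, ContMDiff 𝓘(ℝ, E) 𝓘(ℝ, G) ∞ (z i)) :
    ∃ (n : ℕ) (x : M → EuclideanSpace ℝ (Fin n)),
      ContMDiff 𝓘(ℝ, E) 𝓘(ℝ, EuclideanSpace ℝ (Fin n)) ∞ x ∧ (∀ p, (∀ i, z i p = 0) → x p = 0) ∧
        ∀ i p, Function.Injective (chartDeriv (E := E) (z i) p) →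
          Function.Injective (chartDeriv (E := E) x p) := by
  let Z (q : M) (i : ι) : G := z i q
  have hZ : ContMDiff 𝓘(ℝ, E) 𝓘(ℝ, ι → G) ∞ Z := contMDiff_pi_space.2 hz
  let e : (ι → G) ≃L[ℝ] EuclideanSpace ℝ (Fin (finrank ℝ (ι → G))) := toEuclidean
  refine ⟨_, fun q => e (Z q), e.contDiff.contMDiff.comp hZ, fun p hp => ?_, fun i p hi => ?_⟩
  · exact (congrArg e (funext hp)).trans (map_zero _)
  · have h1 := chartDeriv_clm_comp (E := E) e.toContinuousLinearMap hZ p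
    refine h1 ▸ e.injective.comp ?_
    have h2 := chartDeriv_clm_comp (E := E)
      (ContinuousLinearMap.proj (R := ℝ) (φ := fun _ : ι => G) i) hZ p
    have h3 : Function.Injective ((ContinuousLinearMap.proj (R := ℝ) (φ := fun _ : ι => G) i) ∘L
        chartDeriv (E := E) Z p) := by
      rw [← h2]
      exact hi
    exact Function.Injective.of_comp (f := fun w : ι → G => w i) h3

/-- Near a compact set there is a smooth map with compact support that is immersive on the set. -/
theorem exists_injective_chartDeriv_of_isCompact {K U : Set M} (hK : IsCompact K)
    (hU : IsOpen U) (hKU : K ⊆ U) :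
    ∃ (n : ℕ) (x : M → EuclideanSpace ℝ (Fin n)),
      ContMDiff 𝓘(ℝ, E) 𝓘(ℝ, EuclideanSpace ℝ (Fin n)) ∞ x ∧ Function.support x ⊆ U ∧
        ∀ p ∈ K, Function.Injective (chartDeriv (E := E) x p) := by
  have hex (p : K) : ∃ χ : SmoothBumpFunction 𝓘(ℝ, E) (p : M), tsupport χ ⊆ U := by
    obtain ⟨χ, -, h⟩ := (SmoothBumpFunction.nhds_basis_tsupport (I := 𝓘(ℝ, E)) (p : M)).mem_iff.1
      (hU.mem_nhds (hKU p.2))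
    exact ⟨χ, h⟩
  choose χ hχ using hex
  -- On this set the cut-off chart agrees with the chart, hence is immersive.
  let V (p : K) : Set M := interior {q | χ p q = 1} ∩ (chartAt E (p : M)).source
  have hV (p : K) : V p ∈ 𝓝 (p : M) :=
    inter_mem (interior_mem_nhds.2 (χ p).eventuallyEq_one)
      ((chartAt E (p : M)).open_source.mem_nhds (mem_chart_source E _))
  obtain ⟨t, ht⟩ := hK.elim_nhds_subcover' (fun p hp => V ⟨p, hp⟩) fun p hp => hV ⟨p, hp⟩
  let y (k : t) (q : M) : E := χ k q • extChartAt 𝓘(ℝ, E) (k : M) q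
  have hy (k : t) : ContMDiff 𝓘(ℝ, E) 𝓘(ℝ, E) ∞ (y k) := (χ k).contMDiff_smul contMDiffOn_extChartAt
  obtain ⟨n, x, hx, hx0, hinj⟩ := exists_map_of_finite_family hy
  refine ⟨n, x, hx, fun q hq => ?_, fun p hp => ?_⟩
  · by_contra hqU
    refine hq (hx0 q fun k => ?_)
    have : χ k q = 0 := image_eq_zero_of_notMem_tsupport fun h => hqU (hχ k h)
    simp [y, this]
  · obtain ⟨k, hk, hpk⟩ := mem_iUnion₂.1 (ht hp)
    obtain ⟨a, ha⟩ : ∃ a : E ≃L[ℝ] E, chartDeriv (y ⟨k, hk⟩) p = (a : E →L[ℝ] E) := by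
      obtain ⟨a, ha⟩ := exists_chartDeriv_eq_comp hpk.2
      refine ⟨a, ?_⟩
      have hp' : p ∈ (extChartAt 𝓘(ℝ, E) (k : M)).source := by simpa using hpk.2
      have hev : y ⟨k, hk⟩ ∘ (extChartAt 𝓘(ℝ, E) (k : M)).symm
          =ᶠ[𝓝 (extChartAt 𝓘(ℝ, E) (k : M) p)] id := by
        have htend := (continuousAt_extChartAt_symm' hp').tendsto
        rw [(extChartAt 𝓘(ℝ, E) (k : M)).left_inv hp'] at htend
        filter_upwards [htend.eventually (mem_interior_iff_mem_nhds.1 hpk.1),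
          (isOpen_extChartAt_target (k : M)).mem_nhds
            ((extChartAt 𝓘(ℝ, E) (k : M)).map_source hp')] with u hu hu'
        have hu1 : χ k ((extChartAt 𝓘(ℝ, E) (k : M)).symm u) = 1 := hu
        simp only [Function.comp_apply, y, hu1, one_smul, id]
        exact (extChartAt 𝓘(ℝ, E) (k : M)).right_inv hu'
      rw [ha (hy ⟨k, hk⟩), hev.fderiv_eq, fderiv_id, ContinuousLinearMap.id_comp]
    refine hinj ⟨k, hk⟩ p ?_
    rw [ha]
    exact a.injective

/-- Exhaust M by compact sets and cover it by the shells L m, each with a map supported in a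
neighbourhood U m and immersive on L m, all into one Euclidean space. The sets U m and U m' are
disjoint once the indices differ by 3, so the maps whose index has a given residue modulo 3 can be
added without interference, and the three sums together are an immersion. -/
theorem exists_immersion [SecondCountableTopology M] :
    ∃ (N : ℕ) (x : M → EuclideanSpace ℝ (Fin N)),
      ContMDiff 𝓘(ℝ, E) 𝓘(ℝ, EuclideanSpace ℝ (Fin N)) ∞ x ∧
        ∀ p, Function.Injective (chartDeriv (E := E) x p) := by
  have := ChartedSpace.locallyCompactSpace E M
  -- The shift makes K 0 empty, so the truncated m − 1 in U does no harm for m = 0.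
  let K := (default : CompactExhaustion M).shiftr
  have hK0 : K 0 = ∅ := rfl
  have hKm {i j : ℕ} (h : i ≤ j) : K i ⊆ K j := K.subset h
  let L (m : ℕ) : Set M := K (m + 1) \ interior (K m)
  let U (m : ℕ) : Set M := interior (K (m + 2)) \ K (m - 1)
  have hL (m : ℕ) : IsCompact (L m) := (K.isCompact _).diff isOpen_interior
  have hU (m : ℕ) : IsOpen (U m) := isOpen_interior.sdiff (K.isCompact _).isClosed
  have hLU (m : ℕ) : L m ⊆ U m := by
    refine sdiff_subset_sdiff (K.subset_interior_succ _) ?_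
    cases m with
    | zero => rw [Nat.zero_sub, hK0]; exact empty_subset _
    | succ m => exact K.subset_interior_succ m
  have hcov (p : M) : ∃ m, p ∈ L m := by
    have h := (default : CompactExhaustion M).mem_sdiff_shiftr_find p
    exact ⟨_, h.1, fun h' => h.2 (interior_subset h')⟩
  have hex (m : ℕ) : ∃ y : M → EuclideanSpace ℝ (Fin (2 * finrank ℝ E + 1)),
      ContMDiff 𝓘(ℝ, E) 𝓘(ℝ, EuclideanSpace ℝ (Fin (2 * finrank ℝ E + 1))) ∞ y ∧
        Function.support y ⊆ U m ∧ ∀ p ∈ L m, Function.Injective (chartDeriv (E := E) y p) := by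
    obtain ⟨n, x, hx, hs, hinj⟩ := exists_injective_chartDeriv_of_isCompact (E := E) (hL m) (hU m) (hLU m)
    obtain ⟨T, hT⟩ := exists_clm_injective_chartDeriv hx
    refine ⟨fun q => T (x q), T.contMDiff.comp hx, fun q hq => hs fun h => hq ?_, fun p hp => ?_⟩
    · exact (congrArg T h).trans (map_zero _)
    · rw [chartDeriv_clm_comp T hx]
      exact hT p (hinj p hp)
  choose y hy hsupp hinj using hex
  have hdisj {m m' : ℕ} (h : m + 3 ≤ m') {p : M} (hp : p ∈ U m) : p ∉ U m' := fun h' =>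
    h'.2 (hKm (by omega) (interior_subset hp.1))
  let z (c : Fin 3) (q : M) : EuclideanSpace ℝ (Fin (2 * finrank ℝ E + 1)) :=
    ∑ᶠ k : ℕ, y (3 * k + c) q
  have hz (c : Fin 3) : ContMDiff 𝓘(ℝ, E)
      𝓘(ℝ, EuclideanSpace ℝ (Fin (2 * finrank ℝ E + 1))) ∞ (z c) := by
    refine contMDiff_finsum (fun k => hy _) fun p => ?_
    obtain ⟨j, hj⟩ := K.exists_mem_nhds p
    refine ⟨K j, hj, (finite_Iic (j + 1)).subset fun k hk => ?_⟩
    obtain ⟨q, hq, hqj⟩ := hk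
    by_contra hkj
    rw [mem_Iic, not_le] at hkj
    exact (hsupp _ hq).2 (hKm (by omega) hqj)
  have hzinj (p : M) : ∃ c, Function.Injective (chartDeriv (E := E) (z c) p) := by
    obtain ⟨m, hm⟩ := hcov p
    refine ⟨⟨m % 3, Nat.mod_lt _ (by norm_num)⟩, ?_⟩
    rw [chartDeriv_congr (g := y m)]
    · exact hinj m p hm
    · filter_upwards [(hU m).mem_nhds (hLU m hm)] with q hq
      change ∑ᶠ k : ℕ, y (3 * k + m % 3) q = y m q
      rw [finsum_eq_single _ (m / 3), Nat.div_add_mod]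
      intro k hk
      by_contra h
      have hq' := hsupp _ h
      rcases lt_or_gt_of_ne hk with h1 | h1
      · exact hdisj (by omega) hq' hq
      · exact hdisj (by omega) hq hq'
  obtain ⟨N, x, hx, -, hxinj⟩ := exists_map_of_finite_family hz
  exact ⟨N, x, hx, fun p => (hzinj p).elim fun c hc => hxinj c p hc⟩

end Whitney

end Fedosov

end

noncomputable section

namespace Fedosov

theorem exists_frame {d : ℕ} (M : Type*) [TopologicalSpace M] [T2Space M]
    [SecondCountableTopology M] [ChartedSpace (EuclideanSpace ℝ (Fin d)) M] [IsManifold (𝓡 d) ∞ M] :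
    ∃ N : ℕ, Nonempty (Frame C^∞⟮𝓡 d, M; ℝ⟯ (Fin N)) := by
  obtain ⟨N, x, hx, hinj⟩ := exists_immersion (E := EuclideanSpace ℝ (Fin d)) (M := M)
  exact ⟨N, nonempty_frame_of_immersion hx hinj⟩

end Fedosov

end

theorem mainTheorem9 {d : ℕ} {M : Type*} [TopologicalSpace M] [T2Space M]
    [SecondCountableTopology M] [ChartedSpace (EuclideanSpace ℝ (Fin d)) M] [IsManifold (𝓡 d) ∞ M]
    (nabla : Fedosov.TorsionFreeConnection C^∞⟮𝓡 d, M; ℝ⟯)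
    (A : Fedosov.OneForm C^∞⟮𝓡 d, M; ℝ⟯) (hA : Fedosov.IsAdmissible A) :
    (Fedosov.SolvesFedosovEquation nabla A →
      ∀ X Y, Fedosov.curvature (Fedosov.fedosovD nabla A) X Y = 0) ∧
    ((∀ X Y, Fedosov.curvature (Fedosov.fedosovD nabla A) X Y = 0) →
      Fedosov.HasFlatLifts (Fedosov.fedosovD nabla A) ∧
      Fedosov.IsDGLAResolution (Fedosov.fedosovD nabla A)
        (Fedosov.formsT C^∞⟮𝓡 d, M; ℝ⟯)
        (fun n n' => Fedosov.schouten (n + n' - 1)) (fun _ _ => 0)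
        (Fedosov.polyVect ℝ C^∞⟮𝓡 d, M; ℝ⟯)
        (fun n n' => Fedosov.schouten (n + n' - 1)) (fun _ _ => 0) ∧
      Fedosov.IsDGLAResolution (Fedosov.fedosovD nabla A)
        (Fedosov.formsD C^∞⟮𝓡 d, M; ℝ⟯)
        (fun n n' => Fedosov.gerstenhaber (n + n' - 1)) (fun _ => Fedosov.hochschild)
        (Fedosov.polyDiff ℝ C^∞⟮𝓡 d, M; ℝ⟯)
        (fun n n' => Fedosov.gerstenhaber (n + n' - 1)) (fun _ => Fedosov.hochschild)) := by
  obtain ⟨N, ⟨fr⟩⟩ := Fedosov.exists_frame (d := d) M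
  exact fr.fedosov_resolution nabla A hA
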